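/- **Setting.** Let $M\to B$ be an end-periodic fibre bundle over a closed manifold $B$: there are a smooth fibre bundle $Y\to B$ with closed total space and a smooth map $f_0:Y\to S^1$ with infinite cyclic cover $\tilde Y=\{(t,y)\in\mathbb R\times Y: e^{2\pi i t}=f_0(y)\}$, $f(t,y)=t$, $(t,y)+m=(t+m,y)$ for $m\in\mathbb Z$, such that $M$, and compatibly each fibre $M_z$, is the union of a compact part $Z$ and the half $\{f\ge 0\}$ of $\tilde Y$ (resp. $\tilde Y_z$). Write $W_k=\{k\le f\le k+1\}$ and $Z_N=Z\cup W_0\cup\dots\cup W_N$. The fibres of $Y\to B$ carry Riemannian metrics, and the metrics of the fibres $M_z$ agree on the end with the lifted metrics; $d$ is the Riemannian distance and $dx$ the Riemannian volume of the fibres. Let $E\to M$ be a $\mathbb Z_2$-graded Hermitian vector bundle that agrees over the end with the lift of such a bundle $E_Y\to Y$. A vertical family of asymptotically periodic smoothing operators $P$ is given by smooth kernels $K_P^z(x,x')\in\Lambda T_z^*B\otimes \mathrm{Hom}(E_{x'},E_x)$ on $M_z\times M_z$, $z\in B$, for which there are smooth kernels $K_{N(P)}^z$ on $\tilde Y_z\times\tilde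 Y_z$, invariant under $(x,x')\mapsto(x+1,x'+1)$ (the kernels of the normal operator $N(P)$, uniquely determined by $P$), such that for every $z$, with constants $C,\gamma>0$ that may depend on $z$ and on the estimate, (AP1) $|K_P(x,x')|\le Ce^{-\gamma d^2(x,x')}$ for all $x,x'\in M_z$; (AP2) $|K_P(x,x)-K_{N(P)}(x,x)|\le Ce^{-\gamma d^2(x,W_0)}$ for $x\in\bigcup_{k\ge1}W_k$; (AP3) $|K_P(x,x')-K_{N(P)}(x,x')|\le Ce^{-\gamma \min\{d(x,W_0),d(x',W_0)\}^2}$ for $x,x'\in\bigcup_{k\ge1}W_k$ (with $e^{-\gamma d^2}=0$ if $d=\infty$). Kernels are composed in the graded tensor product, $(\alpha\otimes A)(\beta\otimes A')=(-1)^{|A||\beta|}\alpha\wedge\beta\otimes AA'$, and $\mathrm{str}(\alpha\otimes A)=\alpha\,\mathrm{str}(A)$. For a kernel $K_H$ satisfying (AP1)–(AP3) with normal kernel $K_{N(H)}$ the renormalized supertrace is the form on $B$ $${}^R\mathrm{Str}\,H=\lim_{N\to\infty}\Big[\int_{Z_N/B}\mathrm{str}\,K_H(x,x)\,dx-(N+1)\int_{W_0/B}\mathrm{str}\,K_{N(H)}(x,x)\,dx\Big].$$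 The indicial family $P_\xi$, $\xi\in\mathbb C^\times$, is the family of vertical operators on $Y$ determined by $\mathcal F_\xi\circ N(P)=P_\xi\circ\mathcal F_\xi$, where $(\mathcal F_\xi u)(p(x))=\xi^{f(x)}\sum_{m\in\mathbb Z}\xi^m u(x+m)$ and $p:\tilde Y\to Y$ is the projection; its kernel is $\xi^{f(x)-f(x')}\sum_m\xi^mK_{N(P)}(x+m,x')$, with the principal branch of the powers of $\xi$. **Proposition (supertrace defect formula).** Let $P$ and $Q$ be vertical families of asymptotically periodic smoothing operators, each even or odd for the total $\mathbb Z_2$-grading, and let $[P,Q]=PQ-(-1)^{|P||Q|}QP$. Then the integrals defining the kernels of $PQ$ and $QP$ converge, the kernel $K_{[P,Q]}$ satisfies (AP1)–(AP3) for some periodic kernel, the kernels above define the indicial families of $P$ and $Q$, $P_\xi$ is differentiable in $\xi\in\mathbb C\setminus(-\infty,0]$, the limit defining ${}^R\mathrm{Str}[P,Q]$ exists, and at every $z\in B$ $${}^R\mathrm{Str}[P,Q]=\frac1{2\pi i}\oint_{|\xi|=1}\int_{W_0/B}f(x)\,\mathrm{str}\big(K_{[P_\xi,Q_\xi]}(x,x)\big)\,dx\,\frac{d\xi}{\xi}-\frac1{2\pi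 i}\oint_{|\xi|=1}\mathrm{Str}\Big(\frac{\partial P_\xi}{\partial\xi}Q_\xi\Big)\,d\xi,$$ where $[P_\xi,Q_\xi]=P_\xi Q_\xi-(-1)^{|P||Q|}Q_\xi P_\xi$ and $\mathrm{Str}(H)=\int_{Y/B}\mathrm{str}\,K_H(y,y)\,dy$. -/

import Mathlib

open scoped Manifold ContDiff Topology ENNReal TensorProduct Bundle
open Bundle MeasureTheory Filter

noncomputable section

namespace EndPeriodic

/-! ### Form-valued homomorphisms `Λ ⊗ Hom(V, V')` -/

section Coefficients

/-- The exterior algebra `Λ W`, as a type that carries a norm. -/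
def Form (W : Type*) [AddCommGroup W] [Module ℂ W] : Type _ := ExteriorAlgebra ℂ W

/-- The form-valued elements `Λ W ⊗ H` of `H`, as a type that carries a norm. -/
def Coeff (W : Type*) [AddCommGroup W] [Module ℂ W]
    (H : Type*) [NormedAddCommGroup H] [NormedSpace ℂ H] : Type _ := ExteriorAlgebra ℂ W ⊗[ℂ] H

section Algebra

variable {W : Type*} [AddCommGroup W] [Module ℂ W] {H : Type*} [NormedAddCommGroup H] [NormedSpace ℂ H]

instance : AddCommGroup (Form W) := inferInstanceAs (AddCommGroup (ExteriorAlgebra ℂ W))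

instance : Module ℂ (Form W) := inferInstanceAs (Module ℂ (ExteriorAlgebra ℂ W))

instance : AddCommGroup (Coeff W H) := inferInstanceAs (AddCommGroup (ExteriorAlgebra ℂ W ⊗[ℂ] H))

instance : Module ℂ (Coeff W H) := inferInstanceAs (Module ℂ (ExteriorAlgebra ℂ W ⊗[ℂ] H))

/-- The identity map `Λ W → Λ W`. -/
def Form.equiv (W : Type*) [AddCommGroup W] [Module ℂ W] : Form W ≃ₗ[ℂ] ExteriorAlgebra ℂ W :=
  LinearEquiv.refl ℂ (ExteriorAlgebra ℂ W)

/-- The identity map `Λ W ⊗ H → Λ W ⊗ H`. -/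
def Coeff.equiv (W : Type*) [AddCommGroup W] [Module ℂ W]
    (H : Type*) [NormedAddCommGroup H] [NormedSpace ℂ H] : Coeff W H ≃ₗ[ℂ] ExteriorAlgebra ℂ W ⊗[ℂ] H :=
  LinearEquiv.refl ℂ (ExteriorAlgebra ℂ W ⊗[ℂ] H)

/-- `ε ⊗ 1`, where `ε` is the parity involution of the exterior algebra. -/
def formInvol : Coeff W H →ₗ[ℂ] Coeff W H :=
  (Coeff.equiv W H).symm.toLinearMap ∘ₗ
    LinearMap.rTensor H (CliffordAlgebra.involute (Q := (0 : QuadraticForm ℂ W))).toLinearMap ∘ₗ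
    (Coeff.equiv W H).toLinearMap

/-- The component `(ℓ ⊗ 1) k` of a form-valued element. -/
def component (ℓ : Form W →ₗ[ℂ] ℂ) : Coeff W H →ₗ[ℂ] H :=
  (TensorProduct.lid ℂ H).toLinearMap ∘ₗ
    LinearMap.rTensor H (ℓ ∘ₗ (Form.equiv W).symm.toLinearMap) ∘ₗ (Coeff.equiv W H).toLinearMap

variable {V₀ V₁ V₂ V₃ : Type*} [NormedAddCommGroup V₀] [NormedSpace ℂ V₀]
  [NormedAddCommGroup V₁] [NormedSpace ℂ V₁]
  [NormedAddCommGroup V₂] [NormedSpace ℂ V₂] [NormedAddCommGroup V₃] [NormedSpace ℂ V₃]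

/-- `α ⊗ A ↦ α ⊗ T' A T`. -/
def sandwich (T' : V₂ →L[ℂ] V₃) (T : V₀ →L[ℂ] V₁) :
    Coeff W (V₁ →L[ℂ] V₂) →ₗ[ℂ] Coeff W (V₀ →L[ℂ] V₃) :=
  (Coeff.equiv W _).symm.toLinearMap ∘ₗ
    LinearMap.lTensor _
      { toFun := fun A : V₁ →L[ℂ] V₂ => T' ∘L A ∘L T
        map_add' := fun A A' => by ext; simp
        map_smul' := fun c A => by ext; simp } ∘ₗ
    (Coeff.equiv W _).toLinearMap

/-- `(α ⊗ A, β ⊗ A') ↦ (α ∧ β) ⊗ A A'`, without signs. -/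
def plainComp (k : Coeff W (V₂ →L[ℂ] V₃)) (l : Coeff W (V₁ →L[ℂ] V₂)) :
    Coeff W (V₁ →L[ℂ] V₃) :=
  (Coeff.equiv W _).symm (TensorProduct.map₂ (LinearMap.mul ℂ (ExteriorAlgebra ℂ W))
    (LinearMap.mk₂ ℂ (fun (A : V₂ →L[ℂ] V₃) (A' : V₁ →L[ℂ] V₂) => A ∘L A')
      (fun A A' A'' => by ext; simp) (fun c A A' => by ext; simp)
      (fun A A' A'' => by ext; simp) (fun c A A' => by ext; simp))
    (Coeff.equiv W _ k) (Coeff.equiv W _ l))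

/-- The product of form-valued homomorphisms between super vector spaces with grading
involutions `τ₂`, `τ₃`, in the graded tensor product:
`(α ⊗ A) (β ⊗ A') = (-1)^(|A| |β|) (α ∧ β) ⊗ A A'`. The two summands belong to the even part
`(A + τ₃ A τ₂) / 2` and to the odd part `(A - τ₃ A τ₂) / 2` of `A`. -/
def gradedComp (τ₂ : V₂ →L[ℂ] V₂) (τ₃ : V₃ →L[ℂ] V₃)
    (k : Coeff W (V₂ →L[ℂ] V₃)) (l : Coeff W (V₁ →L[ℂ] V₂)) : Coeff W (V₁ →L[ℂ] V₃) :=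
  plainComp ((1 / 2 : ℂ) • (k + sandwich τ₃ τ₂ k)) l +
    plainComp ((1 / 2 : ℂ) • (k - sandwich τ₃ τ₂ k)) (formInvol l)

/-- The supertrace `str (α ⊗ A) = tr (τ A) α`. -/
def str (τ : V₁ →L[ℂ] V₁) : Coeff W (V₁ →L[ℂ] V₁) →ₗ[ℂ] Form W :=
  (Form.equiv W).symm.toLinearMap ∘ₗ (TensorProduct.rid ℂ (ExteriorAlgebra ℂ W)).toLinearMap ∘ₗ
    LinearMap.lTensor _
      { toFun := fun A : V₁ →L[ℂ] V₁ => LinearMap.trace ℂ V₁ (τ ∘L A : V₁ →L[ℂ] V₁).toLinearMap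
        map_add' := fun A A' => by simp [ContinuousLinearMap.comp_add]
        map_smul' := fun c A => by simp } ∘ₗ
    (Coeff.equiv W _).toLinearMap

/-- `k` has total degree `p` modulo 2 (`α ⊗ A` has total degree `|α| + |A|`). -/
def HasParity (τ₁ : V₁ →L[ℂ] V₁) (τ₂ : V₂ →L[ℂ] V₂) (p : ℕ)
    (k : Coeff W (V₁ →L[ℂ] V₂)) : Prop :=
  formInvol (sandwich τ₂ τ₁ k) = (-1 : ℂ) ^ p • k

end Algebra

variable {W : Type*} [AddCommGroup W] [Module ℂ W] [FiniteDimensional ℂ W]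

/-- The coordinates of a form with respect to the basis of wedge products of vectors of a
(chosen) basis of `W`. -/
def Form.coords (W : Type*) [AddCommGroup W] [Module ℂ W] [FiniteDimensional ℂ W] :
    Form W ≃ₗ[ℂ] (Finset (Fin (Module.finrank ℂ W)) → ℂ) :=
  (Form.equiv W).trans (Module.finBasis ℂ W).ExteriorAlgebra.equivFun

/-- A norm on the finite-dimensional space `Λ W` (all choices are equivalent): the maximum of
the coordinates. -/
instance : NormedAddCommGroup (Form W) :=
  NormedAddCommGroup.induced _ _ (Form.coords W).toLinearMap (Form.coords W).injective

instance : NormedSpace ℂ (Form W) :=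
  NormedSpace.induced ℂ _ _ (Form.coords W).toLinearMap

variable {H : Type*} [NormedAddCommGroup H] [NormedSpace ℂ H]

/-- The coordinates in `H` of an element of `Λ W ⊗ H` with respect to the same basis. -/
def Coeff.coords (W : Type*) [AddCommGroup W] [Module ℂ W] [FiniteDimensional ℂ W]
    (H : Type*) [NormedAddCommGroup H] [NormedSpace ℂ H] :
    Coeff W H ≃ₗ[ℂ] (Finset (Fin (Module.finrank ℂ W)) → H) :=
  (Coeff.equiv W H).trans ((TensorProduct.equivFinsuppOfBasisLeft
    (Module.finBasis ℂ W).ExteriorAlgebra).trans (Finsupp.linearEquivFunOnFinite ℂ H _))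

/-- The norm on `Λ W ⊗ H`: the maximum of the norms in `H` of the coordinates. It is used both
for the pointwise estimates on kernels (with `H = Hom(V, V')` carrying the operator norm of the
Hermitian metrics) and for the topology of the finite-dimensional space of coefficients. -/
instance : NormedAddCommGroup (Coeff W H) :=
  NormedAddCommGroup.induced _ _ (Coeff.coords W H).toLinearMap (Coeff.coords W H).injective

instance : NormedSpace ℂ (Coeff W H) :=
  NormedSpace.induced ℂ _ _ (Coeff.coords W H).toLinearMap

end Coefficients

/-! ### Integral kernels -/

section Kernels

/-- Form-valued integral kernels `K(x, x') ∈ Λ W ⊗ Hom(V x', V x)`. -/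
abbrev Kernel (W : Type*) [AddCommGroup W] [Module ℂ W] {X : Type*} (V : X → Type*)
    [∀ x, NormedAddCommGroup (V x)] [∀ x, NormedSpace ℂ (V x)] : Type _ :=
  ∀ x x' : X, Coeff W (V x' →L[ℂ] V x)

variable {W : Type*} [AddCommGroup W] [Module ℂ W] [FiniteDimensional ℂ W]
  {X : Type*} [MeasurableSpace X] {V : X → Type*}
  [∀ x, NormedAddCommGroup (V x)] [∀ x, NormedSpace ℂ (V x)]

/-- The kernel of the composition of two operators, `∫ K(x, w) L(w, x') dw`. -/
def kcomp (τ : ∀ x, V x →L[ℂ] V x) (μ : Measure X) (K L : Kernel W V) : Kernel W V :=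
  fun x x' => ∫ w, gradedComp (τ w) (τ x) (K x w) (L w x') ∂μ

/-- The kernel of the supercommutator `PQ - (-1)^(p q) QP` of operators of degrees `p`, `q`. -/
def superComm (τ : ∀ x, V x →L[ℂ] V x) (μ : Measure X) (p q : ℕ) (K L : Kernel W V) :
    Kernel W V :=
  fun x x' => kcomp τ μ K L x x' - (-1 : ℂ) ^ (p * q) • kcomp τ μ L K x x'

/-- The value at `x` of the operator with kernel `K` on the form-valued section `u`. A form-valued
vector, an element of `Λ W ⊗ V x`, is written as an element of `Λ W ⊗ Hom(ℂ, V x)`. -/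
def kapply (τ : ∀ x, V x →L[ℂ] V x) (μ : Measure X) (K : Kernel W V)
    (u : ∀ x, Coeff W (ℂ →L[ℂ] V x)) :
    ∀ x, Coeff W (ℂ →L[ℂ] V x) :=
  fun x => ∫ w, gradedComp (τ w) (τ x) (K x w) (u w) ∂μ

end Kernels

/-! ### Riemannian volume, infinite cyclic covers and periodic ends -/

section Geometry

/-- `μ` is the Riemannian volume measure of `X`: in every smooth local parametrization `ψ` by an
open subset of `ℝⁿ` it has the density `√det ⟨∂ᵢψ, ∂ⱼψ⟩`. -/
def IsRiemannianVolume {n : ℕ} {X : Type*} [TopologicalSpace X]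
    [ChartedSpace (EuclideanSpace ℝ (Fin n)) X]
    [RiemannianBundle (fun x : X => TangentSpace (𝓡 n) x)] [MeasurableSpace X]
    (μ : Measure X) : Prop :=
  ∀ (U : Set (EuclideanSpace ℝ (Fin n))) (ψ : EuclideanSpace ℝ (Fin n) → X), IsOpen U →
    ContMDiffOn (𝓡 n) (𝓡 n) ∞ ψ U → Set.InjOn ψ U →
    (∀ v ∈ U, Function.Injective (mfderiv (𝓡 n) (𝓡 n) ψ v)) →
    ∀ A ⊆ U, MeasurableSet A →
      μ (ψ '' A) = ∫⁻ v in A, ENNReal.ofReal (Real.sqrt (Matrix.det (Matrix.of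
        (fun i j : Fin n => inner ℝ
          (mfderiv (𝓡 n) (𝓡 n) ψ v (EuclideanSpace.single i (1 : ℝ)) : TangentSpace (𝓡 n) (ψ v))
          (mfderiv (𝓡 n) (𝓡 n) ψ v (EuclideanSpace.single j (1 : ℝ)) :
            TangentSpace (𝓡 n) (ψ v))))))

variable {Y : Type*}

/-- The infinite cyclic cover `{(t, y) : exp (2πit) = f₀ y}` of `Y`. Its projection to `ℝ` is
denoted `f`, its projection to `Y` is the covering map, and `ℤ` acts by translation of `t`. -/
def cover (f₀ : Y → Circle) : Set (ℝ × Y) :=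
  {x | Circle.exp (2 * Real.pi * x.1) = f₀ x.2}

/-- The value of `f` at the point over `y` of the fundamental segment `0 ≤ f < 1`. -/
def segmentCoord (f₀ : Y → Circle) (y : Y) : ℝ :=
  Int.fract (Complex.arg (f₀ y : ℂ) / (2 * Real.pi))

/-- The lift to the infinite cyclic cover of a measure on `Y`: the covering map is a measure
preserving bijection from each segment `m ≤ f < m + 1` onto `Y`. -/
def coverMeasure [MeasurableSpace Y] (f₀ : Y → Circle) (μ : Measure Y) : Measure (ℝ × Y) :=
  Measure.sum fun m : ℤ => μ.map fun y => (segmentCoord f₀ y + m, y)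

/-- The fundamental segment `0 ≤ f < 1`, as a domain of integration (it differs from the closed
segment `0 ≤ f ≤ 1` by a boundary component). -/
def segment (f₀ : Y → Circle) : Set (ℝ × Y) :=
  {x | x ∈ cover f₀ ∧ 0 ≤ x.1 ∧ x.1 < 1}

variable {EX HX EY HY : Type*} [NormedAddCommGroup EX] [NormedSpace ℝ EX] [TopologicalSpace HX]
  [NormedAddCommGroup EY] [NormedSpace ℝ EY] [TopologicalSpace HY]
  (IX : ModelWithCorners ℝ EX HX) (IY : ModelWithCorners ℝ EY HY)

/-- `s` is a smooth local lift of `f₀` on the open set `U`. The maps `y ↦ (s y, y)` are the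
smooth local sections of the covering map, so they are the local inverses of the covering map
through which the smooth structure of the cover is defined. -/
structure IsLift [TopologicalSpace Y] [ChartedSpace HY Y] (f₀ : Y → Circle) (U : Set Y)
    (s : Y → ℝ) : Prop where
  isOpen : IsOpen U
  smooth : ContMDiffOn IY 𝓘(ℝ, ℝ) ∞ s U
  mem : ∀ y ∈ U, (s y, y) ∈ cover f₀

/-- `X` is an end-periodic manifold with end modelled on the infinite cyclic cover of `Y`
determined by `f₀`: it is the union of a compact part `Z` and of the half `f ≥ 0` of the cover,
embedded by `ι`, the open end `f > 0` being diffeomorphic to the complement of `Z`.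
(Only the values of `ι` at points of the cover with `f ≥ 0` matter.) -/
structure PeriodicEnd (X : Type*) [TopologicalSpace X] [ChartedSpace HX X]
    [TopologicalSpace Y] [ChartedSpace HY Y] (f₀ : Y → Circle) where
  smooth_f₀ : ContMDiff IY (𝓡 1) ∞ f₀
  Z : Set X
  ι : ℝ → Y → X
  isCompact_Z : IsCompact Z
  isClosedEmbedding_ι : Topology.IsClosedEmbedding
    (fun x : {x : ℝ × Y // x ∈ cover f₀ ∧ 0 ≤ x.1} => ι x.1.1 x.1.2)
  image_ι : {x | ∃ t y, (t, y) ∈ cover f₀ ∧ 0 < t ∧ ι t y = x} = Zᶜ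
  isLocalDiffeomorph_ι : ∀ U s, IsLift IY f₀ U s → (∀ y ∈ U, 0 < s y) →
    IsLocalDiffeomorphOn IY IX ∞ (fun y => ι (s y) y) U

/-- `exp (-γ d²)`, which is `0` for points at infinite distance. -/
def gauss (γ : ℝ) (d : ℝ≥0∞) : ℝ :=
  if d = ⊤ then 0 else Real.exp (-γ * d.toReal ^ 2)

end Geometry

/-! ### End-periodic fibre bundles -/

section FiberBundles

variable {EB : Type*} [NormedAddCommGroup EB] [NormedSpace ℝ EB]
  {B : Type*} [TopologicalSpace B] [ChartedSpace EB B]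

/-- The complexified cotangent space `T_z^*B ⊗ ℂ = Hom_ℝ(T_z B, ℂ)`. -/
abbrev Cotangent (EB : Type*) [NormedAddCommGroup EB] [NormedSpace ℝ EB]
    {B : Type*} [TopologicalSpace B] [ChartedSpace EB B] (z : B) : Type _ :=
  TangentSpace 𝓘(ℝ, EB) z →ₗ[ℝ] ℂ

/-- The complex-valued forms `Λ T_z^*B ⊗ ℂ` at `z`. -/
abbrev Forms (EB : Type*) [NormedAddCommGroup EB] [NormedSpace ℝ EB]
    {B : Type*} [TopologicalSpace B] [ChartedSpace EB B] (z : B) : Type _ :=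
  Form (Cotangent EB z)

instance finiteDimensional_cotangent [FiniteDimensional ℝ EB] (z : B) :
    FiniteDimensional ℂ (Cotangent EB z) := by
  have : FiniteDimensional ℝ (TangentSpace 𝓘(ℝ, EB) z) := inferInstanceAs (FiniteDimensional ℝ EB)
  have : Module.Finite ℝ (TangentSpace 𝓘(ℝ, EB) z →ₗ[ℝ] ℂ) := inferInstance
  exact Module.Finite.of_restrictScalars_finite ℝ ℂ _

variable (n : ℕ)

/-- The manifolds `M z` are the fibres of a smooth fibre bundle over `B` with typical fibre `FM`:
the total space (a manifold) has smooth local trivializations that restrict to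
diffeomorphisms from the fibres to `FM`. -/
def IsSmoothFiberBundle (FM : Type*) [TopologicalSpace FM]
    [ChartedSpace (EuclideanSpace ℝ (Fin n)) FM]
    (M : B → Type*) [∀ z, TopologicalSpace (M z)]
    [∀ z, ChartedSpace (EuclideanSpace ℝ (Fin n)) (M z)]
    [TopologicalSpace (TotalSpace FM M)]
    [ChartedSpace (ModelProd EB (EuclideanSpace ℝ (Fin n))) (TotalSpace FM M)] : Prop :=
  ∀ z₀ : B, ∃ e : Trivialization FM (TotalSpace.proj : TotalSpace FM M → B), z₀ ∈ e.baseSet ∧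
    ContMDiffOn (𝓘(ℝ, EB).prod (𝓡 n)) (𝓘(ℝ, EB).prod (𝓡 n)) ∞ e e.source ∧
    ContMDiffOn (𝓘(ℝ, EB).prod (𝓡 n)) (𝓘(ℝ, EB).prod (𝓡 n)) ∞
      e.toOpenPartialHomeomorph.symm e.target ∧
    ∀ z ∈ e.baseSet, ∃ d : M z ≃ₘ^∞⟮𝓡 n, 𝓡 n⟯ FM, ∀ x, d x = (e ⟨z, x⟩).2

variable (FM : Type*) [TopologicalSpace FM] [ChartedSpace (EuclideanSpace ℝ (Fin n)) FM]
  (M : B → Type*) [∀ z, TopologicalSpace (M z)]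
  [∀ z, ChartedSpace (EuclideanSpace ℝ (Fin n)) (M z)]
  [TopologicalSpace (TotalSpace FM M)]
  [ChartedSpace (ModelProd EB (EuclideanSpace ℝ (Fin n))) (TotalSpace FM M)]
  [∀ z, RiemannianBundle (fun x : M z => TangentSpace (𝓡 n) x)]
  (FY : Type*) [TopologicalSpace FY] [ChartedSpace (EuclideanSpace ℝ (Fin n)) FY]
  (Y : B → Type*) [∀ z, TopologicalSpace (Y z)]
  [∀ z, ChartedSpace (EuclideanSpace ℝ (Fin n)) (Y z)]
  [TopologicalSpace (TotalSpace FY Y)]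
  [ChartedSpace (ModelProd EB (EuclideanSpace ℝ (Fin n))) (TotalSpace FY Y)]
  [∀ z, RiemannianBundle (fun y : Y z => TangentSpace (𝓡 n) y)]

/-- An end-periodic fibre bundle `M → B` over the bundle `Y → B`, with end-periodic metrics on the
fibres: the total space and all the fibres are end-periodic, with compatible
identifications of the ends, and the metric on the end of `M z` is the lift of that of `Y z`. -/
structure EndPeriodicFiberBundle where
  isBundle_M : IsSmoothFiberBundle (EB := EB) n FM M
  isBundle_Y : IsSmoothFiberBundle (EB := EB) n FY Y
  f₀ : TotalSpace FY Y → Circle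
  total : PeriodicEnd (𝓘(ℝ, EB).prod (𝓡 n)) (𝓘(ℝ, EB).prod (𝓡 n)) (TotalSpace FM M) f₀
  fiber : ∀ z, PeriodicEnd (𝓡 n) (𝓡 n) (M z) (fun y : Y z => f₀ ⟨z, y⟩)
  mem_Z : ∀ z x, x ∈ (fiber z).Z ↔ (⟨z, x⟩ : TotalSpace FM M) ∈ total.Z
  total_ι : ∀ z t (y : Y z), (t, y) ∈ cover (fun y : Y z => f₀ ⟨z, y⟩) → 0 ≤ t →
    total.ι t ⟨z, y⟩ = ⟨z, (fiber z).ι t y⟩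
  isometry_ι : ∀ z U s, IsLift (𝓡 n) (fun y : Y z => f₀ ⟨z, y⟩) U s → (∀ y ∈ U, 0 < s y) →
    ∀ y ∈ U, ∀ v : TangentSpace (𝓡 n) y,
      ‖(mfderiv (𝓡 n) (𝓡 n) (fun y => (fiber z).ι (s y) y) y v :
        TangentSpace (𝓡 n) ((fiber z).ι (s y) y))‖ = ‖v‖

end FiberBundles

/-! ### Super vector bundles -/

section VectorBundles

variable {EX HX : Type*} [NormedAddCommGroup EX] [NormedSpace ℝ EX] [TopologicalSpace HX]
  (IX : ModelWithCorners ℝ EX HX) {X : Type*} [TopologicalSpace X] [ChartedSpace HX X]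
  (F : Type*) [NormedAddCommGroup F] [NormedSpace ℂ F]
  (E : X → Type*) [∀ x, NormedAddCommGroup (E x)] [∀ x, InnerProductSpace ℂ (E x)]
  [TopologicalSpace (TotalSpace F E)] [FiberBundle F E] [VectorBundle ℂ F E]

/-- The complex vector bundle `E → X` is a smooth `ℤ/2`-graded Hermitian vector bundle: the
coordinate changes are smooth, the Hermitian metric (the given inner product on the fibres) is
smooth, and the grading `E = E⁺ ⊕ E⁻` is given by a smooth family of involutions `τ`, with
eigenspaces `E⁺` and `E⁻` for `1` and `-1`, which are orthogonal. -/
structure SuperBundle where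
  smooth_coordChange : ∀ (e e' : Trivialization F (TotalSpace.proj : TotalSpace F E → X))
    [MemTrivializationAtlas e] [MemTrivializationAtlas e'],
    ContMDiffOn IX 𝓘(ℝ, F →L[ℂ] F) ∞ (fun x => (e.coordChangeL ℂ e' x : F →L[ℂ] F))
      (e.baseSet ∩ e'.baseSet)
  smooth_metric : ∀ (e : Trivialization F (TotalSpace.proj : TotalSpace F E → X))
    [MemTrivializationAtlas e] (v w : F),
    ContMDiffOn IX 𝓘(ℝ, ℂ) ∞ (fun x => inner ℂ (e.symmL ℂ x v) (e.symmL ℂ x w)) e.baseSet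
  τ : ∀ x, E x →L[ℂ] E x
  τ_τ : ∀ x v, τ x (τ x v) = v
  norm_τ : ∀ x v, ‖τ x v‖ = ‖v‖
  smooth_τ : ∀ (e : Trivialization F (TotalSpace.proj : TotalSpace F E → X))
    [MemTrivializationAtlas e] (v : F),
    ContMDiffOn IX 𝓘(ℝ, F) ∞
      (fun x => e.continuousLinearMapAt ℂ x (τ x (e.symmL ℂ x v))) e.baseSet

variable {F E}

/-- A matrix entry of (a form component of) an element of `Λ W ⊗ Hom(E x', E x)` in local
trivializations of `E` around `x` and `x'`. -/
def entry {W : Type*} [AddCommGroup W] [Module ℂ W]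
    (e e' : Trivialization F (TotalSpace.proj : TotalSpace F E → X))
    [MemTrivializationAtlas e] [MemTrivializationAtlas e']
    (ℓ : Form W →ₗ[ℂ] ℂ) (φ : F →L[ℂ] ℂ) (v : F) (x x' : X)
    (k : Coeff W (E x' →L[ℂ] E x)) : ℂ :=
  φ (e.continuousLinearMapAt ℂ x (component ℓ k (e'.symmL ℂ x' v)))

end VectorBundles

/-! ### End-periodic super vector bundles and asymptotically periodic smoothing operators -/

section Main

variable {EB : Type*} [NormedAddCommGroup EB] [NormedSpace ℝ EB]
  {B : Type*} [TopologicalSpace B] [ChartedSpace EB B] {n : ℕ}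
  {FM : Type*} [TopologicalSpace FM] [ChartedSpace (EuclideanSpace ℝ (Fin n)) FM]
  {M : B → Type*} [∀ z, TopologicalSpace (M z)]
  [∀ z, ChartedSpace (EuclideanSpace ℝ (Fin n)) (M z)]
  [TopologicalSpace (TotalSpace FM M)]
  [ChartedSpace (ModelProd EB (EuclideanSpace ℝ (Fin n))) (TotalSpace FM M)]
  [∀ z, RiemannianBundle (fun x : M z => TangentSpace (𝓡 n) x)]
  {FY : Type*} [TopologicalSpace FY] [ChartedSpace (EuclideanSpace ℝ (Fin n)) FY]
  {Y : B → Type*} [∀ z, TopologicalSpace (Y z)]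
  [∀ z, ChartedSpace (EuclideanSpace ℝ (Fin n)) (Y z)]
  [TopologicalSpace (TotalSpace FY Y)]
  [ChartedSpace (ModelProd EB (EuclideanSpace ℝ (Fin n))) (TotalSpace FY Y)]
  [∀ z, RiemannianBundle (fun y : Y z => TangentSpace (𝓡 n) y)]

namespace EndPeriodicFiberBundle

variable (D : EndPeriodicFiberBundle (EB := EB) n FM M FY Y)

/-- The map `f₀ : Y z → S¹` defining the infinite cyclic cover of the fibre `Y z`. -/
def f₀At (z : B) : Y z → Circle := fun y => D.f₀ ⟨z, y⟩

/-- The infinite cyclic cover of the fibre `Y z`. -/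
def coverAt (z : B) : Set (ℝ × Y z) := cover (D.f₀At z)

/-- The identification of the half `f ≥ 0` of the cover of `Y z` with the end of `M z`. -/
def ιAt (z : B) (x : ℝ × Y z) : M z := (D.fiber z).ι x.1 x.2

/-- The compact part of `M z` together with the first `N + 1` segments `W_0, …, W_N`. -/
def Z (z : B) (N : ℕ) : Set (M z) :=
  (D.fiber z).Z ∪ D.ιAt z '' {x | x ∈ D.coverAt z ∧ 0 ≤ x.1 ∧ x.1 < N + 1}

/-- The Riemannian distance in `M z` from the image of a point of the end to the
segment `W_0`. -/
def distW₀ (z : B) (x : ℝ × Y z) : ℝ≥0∞ :=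
  ⨅ w ∈ {w | w ∈ D.coverAt z ∧ 0 ≤ w.1 ∧ w.1 ≤ 1},
    Manifold.riemannianEDist (𝓡 n) (D.ιAt z x) (D.ιAt z w)

end EndPeriodicFiberBundle

variable {F : Type*} [NormedAddCommGroup F] [NormedSpace ℂ F]
  {E : TotalSpace FM M → Type*} [∀ x, NormedAddCommGroup (E x)] [∀ x, InnerProductSpace ℂ (E x)]
  [TopologicalSpace (TotalSpace F E)] [FiberBundle F E] [VectorBundle ℂ F E]
  {E' : TotalSpace FY Y → Type*} [∀ y, NormedAddCommGroup (E' y)]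
  [∀ y, InnerProductSpace ℂ (E' y)]
  [TopologicalSpace (TotalSpace F E')] [FiberBundle F E'] [VectorBundle ℂ F E']

/-- A family of end-periodic `ℤ/2`-graded Hermitian vector bundles: over the end, `E` is identified
by `Φ` with the lift of a bundle `E'` over `Y`. The fibre of the lift of `E'` at
`(t, y)` is the fibre of `E'` at `y`. -/
structure EndPeriodicSuperBundle (D : EndPeriodicFiberBundle (EB := EB) n FM M FY Y)
    (F : Type*) [NormedAddCommGroup F] [NormedSpace ℂ F]
    (E : TotalSpace FM M → Type*) [∀ x, NormedAddCommGroup (E x)]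
    [∀ x, InnerProductSpace ℂ (E x)]
    [TopologicalSpace (TotalSpace F E)] [FiberBundle F E] [VectorBundle ℂ F E]
    (E' : TotalSpace FY Y → Type*) [∀ y, NormedAddCommGroup (E' y)]
    [∀ y, InnerProductSpace ℂ (E' y)]
    [TopologicalSpace (TotalSpace F E')] [FiberBundle F E'] [VectorBundle ℂ F E'] where
  onM : SuperBundle (𝓘(ℝ, EB).prod (𝓡 n)) F E
  onY : SuperBundle (𝓘(ℝ, EB).prod (𝓡 n)) F E'
  Φ : ∀ (z : B) (x : ℝ × Y z), E' ⟨z, x.2⟩ ≃ₗᵢ[ℂ] E ⟨z, D.ιAt z x⟩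
  Φ_τ : ∀ (z : B), ∀ x ∈ D.coverAt z, 0 ≤ x.1 → ∀ v : E' ⟨z, x.2⟩,
    Φ z x (onY.τ ⟨z, x.2⟩ v) = onM.τ ⟨z, D.ιAt z x⟩ (Φ z x v)
  smooth_Φ : ∀ U s, IsLift (𝓘(ℝ, EB).prod (𝓡 n)) D.f₀ U s → (∀ w ∈ U, 0 < s w) →
    ∀ (e : Trivialization F (TotalSpace.proj : TotalSpace F E → TotalSpace FM M))
      (e' : Trivialization F (TotalSpace.proj : TotalSpace F E' → TotalSpace FY Y))
      [MemTrivializationAtlas e] [MemTrivializationAtlas e'] (v : F),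
      ContMDiffOn (𝓘(ℝ, EB).prod (𝓡 n)) 𝓘(ℝ, F) ∞
        (fun w : TotalSpace FY Y => e.continuousLinearMapAt ℂ ⟨w.1, D.ιAt w.1 (s w, w.2)⟩
          (Φ w.1 (s w, w.2) (e'.symmL ℂ w v)))
        {w | w ∈ U ∧ w ∈ e'.baseSet ∧
          (⟨w.1, D.ιAt w.1 (s w, w.2)⟩ : TotalSpace FM M) ∈ e.baseSet}

namespace EndPeriodicSuperBundle

variable {D : EndPeriodicFiberBundle (EB := EB) n FM M FY Y}
  (S : EndPeriodicSuperBundle D F E E')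

/-- Kernels on the fibre `M z` with values in `Λ T_z^*B ⊗ Hom(E, E)`. -/
abbrev KernelM (_ : EndPeriodicSuperBundle D F E E') (z : B) : Type _ :=
  Kernel (Cotangent EB z) (fun x : M z => E ⟨z, x⟩)

/-- Kernels on the infinite cyclic cover of `Y z` (only their values at points of the cover
matter). -/
abbrev KernelCover (_ : EndPeriodicSuperBundle D F E E') (z : B) : Type _ :=
  Kernel (Cotangent EB z) (fun x : ℝ × Y z => E' ⟨z, x.2⟩)

/-- Kernels on the closed fibre `Y z`. -/
abbrev KernelY (_ : EndPeriodicSuperBundle D F E E') (z : B) : Type _ :=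
  Kernel (Cotangent EB z) (fun y : Y z => E' ⟨z, y⟩)

/-- The grading on the fibres of the bundle over `M z`. -/
def τM (z : B) (x : M z) : E ⟨z, x⟩ →L[ℂ] E ⟨z, x⟩ := S.onM.τ ⟨z, x⟩

/-- The grading on the fibres of the bundle over `Y z`. -/
def τY (z : B) (y : Y z) : E' ⟨z, y⟩ →L[ℂ] E' ⟨z, y⟩ := S.onY.τ ⟨z, y⟩

/-- The grading on the fibres of the lifted bundle over the cover of `Y z`. -/
def τCover (z : B) (x : ℝ × Y z) : E' ⟨z, x.2⟩ →L[ℂ] E' ⟨z, x.2⟩ := S.onY.τ ⟨z, x.2⟩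

/-- The restriction to the end of a kernel on `M z`, as a kernel on the cover of `Y z`. -/
def restrictEnd (z : B) (K : S.KernelM z) : S.KernelCover z :=
  fun x x' => sandwich
    ((S.Φ z x).symm.toContinuousLinearEquiv : E ⟨z, D.ιAt z x⟩ →L[ℂ] E' ⟨z, x.2⟩)
    ((S.Φ z x').toContinuousLinearEquiv : E' ⟨z, x'.2⟩ →L[ℂ] E ⟨z, D.ιAt z x'⟩)
    (K (D.ιAt z x) (D.ιAt z x'))

section

variable [FiniteDimensional ℝ EB]

/-- The kernel `K` on `M z` is asymptotically periodic, with normal kernel `N`. -/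
structure IsAsymptoticTo (z : B) (K : S.KernelM z) (N : S.KernelCover z) : Prop where
  periodic : ∀ x ∈ D.coverAt z, ∀ x' ∈ D.coverAt z, N (x.1 + 1, x.2) (x'.1 + 1, x'.2) = N x x'
  ap1 : ∃ C > 0, ∃ γ > 0, ∀ x x' : M z,
    ‖K x x'‖ ≤ C * gauss γ (Manifold.riemannianEDist (𝓡 n) x x')
  ap2 : ∃ C > 0, ∃ γ > 0, ∀ x ∈ D.coverAt z, 1 ≤ x.1 →
    ‖S.restrictEnd z K x x - N x x‖ ≤ C * gauss γ (D.distW₀ z x)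
  ap3 : ∃ C > 0, ∃ γ > 0, ∀ x ∈ D.coverAt z, ∀ x' ∈ D.coverAt z, 1 ≤ x.1 → 1 ≤ x'.1 →
    ‖S.restrictEnd z K x x' - N x x'‖ ≤ C * gauss γ (min (D.distW₀ z x) (D.distW₀ z x'))

/-- `K` is the smooth kernel of an asymptotically periodic smoothing operator on the fibre `M z`,
whose normal operator has the smooth kernel `N`. -/
structure IsAPSmoothing (z : B) (K : S.KernelM z) (N : S.KernelCover z) : Prop
    extends S.IsAsymptoticTo z K N where
  smooth : ∀ (e e' : Trivialization F (TotalSpace.proj : TotalSpace F E → TotalSpace FM M))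
    [MemTrivializationAtlas e] [MemTrivializationAtlas e']
    (ℓ : Forms EB z →ₗ[ℂ] ℂ) (φ : F →L[ℂ] ℂ) (v : F),
    ContMDiffOn ((𝓡 n).prod (𝓡 n)) 𝓘(ℝ, ℂ) ∞
      (fun q : M z × M z => entry e e' ℓ φ v ⟨z, q.1⟩ ⟨z, q.2⟩ (K q.1 q.2))
      {q | (⟨z, q.1⟩ : TotalSpace FM M) ∈ e.baseSet ∧ (⟨z, q.2⟩ : TotalSpace FM M) ∈ e'.baseSet}
  smooth_normal :
    ∀ (e e' : Trivialization F (TotalSpace.proj : TotalSpace F E' → TotalSpace FY Y))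
    [MemTrivializationAtlas e] [MemTrivializationAtlas e']
    (ℓ : Forms EB z →ₗ[ℂ] ℂ) (φ : F →L[ℂ] ℂ) (v : F) (U U' : Set (Y z)) (s s' : Y z → ℝ),
    IsLift (𝓡 n) (D.f₀At z) U s → IsLift (𝓡 n) (D.f₀At z) U' s' →
    ContMDiffOn ((𝓡 n).prod (𝓡 n)) 𝓘(ℝ, ℂ) ∞
      (fun q : Y z × Y z => entry e e' ℓ φ v ⟨z, q.1⟩ ⟨z, q.2⟩ (N (s q.1, q.1) (s' q.2, q.2)))
      {q | q.1 ∈ U ∧ q.2 ∈ U' ∧ (⟨z, q.1⟩ : TotalSpace FY Y) ∈ e.baseSet ∧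
        (⟨z, q.2⟩ : TotalSpace FY Y) ∈ e'.baseSet}

/-- `r ∈ Λ T_z^*B` is the renormalized supertrace of the asymptotically periodic kernel `K`. (The
normal kernel `N` is determined by `K`, by the third estimate and periodicity.) -/
def HasRenormalizedStr (z : B) [MeasurableSpace (M z)] [MeasurableSpace (Y z)]
    (volM : Measure (M z)) (volY : Measure (Y z)) (K : S.KernelM z) (r : Forms EB z) : Prop :=
  ∃ N : S.KernelCover z, S.IsAsymptoticTo z K N ∧
    Tendsto (fun j : ℕ => (∫ x in D.Z z j, str (S.τM z x) (K x x) ∂volM) -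
      ((j : ℂ) + 1) • ∫ x in segment (D.f₀At z),
        str (S.τCover z x) (N x x) ∂(coverMeasure (D.f₀At z) volY)) atTop (𝓝 r)

/-- The Fourier–Laplace transform `(𝓕_ξ u)(y) = ξ^f(x) ∑ₘ ξ^m u(x + m)`, where `x` is the point
over `y` with `0 ≤ f(x) < 1`, of a form-valued section `u` of the lifted bundle. The powers
`ξ^f(x)` are the principal ones. -/
def fourierLaplace (_ : EndPeriodicSuperBundle D F E E') (z : B) (ξ : ℂ)
    (u : ∀ x : ℝ × Y z, Coeff (Cotangent EB z) (ℂ →L[ℂ] E' ⟨z, x.2⟩)) (y : Y z) :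
    Coeff (Cotangent EB z) (ℂ →L[ℂ] E' ⟨z, y⟩) :=
  ξ ^ (segmentCoord (D.f₀At z) y : ℂ) •
    ∑' m : ℤ, ξ ^ m • u (segmentCoord (D.f₀At z) y + m, y)

/-- The kernel on `Y z` of the indicial operator at `ξ` of an operator with normal kernel `N`:
`ξ^(f(x) - f(x')) ∑ₘ ξ^m N(x + m, x')`. -/
def indicial (z : B) (N : S.KernelCover z) (ξ : ℂ) : S.KernelY z :=
  fun y y' => ξ ^ ((segmentCoord (D.f₀At z) y : ℂ) - (segmentCoord (D.f₀At z) y' : ℂ)) •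
    ∑' m : ℤ, ξ ^ m •
      N (segmentCoord (D.f₀At z) y + m, y) (segmentCoord (D.f₀At z) y', y')

/-- The kernel of the derivative in `ξ` of the indicial family. -/
def indicialDeriv (z : B) (N : S.KernelCover z) (ξ : ℂ) : S.KernelY z :=
  fun y y' => deriv (fun ζ : ℂ => S.indicial z N ζ y y') ξ

/-- `u` is a smooth compactly supported section of the lifted bundle over the cover of `Y z`. -/
structure IsTestSection (_ : EndPeriodicSuperBundle D F E E') (z : B)
    (u : ∀ x : ℝ × Y z, E' ⟨z, x.2⟩) : Prop where
  smooth : ∀ (e : Trivialization F (TotalSpace.proj : TotalSpace F E' → TotalSpace FY Y))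
    [MemTrivializationAtlas e] (U : Set (Y z)) (s : Y z → ℝ), IsLift (𝓡 n) (D.f₀At z) U s →
    ContMDiffOn (𝓡 n) 𝓘(ℝ, F) ∞
      (fun y : Y z => e.continuousLinearMapAt ℂ ⟨z, y⟩ (u (s y, y)))
      {y | y ∈ U ∧ (⟨z, y⟩ : TotalSpace FY Y) ∈ e.baseSet}
  compact : ∃ R : ℝ, ∀ x ∈ D.coverAt z, R < |x.1| → u x = 0

/-- A section without form part, as a form-valued section. -/
def toForm (_ : EndPeriodicSuperBundle D F E E') (z : B) (u : ∀ x : ℝ × Y z, E' ⟨z, x.2⟩)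
    (x : ℝ × Y z) : Coeff (Cotangent EB z) (ℂ →L[ℂ] E' ⟨z, x.2⟩) :=
  (Coeff.equiv _ _).symm (1 ⊗ₜ ContinuousLinearMap.toSpanSingleton ℂ (u x))

/-- The relation `𝓕_ξ ∘ N = P_ξ ∘ 𝓕_ξ` that determines the indicial operator `P_ξ`. -/
def Intertwines (z : B) [MeasurableSpace (Y z)] (volY : Measure (Y z)) (ξ : ℂ)
    (N : S.KernelCover z) (Pξ : S.KernelY z) : Prop :=
  ∀ u : ∀ x : ℝ × Y z, E' ⟨z, x.2⟩, S.IsTestSection z u → ∀ y : Y z,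
    S.fourierLaplace z ξ (kapply (S.τCover z) (coverMeasure (D.f₀At z) volY) N (S.toForm z u)) y =
      kapply (S.τY z) volY Pξ (S.fourierLaplace z ξ (S.toForm z u)) y

end

end EndPeriodicSuperBundle

end Main

end EndPeriodic

end

set_option linter.unusedSectionVars false

noncomputable section

/-! Put `a(x, w) = str (P(x, w) Q(w, x))`. The supertrace of form-valued homomorphisms vanishes on
supercommutators (`str_gradedComp_comm`), so the supertrace of the kernel of `[P, Q]` at `(x, x)` is
the integral of `a(x, w) - a(w, x)` over `w` (`str_superComm`).

Cut the fibre into levels: level `0` is the compact part together with `W₀`, level `k ≥ 1` is `W_k`.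
When `x` runs over the levels up to `N`, the pairs with both levels at most `N` cancel by
antisymmetry. What is left are the pairs across the cut, with levels `N - q₁` and `N + 1 + q₂`. For
fixed `q₁`, `q₂` both levels run off to infinity, where the kernels approach their periodic models,
so the contributions converge to `A(-(q₁ + q₂ + 1)) - A(q₁ + q₂ + 1)`. Here `A(m)` is the integral
of `str (N(P)(x + m, x') N(Q)(x' - m, x))` over two copies of a segment. Gaussian decay dominates
the sum, and exactly `m` pairs `q₁`, `q₂` have `q₁ + q₂ + 1 = m`; hence the limit is `-∑ m A(m)`
(`BoundedLevels.tendsto_setIntegral_sub_swap`, `tendsto_setIntegral_str_superComm`). The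
renormalization subtracts nothing: the normal kernel of `[P, Q]` is `[N(P), N(Q)]`, whose supertrace
integrates to `0` over a segment by periodicity (`integral_segment_str_superComm`).

The contour integrals give the same sum. The indicial kernels are Laurent series in `ξ` times the
powers `ξ^(f(x) - f(x'))`, and these prefactors cancel in the supertrace of a product. The contour
integral selects the terms with opposite exponents `m`, `-m`. The weight of the integrand `b` of
`A(m)` is `f(x) - f(x')` in the first contour integral, after symmetrization, and `f(x) - f(x') + m`
in the second, where the derivative produces it. The difference is `-m` (`fourier_defect`,
`indicial_defect`).

The analytic input concerns the distance. Lifts of `f₀` have bounded derivatives since `Y` is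
compact, so Gaussian decay in the distance implies Gaussian decay in the difference of levels, and
every level has bounded volume (`PeriodicEnd.IsMetricLift.isEndModel`). Translations of the end
preserve lengths, and a path that cannot be translated back must reach the translate of `W₀`; this
makes the composition asymptotic to the composition of the normal kernels, with errors governed by
the distance to `W₀` (`norm_pull_kcomp_sub_le`). Decay and parity of a normal kernel are not
assumed: it is the limit of translates of the kernel (`IsAsymptoticKernel.tendsto`). Measurability
is obtained by reading kernels in countably many trivializations and along countably many smooth
lifts. -/

namespace EndPeriodic

/-! ### Algebra of form-valued homomorphisms -/

section CoefficientAlgebra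

variable {W : Type*} [AddCommGroup W] [Module ℂ W] {H : Type*} [NormedAddCommGroup H]
  [NormedSpace ℂ H]

/-- The pure tensor `α ⊗ A`. -/
def Coeff.tmul (α : ExteriorAlgebra ℂ W) (A : H) : Coeff W H := (Coeff.equiv W H).symm (α ⊗ₜ A)

theorem Coeff.induction {motive : Coeff W H → Prop} (zero : motive 0)
    (tmul : ∀ α A, motive (Coeff.tmul α A)) (add : ∀ k l, motive k → motive l → motive (k + l))
    (k : Coeff W H) : motive k :=
  TensorProduct.induction_on (R := ℂ) (M := ExteriorAlgebra ℂ W) (N := H) k zero tmul add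

variable {V₀ V₁ V₂ V₃ : Type*} [NormedAddCommGroup V₀] [NormedSpace ℂ V₀]
  [NormedAddCommGroup V₁] [NormedSpace ℂ V₁]
  [NormedAddCommGroup V₂] [NormedSpace ℂ V₂] [NormedAddCommGroup V₃] [NormedSpace ℂ V₃]

theorem formInvol_tmul (α : ExteriorAlgebra ℂ W) (A : H) :
    formInvol (Coeff.tmul α A) = Coeff.tmul (CliffordAlgebra.involute α) A := rfl

theorem component_tmul (ℓ : Form W →ₗ[ℂ] ℂ) (α : ExteriorAlgebra ℂ W) (A : H) :
    component ℓ (Coeff.tmul α A) = ℓ ((Form.equiv W).symm α) • A := by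
  simp [component, Coeff.tmul]

theorem sandwich_tmul (T' : V₂ →L[ℂ] V₃) (T : V₀ →L[ℂ] V₁) (α : ExteriorAlgebra ℂ W)
    (A : V₁ →L[ℂ] V₂) : sandwich T' T (Coeff.tmul α A) = Coeff.tmul α (T' ∘L A ∘L T) := rfl

theorem plainComp_tmul (α β : ExteriorAlgebra ℂ W) (A : V₂ →L[ℂ] V₃) (A' : V₁ →L[ℂ] V₂) :
    plainComp (Coeff.tmul α A) (Coeff.tmul β A') = Coeff.tmul (α * β) (A ∘L A') := rfl

theorem str_tmul (τ : V₁ →L[ℂ] V₁) (α : ExteriorAlgebra ℂ W) (A : V₁ →L[ℂ] V₁) :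
    str τ (Coeff.tmul α A) = LinearMap.trace ℂ V₁ (τ ∘L A : V₁ →L[ℂ] V₁).toLinearMap •
      (Form.equiv W).symm α := by
  simp [str, Coeff.tmul]

theorem plainComp_add_left (k k' : Coeff W (V₂ →L[ℂ] V₃)) (l : Coeff W (V₁ →L[ℂ] V₂)) :
    plainComp (k + k') l = plainComp k l + plainComp k' l := by
  simp [plainComp]

theorem plainComp_add_right (k : Coeff W (V₂ →L[ℂ] V₃)) (l l' : Coeff W (V₁ →L[ℂ] V₂)) :
    plainComp k (l + l') = plainComp k l + plainComp k l' := by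
  simp [plainComp]

theorem plainComp_smul_left (c : ℂ) (k : Coeff W (V₂ →L[ℂ] V₃)) (l : Coeff W (V₁ →L[ℂ] V₂)) :
    plainComp (c • k) l = c • plainComp k l := by
  simp [plainComp]

theorem plainComp_smul_right (c : ℂ) (k : Coeff W (V₂ →L[ℂ] V₃)) (l : Coeff W (V₁ →L[ℂ] V₂)) :
    plainComp k (c • l) = c • plainComp k l := by
  simp [plainComp]

theorem plainComp_zero_left (l : Coeff W (V₁ →L[ℂ] V₂)) :
    plainComp (0 : Coeff W (V₂ →L[ℂ] V₃)) l = 0 := by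
  simp [plainComp]

theorem plainComp_zero_right (k : Coeff W (V₂ →L[ℂ] V₃)) :
    plainComp k (0 : Coeff W (V₁ →L[ℂ] V₂)) = 0 := by
  simp [plainComp]

/-- The graded product as a bilinear map. -/
def gradedCompₗ (τ₂ : V₂ →L[ℂ] V₂) (τ₃ : V₃ →L[ℂ] V₃) :
    Coeff W (V₂ →L[ℂ] V₃) →ₗ[ℂ] Coeff W (V₁ →L[ℂ] V₂) →ₗ[ℂ] Coeff W (V₁ →L[ℂ] V₃) :=
  LinearMap.mk₂ ℂ (gradedComp τ₂ τ₃)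
    (fun k k' l => by
      simp only [gradedComp, map_add, plainComp_smul_left, sub_eq_add_neg, plainComp_add_left,
        smul_add, neg_add]
      abel)
    (fun c k l => by
      simp only [gradedComp, map_smul, plainComp_smul_left, ← smul_add, ← smul_sub]
      simp only [smul_comm _ c, smul_add])
    (fun k l l' => by
      simp only [gradedComp, map_add, plainComp_add_right]
      abel)
    (fun c k l => by
      simp only [gradedComp, map_smul, plainComp_smul_right, smul_add])

theorem sandwich_sandwich {V₄ V₅ : Type*} [NormedAddCommGroup V₄] [NormedSpace ℂ V₄]
    [NormedAddCommGroup V₅] [NormedSpace ℂ V₅] (S' : V₃ →L[ℂ] V₄) (S : V₅ →L[ℂ] V₀)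
    (T' : V₂ →L[ℂ] V₃) (T : V₀ →L[ℂ] V₁) (k : Coeff W (V₁ →L[ℂ] V₂)) :
    sandwich S' S (sandwich T' T k) = sandwich (S' ∘L T') (T ∘L S) k := by
  induction k using Coeff.induction with
  | zero => simp
  | tmul α A => simp only [sandwich_tmul]; rfl
  | add k l hk hl => simp [hk, hl]

theorem sandwich_id (k : Coeff W (V₁ →L[ℂ] V₂)) :
    sandwich (ContinuousLinearMap.id ℂ V₂) (ContinuousLinearMap.id ℂ V₁) k = k := by
  induction k using Coeff.induction with
  | zero => simp
  | tmul α A => simp only [sandwich_tmul]; rfl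
  | add k l hk hl => simp [hk, hl]

theorem formInvol_sandwich (T' : V₂ →L[ℂ] V₃) (T : V₀ →L[ℂ] V₁) (k : Coeff W (V₁ →L[ℂ] V₂)) :
    formInvol (sandwich T' T k) = sandwich T' T (formInvol k) := by
  induction k using Coeff.induction with
  | zero => simp
  | tmul α A => simp only [sandwich_tmul, formInvol_tmul]
  | add k l hk hl => simp [hk, hl]

/-- The pair `U`, `U'` is inserted between the two factors, where it cancels. A one-sided inverse is
enough, and the outer maps need not be invertible. -/
theorem sandwich_plainComp {V₄ V₅ : Type*} [NormedAddCommGroup V₄] [NormedSpace ℂ V₄]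
    [NormedAddCommGroup V₅] [NormedSpace ℂ V₅]
    (T' : V₃ →L[ℂ] V₄) (T : V₀ →L[ℂ] V₁) (U : V₅ →L[ℂ] V₂) (U' : V₂ →L[ℂ] V₅)
    (hU : U ∘L U' = ContinuousLinearMap.id ℂ V₂)
    (k : Coeff W (V₂ →L[ℂ] V₃)) (l : Coeff W (V₁ →L[ℂ] V₂)) :
    sandwich T' T (plainComp k l) = plainComp (sandwich T' U k) (sandwich U' T l) := by
  induction k using Coeff.induction with
  | zero => simp [plainComp_zero_left]
  | add k k' hk hl => simp [hk, hl, plainComp_add_left]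
  | tmul α A =>
    induction l using Coeff.induction with
    | zero => simp [plainComp_zero_right]
    | add k k' hk hl => simp only [plainComp_add_right, hk, hl, map_add]
    | tmul β A' =>
      simp only [sandwich_tmul, plainComp_tmul]
      congr 1
      ext v
      have := fun v => DFunLike.congr_fun hU v
      simp at this
      simp [this]

/-- Changing all fibres by isomorphisms that respect the gradings is compatible with the graded
product. -/
theorem sandwich_gradedComp {V₄ V₅ : Type*} [NormedAddCommGroup V₄] [NormedSpace ℂ V₄]
    [NormedAddCommGroup V₅] [NormedSpace ℂ V₅]
    (T' : V₃ →L[ℂ] V₄) (T : V₀ →L[ℂ] V₁) (U : V₅ →L[ℂ] V₂) (U' : V₂ →L[ℂ] V₅)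
    (hU : U ∘L U' = ContinuousLinearMap.id ℂ V₂) {τ₂ : V₂ →L[ℂ] V₂} {τ₃ : V₃ →L[ℂ] V₃}
    {τ₅ : V₅ →L[ℂ] V₅} {τ₄ : V₄ →L[ℂ] V₄} (h₂ : τ₂ ∘L U = U ∘L τ₅) (h₃ : T' ∘L τ₃ = τ₄ ∘L T')
    (k : Coeff W (V₂ →L[ℂ] V₃)) (l : Coeff W (V₁ →L[ℂ] V₂)) :
    sandwich T' T (gradedComp τ₂ τ₃ k l) =
      gradedComp τ₅ τ₄ (sandwich T' U k) (sandwich U' T l) := by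
  simp only [gradedComp, map_add, sandwich_plainComp T' T U U' hU, map_smul, map_sub,
    sandwich_sandwich, h₂, h₃, formInvol_sandwich]

/-- The compatibility with the gradings moves `U'` to the far left, and cyclicity of the trace
brings it back next to `U`, where the two cancel. -/
theorem str_sandwich [FiniteDimensional ℂ V₁] [FiniteDimensional ℂ V₂]
    {τ₁ : V₁ →L[ℂ] V₁} {τ₂ : V₂ →L[ℂ] V₂} (U : V₂ →L[ℂ] V₁) (U' : V₁ →L[ℂ] V₂)
    (hU : U ∘L U' = ContinuousLinearMap.id ℂ V₁) (h : U' ∘L τ₁ = τ₂ ∘L U')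
    (k : Coeff W (V₁ →L[ℂ] V₁)) : str τ₂ (sandwich U' U k) = str τ₁ k := by
  induction k using Coeff.induction with
  | zero => simp
  | add k k' hk hl => simp [hk, hl]
  | tmul α A =>
    simp only [sandwich_tmul, str_tmul]
    congr 1
    have h1 : ((τ₂ ∘L U' ∘L A ∘L U : V₂ →L[ℂ] V₂)).toLinearMap =
        (U'.toLinearMap) ∘ₗ ((τ₁ ∘L A).toLinearMap ∘ₗ U.toLinearMap) := by
      rw [← ContinuousLinearMap.comp_assoc, ← h]; rfl
    rw [h1, LinearMap.trace_comp_comm', LinearMap.comp_assoc]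
    have : U.toLinearMap ∘ₗ U'.toLinearMap = LinearMap.id := by
      ext v; exact DFunLike.congr_fun hU v
    rw [this, LinearMap.comp_id]

end CoefficientAlgebra

/-! ### Graded commutativity of forms and the trace property of the supertrace -/

section Supertrace

variable {W : Type*} [AddCommGroup W] [Module ℂ W]

-- Vectors anticommute and the parity involution is multiplicative, so the sign collected by moving
-- a vector through `β` is the one recorded by `involute`.
open CliffordAlgebra in
theorem ι_mul_eq_involute_mul_ι (w : W) (β : ExteriorAlgebra ℂ W) :
    ExteriorAlgebra.ι ℂ w * β =
      involute (Q := (0 : QuadraticForm ℂ W)) β * ExteriorAlgebra.ι ℂ w := by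
  induction β using ExteriorAlgebra.induction with
  | algebraMap r =>
    rw [AlgHom.commutes]; exact (Algebra.commutes r _).symm
  | ι x =>
    have h1 := ExteriorAlgebra.ι_add_mul_swap (R := ℂ) w x
    have h2 : involute (Q := (0 : QuadraticForm ℂ W)) (ExteriorAlgebra.ι ℂ x) =
      -ExteriorAlgebra.ι ℂ x := involute_ι _
    rw [h2, neg_mul]; exact eq_neg_of_add_eq_zero_left h1
  | mul a b ha hb => rw [← mul_assoc, ha, mul_assoc, hb, ← mul_assoc, map_mul]
  | add a b ha hb => rw [mul_add, ha, hb, map_add, add_mul]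

open CliffordAlgebra in
/-- Graded commutativity of the exterior algebra. -/
theorem two_smul_mul_eq (α β : ExteriorAlgebra ℂ W) :
    (2 : ℂ) • (α * β) = β * (α + involute (Q := (0 : QuadraticForm ℂ W)) α) +
      involute (Q := (0 : QuadraticForm ℂ W)) β * (α - involute (Q := (0 : QuadraticForm ℂ W)) α) := by
  induction α using ExteriorAlgebra.induction generalizing β with
  | algebraMap r =>
    rw [AlgHom.commutes, sub_self, mul_zero, add_zero, ← two_smul ℂ, mul_smul_comm,
      Algebra.commutes]
  | ι x =>
    have h2 : involute (Q := (0 : QuadraticForm ℂ W)) (ExteriorAlgebra.ι ℂ x) =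
      -ExteriorAlgebra.ι ℂ x := involute_ι _
    rw [h2, add_neg_cancel, mul_zero, zero_add, sub_neg_eq_add, ← two_smul ℂ, mul_smul_comm,
      ι_mul_eq_involute_mul_ι]
  | add a b ha hb => rw [add_mul, smul_add, ha, hb, map_add]; noncomm_ring
  | mul a b ha hb =>
    -- Doubling once more makes room for both induction hypotheses: the one for `b` splits `b * β`
    -- into two products, and the one for `a` is applied to each of them.
    have key : (2 : ℂ) • ((2 : ℂ) • (a * b * β)) = (2 : ℂ) • (β * (a * b + involute (a * b)) +
      involute (Q := (0 : QuadraticForm ℂ W)) β * (a * b - involute (a * b))) := by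
      have h1 : ∀ β c : ExteriorAlgebra ℂ W, (2 : ℂ) • (a * (β * c)) =
          (β * (a + involute (Q := (0 : QuadraticForm ℂ W)) a) +
            involute (Q := (0 : QuadraticForm ℂ W)) β *
              (a - involute (Q := (0 : QuadraticForm ℂ W)) a)) * c := by
        intro β c; rw [← ha, smul_mul_assoc, mul_assoc]
      rw [mul_assoc, ← mul_smul_comm, hb, mul_add, smul_add, h1, h1, involute_involute, map_mul,
        two_smul]
      noncomm_ring
    exact smul_right_injective _ two_ne_zero key

variable {V₁ V₂ : Type*} [NormedAddCommGroup V₁] [NormedSpace ℂ V₁] [FiniteDimensional ℂ V₁]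
  [NormedAddCommGroup V₂] [NormedSpace ℂ V₂] [FiniteDimensional ℂ V₂]

/-- Conjugation by the gradings cancels `τ₁` in front of `A`, so cyclicity yields the trace of `τ₂ B
A` without a sign. What remains is the sign `(-1)^(|α| |β|)` from exchanging the forms; with the
parity involution `ε` it is `(1 + ε ⊗ 1 + 1 ⊗ ε - ε ⊗ ε) / 2`, which accounts for the four terms and
the factor `2`. -/
theorem two_smul_str_plainComp_sandwich {τ₁ : V₁ →L[ℂ] V₁} {τ₂ : V₂ →L[ℂ] V₂}
    (h₁ : τ₁ ∘L τ₁ = ContinuousLinearMap.id ℂ V₁)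
    (k : Coeff W (V₂ →L[ℂ] V₁)) (l : Coeff W (V₁ →L[ℂ] V₂)) :
    (2 : ℂ) • str τ₁ (plainComp (sandwich τ₁ τ₂ k) l) = str τ₂ (plainComp l k) +
      str τ₂ (plainComp l (formInvol k)) + str τ₂ (plainComp (formInvol l) k) -
      str τ₂ (plainComp (formInvol l) (formInvol k)) := by
  induction k using Coeff.induction with
  | zero => simp [plainComp_zero_left, plainComp_zero_right]
  | add k k' hk hl =>
    simp only [map_add, plainComp_add_left, plainComp_add_right, smul_add, hk, hl]
    abel
  | tmul α A =>
    induction l using Coeff.induction with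
    | zero => simp [plainComp_zero_left, plainComp_zero_right]
    | add k k' hk hl =>
      simp only [map_add, plainComp_add_left, plainComp_add_right, smul_add, hk, hl]
      abel
    | tmul β B =>
      simp only [sandwich_tmul, plainComp_tmul, formInvol_tmul, str_tmul]
      have htr : LinearMap.trace ℂ V₁ (τ₁ ∘L (τ₁ ∘L A ∘L τ₂) ∘L B : V₁ →L[ℂ] V₁).toLinearMap =
          LinearMap.trace ℂ V₂ (τ₂ ∘L B ∘L A : V₂ →L[ℂ] V₂).toLinearMap := by
        have e1 : (τ₁ ∘L (τ₁ ∘L A ∘L τ₂) ∘L B : V₁ →L[ℂ] V₁).toLinearMap =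
            A.toLinearMap ∘ₗ (τ₂ ∘L B).toLinearMap := by
          ext v
          have := DFunLike.congr_fun h₁ (A (τ₂ (B v)))
          simpa using this
        rw [e1, LinearMap.trace_comp_comm']
        rfl
      rw [htr, smul_comm, ← map_smul, two_smul_mul_eq, ← smul_add, ← smul_add, ← smul_sub,
        ← map_add, ← map_add, ← map_sub]
      congr 2
      noncomm_ring

theorem str_plainComp_sandwich_sandwich {τ₁ : V₁ →L[ℂ] V₁} {τ₂ : V₂ →L[ℂ] V₂}
    (h₁ : τ₁ ∘L τ₁ = ContinuousLinearMap.id ℂ V₁) (h₂ : τ₂ ∘L τ₂ = ContinuousLinearMap.id ℂ V₂)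
    (k : Coeff W (V₂ →L[ℂ] V₁)) (l : Coeff W (V₁ →L[ℂ] V₂)) :
    str τ₁ (plainComp (sandwich τ₁ τ₂ k) (sandwich τ₂ τ₁ l)) = str τ₁ (plainComp k l) := by
  rw [← sandwich_plainComp _ _ _ _ h₂, str_sandwich _ _ h₁ rfl]

theorem formInvol_formInvol {H : Type*} [NormedAddCommGroup H] [NormedSpace ℂ H]
    (k : Coeff W H) : formInvol (formInvol k) = k := by
  induction k using Coeff.induction with
  | zero => simp
  | tmul α A => simp only [formInvol_tmul, CliffordAlgebra.involute_involute]
  | add k l hk hl => simp [hk, hl]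

/-- A definite total degree ties the degree of the homomorphism to that of the form. Conjugation by
the gradings can then be traded for `formInvol`, and only form signs are left to compare. -/
theorem HasParity.sandwich_eq {τ₁ : V₁ →L[ℂ] V₁} {τ₂ : V₂ →L[ℂ] V₂} {p : ℕ}
    {k : Coeff W (V₁ →L[ℂ] V₂)} (h : HasParity τ₁ τ₂ p k) :
    sandwich τ₂ τ₁ k = (-1 : ℂ) ^ p • formInvol k := by
  rw [← formInvol_formInvol (sandwich τ₂ τ₁ k), h, map_smul]

/-- The supertrace vanishes on supercommutators. -/
theorem str_gradedComp_comm {τ₁ : V₁ →L[ℂ] V₁} {τ₂ : V₂ →L[ℂ] V₂}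
    (h₁ : τ₁ ∘L τ₁ = ContinuousLinearMap.id ℂ V₁) (h₂ : τ₂ ∘L τ₂ = ContinuousLinearMap.id ℂ V₂)
    {p q : ℕ} {k : Coeff W (V₂ →L[ℂ] V₁)} {l : Coeff W (V₁ →L[ℂ] V₂)}
    (hk : HasParity τ₂ τ₁ p k) (hl : HasParity τ₁ τ₂ q l) :
    (-1 : ℂ) ^ (p * q) • str τ₂ (gradedComp τ₁ τ₂ l k) = str τ₁ (gradedComp τ₂ τ₁ k l) := by
  have sk := hk.sandwich_eq
  have sl := hl.sandwich_eq
  have sk' : sandwich τ₁ τ₂ (formInvol k) = (-1 : ℂ) ^ p • k := by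
    rw [← formInvol_sandwich]; exact hk
  have sl' : sandwich τ₂ τ₁ (formInvol l) = (-1 : ℂ) ^ q • l := by
    rw [← formInvol_sandwich]; exact hl
  have a1 := two_smul_str_plainComp_sandwich (τ₂ := τ₂) h₁ k l
  have a2 := two_smul_str_plainComp_sandwich (τ₂ := τ₂) h₁ (formInvol k) l
  have a3 := two_smul_str_plainComp_sandwich (τ₂ := τ₂) h₁ k (formInvol l)
  have a4 := two_smul_str_plainComp_sandwich (τ₂ := τ₂) h₁ (formInvol k) (formInvol l)
  have b1 := str_plainComp_sandwich_sandwich h₂ h₁ l k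
  have b2 := str_plainComp_sandwich_sandwich h₂ h₁ l (formInvol k)
  rw [sk, plainComp_smul_left, map_smul] at a1 a3
  rw [sk', plainComp_smul_left, map_smul] at a2 a4
  rw [sk, sl, plainComp_smul_left, plainComp_smul_right, map_smul, map_smul] at b1
  rw [sk', sl, plainComp_smul_left, plainComp_smul_right, map_smul, map_smul] at b2
  simp only [formInvol_formInvol] at a1 a2 a3 a4
  simp only [gradedComp, sk, sl, sub_eq_add_neg, plainComp_add_left, plainComp_smul_left, map_add,
    map_smul, smul_add, ← neg_smul]
  generalize str τ₁ (plainComp k l) = R₁ at *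
  generalize str τ₁ (plainComp (formInvol k) l) = R₂ at *
  -- Eight supertraces remain. The relations `a1`–`a4` express those of products `k l` by those of
  -- products `l k`, while `b1` and `b2` say `S₁ = ± S₄` and `S₂ = ± S₃`. In each of the four parity
  -- cases the claim is linear algebra.
  generalize str τ₁ (plainComp k (formInvol l)) = R₃ at *
  generalize str τ₁ (plainComp (formInvol k) (formInvol l)) = R₄ at *
  generalize str τ₂ (plainComp l k) = S₁ at *
  generalize str τ₂ (plainComp l (formInvol k)) = S₂ at *
  generalize str τ₂ (plainComp (formInvol l) k) = S₃ at *
  generalize str τ₂ (plainComp (formInvol l) (formInvol k)) = S₄ at *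
  rcases Nat.even_or_odd p with hp | hp <;> rcases Nat.even_or_odd q with hq | hq
  all_goals
    first
    | rw [(hp.mul_right q).neg_one_pow]
    | rw [(hq.mul_left p).neg_one_pow]
    | rw [(hp.mul hq).neg_one_pow]
    simp only [hp.neg_one_pow, hq.neg_one_pow] at *
    subst b1
    subst b2
    refine smul_right_injective _ (two_ne_zero (α := ℂ)) ?_
    simp only [smul_add]
    have c1 : R₁ = (1 / 2 : ℂ) • (2 : ℂ) • R₁ := by rw [smul_smul]; norm_num
    have c2 : R₂ = (1 / 2 : ℂ) • (2 : ℂ) • R₂ := by rw [smul_smul]; norm_num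
    have c3 : R₃ = (1 / 2 : ℂ) • (2 : ℂ) • R₃ := by rw [smul_smul]; norm_num
    have c4 : R₄ = (1 / 2 : ℂ) • (2 : ℂ) • R₄ := by rw [smul_smul]; norm_num
    simp only [one_smul, neg_smul, smul_neg, neg_eq_iff_eq_neg] at a1 a2 a3 a4
    rw [c1, c2, c3, c4, a1, a2, a3, a4]
    module

end Supertrace

/-! ### Norm estimates for form-valued homomorphisms -/

section CoefficientNorms

variable {W : Type*} [AddCommGroup W] [Module ℂ W] [FiniteDimensional ℂ W]

/-- The index set of the basis of the exterior algebra of `W`. -/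
abbrev FormIndex (W : Type*) [AddCommGroup W] [Module ℂ W] : Type :=
  Finset (Fin (Module.finrank ℂ W))

/-- The basis of the exterior algebra by which the norms of forms are defined. -/
def formBasis (W : Type*) [AddCommGroup W] [Module ℂ W] [FiniteDimensional ℂ W] :
    Module.Basis (FormIndex W) ℂ (ExteriorAlgebra ℂ W) :=
  (Module.finBasis ℂ W).ExteriorAlgebra

variable {H : Type*} [NormedAddCommGroup H] [NormedSpace ℂ H]

theorem Coeff.norm_coords_le (k : Coeff W H) (I : FormIndex W) : ‖Coeff.coords W H k I‖ ≤ ‖k‖ :=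
  norm_le_pi_norm (Coeff.coords W H k) I

theorem Coeff.norm_le {k : Coeff W H} {r : ℝ} (hr : 0 ≤ r)
    (h : ∀ I, ‖Coeff.coords W H k I‖ ≤ r) : ‖k‖ ≤ r :=
  (pi_norm_le_iff_of_nonneg hr).2 h

theorem Form.norm_le {α : Form W} {r : ℝ} (hr : 0 ≤ r)
    (h : ∀ I, ‖Form.coords W α I‖ ≤ r) : ‖α‖ ≤ r :=
  (pi_norm_le_iff_of_nonneg hr).2 h

instance [FiniteDimensional ℂ H] : FiniteDimensional ℂ (Coeff W H) :=
  (Coeff.coords W H).symm.finiteDimensional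

instance : FiniteDimensional ℂ (Form W) := (Form.coords W).symm.finiteDimensional

instance : CompleteSpace (Form W) := FiniteDimensional.complete ℂ _

instance {V V' : Type*} [NormedAddCommGroup V] [NormedSpace ℂ V] [FiniteDimensional ℂ V]
    [NormedAddCommGroup V'] [NormedSpace ℂ V'] [FiniteDimensional ℂ V'] :
    CompleteSpace (Coeff W (V →L[ℂ] V')) := FiniteDimensional.complete ℂ _

theorem Coeff.coords_tmul (α : ExteriorAlgebra ℂ W) (A : H) (I : FormIndex W) :
    Coeff.coords W H (Coeff.tmul α A) I = (formBasis W).repr α I • A :=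
  TensorProduct.equivFinsuppOfBasisLeft_apply_tmul_apply (Module.finBasis ℂ W).ExteriorAlgebra α A I

theorem Coeff.coords_eq_component (k : Coeff W H) (I : FormIndex W) :
    Coeff.coords W H k I =
      component ((formBasis W).coord I ∘ₗ (Form.equiv W).toLinearMap) k := by
  induction k using Coeff.induction with
  | zero => simp
  | tmul α A => rw [Coeff.coords_tmul, component_tmul]; simp
  | add k l hk hl => simp [hk, hl]

theorem Form.coords_symm_apply (α : ExteriorAlgebra ℂ W) (I : FormIndex W) :
    Form.coords W ((Form.equiv W).symm α) I = (formBasis W).repr α I := rfl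

theorem Coeff.coords_formInvol (k : Coeff W H) (I : FormIndex W) :
    Coeff.coords W H (formInvol k) I = ∑ J,
      (formBasis W).repr (CliffordAlgebra.involute (Q := (0 : QuadraticForm ℂ W))
        (formBasis W J)) I • Coeff.coords W H k J := by
  induction k using Coeff.induction with
  | zero => simp
  | tmul α A =>
    simp only [formInvol_tmul, Coeff.coords_tmul, smul_smul, ← Finset.sum_smul]
    congr 1
    conv_lhs => rw [← (formBasis W).sum_repr α]
    simp only [map_sum, map_smul, Finset.sum_apply', Finsupp.smul_apply, smul_eq_mul, mul_comm]
  | add k l hk hl => simp [hk, hl, Finset.sum_add_distrib]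

variable {V₀ V₁ V₂ V₃ : Type*} [NormedAddCommGroup V₀] [NormedSpace ℂ V₀]
  [NormedAddCommGroup V₁] [NormedSpace ℂ V₁]
  [NormedAddCommGroup V₂] [NormedSpace ℂ V₂] [NormedAddCommGroup V₃] [NormedSpace ℂ V₃]

theorem Coeff.coords_sandwich (T' : V₂ →L[ℂ] V₃) (T : V₀ →L[ℂ] V₁) (k : Coeff W (V₁ →L[ℂ] V₂))
    (I : FormIndex W) :
    Coeff.coords W _ (sandwich T' T k) I = T' ∘L Coeff.coords W _ k I ∘L T := by
  induction k using Coeff.induction with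
  | zero => simp
  | tmul α A => simp [sandwich_tmul, Coeff.coords_tmul]
  | add k l hk hl => simp [hk, hl, ContinuousLinearMap.comp_add]

theorem Coeff.coords_plainComp (k : Coeff W (V₂ →L[ℂ] V₃)) (l : Coeff W (V₁ →L[ℂ] V₂))
    (I : FormIndex W) :
    Coeff.coords W _ (plainComp k l) I = ∑ J, ∑ J',
      (formBasis W).repr (formBasis W J * formBasis W J') I •
        (Coeff.coords W _ k J ∘L Coeff.coords W _ l J') := by
  induction k using Coeff.induction with
  | zero => simp [plainComp_zero_left]
  | add k l hk hl => simp [hk, hl, plainComp_add_left, Finset.sum_add_distrib]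
  | tmul α A =>
    induction l using Coeff.induction with
    | zero => simp [plainComp_zero_right]
    | add k l hk hl =>
      simp only [hk, hl, plainComp_add_right, map_add, Pi.add_apply, ContinuousLinearMap.comp_add,
        smul_add, Finset.sum_add_distrib]
    | tmul β B =>
      simp only [plainComp_tmul, Coeff.coords_tmul, ContinuousLinearMap.comp_smul,
        ContinuousLinearMap.smul_comp, smul_smul, ← Finset.sum_smul]
      congr 1
      conv_lhs => rw [← (formBasis W).sum_repr α, ← (formBasis W).sum_repr β, Finset.sum_mul_sum]
      simp only [smul_mul_smul_comm, map_sum, map_smul, Finset.sum_apply', Finsupp.smul_apply,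
        smul_eq_mul]
      refine Finset.sum_congr rfl fun J _ => Finset.sum_congr rfl fun J' _ => ?_
      ring

theorem Form.coords_str (τ : V₁ →L[ℂ] V₁) (k : Coeff W (V₁ →L[ℂ] V₁)) (I : FormIndex W) :
    Form.coords W (str τ k) I =
      LinearMap.trace ℂ V₁ (τ ∘L Coeff.coords W _ k I : V₁ →L[ℂ] V₁).toLinearMap := by
  induction k using Coeff.induction with
  | zero => simp
  | tmul α A =>
    simp only [str_tmul, Coeff.coords_tmul, map_smul, Pi.smul_apply, Form.coords_symm_apply,
      ContinuousLinearMap.comp_smul, ContinuousLinearMap.toLinearMap_smul, smul_eq_mul]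
    ring
  | add k l hk hl => simp [hk, hl, ContinuousLinearMap.comp_add]

/-- A bound for the norm of the parity involution. -/
def involBound (W : Type*) [AddCommGroup W] [Module ℂ W] [FiniteDimensional ℂ W] : ℝ :=
  ∑ I, ∑ J, ‖(formBasis W).repr (CliffordAlgebra.involute (Q := (0 : QuadraticForm ℂ W))
        (formBasis W J)) I‖

/-- A bound for the norm of the exterior product. -/
def mulBound (W : Type*) [AddCommGroup W] [Module ℂ W] [FiniteDimensional ℂ W] : ℝ :=
  ∑ I, ∑ J, ∑ J', ‖(formBasis W).repr (formBasis W J * formBasis W J') I‖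

theorem involBound_nonneg : 0 ≤ involBound W := by unfold involBound; positivity

theorem mulBound_nonneg : 0 ≤ mulBound W := by unfold mulBound; positivity

theorem norm_formInvol_le (k : Coeff W H) : ‖formInvol k‖ ≤ involBound W * ‖k‖ := by
  refine Coeff.norm_le (mul_nonneg involBound_nonneg (norm_nonneg _)) fun I => ?_
  rw [Coeff.coords_formInvol]
  refine (norm_sum_le _ _).trans ?_
  calc _ ≤ ∑ J, ‖(formBasis W).repr (CliffordAlgebra.involute (Q := (0 : QuadraticForm ℂ W))
        (formBasis W J)) I‖ * ‖k‖ := by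
        refine Finset.sum_le_sum fun J _ => ?_
        rw [norm_smul]
        gcongr
        exact Coeff.norm_coords_le k J
    _ ≤ _ := by
        rw [← Finset.sum_mul]
        gcongr
        exact Finset.single_le_sum (f := fun I => ∑ J, ‖(formBasis W).repr
          (CliffordAlgebra.involute (Q := (0 : QuadraticForm ℂ W)) (formBasis W J)) I‖)
          (fun I _ => by positivity) (Finset.mem_univ I)

theorem norm_sandwich_le (T' : V₂ →L[ℂ] V₃) (T : V₀ →L[ℂ] V₁) (k : Coeff W (V₁ →L[ℂ] V₂)) :
    ‖sandwich T' T k‖ ≤ ‖T'‖ * ‖T‖ * ‖k‖ := by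
  refine Coeff.norm_le (by positivity) fun I => ?_
  rw [Coeff.coords_sandwich]
  refine (ContinuousLinearMap.opNorm_comp_le _ _).trans ?_
  rw [mul_assoc, mul_comm ‖T‖]
  gcongr
  refine (ContinuousLinearMap.opNorm_comp_le _ _).trans ?_
  gcongr
  exact Coeff.norm_coords_le k I

theorem norm_sandwich_le_of_le_one {T' : V₂ →L[ℂ] V₃} {T : V₀ →L[ℂ] V₁} (hT' : ‖T'‖ ≤ 1)
    (hT : ‖T‖ ≤ 1) (k : Coeff W (V₁ →L[ℂ] V₂)) : ‖sandwich T' T k‖ ≤ ‖k‖ :=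
  (norm_sandwich_le T' T k).trans
    (mul_le_of_le_one_left (norm_nonneg _) (mul_le_one₀ hT' (norm_nonneg _) hT))

theorem norm_plainComp_le (k : Coeff W (V₂ →L[ℂ] V₃)) (l : Coeff W (V₁ →L[ℂ] V₂)) :
    ‖plainComp k l‖ ≤ mulBound W * ‖k‖ * ‖l‖ := by
  refine Coeff.norm_le (mul_nonneg (mul_nonneg mulBound_nonneg (norm_nonneg _)) (norm_nonneg _))
    fun I => ?_
  rw [Coeff.coords_plainComp]
  calc _ ≤ ∑ J, ∑ J', ‖(formBasis W).repr (formBasis W J * formBasis W J') I‖ *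
          (‖k‖ * ‖l‖) := by
        refine (norm_sum_le _ _).trans (Finset.sum_le_sum fun J _ => ?_)
        refine (norm_sum_le _ _).trans (Finset.sum_le_sum fun J' _ => ?_)
        rw [norm_smul]
        gcongr
        refine (ContinuousLinearMap.opNorm_comp_le _ _).trans ?_
        gcongr
        · exact Coeff.norm_coords_le k J
        · exact Coeff.norm_coords_le l J'
    _ ≤ _ := by
        simp only [← Finset.sum_mul]
        rw [mul_assoc]
        gcongr
        exact Finset.single_le_sum (f := fun I => ∑ J, ∑ J',
          ‖(formBasis W).repr (formBasis W J * formBasis W J') I‖)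
          (fun I _ => by positivity) (Finset.mem_univ I)

/-- A bound for the norm of the graded product. -/
def gradedBound (W : Type*) [AddCommGroup W] [Module ℂ W] [FiniteDimensional ℂ W] : ℝ :=
  mulBound W + mulBound W * involBound W

theorem gradedBound_nonneg : 0 ≤ gradedBound W :=
  add_nonneg mulBound_nonneg (mul_nonneg mulBound_nonneg involBound_nonneg)

/-- Each homogeneous part of `k` is half of `k` plus or minus a contracted copy of `k`, hence no
larger than `k`. The odd part is multiplied with `formInvol l`, which costs the extra factor
`involBound W`. -/
theorem norm_gradedComp_le {τ₂ : V₂ →L[ℂ] V₂} {τ₃ : V₃ →L[ℂ] V₃} (h₂ : ‖τ₂‖ ≤ 1) (h₃ : ‖τ₃‖ ≤ 1)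
    (k : Coeff W (V₂ →L[ℂ] V₃)) (l : Coeff W (V₁ →L[ℂ] V₂)) :
    ‖gradedComp τ₂ τ₃ k l‖ ≤ gradedBound W * ‖k‖ * ‖l‖ := by
  have hs := norm_sandwich_le_of_le_one h₃ h₂ k
  have h1 : ‖(1 / 2 : ℂ) • (k + sandwich τ₃ τ₂ k)‖ ≤ ‖k‖ := by
    rw [norm_smul]
    have := norm_add_le k (sandwich τ₃ τ₂ k)
    norm_num
    linarith
  have h2 : ‖(1 / 2 : ℂ) • (k - sandwich τ₃ τ₂ k)‖ ≤ ‖k‖ := by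
    rw [norm_smul]
    have := norm_sub_le k (sandwich τ₃ τ₂ k)
    norm_num
    linarith
  have hm := mulBound_nonneg (W := W)
  have hi := involBound_nonneg (W := W)
  calc _ ≤ mulBound W * ‖k‖ * ‖l‖ + mulBound W * ‖k‖ * (involBound W * ‖l‖) := by
        refine (norm_add_le _ _).trans (add_le_add ?_ ?_)
        · refine (norm_plainComp_le _ _).trans ?_
          gcongr
        · have h3 := norm_formInvol_le l
          have h4 := norm_plainComp_le ((1 / 2 : ℂ) • (k - sandwich τ₃ τ₂ k)) (formInvol l)
          exact h4.trans (mul_le_mul (mul_le_mul_of_nonneg_left h2 hm) h3 (norm_nonneg _)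
            (mul_nonneg hm (norm_nonneg _)))
    _ = _ := by unfold gradedBound; ring

/-- The graded product as a continuous bilinear map, for gradings of norm at most `1`. -/
def gradedCompL {τ₂ : V₂ →L[ℂ] V₂} {τ₃ : V₃ →L[ℂ] V₃} (h₂ : ‖τ₂‖ ≤ 1) (h₃ : ‖τ₃‖ ≤ 1) :
    Coeff W (V₂ →L[ℂ] V₃) →L[ℂ] Coeff W (V₁ →L[ℂ] V₂) →L[ℂ] Coeff W (V₁ →L[ℂ] V₃) :=
  LinearMap.mkContinuous₂ (gradedCompₗ τ₂ τ₃) (gradedBound W) (norm_gradedComp_le h₂ h₃)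

theorem gradedCompL_apply {τ₂ : V₂ →L[ℂ] V₂} {τ₃ : V₃ →L[ℂ] V₃} (h₂ : ‖τ₂‖ ≤ 1) (h₃ : ‖τ₃‖ ≤ 1)
    (k : Coeff W (V₂ →L[ℂ] V₃)) (l : Coeff W (V₁ →L[ℂ] V₂)) :
    gradedCompL h₂ h₃ k l = gradedComp τ₂ τ₃ k l := rfl

/-- `sandwich` as a continuous linear map. -/
def sandwichL (T' : V₂ →L[ℂ] V₃) (T : V₀ →L[ℂ] V₁) :
    Coeff W (V₁ →L[ℂ] V₂) →L[ℂ] Coeff W (V₀ →L[ℂ] V₃) :=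
  (sandwich T' T).mkContinuous (‖T'‖ * ‖T‖) (norm_sandwich_le T' T)

theorem sandwichL_apply (T' : V₂ →L[ℂ] V₃) (T : V₀ →L[ℂ] V₁) (k : Coeff W (V₁ →L[ℂ] V₂)) :
    sandwichL T' T k = sandwich T' T k := rfl

/-- The parity involution as a continuous linear map. -/
def formInvolL : Coeff W H →L[ℂ] Coeff W H :=
  LinearMap.mkContinuous (formInvol (W := W) (H := H)) (involBound W) fun k => norm_formInvol_le k

/-- In an orthonormal basis every diagonal entry is at most the operator norm. Because of the
Hermitian metric the bound depends on the rank only and is uniform over all fibres. -/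
theorem norm_trace_le {V : Type*} [NormedAddCommGroup V] [InnerProductSpace ℂ V]
    [FiniteDimensional ℂ V] (A : V →L[ℂ] V) :
    ‖LinearMap.trace ℂ V A.toLinearMap‖ ≤ Module.finrank ℂ V * ‖A‖ := by
  rw [LinearMap.trace_eq_sum_inner _ (stdOrthonormalBasis ℂ V)]
  refine (norm_sum_le _ _).trans ?_
  calc _ ≤ ∑ _i : Fin (Module.finrank ℂ V), ‖A‖ := by
        refine Finset.sum_le_sum fun i _ => ?_
        refine (norm_inner_le_norm _ _).trans ?_
        have := A.le_opNorm (stdOrthonormalBasis ℂ V i)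
        simpa using this
    _ = _ := by simp

theorem norm_str_le {V : Type*} [NormedAddCommGroup V] [InnerProductSpace ℂ V]
    [FiniteDimensional ℂ V] {τ : V →L[ℂ] V} (hτ : ‖τ‖ ≤ 1) (k : Coeff W (V →L[ℂ] V)) :
    ‖str τ k‖ ≤ Module.finrank ℂ V * ‖k‖ := by
  refine Form.norm_le (by positivity) fun I => ?_
  rw [Form.coords_str]
  refine (norm_trace_le _).trans ?_
  gcongr
  refine (ContinuousLinearMap.opNorm_comp_le _ _).trans ?_
  exact (mul_le_of_le_one_left (norm_nonneg _) hτ).trans (Coeff.norm_coords_le k I)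

/-- The supertrace as a continuous linear map. -/
def strL {V : Type*} [NormedAddCommGroup V] [InnerProductSpace ℂ V]
    [FiniteDimensional ℂ V] {τ : V →L[ℂ] V} (hτ : ‖τ‖ ≤ 1) : Coeff W (V →L[ℂ] V) →L[ℂ] Form W :=
  LinearMap.mkContinuous (str (W := W) τ) (Module.finrank ℂ V) fun k => norm_str_le hτ k

theorem strL_apply {V : Type*} [NormedAddCommGroup V] [InnerProductSpace ℂ V]
    [FiniteDimensional ℂ V] {τ : V →L[ℂ] V} (hτ : ‖τ‖ ≤ 1) (k : Coeff W (V →L[ℂ] V)) :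
    strL hτ k = str τ k := rfl

end CoefficientNorms

/-! ### Fibres and smooth local sections of the cyclic cover -/

section Lifts

variable {Y : Type*} {f₀ : Y → Circle}

theorem mem_cover_iff {x : ℝ × Y} : x ∈ cover f₀ ↔ Circle.exp (2 * Real.pi * x.1) = f₀ x.2 :=
  Iff.rfl

theorem cover_add_int {t : ℝ} {y : Y} (h : (t, y) ∈ cover f₀) (m : ℤ) : (t + m, y) ∈ cover f₀ := by
  rw [mem_cover_iff] at h ⊢
  rw [← h]
  have : 2 * Real.pi * (t + m) = 2 * Real.pi * t + m * (2 * Real.pi) := by ring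
  simp only
  rw [this]
  exact Circle.periodic_exp.int_mul m _

theorem cover_sub_nat {t : ℝ} {y : Y} (h : (t, y) ∈ cover f₀) (m : ℕ) : (t - m, y) ∈ cover f₀ := by
  simpa [sub_eq_add_neg] using cover_add_int h (-m)

theorem cover_add_nat {t : ℝ} {y : Y} (h : (t, y) ∈ cover f₀) (m : ℕ) : (t + m, y) ∈ cover f₀ := by
  simpa using cover_add_int h m

theorem exists_int_of_mem_cover {t t' : ℝ} {y : Y} (h : (t, y) ∈ cover f₀)
    (h' : (t', y) ∈ cover f₀) : ∃ m : ℤ, t = t' + m := by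
  rw [mem_cover_iff] at h h'
  obtain ⟨m, hm⟩ := Circle.exp_eq_exp.1 (h.trans h'.symm)
  refine ⟨m, ?_⟩
  simp only at hm
  have := Real.pi_pos
  have h2 : (2 * Real.pi) * t = (2 * Real.pi) * (t' + m) := by linarith
  exact mul_left_cancel₀ (by positivity) h2

theorem eq_of_mem_cover {t t' : ℝ} {y : Y} (h : (t, y) ∈ cover f₀)
    (h' : (t', y) ∈ cover f₀) (hlt : |t - t'| < 1) : t = t' := by
  obtain ⟨m, hm⟩ := exists_int_of_mem_cover h h'
  have : |(m : ℝ)| < 1 := by rw [hm] at hlt; simpa using hlt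
  have hm0 : m = 0 := by
    have : |m| < 1 := by exact_mod_cast this
    exact Int.abs_lt_one_iff.1 this
  simp [hm, hm0]

theorem segmentCoord_nonneg (y : Y) : 0 ≤ segmentCoord f₀ y := Int.fract_nonneg _

theorem segmentCoord_lt_one (y : Y) : segmentCoord f₀ y < 1 := Int.fract_lt_one _

theorem segmentCoord_mem_cover (y : Y) : (segmentCoord f₀ y, y) ∈ cover f₀ := by
  have h0 : (Complex.arg (f₀ y : ℂ) / (2 * Real.pi), y) ∈ cover f₀ := by
    rw [mem_cover_iff]
    have := Real.pi_pos
    simp only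
    rw [mul_div_cancel₀ _ (by positivity)]
    exact Circle.exp_arg _
  have := cover_add_int h0 (-⌊Complex.arg (f₀ y : ℂ) / (2 * Real.pi)⌋)
  simpa [segmentCoord, Int.fract, sub_eq_add_neg] using this

/-- The points of the cover over `y` are `segmentCoord y + m`, where `m` is the integral part. -/
theorem eq_segmentCoord_add_floor {t : ℝ} {y : Y} (h : (t, y) ∈ cover f₀) :
    t = segmentCoord f₀ y + ⌊t⌋ := by
  obtain ⟨m, hm⟩ := exists_int_of_mem_cover h (segmentCoord_mem_cover y)
  have : ⌊t⌋ = m := by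
    rw [hm, Int.floor_add_intCast, Int.floor_eq_zero_iff.2 ⟨segmentCoord_nonneg y, segmentCoord_lt_one y⟩,
      zero_add]
  rw [this, hm]

variable [TopologicalSpace Y]

theorem isClosed_cover (hf : Continuous f₀) : IsClosed (cover f₀) := by
  have h1 : Continuous fun x : ℝ × Y => Circle.exp (2 * Real.pi * x.1) := by fun_prop
  exact isClosed_eq h1 (hf.comp continuous_snd)

variable {EY HY : Type*} [NormedAddCommGroup EY] [NormedSpace ℝ EY] [TopologicalSpace HY]
  {IY : ModelWithCorners ℝ EY HY} [ChartedSpace HY Y]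

theorem IsLift.add_int {U : Set Y} {s : Y → ℝ} (h : IsLift IY f₀ U s) (m : ℤ) :
    IsLift IY f₀ U (fun y => s y + m) where
  isOpen := h.isOpen
  smooth := h.smooth.add contMDiffOn_const
  mem y hy := cover_add_int (h.mem y hy) m

theorem IsLift.sub_nat {U : Set Y} {s : Y → ℝ} (h : IsLift IY f₀ U s) (m : ℕ) :
    IsLift IY f₀ U (fun y => s y - m) := by
  simpa [sub_eq_add_neg] using h.add_int (-m)

theorem IsLift.mono {U U' : Set Y} {s : Y → ℝ} (h : IsLift IY f₀ U s) (hU' : IsOpen U')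
    (hsub : U' ⊆ U) : IsLift IY f₀ U' s where
  isOpen := hU'
  smooth := h.smooth.mono hsub
  mem y hy := h.mem y (hsub hy)

theorem IsLift.continuousAt {U : Set Y} {s : Y → ℝ} (h : IsLift IY f₀ U s) {y : Y} (hy : y ∈ U) :
    ContinuousAt s y :=
  (h.smooth.continuousOn).continuousAt (h.isOpen.mem_nhds hy)

/-- The cover has a smooth local section through each of its points. -/
theorem exists_isLift (hf : ContMDiff IY (𝓡 1) ∞ f₀) {t₀ : ℝ} {y₀ : Y} (h : (t₀, y₀) ∈ cover f₀) :
    ∃ U s, IsLift IY f₀ U s ∧ y₀ ∈ U ∧ s y₀ = t₀ := by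
  have hc : ContMDiff IY 𝓘(ℝ, ℂ) ∞ fun y => ((f₀ y : Circle) : ℂ) := by
    have : ContMDiff (𝓡 1) 𝓘(ℝ, ℂ) ∞ (fun z : Circle => (z : ℂ)) := by
      let _ : Fact (Module.finrank ℝ ℂ = 1 + 1) := finrank_real_complex_fact'
      exact contMDiff_coe_sphere (E := ℂ) (n := 1)
    exact this.comp hf
  -- Dividing by the value at `y₀` gives `g y₀ = 1`, so near `y₀` the argument of `g` is a smooth
  -- function that vanishes at `y₀`.
  set g : Y → ℂ := fun y => (f₀ y : ℂ) * ((f₀ y₀)⁻¹ : Circle) with hg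
  have hmul : ContDiff ℝ ∞ fun w : ℂ => w * (((f₀ y₀)⁻¹ : Circle) : ℂ) := by fun_prop
  have hgs : ContMDiff IY 𝓘(ℝ, ℂ) ∞ g := hmul.contMDiff.comp hc
  set U : Set Y := g ⁻¹' Complex.slitPlane with hU
  have hUo : IsOpen U := Complex.isOpen_slitPlane.preimage hgs.continuous
  have hpi := Real.pi_pos
  have hg0 : g y₀ = 1 := by
    simp only [hg]
    rw [← Circle.coe_mul, mul_inv_cancel, Circle.coe_one]
  refine ⟨U, fun y => t₀ + (2 * Real.pi)⁻¹ * Complex.arg (g y), ⟨hUo, ?_, ?_⟩, ?_, ?_⟩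
  · intro y hy
    have harg : ContMDiffAt IY 𝓘(ℝ, ℝ) ∞ (fun y => Complex.arg (g y)) y := by
      have h1 : ContDiffAt ℝ ∞ (fun w : ℂ => (Complex.log w).im) (g y) := by
        have h2 : ContDiffAt ℝ ∞ Complex.log (g y) :=
          (Complex.contDiffAt_log (n := ∞) hy).restrict_scalars ℝ
        exact Complex.imCLM.contDiff.contDiffAt.comp _ h2
      have h3 := h1.contMDiffAt.comp y (hgs y)
      simpa [Function.comp_def, Complex.log_im] using h3
    exact (contMDiffAt_const.add (contMDiffAt_const.mul harg)).contMDiffWithinAt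
  · intro y hy
    rw [mem_cover_iff] at h ⊢
    simp only at h ⊢
    have e1 : 2 * Real.pi * (t₀ + (2 * Real.pi)⁻¹ * Complex.arg (g y)) =
      2 * Real.pi * t₀ + Complex.arg (g y) := by
      field_simp
    have e2 : g y = ((f₀ y * (f₀ y₀)⁻¹ : Circle) : ℂ) := by simp [hg]
    rw [e1, Circle.exp_add, h, e2, Circle.exp_arg]
    rw [mul_comm, mul_assoc, inv_mul_cancel, mul_one]
  · simp [hU, hg0]
  · simp [hg0]

end Lifts

/-! ### The coordinate `f` and the translations on the end -/

section EndCoordinates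

variable {EX HX EY HY : Type*} [NormedAddCommGroup EX] [NormedSpace ℝ EX] [TopologicalSpace HX]
  [NormedAddCommGroup EY] [NormedSpace ℝ EY] [TopologicalSpace HY]
  {IX : ModelWithCorners ℝ EX HX} {IY : ModelWithCorners ℝ EY HY}
  {X : Type*} [TopologicalSpace X] [ChartedSpace HX X]
  {Y : Type*} [TopologicalSpace Y] [ChartedSpace HY Y] {f₀ : Y → Circle}

namespace PeriodicEnd

variable (D : PeriodicEnd IX IY X f₀)

/-- The closed half `f ≥ 0` of the cover. -/
abbrev Half (f₀ : Y → Circle) : Type _ := {x : ℝ × Y // x ∈ cover f₀ ∧ 0 ≤ x.1}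

/-- The embedding of the closed half `f ≥ 0` of the cover. -/
def embed (x : Half f₀) : X := D.ι x.1.1 x.1.2

theorem isClosedEmbedding_embed : Topology.IsClosedEmbedding D.embed := D.isClosedEmbedding_ι

/-- The function `f` on the end, extended by `0` to the compact part. -/
def endCoord : X → ℝ := Function.extend D.embed (fun x => x.1.1) 0

/-- The translation by `-k`, where it is defined. -/
def translate (k : ℕ) : X → X :=
  Function.extend D.embed (fun x => D.ι (x.1.1 - k) x.1.2) id

theorem endCoord_ι {t : ℝ} {y : Y} (h : (t, y) ∈ cover f₀) (ht : 0 ≤ t) :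
    D.endCoord (D.ι t y) = t :=
  D.isClosedEmbedding_embed.injective.extend_apply (fun x => x.1.1) 0 ⟨(t, y), h, ht⟩

theorem translate_ι (k : ℕ) {t : ℝ} {y : Y} (h : (t, y) ∈ cover f₀) (ht : 0 ≤ t) :
    D.translate k (D.ι t y) = D.ι (t - k) y :=
  D.isClosedEmbedding_embed.injective.extend_apply (fun x => D.ι (x.1.1 - k) x.1.2) id
    ⟨(t, y), h, ht⟩

theorem ι_inj {t t' : ℝ} {y y' : Y} (h : (t, y) ∈ cover f₀) (ht : 0 ≤ t)
    (h' : (t', y') ∈ cover f₀) (ht' : 0 ≤ t') (he : D.ι t y = D.ι t' y') : t = t' ∧ y = y' := by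
  have := D.isClosedEmbedding_embed.injective (a₁ := ⟨(t, y), h, ht⟩) (a₂ := ⟨(t', y'), h', ht'⟩) he
  simpa using this

/-- The complement of `Z` is the image of the open end, and `ι` is injective; so only the boundary
`f = 0` of the end can meet `Z`, where `f` agrees with its extension by `0`. -/
theorem ι_mem_Z_iff {t : ℝ} {y : Y} (h : (t, y) ∈ cover f₀) (ht : 0 ≤ t) :
    D.ι t y ∈ D.Z ↔ t = 0 := by
  rw [← not_iff_not, ← Set.mem_compl_iff, ← D.image_ι]
  constructor
  · rintro ⟨t', y', h', ht', he⟩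
    obtain ⟨rfl, rfl⟩ := D.ι_inj h' ht'.le h ht he
    exact ht'.ne'
  · intro hne
    exact ⟨t, y, h, lt_of_le_of_ne ht (Ne.symm hne), rfl⟩

theorem exists_ι_of_notMem {x : X} (h : x ∉ D.Z) :
    ∃ t y, (t, y) ∈ cover f₀ ∧ 0 < t ∧ D.ι t y = x := by
  have : x ∈ (D.Zᶜ) := h
  rwa [← D.image_ι] at this

theorem endCoord_eq_zero_of_mem {x : X} (h : x ∈ D.Z) : D.endCoord x = 0 := by
  by_cases hx : ∃ q, D.embed q = x
  · obtain ⟨⟨⟨t, y⟩, hc, ht⟩, rfl⟩ := hx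
    have : D.embed ⟨(t, y), hc, ht⟩ = D.ι t y := rfl
    rw [this, D.endCoord_ι hc ht]
    exact (D.ι_mem_Z_iff hc ht).1 h
  · exact Function.extend_apply' _ _ _ hx

theorem endCoord_nonneg (x : X) : 0 ≤ D.endCoord x := by
  by_cases h : x ∈ D.Z
  · rw [D.endCoord_eq_zero_of_mem h]
  · obtain ⟨t, y, hc, ht, rfl⟩ := D.exists_ι_of_notMem h
    rw [D.endCoord_ι hc ht.le]; exact ht.le

theorem exists_ι_of_endCoord_pos {x : X} (h : 0 < D.endCoord x) :
    ∃ y, (D.endCoord x, y) ∈ cover f₀ ∧ D.ι (D.endCoord x) y = x := by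
  have hx : x ∉ D.Z := fun hx => h.ne' (D.endCoord_eq_zero_of_mem hx)
  obtain ⟨t, y, hc, ht, rfl⟩ := D.exists_ι_of_notMem hx
  refine ⟨y, ?_, ?_⟩ <;> rw [D.endCoord_ι hc ht.le]
  exact hc

/-- The compact part and the image of the closed half of the cover are two closed sets that cover
`X`, and the function is continuous on each of them. -/
theorem continuous_endCoord [T2Space X] : Continuous D.endCoord := by
  have h1 : ContinuousOn D.endCoord D.Z :=
    (continuousOn_const (c := (0 : ℝ))).congr fun x hx => D.endCoord_eq_zero_of_mem hx
  have h2 : ContinuousOn D.endCoord (Set.range D.embed) := by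
    rw [← Set.image_univ]
    intro x hx
    obtain ⟨q, -, rfl⟩ := hx
    have hq : Tendsto (D.endCoord ∘ D.embed) (𝓝 q) (𝓝 (D.endCoord (D.embed q))) := by
      have : D.endCoord ∘ D.embed = fun q => q.1.1 := by
        funext q; exact D.endCoord_ι q.2.1 q.2.2
      rw [this, show D.endCoord (D.embed q) = q.1.1 from D.endCoord_ι q.2.1 q.2.2]
      exact (continuous_fst.comp continuous_subtype_val).tendsto q
    rw [ContinuousWithinAt, Set.image_univ, D.isClosedEmbedding_embed.isEmbedding.map_nhds_eq q |>.symm]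
    exact hq
  have hcov : D.Z ∪ Set.range D.embed = Set.univ := by
    refine Set.eq_univ_of_forall fun x => ?_
    by_cases h : x ∈ D.Z
    · exact Or.inl h
    · obtain ⟨t, y, hc, ht, rfl⟩ := D.exists_ι_of_notMem h
      exact Or.inr ⟨⟨(t, y), hc, ht.le⟩, rfl⟩
  rw [← continuousOn_univ, ← hcov]
  exact h1.union_of_isClosed h2 D.isCompact_Z.isClosed D.isClosedEmbedding_embed.isClosed_range

end PeriodicEnd

end EndCoordinates

/-! ### Maps seen through local diffeomorphisms, and lengths of paths -/

section LocalIsometries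

open Manifold

variable {EX HX EY HY EX' HX' : Type*} [NormedAddCommGroup EX] [NormedSpace ℝ EX]
  [TopologicalSpace HX] [NormedAddCommGroup EY] [NormedSpace ℝ EY] [TopologicalSpace HY]
  [NormedAddCommGroup EX'] [NormedSpace ℝ EX'] [TopologicalSpace HX']
  {IX : ModelWithCorners ℝ EX HX} {IY : ModelWithCorners ℝ EY HY}
  {IX' : ModelWithCorners ℝ EX' HX'}
  {X : Type*} [TopologicalSpace X] [ChartedSpace HX X]
  {Y : Type*} [TopologicalSpace Y] [ChartedSpace HY Y]
  {X' : Type*} [TopologicalSpace X'] [ChartedSpace HX' X']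

/-- Compose with a smooth local inverse of `j`. The smooth structure of the end is known only
through lifts, so smoothness on the end is tested in this way. -/
theorem contMDiffAt_of_comp_isLocalDiffeomorphAt {j : Y → X} {y : Y}
    (hj : IsLocalDiffeomorphAt IY IX ∞ j y) {g : X → X'}
    (hg : ContMDiffAt IY IX' ∞ (g ∘ j) y) : ContMDiffAt IX IX' ∞ g (j y) := by
  have h1 := hj.localInverse_contMDiffAt
  have h2 := hj.localInverse_eventuallyEq_right
  have h3 : hj.localInverse (j y) = y := hj.localInverse_left_inv hj.localInverse_mem_target
  have h4 : ContMDiffAt IX IX' ∞ ((g ∘ j) ∘ hj.localInverse) (j y) := by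
    refine ContMDiffAt.comp (j y) ?_ h1
    rw [h3]; exact hg
  refine h4.congr_of_eventuallyEq ?_
  filter_upwards [h2] with x hx
  simp only [Function.comp_apply] at hx ⊢
  rw [hx]; rfl

theorem exists_mfderiv_eq_of_isLocalDiffeomorphAt (j : Y → X) {y : Y}
    (hj : IsLocalDiffeomorphAt IY IX ∞ j y) (g : X → X') (hg : MDifferentiableAt IX IX' g (j y))
    (v : TangentSpace IX (j y)) :
    ∃ w : TangentSpace IY y, mfderiv IY IX j y w = v ∧
      mfderiv IY IX' (g ∘ j) y w = mfderiv IX IX' g (j y) v := by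
  obtain ⟨w, hw⟩ := (hj.mfderivToContinuousLinearEquiv (by simp)).surjective v
  have hw' : mfderiv IY IX j y w = v := by
    rw [← hw, ← hj.mfderivToContinuousLinearEquiv_coe (by simp)]
    rfl
  refine ⟨w, hw', ?_⟩
  rw [mfderiv_comp y hg (hj.mdifferentiableAt (by simp)), ← hw']
  rfl

theorem enorm_mfderiv_congr [∀ x : X, ENorm (TangentSpace IX x)] {g₁ g₂ : Y → X} {y : Y}
    (h : g₁ =ᶠ[𝓝 y] g₂) (w : TangentSpace IY y) :
    ‖mfderiv IY IX g₁ y w‖ₑ = ‖mfderiv IY IX g₂ y w‖ₑ := by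
  have h1 : mfderiv IY IX g₁ y = mfderiv IY IX g₂ y := h.mfderiv_eq
  -- The two norms belong to tangent spaces at points that are equal only propositionally, so the
  -- points have to be generalized before they can be identified.
  have key : ∀ p q : X, p = q → ∀ v v' : EX, v = v' →
      @enorm (TangentSpace IX p) _ v = @enorm (TangentSpace IX q) _ v' := by
    rintro p q rfl v v' rfl; rfl
  exact key (g₁ y) (g₂ y) h.eq_of_nhds _ _ (DFunLike.congr_fun h1 w)

/-- A map that does not increase the lengths of tangent vectors by more than the factor `L`
does not increase the lengths of paths by more than that factor. -/
theorem pathELength_comp_le [∀ x : X, ENorm (TangentSpace IX x)]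
    [∀ x : X', ENorm (TangentSpace IX' x)] {f : X → X'} {γ : ℝ → X} {a b : ℝ} {L : ℝ≥0∞}
    (hL : L ≠ ⊤) (hγ : ContMDiffOn 𝓘(ℝ, ℝ) IX 1 γ (Set.Icc a b))
    (hf : ∀ t ∈ Set.Ioo a b, MDifferentiableAt IX IX' f (γ t))
    (hle : ∀ t ∈ Set.Ioo a b, ∀ v : TangentSpace IX (γ t),
      ‖mfderiv IX IX' f (γ t) v‖ₑ ≤ L * ‖v‖ₑ) :
    pathELength IX' (f ∘ γ) a b ≤ L * pathELength IX γ a b := by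
  rw [pathELength_eq_lintegral_mfderiv_Ioo, pathELength_eq_lintegral_mfderiv_Ioo,
    ← lintegral_const_mul' _ _ hL]
  refine setLIntegral_mono' measurableSet_Ioo fun t ht => ?_
  have h1 : MDifferentiableAt 𝓘(ℝ, ℝ) IX γ t :=
    ((hγ.mdifferentiableOn one_ne_zero) t (Set.Ioo_subset_Icc_self ht)).mdifferentiableAt
      (Icc_mem_nhds ht.1 ht.2)
  rw [mfderiv_comp t (hf t ht) h1]
  exact hle t ht _

/-- The set of times with `g ≤ c` is compact, so if it is not empty it has a first element. It
serves to cut a path before it enters the region where `f` or a translation is no longer smooth. -/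
theorem exists_first_hit {g : ℝ → ℝ} {c : ℝ} (hg : ContinuousOn g (Set.Icc 0 1)) (h0 : c ≤ g 0) :
    (∀ u ∈ Set.Icc (0 : ℝ) 1, c < g u) ∨
      ∃ T ∈ Set.Icc (0 : ℝ) 1, g T = c ∧ ∀ u ∈ Set.Icc 0 T, c ≤ g u := by
  by_cases H : ∀ u ∈ Set.Icc (0 : ℝ) 1, c < g u
  · exact Or.inl H
  right
  push Not at H
  obtain ⟨u₀, hu₀, hgu₀⟩ := H
  set A := Set.Icc (0 : ℝ) 1 ∩ g ⁻¹' Set.Iic c with hA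
  have hAc : IsCompact A := isCompact_Icc.of_isClosed_subset
    (hg.preimage_isClosed_of_isClosed isClosed_Icc isClosed_Iic) Set.inter_subset_left
  obtain ⟨T, hTA, hT⟩ := hAc.exists_isLeast ⟨u₀, hu₀, hgu₀⟩
  have hlow : ∀ u ∈ Set.Ico 0 T, c < g u := fun u hu => by
    by_contra hcon
    exact absurd (hT ⟨⟨hu.1, hu.2.le.trans hTA.1.2⟩, not_lt.1 hcon⟩) (not_le.2 hu.2)
  have hTc : g T = c := by
    refine le_antisymm hTA.2 ?_
    rcases hTA.1.1.eq_or_lt with h | h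
    · rw [← h]; exact h0
    · have hcw : ContinuousWithinAt g (Set.Ico 0 T) T :=
        (hg T hTA.1).mono fun u hu => ⟨hu.1, hu.2.le.trans hTA.1.2⟩
      have hcl : T ∈ closure (Set.Ico 0 T) := by
        rw [closure_Ico h.ne]; exact ⟨h.le, le_rfl⟩
      have : (𝓝[Set.Ico 0 T] T).NeBot := mem_closure_iff_nhdsWithin_neBot.1 hcl
      exact ge_of_tendsto hcw (eventually_nhdsWithin_of_forall fun u hu => (hlow u hu).le)
  refine ⟨T, hTA.1, hTc, fun u hu => ?_⟩
  rcases hu.2.eq_or_lt with h | h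
  · rw [h, hTc]
  · exact (hlow u ⟨hu.1, h⟩).le

end LocalIsometries

/-! ### Smoothness of the coordinate and of translations, and the isometry property -/

section Distance

open Manifold

variable {n : ℕ} {X : Type*} [TopologicalSpace X] [ChartedSpace (EuclideanSpace ℝ (Fin n)) X]
  {Y : Type*} [TopologicalSpace Y] [ChartedSpace (EuclideanSpace ℝ (Fin n)) Y] {f₀ : Y → Circle}

namespace PeriodicEnd

variable (D : PeriodicEnd (𝓡 n) (𝓡 n) X f₀)

/-- Shrinking the domain keeps the lift above `k`, so that the lift and its translate by `-k` both
run inside the open end, where `ι` is a local diffeomorphism. -/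
theorem exists_lift_at {x : X} (k : ℕ) (hx : k < D.endCoord x) :
    ∃ U s y, IsLift (𝓡 n) f₀ U s ∧ y ∈ U ∧ s y = D.endCoord x ∧ D.ι (s y) y = x ∧
      ∀ y ∈ U, (k : ℝ) < s y := by
  have h0 : 0 < D.endCoord x := lt_of_le_of_lt (Nat.cast_nonneg k) hx
  obtain ⟨y, hy, hyx⟩ := D.exists_ι_of_endCoord_pos h0
  obtain ⟨U, s, hs, hyU, hsy⟩ := exists_isLift D.smooth_f₀ hy
  have hU : IsOpen (U ∩ s ⁻¹' Set.Ioi (k : ℝ)) :=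
    hs.smooth.continuousOn.isOpen_inter_preimage hs.isOpen isOpen_Ioi
  refine ⟨U ∩ s ⁻¹' Set.Ioi (k : ℝ), s, y, hs.mono hU Set.inter_subset_left, ⟨hyU, ?_⟩, hsy, ?_,
    fun y hy => hy.2⟩
  · simpa [hsy] using hx
  · rw [hsy, hyx]

theorem endCoord_comp_eventuallyEq {U : Set Y} {s : Y → ℝ} (hs : IsLift (𝓡 n) f₀ U s)
    (hpos : ∀ y ∈ U, 0 < s y) {y : Y} (hy : y ∈ U) :
    (D.endCoord ∘ fun y => D.ι (s y) y) =ᶠ[𝓝 y] s := by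
  filter_upwards [hs.isOpen.mem_nhds hy] with y' hy'
  exact D.endCoord_ι (hs.mem y' hy') (hpos y' hy').le

theorem translate_comp_eventuallyEq (k : ℕ) {U : Set Y} {s : Y → ℝ} (hs : IsLift (𝓡 n) f₀ U s)
    (hpos : ∀ y ∈ U, 0 < s y) {y : Y} (hy : y ∈ U) :
    (D.translate k ∘ fun y => D.ι (s y) y) =ᶠ[𝓝 y] fun y => D.ι (s y - k) y := by
  filter_upwards [hs.isOpen.mem_nhds hy] with y' hy'
  exact D.translate_ι k (hs.mem y' hy') (hpos y' hy').le

theorem contMDiffAt_endCoord {x : X} (hx : 0 < D.endCoord x) :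
    ContMDiffAt (𝓡 n) 𝓘(ℝ, ℝ) ∞ D.endCoord x := by
  obtain ⟨U, s, y, hs, hy, hsy, rfl, hpos⟩ := D.exists_lift_at 0 (by simpa using hx)
  simp only [Nat.cast_zero] at hpos
  refine contMDiffAt_of_comp_isLocalDiffeomorphAt (j := fun y => D.ι (s y) y)
    (D.isLocalDiffeomorph_ι U s hs hpos ⟨y, hy⟩) ?_
  exact ((hs.smooth y hy).contMDiffAt (hs.isOpen.mem_nhds hy)).congr_of_eventuallyEq
    (D.endCoord_comp_eventuallyEq hs hpos hy)

theorem contMDiffAt_translate (k : ℕ) {x : X} (hx : k < D.endCoord x) :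
    ContMDiffAt (𝓡 n) (𝓡 n) ∞ (D.translate k) x := by
  obtain ⟨U, s, y, hs, hy, hsy, rfl, hpos⟩ := D.exists_lift_at k hx
  have hpos0 : ∀ y ∈ U, 0 < s y := fun y hy => lt_of_le_of_lt (Nat.cast_nonneg k) (hpos y hy)
  refine contMDiffAt_of_comp_isLocalDiffeomorphAt (j := fun y => D.ι (s y) y)
    (D.isLocalDiffeomorph_ι U s hs hpos0 ⟨y, hy⟩) ?_
  have h1 := D.isLocalDiffeomorph_ι U _ (hs.sub_nat k) (fun y hy => sub_pos.2 (hpos y hy)) ⟨y, hy⟩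
  exact h1.contMDiffAt.congr_of_eventuallyEq (D.translate_comp_eventuallyEq k hs hpos0 hy)

variable [RiemannianBundle (fun x : X => TangentSpace (𝓡 n) x)]
  [RiemannianBundle (fun y : Y => TangentSpace (𝓡 n) y)]

/-- The metric on the end is the lift of the metric of `Y`. -/
def IsMetricLift : Prop :=
  ∀ U s, IsLift (𝓡 n) f₀ U s → (∀ y ∈ U, 0 < s y) →
    ∀ y ∈ U, ∀ v : TangentSpace (𝓡 n) y,
      ‖(mfderiv (𝓡 n) (𝓡 n) (fun y => D.ι (s y) y) y v :
        TangentSpace (𝓡 n) (D.ι (s y) y))‖ = ‖v‖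

variable {D}

theorem IsMetricLift.enorm_eq (hD : D.IsMetricLift) {U : Set Y} {s : Y → ℝ}
    (hs : IsLift (𝓡 n) f₀ U s) (hpos : ∀ y ∈ U, 0 < s y) {y : Y} (hy : y ∈ U)
    (v : TangentSpace (𝓡 n) y) :
    ‖(mfderiv (𝓡 n) (𝓡 n) (fun y => D.ι (s y) y) y v :
        TangentSpace (𝓡 n) (D.ι (s y) y))‖ₑ = ‖v‖ₑ := by
  rw [← ofReal_norm, ← ofReal_norm, hD U s hs hpos y hy v]

/-- Along a lift `s`, the translation exchanges the local sections for `s` and `s - k` over the same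
open set of `Y`. Both preserve the norms of tangent vectors of `Y`. -/
theorem IsMetricLift.enorm_mfderiv_translate (hD : D.IsMetricLift) (k : ℕ) {x : X}
    (hx : k < D.endCoord x) (v : TangentSpace (𝓡 n) x) :
    ‖mfderiv (𝓡 n) (𝓡 n) (D.translate k) x v‖ₑ = ‖v‖ₑ := by
  have hc := D.contMDiffAt_translate k hx
  obtain ⟨U, s, y, hs, hy, hsy, rfl, hpos⟩ := D.exists_lift_at k hx
  have hpos0 : ∀ y ∈ U, 0 < s y := fun y hy => lt_of_le_of_lt (Nat.cast_nonneg k) (hpos y hy)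
  have hj := D.isLocalDiffeomorph_ι U s hs hpos0 ⟨y, hy⟩
  obtain ⟨w, hw, hw'⟩ := exists_mfderiv_eq_of_isLocalDiffeomorphAt (fun y => D.ι (s y) y) hj
    (D.translate k) (hc.mdifferentiableAt (by simp)) v
  have h1 := enorm_mfderiv_congr (IX := 𝓡 n) (IY := 𝓡 n)
    (D.translate_comp_eventuallyEq k hs hpos0 hy) w
  have h2 := hD.enorm_eq (hs.sub_nat k) (fun y hy => sub_pos.2 (hpos y hy)) hy w
  have h3 := hD.enorm_eq hs hpos0 hy w
  rw [← hw, h3, ← h2, ← h1, hw', ← hw]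

end PeriodicEnd

end Distance

/-! ### Local derivative bounds from continuity of the Riemannian metric -/

section DerivativeBounds

open Manifold

variable {n : ℕ} {Y : Type*} [TopologicalSpace Y] [ChartedSpace (EuclideanSpace ℝ (Fin n)) Y]
  [IsManifold (𝓡 n) ∞ Y] [RiemannianBundle (fun y : Y => TangentSpace (𝓡 n) y)]
  [IsContMDiffRiemannianBundle (𝓡 n) ∞ (EuclideanSpace ℝ (Fin n))
      (fun y : Y => TangentSpace (𝓡 n) y)]

theorem eventually_norm_mfderiv_extChartAt_le (y₀ : Y) :
    ∃ C : ℝ, ∀ᶠ y in 𝓝 y₀, ∀ v : TangentSpace (𝓡 n) y,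
      @norm (EuclideanSpace ℝ (Fin n)) _ (mfderiv (𝓡 n) 𝓘(ℝ, EuclideanSpace ℝ (Fin n)) (extChartAt (𝓡 n) y₀) y v) ≤ C * ‖v‖ := by
  have : IsContinuousRiemannianBundle (EuclideanSpace ℝ (Fin n))
      (fun y : Y => TangentSpace (𝓡 n) y) := by
    obtain ⟨g, hg, hg'⟩ := IsContMDiffRiemannianBundle.exists_contMDiff (IB := 𝓡 n) (n := ∞)
      (F := EuclideanSpace ℝ (Fin n)) (E := fun y : Y => TangentSpace (𝓡 n) y)
    exact ⟨⟨g, hg.continuous, hg'⟩⟩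
  obtain ⟨C, hC, h⟩ := eventually_norm_trivializationAt_lt (EuclideanSpace ℝ (Fin n))
    (fun y : Y => TangentSpace (𝓡 n) y) y₀
  refine ⟨C, ?_⟩
  filter_upwards [h, chart_source_mem_nhds (EuclideanSpace ℝ (Fin n)) y₀] with y hy hy' v
  have h1 := ContinuousLinearMap.le_of_opNorm_le _ hy.le v
  have h2 := TangentBundle.continuousLinearMapAt_trivializationAt (I := 𝓡 n) hy'
  have h3 := DFunLike.congr_fun h2 v
  refine le_trans (le_of_eq ?_) h1
  exact congrArg (@norm (EuclideanSpace ℝ (Fin n)) _) h3.symm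

theorem eventually_norm_mfderiv_extChartAt_symm_le (y₀ : Y) :
    ∃ C : ℝ, 0 < C ∧ ∀ᶠ y in 𝓝 y₀, ∀ v : EuclideanSpace ℝ (Fin n),
      @norm (TangentSpace (𝓡 n) ((extChartAt (𝓡 n) y₀).symm (extChartAt (𝓡 n) y₀ y))) _ (mfderiv 𝓘(ℝ, EuclideanSpace ℝ (Fin n)) (𝓡 n) (extChartAt (𝓡 n) y₀).symm (extChartAt (𝓡 n) y₀ y) v) ≤ C * ‖v‖ := by
  have : IsContinuousRiemannianBundle (EuclideanSpace ℝ (Fin n))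
      (fun y : Y => TangentSpace (𝓡 n) y) := by
    obtain ⟨g, hg, hg'⟩ := IsContMDiffRiemannianBundle.exists_contMDiff (IB := 𝓡 n) (n := ∞)
      (F := EuclideanSpace ℝ (Fin n)) (E := fun y : Y => TangentSpace (𝓡 n) y)
    exact ⟨⟨g, hg.continuous, hg'⟩⟩
  obtain ⟨C, hC, h⟩ := eventually_norm_symmL_trivializationAt_lt (EuclideanSpace ℝ (Fin n))
    (fun y : Y => TangentSpace (𝓡 n) y) y₀
  refine ⟨C, hC, ?_⟩
  filter_upwards [h, chart_source_mem_nhds (EuclideanSpace ℝ (Fin n)) y₀] with y hy hy' v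
  have h1 := ContinuousLinearMap.le_of_opNorm_le _ hy.le v
  have h2 := TangentBundle.symmL_trivializationAt (I := 𝓡 n) hy'
  rw [ModelWithCorners.range_eq_univ, mfderivWithin_univ] at h2
  have h3 := DFunLike.congr_fun h2 v
  refine le_trans (le_of_eq ?_) h1
  have key : ∀ p q : Y, p = q → ∀ v v' : EuclideanSpace ℝ (Fin n), v = v' →
      @norm (TangentSpace (𝓡 n) p) _ v = @norm (TangentSpace (𝓡 n) q) _ v' := by
    rintro p q rfl v v' rfl; rfl
  refine key _ _ ((extChartAt (𝓡 n) y₀).left_inv ?_) _ _ h3.symm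
  rwa [extChartAt_source]

/-- Factor `s` through a chart: the derivative of `s` in the chart is continuous, hence bounded near
the centre, and the derivative of the chart is bounded with respect to the Riemannian norms. -/
theorem eventually_enorm_mfderiv_le {s : Y → ℝ} {y₀ : Y}
    (hs : ContMDiffAt (𝓡 n) 𝓘(ℝ, ℝ) ∞ s y₀) :
    ∃ C : NNReal, ∀ᶠ y in 𝓝 y₀, ∀ v : TangentSpace (𝓡 n) y,
      ‖mfderiv (𝓡 n) 𝓘(ℝ, ℝ) s y v‖ₑ ≤ C * ‖v‖ₑ := by
  obtain ⟨C, hC⟩ := eventually_norm_mfderiv_extChartAt_le (n := n) y₀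
  set φ := extChartAt (𝓡 n) y₀ with hφ
  have hg : ContDiffAt ℝ ∞ (s ∘ φ.symm) (φ y₀) := by
    rw [← contMDiffAt_iff_contDiffAt]
    refine ContMDiffAt.comp _ ?_ ((contMDiffOn_extChartAt_symm y₀).contMDiffAt
      (extChartAt_target_mem_nhds y₀))
    rw [hφ, extChartAt_to_inv]
    exact hs
  have hev : ∀ᶠ v in 𝓝 (φ y₀), DifferentiableAt ℝ (s ∘ φ.symm) v ∧
      ‖fderiv ℝ (s ∘ φ.symm) v‖ < ‖fderiv ℝ (s ∘ φ.symm) (φ y₀)‖ + 1 := by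
    have h1 : ∀ᶠ v in 𝓝 (φ y₀), ContDiffAt ℝ 1 (s ∘ φ.symm) v :=
      (hg.of_le (by simp)).eventually (by simp)
    have h2 : ContinuousAt (fderiv ℝ (s ∘ φ.symm)) (φ y₀) :=
      (hg.fderiv_right (m := 0) (by simp)).continuousAt
    filter_upwards [h1, h2.norm.eventually_lt_const (lt_add_one _)] with v hv hv'
    exact ⟨hv.differentiableAt one_ne_zero, hv'⟩
  have hev' := (continuousAt_extChartAt (I := 𝓡 n) y₀).eventually hev
  refine ⟨Real.toNNReal ((‖fderiv ℝ (s ∘ φ.symm) (φ y₀)‖ + 1) * C), ?_⟩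
  filter_upwards [hC, hev', extChartAt_source_mem_nhds (I := 𝓡 n) y₀] with y hy1 hy2 hy3 v
  have heq : s =ᶠ[𝓝 y] (s ∘ φ.symm) ∘ φ := by
    filter_upwards [(isOpen_extChartAt_source (I := 𝓡 n) y₀).mem_nhds hy3] with y' hy'
    simp only [Function.comp_apply]
    rw [φ.left_inv hy']
  have hφd : MDifferentiableAt (𝓡 n) 𝓘(ℝ, EuclideanSpace ℝ (Fin n)) φ y :=
    (contMDiffAt_extChartAt' (I := 𝓡 n) (n := ∞) (by rwa [extChartAt_source] at hy3)).mdifferentiableAt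
      (by simp)
  have h1 := enorm_mfderiv_congr (IX := 𝓘(ℝ, ℝ)) (IY := 𝓡 n) heq v
  have h2 : @norm ℝ _ (mfderiv (𝓡 n) 𝓘(ℝ, ℝ) ((s ∘ φ.symm) ∘ φ) y v) ≤
      (‖fderiv ℝ (s ∘ φ.symm) (φ y₀)‖ + 1) * C * ‖v‖ := by
    rw [mfderiv_comp y hy2.1.mdifferentiableAt hφd, mfderiv_eq_fderiv]
    refine le_trans ((fderiv ℝ (s ∘ φ.symm) (φ y)).le_opNorm
      (mfderiv (𝓡 n) 𝓘(ℝ, EuclideanSpace ℝ (Fin n)) φ y v)) ?_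
    refine le_trans (mul_le_mul hy2.2.le (hy1 v) (norm_nonneg _) (by positivity)) ?_
    rw [← mul_assoc]
  have h3 : ∀ a b K : ℝ, 0 ≤ b → ‖a‖ ≤ K * b → ‖a‖ₑ ≤ Real.toNNReal K * ENNReal.ofReal b := by
    intro a b K hb hab
    rw [← ofReal_norm, ← ENNReal.ofReal_coe_nnreal, ← ENNReal.ofReal_mul (NNReal.coe_nonneg _)]
    refine ENNReal.ofReal_le_ofReal (hab.trans ?_)
    gcongr
    exact Real.le_coe_toNNReal _
  rw [h1, ← ofReal_norm v]
  exact enorm_tangentSpace_vectorSpace.trans_le (h3 _ _ _ (norm_nonneg _) h2)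

end DerivativeBounds

/-! ### Riemannian distance on the end compared with the coordinate `f` -/

section Distance

open Manifold

variable {n : ℕ} {X : Type*} [TopologicalSpace X] [ChartedSpace (EuclideanSpace ℝ (Fin n)) X]
  {Y : Type*} [TopologicalSpace Y] [ChartedSpace (EuclideanSpace ℝ (Fin n)) Y] {f₀ : Y → Circle}
  [RiemannianBundle (fun x : X => TangentSpace (𝓡 n) x)]
  [RiemannianBundle (fun y : Y => TangentSpace (𝓡 n) y)]

/-- Lifts of `f₀` have uniformly bounded derivatives. -/
theorem exists_enorm_mfderiv_lift_le [IsManifold (𝓡 n) ∞ Y] [CompactSpace Y]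
    [IsContMDiffRiemannianBundle (𝓡 n) ∞ (EuclideanSpace ℝ (Fin n))
      (fun y : Y => TangentSpace (𝓡 n) y)] (hf : ContMDiff (𝓡 n) (𝓡 1) ∞ f₀) :
    ∃ L : NNReal, 0 < L ∧ ∀ U s, IsLift (𝓡 n) f₀ U s → ∀ y ∈ U, ∀ v : TangentSpace (𝓡 n) y,
      ‖mfderiv (𝓡 n) 𝓘(ℝ, ℝ) s y v‖ₑ ≤ L * ‖v‖ₑ := by
  have hloc : ∀ y₀ : Y, ∃ C : NNReal, ∀ᶠ y in 𝓝 y₀, ∀ U s, IsLift (𝓡 n) f₀ U s → y ∈ U →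
      ∀ v : TangentSpace (𝓡 n) y, ‖mfderiv (𝓡 n) 𝓘(ℝ, ℝ) s y v‖ₑ ≤ C * ‖v‖ₑ := by
    intro y₀
    obtain ⟨U₀, s₀, hs₀, hy₀, -⟩ := exists_isLift hf (segmentCoord_mem_cover y₀)
    obtain ⟨C, hC⟩ := eventually_enorm_mfderiv_le
      ((hs₀.smooth y₀ hy₀).contMDiffAt (hs₀.isOpen.mem_nhds hy₀))
    refine ⟨C, ?_⟩
    filter_upwards [hC, hs₀.isOpen.mem_nhds hy₀] with y hy hyU₀ U s hs hyU v
    obtain ⟨m, hm⟩ := exists_int_of_mem_cover (hs.mem y hyU) (hs₀.mem y hyU₀)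
    -- Two lifts differ by an integer, which is locally constant by continuity. A bound for the
    -- derivative of the single lift `s₀` near `y₀` therefore serves for all lifts, and compactness
    -- of `Y` makes it global.
    have heq : s =ᶠ[𝓝 y] fun y => s₀ y + m := by
      have h1 := (hs.continuousAt hyU).sub (hs₀.continuousAt hyU₀)
      have h2 : ∀ᶠ y' in 𝓝 y, |s y' - s₀ y' - m| < 1 := by
        have h3 : ContinuousAt (fun y' => |s y' - s₀ y' - m|) y := (h1.sub continuousAt_const).abs
        refine h3.eventually_lt_const ?_
        simp [hm]
      filter_upwards [h2, hs.isOpen.mem_nhds hyU, hs₀.isOpen.mem_nhds hyU₀] with y' h3 h4 h5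
      refine eq_of_mem_cover (hs.mem y' h4) (cover_add_int (hs₀.mem y' h5) m) ?_
      rwa [← sub_sub]
    rw [enorm_mfderiv_congr (IX := 𝓘(ℝ, ℝ)) (IY := 𝓡 n) heq v]
    have h6 : mfderiv (𝓡 n) 𝓘(ℝ, ℝ) (fun y => s₀ y + (m : ℝ)) y = mfderiv (𝓡 n) 𝓘(ℝ, ℝ) s₀ y := by
      have hd : MDifferentiableAt (𝓡 n) 𝓘(ℝ, ℝ) s₀ y :=
        ((hs₀.smooth y hyU₀).contMDiffAt (hs₀.isOpen.mem_nhds hyU₀)).mdifferentiableAt (by simp)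
      have := mfderiv_add hd (mdifferentiableAt_const (c := (m : ℝ)))
      rw [mfderiv_const] at this
      exact this.trans (add_zero _)
    have h7 := hy v
    rw [enorm_tangentSpace_vectorSpace] at h7 ⊢
    exact (le_of_eq (congrArg (@enorm ℝ _) (DFunLike.congr_fun h6 v))).trans h7
  choose C hC using hloc
  obtain ⟨t, ht⟩ := CompactSpace.elim_nhds_subcover _ hC
  -- The summand `1` makes the constant positive whatever the local bounds are.
  refine ⟨t.sup C + 1, by positivity, fun U s hs y hy v => ?_⟩
  have : y ∈ ⋃ y₀ ∈ t, {y | ∀ U s, IsLift (𝓡 n) f₀ U s → y ∈ U →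
      ∀ v : TangentSpace (𝓡 n) y, ‖mfderiv (𝓡 n) 𝓘(ℝ, ℝ) s y v‖ₑ ≤ C y₀ * ‖v‖ₑ} := by
    rw [ht]; trivial
  simp only [Set.mem_iUnion] at this
  obtain ⟨y₀, hy₀, h⟩ := this
  refine (h U s hs hy v).trans ?_
  gcongr
  exact (Finset.le_sup hy₀).trans (le_add_of_nonneg_right zero_le_one)

namespace PeriodicEnd

variable {D : PeriodicEnd (𝓡 n) (𝓡 n) X f₀}

theorem IsMetricLift.enorm_mfderiv_endCoord_le (hD : D.IsMetricLift) {L : NNReal}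
    (hL : ∀ U s, IsLift (𝓡 n) f₀ U s → ∀ y ∈ U, ∀ v : TangentSpace (𝓡 n) y,
      ‖mfderiv (𝓡 n) 𝓘(ℝ, ℝ) s y v‖ₑ ≤ L * ‖v‖ₑ) {x : X}
    (hx : 0 < D.endCoord x) (v : TangentSpace (𝓡 n) x) :
    ‖mfderiv (𝓡 n) 𝓘(ℝ, ℝ) D.endCoord x v‖ₑ ≤ L * ‖v‖ₑ := by
  have hc := D.contMDiffAt_endCoord hx
  obtain ⟨U, s, y, hs, hy, hsy, rfl, hpos⟩ := D.exists_lift_at 0 (by simpa using hx)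
  simp only [Nat.cast_zero] at hpos
  have hj := D.isLocalDiffeomorph_ι U s hs hpos ⟨y, hy⟩
  obtain ⟨w, hw, hw'⟩ := exists_mfderiv_eq_of_isLocalDiffeomorphAt (fun y => D.ι (s y) y) hj
    D.endCoord (hc.mdifferentiableAt (by simp)) v
  have h1 := enorm_mfderiv_congr (IX := 𝓘(ℝ, ℝ)) (IY := 𝓡 n)
    (D.endCoord_comp_eventuallyEq hs hpos hy) w
  have h3 := hD.enorm_eq hs hpos hy w
  have h4 := hL U s hs y hy w
  rw [← h1, hw', ← h3, hw] at h4
  exact h4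

/-- The coordinate `f` is Lipschitz on the end, up to an error at the boundary of the end. -/
theorem IsMetricLift.endCoord_sub_le [T2Space X] (hD : D.IsMetricLift) {L : NNReal}
    (hL0 : 0 < L) (hL : ∀ U s, IsLift (𝓡 n) f₀ U s → ∀ y ∈ U, ∀ v : TangentSpace (𝓡 n) y,
      ‖mfderiv (𝓡 n) 𝓘(ℝ, ℝ) s y v‖ₑ ≤ L * ‖v‖ₑ) (x x' : X) :
    ENNReal.ofReal (D.endCoord x - D.endCoord x' - 1) ≤ L * riemannianEDist (𝓡 n) x x' := by
  -- A path from `x` is followed only until its coordinate has dropped to `c`. Since `c` is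
  -- positive, this piece stays in the open end, where the coordinate is smooth; the safety margin
  -- is the error `1` of the estimate.
  set c := D.endCoord x' + 1 with hc
  have hc0 : 0 < c := by have := D.endCoord_nonneg x'; linarith
  by_cases hxc : D.endCoord x ≤ c
  · rw [ENNReal.ofReal_of_nonpos (by linarith)]; exact zero_le
  push Not at hxc
  suffices h : ∀ r, riemannianEDist (𝓡 n) x x' < r →
      ENNReal.ofReal (D.endCoord x - D.endCoord x' - 1) ≤ L * r by
    have hL1 : (L : ℝ≥0∞) ≠ 0 := by exact_mod_cast hL0.ne'
    rw [mul_comm, ← ENNReal.div_le_iff hL1 ENNReal.coe_ne_top]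
    refine le_of_forall_gt_imp_ge_of_dense fun r hr => ?_
    rw [ENNReal.div_le_iff hL1 ENNReal.coe_ne_top, mul_comm]
    exact h r hr
  intro r hr
  obtain ⟨γ, h0, h1, hγ, hlen⟩ := exists_lt_of_riemannianEDist_lt hr
  have hcont : ContinuousOn (D.endCoord ∘ γ) (Set.Icc 0 1) :=
    D.continuous_endCoord.comp_continuousOn hγ.continuousOn
  rcases exists_first_hit (c := c) hcont (by simp [h0, hxc.le]) with h | ⟨T, hT, hTc, hle⟩
  · have := h 1 ⟨zero_le_one, le_rfl⟩
    simp [h1] at this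
    linarith
  have hsub : Set.Icc 0 T ⊆ Set.Icc (0 : ℝ) 1 := Set.Icc_subset_Icc le_rfl hT.2
  have hpos : ∀ u ∈ Set.Icc 0 T, 0 < D.endCoord (γ u) := fun u hu => hc0.trans_le (hle u hu)
  have hsm : ContMDiffOn 𝓘(ℝ, ℝ) 𝓘(ℝ, ℝ) 1 (D.endCoord ∘ γ) (Set.Icc 0 T) := by
    intro u hu
    exact ((D.contMDiffAt_endCoord (hpos u hu)).of_le (by simp)).comp_contMDiffWithinAt u
      ((hγ.mono hsub) u hu)
  have h2 := riemannianEDist_le_pathELength hsm rfl rfl hT.1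
  rw [← IsRiemannianManifold.out (I := 𝓘(ℝ, ℝ))] at h2
  have h3 := pathELength_comp_le (IX' := 𝓘(ℝ, ℝ)) (f := D.endCoord) (L := L) (by simp) (hγ.mono hsub)
    (fun t ht => (D.contMDiffAt_endCoord (hpos t (Set.Ioo_subset_Icc_self ht))).mdifferentiableAt
      (by simp))
    (fun t ht v => hD.enorm_mfderiv_endCoord_le hL (hpos t (Set.Ioo_subset_Icc_self ht)) v)
  have h4 : ENNReal.ofReal (D.endCoord x - D.endCoord x' - 1) =
      edist ((D.endCoord ∘ γ) 0) ((D.endCoord ∘ γ) T) := by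
    rw [hTc, Function.comp_apply, h0, edist_dist, Real.dist_eq, abs_of_pos (by linarith), hc,
      sub_sub]
  rw [h4]
  refine h2.trans (h3.trans ?_)
  gcongr
  exact (pathELength_mono le_rfl hT.2).trans hlen.le

variable (D) in
/-- The distance to the segment `W₀`. -/
def distSegment (t : ℝ) (y : Y) : ℝ≥0∞ :=
  ⨅ w ∈ {w : ℝ × Y | w ∈ cover f₀ ∧ 0 ≤ w.1 ∧ w.1 ≤ 1},
    riemannianEDist (𝓡 n) (D.ι t y) (D.ι w.1 w.2)

/-- Take a path of length below `r` and translate it back by `-k` for as long as its coordinate is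
at least `k + 1`; there the translation is smooth and preserves lengths. If the path first reaches
`k + 1`, the translated piece ends on the boundary `f = 1` of `W₀`; otherwise the whole path can be
translated. -/
theorem IsMetricLift.hit_or_stay [T2Space X] (hD : D.IsMetricLift) {t : ℝ} {y : Y}
    (hc : (t, y) ∈ cover f₀) (ht : 1 ≤ t) (k : ℕ) (p : X) {r : ℝ≥0∞}
    (hr : riemannianEDist (𝓡 n) (D.ι (t + k) y) p < r) :
    D.distSegment t y ≤ r ∨
      (k + 1 < D.endCoord p ∧ riemannianEDist (𝓡 n) (D.ι t y) (D.translate k p) ≤ r) := by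
  obtain ⟨γ, h0, h1, hγ, hlen⟩ := exists_lt_of_riemannianEDist_lt hr
  have hck := cover_add_nat hc k
  have htk : 0 ≤ t + k := by positivity
  have hcont : ContinuousOn (D.endCoord ∘ γ) (Set.Icc 0 1) :=
    D.continuous_endCoord.comp_continuousOn hγ.continuousOn
  have hstart : (k : ℝ) + 1 ≤ (D.endCoord ∘ γ) 0 := by
    simp only [Function.comp_apply, h0, D.endCoord_ι hck htk]; linarith
  have hmain : ∀ T ∈ Set.Icc (0 : ℝ) 1, (∀ u ∈ Set.Icc 0 T, (k : ℝ) + 1 ≤ D.endCoord (γ u)) →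
      riemannianEDist (𝓡 n) (D.ι t y) (D.translate k (γ T)) ≤ r := by
    intro T hT hle
    have hsub : Set.Icc 0 T ⊆ Set.Icc (0 : ℝ) 1 := Set.Icc_subset_Icc le_rfl hT.2
    have hk : ∀ u ∈ Set.Icc 0 T, (k : ℝ) < D.endCoord (γ u) := fun u hu => by
      have := hle u hu; linarith
    have hsm : ContMDiffOn 𝓘(ℝ, ℝ) (𝓡 n) 1 (D.translate k ∘ γ) (Set.Icc 0 T) := by
      intro u hu
      exact ((D.contMDiffAt_translate k (hk u hu)).of_le (by simp)).comp_contMDiffWithinAt u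
        ((hγ.mono hsub) u hu)
    have hst : (D.translate k ∘ γ) 0 = D.ι t y := by
      simp [h0, D.translate_ι k hck htk]
    have h2 := riemannianEDist_le_pathELength hsm hst rfl hT.1
    have h3 := pathELength_comp_le (IX' := 𝓡 n) (f := D.translate k) (L := 1) (by simp)
      (hγ.mono hsub)
      (fun t ht => (D.contMDiffAt_translate k (hk t (Set.Ioo_subset_Icc_self ht))).mdifferentiableAt
        (by simp))
      (fun t ht v => by
        rw [hD.enorm_mfderiv_translate k (hk t (Set.Ioo_subset_Icc_self ht)) v, one_mul])
    rw [one_mul] at h3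
    exact h2.trans (h3.trans ((pathELength_mono le_rfl hT.2).trans hlen.le))
  rcases exists_first_hit hcont hstart with h | ⟨T, hT, hTc, hle⟩
  · right
    have h2 := hmain 1 ⟨zero_le_one, le_rfl⟩ fun u hu => (h u hu).le
    have h3 := h 1 ⟨zero_le_one, le_rfl⟩
    rw [h1] at h2
    rw [Function.comp_apply, h1] at h3
    exact ⟨h3, h2⟩
  · left
    have h2 := hmain T hT hle
    have hTc' : D.endCoord (γ T) = k + 1 := hTc
    obtain ⟨y', hy', hxy⟩ := D.exists_ι_of_endCoord_pos (x := γ T) (by rw [hTc']; positivity)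
    rw [hTc'] at hy' hxy
    rw [← hxy, D.translate_ι k hy' (by positivity)] at h2
    have hy1 : ((k : ℝ) + 1 - k, y') ∈ cover f₀ := cover_sub_nat hy' k
    have he : (k : ℝ) + 1 - k = 1 := by ring
    rw [he] at hy1 h2
    exact (iInf₂_le (1, y') ⟨hy1, zero_le_one, le_rfl⟩).trans h2

/-- Translated points are at least as far from the part `f ≤ k + 1` as the original point is
from `W₀`. -/
theorem IsMetricLift.distSegment_le [T2Space X] (hD : D.IsMetricLift) {t : ℝ} {y : Y}
    (hc : (t, y) ∈ cover f₀) (ht : 1 ≤ t) (k : ℕ) {p : X} (hp : D.endCoord p ≤ k + 1) :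
    D.distSegment t y ≤ riemannianEDist (𝓡 n) (D.ι (t + k) y) p := by
  refine le_of_forall_gt_imp_ge_of_dense fun r hr => ?_
  rcases hD.hit_or_stay hc ht k p hr with h | h
  · exact h
  · exact absurd h.1 (not_lt.2 hp)

/-- Translations need not be isometries of the Riemannian distance, because short paths may take a
detour through the compact part. Such detours have to pass the translate of `W₀`, and the minimum
accounts for them. -/
theorem IsMetricLift.min_distSegment_le [T2Space X] (hD : D.IsMetricLift) {t t' : ℝ} {y y' : Y}
    (hc : (t, y) ∈ cover f₀) (ht : 1 ≤ t) (hc' : (t', y') ∈ cover f₀) (ht' : 0 ≤ t') (k : ℕ) :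
    min (D.distSegment t y) (riemannianEDist (𝓡 n) (D.ι t y) (D.ι t' y')) ≤
      riemannianEDist (𝓡 n) (D.ι (t + k) y) (D.ι (t' + k) y') := by
  refine le_of_forall_gt_imp_ge_of_dense fun r hr => ?_
  rcases hD.hit_or_stay hc ht k _ hr with h | h
  · exact (min_le_left _ _).trans h
  · have h2 := h.2
    rw [D.translate_ι k (cover_add_nat hc' k) (by positivity), add_sub_cancel_right] at h2
    exact (min_le_right _ _).trans h2

end PeriodicEnd

end Distance

/-! ### Local finiteness of the Riemannian volume -/

section Volume

open Manifold

variable {n : ℕ} {Y : Type*} [TopologicalSpace Y] [ChartedSpace (EuclideanSpace ℝ (Fin n)) Y]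

theorem injective_mfderiv_extChartAt_symm [IsManifold (𝓡 n) ∞ Y] (y₀ : Y)
    {v : EuclideanSpace ℝ (Fin n)} (hv : v ∈ (extChartAt (𝓡 n) y₀).target) :
    Function.Injective (mfderiv (𝓡 n) (𝓡 n) (extChartAt (𝓡 n) y₀).symm v) := by
  have h := isInvertible_mfderivWithin_extChartAt_symm (I := 𝓡 n) hv
  rw [ModelWithCorners.range_eq_univ, mfderivWithin_univ] at h
  obtain ⟨e, he⟩ := h
  rw [← he]
  exact e.injective

variable [RiemannianBundle (fun y : Y => TangentSpace (𝓡 n) y)]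

/-- The density of the Riemannian volume in a parametrization. -/
def gramDensity (ψ : EuclideanSpace ℝ (Fin n) → Y) (v : EuclideanSpace ℝ (Fin n)) : ℝ≥0∞ :=
  ENNReal.ofReal (Real.sqrt (Matrix.det (Matrix.of
        (fun i j : Fin n => inner ℝ
          (mfderiv (𝓡 n) (𝓡 n) ψ v (EuclideanSpace.single i (1 : ℝ)) : TangentSpace (𝓡 n) (ψ v))
          (mfderiv (𝓡 n) (𝓡 n) ψ v (EuclideanSpace.single j (1 : ℝ)) :
            TangentSpace (𝓡 n) (ψ v))))))

/-- Cauchy–Schwarz bounds the entries of the Gram matrix by `C * C`, and the expansion of the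
determinant has `n!` terms. -/
theorem gramDensity_le {ψ : EuclideanSpace ℝ (Fin n) → Y} {v : EuclideanSpace ℝ (Fin n)} {C : ℝ}
    (h : ∀ w : EuclideanSpace ℝ (Fin n),
      @norm (TangentSpace (𝓡 n) (ψ v)) _ (mfderiv (𝓡 n) (𝓡 n) ψ v w) ≤ C * ‖w‖) :
    gramDensity ψ v ≤ ENNReal.ofReal (Real.sqrt (n.factorial * (C * C) ^ n)) := by
  refine ENNReal.ofReal_le_ofReal (Real.sqrt_le_sqrt ?_)
  set A : Matrix (Fin n) (Fin n) ℝ := Matrix.of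
        (fun i j : Fin n => inner ℝ
          (mfderiv (𝓡 n) (𝓡 n) ψ v (EuclideanSpace.single i (1 : ℝ)) : TangentSpace (𝓡 n) (ψ v))
          (mfderiv (𝓡 n) (𝓡 n) ψ v (EuclideanSpace.single j (1 : ℝ)) :
            TangentSpace (𝓡 n) (ψ v))) with hA
  have h1 := Matrix.det_le (A := A) (abv := AbsoluteValue.abs) (x := C * C) fun i j => by
    have hi := h (EuclideanSpace.single i (1 : ℝ))
    have hj := h (EuclideanSpace.single j (1 : ℝ))
    rw [PiLp.norm_single, norm_one, mul_one] at hi hj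
    exact (abs_real_inner_le_norm _ _).trans (mul_le_mul hi hj (norm_nonneg _)
      ((norm_nonneg _).trans hi))
  have h2 := (le_abs_self A.det).trans h1
  simpa using h2

variable [MeasurableSpace Y]

theorem IsRiemannianVolume.apply_extChartAt_symm_image [IsManifold (𝓡 n) ∞ Y] {μ : Measure Y}
    (hμ : IsRiemannianVolume (n := n) μ) (y₀ : Y) {A : Set (EuclideanSpace ℝ (Fin n))}
    (hA : A ⊆ (extChartAt (𝓡 n) y₀).target) (hAm : MeasurableSet A) :
    μ ((extChartAt (𝓡 n) y₀).symm '' A) =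
      ∫⁻ v in A, gramDensity (Y := Y) (extChartAt (𝓡 n) y₀).symm v :=
  hμ _ _ (isOpen_extChartAt_target y₀) (contMDiffOn_extChartAt_symm y₀)
    (extChartAt (𝓡 n) y₀).symm.injOn
    (fun _ hv => injective_mfderiv_extChartAt_symm y₀ hv) A hA hAm

/-- On a small ball in a chart the inverse chart has bounded derivative, so the volume density is
bounded there and the image of the ball has finite volume. -/
theorem IsRiemannianVolume.isLocallyFiniteMeasure [IsManifold (𝓡 n) ∞ Y]
    [IsContMDiffRiemannianBundle (𝓡 n) ∞ (EuclideanSpace ℝ (Fin n))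
      (fun y : Y => TangentSpace (𝓡 n) y)] {μ : Measure Y}
    (hμ : IsRiemannianVolume (n := n) μ) : IsLocallyFiniteMeasure μ := by
  refine ⟨fun y₀ => ?_⟩
  obtain ⟨C, -, hC⟩ := eventually_norm_mfderiv_extChartAt_symm_le (n := n) y₀
  have hsc : ContinuousAt (extChartAt (𝓡 n) y₀).symm (extChartAt (𝓡 n) y₀ y₀) :=
    continuousAt_extChartAt_symm y₀
  have hC' : ∀ᶠ v in 𝓝 (extChartAt (𝓡 n) y₀ y₀), v ∈ (extChartAt (𝓡 n) y₀).target ∧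
      ∀ w : EuclideanSpace ℝ (Fin n),
        @norm (TangentSpace (𝓡 n) ((extChartAt (𝓡 n) y₀).symm v)) _
        (mfderiv (𝓡 n) (𝓡 n) (extChartAt (𝓡 n) y₀).symm v w) ≤ C * ‖w‖ := by
    rw [ContinuousAt, extChartAt_to_inv] at hsc
    filter_upwards [hsc.eventually hC, extChartAt_target_mem_nhds y₀] with v hv hvt
    refine ⟨hvt, fun w => ?_⟩
    have := hv w
    rwa [(extChartAt (𝓡 n) y₀).right_inv hvt] at this
  obtain ⟨r, hr, hball⟩ := Metric.eventually_nhds_iff_ball.1 hC'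
  refine ⟨(extChartAt (𝓡 n) y₀).symm '' Metric.ball (extChartAt (𝓡 n) y₀ y₀) r, ?_, ?_⟩
  · have h1 := (continuousAt_extChartAt (I := 𝓡 n) y₀).preimage_mem_nhds (Metric.ball_mem_nhds _ hr)
    filter_upwards [h1, extChartAt_source_mem_nhds (I := 𝓡 n) y₀] with y hy hys
    exact ⟨_, hy, (extChartAt (𝓡 n) y₀).left_inv hys⟩
  · rw [hμ.apply_extChartAt_symm_image y₀ (fun v hv => (hball v hv).1) Metric.isOpen_ball.measurableSet]
    refine lt_of_le_of_lt (setLIntegral_mono' Metric.isOpen_ball.measurableSet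
      fun v hv => gramDensity_le (hball v hv).2) ?_
    rw [setLIntegral_const]
    exact ENNReal.mul_lt_top ENNReal.ofReal_lt_top measure_ball_lt_top

end Volume

/-! ### Points of segments, isometric lifts and countable families of lifts -/

section SegmentPoints

variable {Y : Type*} {f₀ : Y → Circle}

/-- The point over `y` of the segment `m ≤ f < m + 1`. -/
def segmentPoint (f₀ : Y → Circle) (m : ℤ) (y : Y) : ℝ × Y := (segmentCoord f₀ y + m, y)

theorem segmentPoint_mem_cover (m : ℤ) (y : Y) : segmentPoint f₀ m y ∈ cover f₀ :=
  cover_add_int (segmentCoord_mem_cover y) m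

theorem floor_segmentPoint (m : ℤ) (y : Y) : ⌊(segmentPoint f₀ m y).1⌋ = m := by
  simp [segmentPoint, Int.floor_eq_zero_iff.2 ⟨segmentCoord_nonneg y, segmentCoord_lt_one y⟩]

end SegmentPoints

section InnerProducts

open Manifold

variable {n : ℕ} {X : Type*} [TopologicalSpace X] [ChartedSpace (EuclideanSpace ℝ (Fin n)) X]
  {Y : Type*} [TopologicalSpace Y] [ChartedSpace (EuclideanSpace ℝ (Fin n)) Y] {f₀ : Y → Circle}
  [RiemannianBundle (fun x : X => TangentSpace (𝓡 n) x)]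
  [RiemannianBundle (fun y : Y => TangentSpace (𝓡 n) y)] {D : PeriodicEnd (𝓡 n) (𝓡 n) X f₀}

/-- Polarization: a linear map that preserves norms preserves inner products, and it is inner
products that enter the Gram determinants. -/
theorem PeriodicEnd.IsMetricLift.inner_mfderiv (hD : D.IsMetricLift) {U : Set Y} {s : Y → ℝ}
    (hs : IsLift (𝓡 n) f₀ U s) (hpos : ∀ y ∈ U, 0 < s y) {y : Y} (hy : y ∈ U)
    (v w : TangentSpace (𝓡 n) y) :
    inner ℝ (mfderiv (𝓡 n) (𝓡 n) (fun y => D.ι (s y) y) y v :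
        TangentSpace (𝓡 n) (D.ι (s y) y))
      (mfderiv (𝓡 n) (𝓡 n) (fun y => D.ι (s y) y) y w : TangentSpace (𝓡 n) (D.ι (s y) y)) =
      inner ℝ v w :=
  (LinearMap.norm_map_iff_inner_map_map
    (mfderiv (𝓡 n) (𝓡 n) (fun y => D.ι (s y) y) y)).1 (fun v => hD U s hs hpos y hy v) v w

end InnerProducts

section CountableLifts

variable {EY HY : Type*} [NormedAddCommGroup EY] [NormedSpace ℝ EY] [TopologicalSpace HY]
  {IY : ModelWithCorners ℝ EY HY} {Y : Type*} [TopologicalSpace Y] [ChartedSpace HY Y]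
  [SecondCountableTopology Y] {f₀ : Y → Circle}

/-- Countably many lifts, defined on small sets, suffice to reach all points of the cover up to
translation. -/
theorem exists_countable_lifts (hf : ContMDiff IY (𝓡 1) ∞ f₀) {O : Y → Set Y}
    (hO : ∀ y, O y ∈ 𝓝 y) :
    ∃ (S : Set Y) (U : Y → Set Y) (s : Y → Y → ℝ), S.Countable ∧
      (∀ y₀, IsLift IY f₀ (U y₀) (s y₀) ∧ U y₀ ⊆ O y₀) ∧ ∀ y, ∃ y₀ ∈ S, y ∈ U y₀ := by
  have h : ∀ y₀ : Y, ∃ U s, IsLift IY f₀ U s ∧ U ⊆ O y₀ ∧ y₀ ∈ U := by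
    intro y₀
    obtain ⟨U, s, hs, hy, -⟩ := exists_isLift hf (segmentCoord_mem_cover y₀)
    obtain ⟨V, hVO, hV, hyV⟩ := mem_nhds_iff.1 (hO y₀)
    exact ⟨U ∩ V, s, hs.mono (hs.isOpen.inter hV) Set.inter_subset_left,
      Set.inter_subset_right.trans hVO, hy, hyV⟩
  choose U s hs hUO hmem using h
  obtain ⟨S, hS, hcov⟩ := TopologicalSpace.countable_cover_nhds fun y =>
    (hs y).isOpen.mem_nhds (hmem y)
  refine ⟨S, U, s, hS, fun y₀ => ⟨hs y₀, hUO y₀⟩, fun y => ?_⟩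
  have : y ∈ ⋃ x ∈ S, U x := by rw [hcov]; trivial
  simpa using this

end CountableLifts

/-! ### The segments of the end have the volume of `Y` -/

section EndVolume

open Manifold

variable {n : ℕ} {X : Type*} [TopologicalSpace X] [ChartedSpace (EuclideanSpace ℝ (Fin n)) X]
  {Y : Type*} [TopologicalSpace Y] [ChartedSpace (EuclideanSpace ℝ (Fin n)) Y] {f₀ : Y → Circle}

section Measurability

variable [MeasurableSpace Y] [BorelSpace Y]

theorem measurable_segmentCoord (hf : Continuous f₀) : Measurable (segmentCoord f₀) := by
  have : Measurable fun y => ((f₀ y : Circle) : ℂ) := (by fun_prop : Continuous _).measurable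
  exact measurable_fract.comp ((Complex.measurable_arg.comp this).div_const _)

theorem measurableEmbedding_segmentPoint (hf : Continuous f₀) (m : ℤ) :
    MeasurableEmbedding (segmentPoint f₀ m) := by
  have hs := measurable_segmentCoord hf
  have hm : Measurable (segmentPoint f₀ m) := (hs.add_const _).prodMk measurable_id
  refine MeasurableEmbedding.of_measurable_inverse (g := Prod.snd) hm ?_ measurable_snd
    fun y => rfl
  have : Set.range (segmentPoint f₀ m) = {x | x.1 = segmentCoord f₀ x.2 + m} := by
    ext ⟨t, y⟩
    simp only [segmentPoint, Set.mem_range, Prod.mk.injEq, Set.mem_ofPred_eq]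
    constructor
    · rintro ⟨y', h1, rfl⟩; exact h1.symm
    · intro h; exact ⟨y, h.symm, rfl⟩
  rw [this]
  exact measurableSet_eq_fun measurable_fst ((hs.comp measurable_snd).add_const _)

end Measurability

namespace PeriodicEnd

variable (D : PeriodicEnd (𝓡 n) (𝓡 n) X f₀)

theorem continuous_f₀ (D : PeriodicEnd (𝓡 n) (𝓡 n) X f₀) : Continuous f₀ := D.smooth_f₀.continuous

/-- The identification of `Y` with the segment `m ≤ f < m + 1` of the end. -/
def segmentMap (m : ℕ) (y : Y) : X := D.ι (segmentCoord f₀ y + m) y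

/-- The number of the segment to which a point belongs, extended by `0` to the compact part. -/
def level (x : X) : ℕ := ⌊D.endCoord x⌋₊

theorem endCoord_segmentMap (m : ℕ) (y : Y) :
    D.endCoord (D.segmentMap m y) = segmentCoord f₀ y + m :=
  D.endCoord_ι (cover_add_nat (segmentCoord_mem_cover y) m)
    (add_nonneg (segmentCoord_nonneg y) (Nat.cast_nonneg m))

theorem level_segmentMap (m : ℕ) (y : Y) : D.level (D.segmentMap m y) = m := by
  have h1 := segmentCoord_nonneg (f₀ := f₀) y
  rw [level, endCoord_segmentMap, Nat.floor_add_natCast h1,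
    Nat.floor_eq_zero.2 (segmentCoord_lt_one y), zero_add]

theorem level_ι {t : ℝ} {y : Y} (h : (t, y) ∈ cover f₀) (ht : 0 ≤ t) : D.level (D.ι t y) = ⌊t⌋₊ := by
  rw [level, D.endCoord_ι h ht]

/-- Points of positive level are points of segments. -/
theorem exists_segmentMap_eq {x : X} (h : 0 < D.level x) : ∃ y, D.segmentMap (D.level x) y = x := by
  have h1 : 1 ≤ D.endCoord x := Nat.one_le_floor_iff _ |>.1 h
  obtain ⟨y, hy, hyx⟩ := D.exists_ι_of_endCoord_pos (x := x) (by linarith)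
  refine ⟨y, ?_⟩
  have h2 := eq_segmentCoord_add_floor hy
  rw [segmentMap, level]
  have h3 : ((⌊D.endCoord x⌋₊ : ℕ) : ℝ) = ((⌊D.endCoord x⌋ : ℤ) : ℝ) :=
    natCast_floor_eq_intCast_floor (D.endCoord_nonneg x)
  rw [h3, ← h2, hyx]

variable [MeasurableSpace X] [BorelSpace X]

theorem measurable_level [T2Space X] : Measurable D.level :=
  Nat.measurable_floor.comp D.continuous_endCoord.measurable

variable [MeasurableSpace Y] [BorelSpace Y] [SecondCountableTopology Y]

theorem measurableEmbedding_segmentMap (m : ℕ) : MeasurableEmbedding (D.segmentMap m) := by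
  have hs := measurable_segmentCoord D.continuous_f₀
  have hmem : ∀ y, (segmentCoord f₀ y + m, y) ∈ cover f₀ ∧ 0 ≤ (segmentCoord f₀ y + m, y).1 :=
    fun y => ⟨cover_add_nat (segmentCoord_mem_cover y) m,
      add_nonneg (segmentCoord_nonneg y) (Nat.cast_nonneg m)⟩
  have h1 : MeasurableEmbedding fun y => (⟨(segmentCoord f₀ y + m, y), hmem y⟩ : Half f₀) := by
    have hm : Measurable fun y => (⟨(segmentCoord f₀ y + m, y), hmem y⟩ : Half f₀) :=
      ((hs.add_const _).prodMk measurable_id).subtype_mk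
    refine MeasurableEmbedding.of_measurable_inverse (g := fun x : Half f₀ => x.1.2) hm ?_
      (measurable_snd.comp measurable_subtype_coe) fun y => rfl
    have : Set.range (fun y => (⟨(segmentCoord f₀ y + m, y), hmem y⟩ : Half f₀)) =
        Subtype.val ⁻¹' {x : ℝ × Y | x.1 = segmentCoord f₀ x.2 + m} := by
      ext ⟨⟨t, y⟩, hx⟩
      simp only [Set.mem_range, Subtype.mk.injEq, Prod.mk.injEq, Set.mem_preimage, Set.mem_ofPred_eq]
      constructor
      · rintro ⟨y', h1, rfl⟩; exact h1.symm
      · intro h; exact ⟨y, h.symm, rfl⟩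
    rw [this]
    exact measurable_subtype_coe
      (measurableSet_eq_fun measurable_fst ((hs.comp measurable_snd).add_const _))
  exact D.isClosedEmbedding_embed.measurableEmbedding.comp h1

variable [RiemannianBundle (fun x : X => TangentSpace (𝓡 n) x)]
  [RiemannianBundle (fun y : Y => TangentSpace (𝓡 n) y)]

variable {D}

/-- A chart of `Y` followed by the lift is a parametrization of the end. The lift is isometric, so
its Gram matrices are those of the chart, and the two volumes are integrals of the same density. -/
theorem IsMetricLift.measure_image_lift [IsManifold (𝓡 n) ∞ Y] (hD : D.IsMetricLift)
    {μX : Measure X} {μY : Measure Y}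
    (hX : IsRiemannianVolume (n := n) μX) (hY : IsRiemannianVolume (n := n) μY)
    {U : Set Y} {s : Y → ℝ} (hs : IsLift (𝓡 n) f₀ U s) (hpos : ∀ y ∈ U, 0 < s y) (y₀ : Y)
    {A : Set Y} (hA : MeasurableSet A) (hAU : A ⊆ U) (hAs : A ⊆ (extChartAt (𝓡 n) y₀).source) :
    μX ((fun y => D.ι (s y) y) '' A) = μY A := by
  set φ := extChartAt (𝓡 n) y₀ with hφ
  set j : Y → X := fun y => D.ι (s y) y with hj
  have hsc : ContinuousOn φ.symm φ.target := continuousOn_extChartAt_symm y₀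
  set A' : Set (EuclideanSpace ℝ (Fin n)) := φ.target ∩ φ.symm ⁻¹' A with hA'
  have hA'm : MeasurableSet A' := by
    have h1 : Measurable (φ.target.domRestrict φ.symm) :=
      (continuousOn_iff_continuous_domRestrict.1 hsc).measurable
    have h2 : A' = Subtype.val '' (φ.target.domRestrict φ.symm ⁻¹' A) := by
      ext v
      constructor
      · exact fun hv => ⟨⟨v, hv.1⟩, hv.2, rfl⟩
      · rintro ⟨w, hw, rfl⟩; exact ⟨w.2, hw⟩
    rw [h2]
    exact (isOpen_extChartAt_target (I := 𝓡 n) y₀).measurableSet.subtype_image (h1 hA)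
  have himg : φ.symm '' A' = A := by
    ext y
    constructor
    · rintro ⟨v, hv, rfl⟩; exact hv.2
    · intro hy
      refine ⟨φ y, ⟨φ.map_source (hAs hy), ?_⟩, φ.left_inv (hAs hy)⟩
      rw [Set.mem_preimage, φ.left_inv (hAs hy)]; exact hy
  set U' : Set (EuclideanSpace ℝ (Fin n)) := φ.target ∩ φ.symm ⁻¹' U with hU'
  have hU'o : IsOpen U' := hsc.isOpen_inter_preimage (isOpen_extChartAt_target (I := 𝓡 n) y₀) hs.isOpen
  have hA'U' : A' ⊆ U' := fun v hv => ⟨hv.1, hAU hv.2⟩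
  have hjl := D.isLocalDiffeomorph_ι U s hs hpos
  have hφs : ContMDiffOn (𝓡 n) (𝓡 n) ∞ φ.symm U' :=
    (contMDiffOn_extChartAt_symm y₀).mono Set.inter_subset_left
  have hder : ∀ v ∈ U', mfderiv (𝓡 n) (𝓡 n) (j ∘ φ.symm) v =
      (mfderiv (𝓡 n) (𝓡 n) j (φ.symm v)).comp (mfderiv (𝓡 n) (𝓡 n) φ.symm v) := fun v hv =>
    mfderiv_comp v ((hjl ⟨φ.symm v, hv.2⟩).mdifferentiableAt (by simp))
      ((hφs.contMDiffAt (hU'o.mem_nhds hv)).mdifferentiableAt (by simp))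
  have h1 := hX U' (j ∘ φ.symm) hU'o (hjl.contMDiffOn.comp hφs fun v hv => hv.2)
    (fun v hv w hw h => by
      have h2 := (D.ι_inj (hs.mem _ hv.2) (hpos _ hv.2).le (hs.mem _ hw.2) (hpos _ hw.2).le h).2
      exact φ.symm.injOn hv.1 hw.1 h2)
    (fun v hv => by
      rw [hder v hv]
      have h2 : Function.Injective (mfderiv (𝓡 n) (𝓡 n) j (φ.symm v)) := by
        have h3 := ((hjl ⟨φ.symm v, hv.2⟩).mfderivToContinuousLinearEquiv (by simp)).injective
        have h4 := (hjl ⟨φ.symm v, hv.2⟩).mfderivToContinuousLinearEquiv_coe (by simp)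
        intro a b hab
        refine h3 ?_
        have h5 := DFunLike.congr_fun h4 a
        have h6 := DFunLike.congr_fun h4 b
        exact h5.trans (hab.trans h6.symm)
      exact h2.comp (injective_mfderiv_extChartAt_symm y₀ hv.1))
    A' hA'U' hA'm
  have h2 := hY.apply_extChartAt_symm_image y₀ (A := A') (fun v hv => hv.1) hA'm
  rw [himg] at h2
  rw [h2, ← himg, ← Set.image_comp]
  rw [h1]
  refine setLIntegral_congr_fun hA'm fun v hv => ?_
  simp only [gramDensity]
  congr 4
  ext i k
  rw [hder v (hA'U' hv)]
  exact hD.inner_mfderiv hs hpos (hA'U' hv).2 _ _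

/-- The segments of the end have the volume of `Y`. -/
theorem IsMetricLift.comap_segmentMap [IsManifold (𝓡 n) ∞ Y] (hD : D.IsMetricLift)
    {μX : Measure X} {μY : Measure Y} (hX : IsRiemannianVolume (n := n) μX)
    (hY : IsRiemannianVolume (n := n) μY) {m : ℕ} (hm : 1 ≤ m) :
    μX.comap (D.segmentMap m) = μY := by
  obtain ⟨S, U, s, hS, hU, hcov⟩ := exists_countable_lifts D.smooth_f₀
    (O := fun y => (extChartAt (𝓡 n) y).source) fun y => extChartAt_source_mem_nhds y
  have hScount : Countable S := hS.to_subtype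
  have hsc := measurable_segmentCoord D.continuous_f₀
  -- The section `segmentCoord` jumps, so `Y` is cut into countably many measurable pieces. On each
  -- of them the section coincides with a smooth lift shifted by an integer.
  set B : S × ℤ → Set Y := fun c =>
    {y | y ∈ U c.1 ∧ s c.1 y + c.2 = segmentCoord f₀ y + m} with hB
  have hBcov : ⋃ c, B c = Set.univ := by
    refine Set.eq_univ_of_forall fun y => ?_
    obtain ⟨y₀, hy₀, hy⟩ := hcov y
    obtain ⟨r, hr⟩ := exists_int_of_mem_cover (cover_add_nat (segmentCoord_mem_cover y) m)
      ((hU y₀).1.mem y hy)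
    exact Set.mem_iUnion.2 ⟨(⟨y₀, hy₀⟩, r), hy, hr.symm⟩
  rw [Measure.ext_iff_of_iUnion_eq_univ hBcov]
  rintro ⟨⟨y₀, hy₀⟩, r⟩
  have hl := (hU y₀).1.add_int r
  have hBm : MeasurableSet (B (⟨y₀, hy₀⟩, r)) := by
    have h1 : Measurable ((U y₀).domRestrict (fun y => s y₀ y + r)) :=
      (continuousOn_iff_continuous_domRestrict.1 hl.smooth.continuousOn).measurable
    have h2 : Measurable ((U y₀).domRestrict (fun y => segmentCoord f₀ y + m)) :=
      (hsc.add_const _).comp measurable_subtype_coe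
    have h3 : B (⟨y₀, hy₀⟩, r) = Subtype.val '' {y : U y₀ |
        (U y₀).domRestrict (fun y => s y₀ y + r) y =
        (U y₀).domRestrict (fun y => segmentCoord f₀ y + m) y} := by
      ext v
      constructor
      · exact fun hv => ⟨⟨v, hv.1⟩, hv.2, rfl⟩
      · rintro ⟨w, hw, rfl⟩; exact ⟨w.2, hw⟩
    rw [h3]
    exact hl.isOpen.measurableSet.subtype_image (measurableSet_eq_fun h1 h2)
  set V : Set Y := U y₀ ∩ (fun y => s y₀ y + r) ⁻¹' Set.Ioi 0 with hV
  have hVo : IsOpen V := hl.smooth.continuousOn.isOpen_inter_preimage hl.isOpen isOpen_Ioi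
  -- Here `1 ≤ m` is used: it keeps the pieces in the open end `f > 0`. The segment `W₀` would touch
  -- the boundary of the compact part.
  have hBV : B (⟨y₀, hy₀⟩, r) ⊆ V := by
    rintro y ⟨hy1, hy2⟩
    refine ⟨hy1, ?_⟩
    have h0 := segmentCoord_nonneg (f₀ := f₀) y
    have h1 : (1 : ℝ) ≤ m := by exact_mod_cast hm
    rw [Set.mem_preimage]
    simp only at hy2
    rw [hy2, Set.mem_Ioi]
    linarith
  refine Measure.ext fun A hA => ?_
  rw [Measure.restrict_apply hA, Measure.restrict_apply hA,
    (D.measurableEmbedding_segmentMap m).comap_apply]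
  have himg : D.segmentMap m '' (A ∩ B (⟨y₀, hy₀⟩, r)) =
      (fun y => D.ι (s y₀ y + r) y) '' (A ∩ B (⟨y₀, hy₀⟩, r)) := by
    refine Set.image_congr fun y hy => ?_
    rw [segmentMap, ← hy.2.2]
  rw [himg]
  exact hD.measure_image_lift hX hY (hl.mono hVo Set.inter_subset_left) (fun y hy => hy.2) y₀
    (hA.inter hBm) (Set.inter_subset_right.trans hBV)
    (fun y hy => (hU y₀).2 hy.2.1)

theorem IsMetricLift.map_segmentMap [IsManifold (𝓡 n) ∞ Y] (hD : D.IsMetricLift)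
    {μX : Measure X} {μY : Measure Y} (hX : IsRiemannianVolume (n := n) μX)
    (hY : IsRiemannianVolume (n := n) μY) {m : ℕ} (hm : 1 ≤ m) :
    μY.map (D.segmentMap m) = μX.restrict {x | D.level x = m} := by
  rw [← hD.comap_segmentMap hX hY hm, (D.measurableEmbedding_segmentMap m).map_comap]
  congr 1
  ext x
  constructor
  · rintro ⟨y, rfl⟩; exact D.level_segmentMap m y
  · rintro rfl; exact D.exists_segmentMap_eq hm

end PeriodicEnd

end EndVolume

/-! ### Sublevel sets of the end-periodic manifold -/

section CompactParts

open Manifold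

variable {n : ℕ} {X : Type*} [TopologicalSpace X] [ChartedSpace (EuclideanSpace ℝ (Fin n)) X]
  {Y : Type*} [TopologicalSpace Y] [ChartedSpace (EuclideanSpace ℝ (Fin n)) Y] {f₀ : Y → Circle}

namespace PeriodicEnd

variable (D : PeriodicEnd (𝓡 n) (𝓡 n) X f₀)

/-- Outside `Z`, level `0` lies over the compact set `[0, 1] × Y`. Together with local finiteness of
the volume this gives level `0` finite measure. -/
theorem exists_isCompact_level_zero [CompactSpace Y] :
    ∃ K : Set X, IsCompact K ∧ {x | D.level x = 0} ⊆ K := by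
  have h1 : IsCompact {x : Half f₀ | x.1.1 ≤ 1} := by
    have hcl : IsClosed {x : ℝ × Y | x ∈ cover f₀ ∧ 0 ≤ x.1} :=
      (isClosed_cover D.continuous_f₀).inter (isClosed_le continuous_const continuous_fst)
    refine hcl.isClosedEmbedding_subtypeVal.isCompact_preimage (K := Set.Icc (-1 : ℝ) 1 ×ˢ Set.univ)
      (isCompact_Icc.prod isCompact_univ) |>.of_isClosed_subset ?_ ?_
    · exact isClosed_le (continuous_fst.comp continuous_subtype_val) continuous_const
    · intro x hx
      exact ⟨⟨by have := x.2.2; linarith, hx⟩, trivial⟩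
  refine ⟨D.Z ∪ D.embed '' {x : Half f₀ | x.1.1 ≤ 1},
    D.isCompact_Z.union (h1.image D.isClosedEmbedding_embed.continuous), fun x hx => ?_⟩
  by_cases hZ : x ∈ D.Z
  · exact Or.inl hZ
  · obtain ⟨t, y, hc, ht, rfl⟩ := D.exists_ι_of_notMem hZ
    refine Or.inr ⟨⟨(t, y), hc, ht.le⟩, ?_, rfl⟩
    have h2 : ⌊t⌋₊ = 0 := by rw [← D.level_ι hc ht.le]; exact hx
    exact (Nat.floor_eq_zero.1 h2).le

/-- The compact part together with the segments up to the `N`-th one. -/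
theorem union_image_eq (N : ℕ) :
    D.Z ∪ (fun x : ℝ × Y => D.ι x.1 x.2) '' {x | x ∈ cover f₀ ∧ 0 ≤ x.1 ∧ x.1 < N + 1} =
      {x | D.level x ≤ N} := by
  have hfl : ∀ t : ℝ, 0 ≤ t → (t < N + 1 ↔ ⌊t⌋₊ ≤ N) := by
    intro t ht
    rw [← Nat.lt_succ_iff, Nat.floor_lt ht]
    push_cast
    rfl
  ext x
  constructor
  · rintro (hx | ⟨⟨t, y⟩, ⟨hc, ht, htN⟩, rfl⟩)
    · have : D.level x = 0 := by rw [level, D.endCoord_eq_zero_of_mem hx, Nat.floor_zero]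
      exact this.le.trans (Nat.zero_le N)
    · have h2 : D.level (D.ι t y) ≤ N := by
        rw [D.level_ι hc ht]
        exact (hfl t ht).1 htN
      exact h2
  · intro hx
    by_cases hZ : x ∈ D.Z
    · exact Or.inl hZ
    · obtain ⟨t, y, hc, ht, rfl⟩ := D.exists_ι_of_notMem hZ
      refine Or.inr ⟨(t, y), ⟨hc, ht.le, ?_⟩, rfl⟩
      have h2 : D.level (D.ι t y) ≤ N := hx
      rw [D.level_ι hc ht.le] at h2
      exact (hfl t ht.le).2 h2

end PeriodicEnd

end CompactParts

/-! ### Continuity of the operations on coefficients -/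

section Continuity

variable {W : Type*} [AddCommGroup W] [Module ℂ W] [FiniteDimensional ℂ W]
  {H : Type*} [NormedAddCommGroup H] [NormedSpace ℂ H]

/-- The coordinates of form-valued elements, as a linear isometry. -/
def Coeff.coordsₗᵢ (W : Type*) [AddCommGroup W] [Module ℂ W] [FiniteDimensional ℂ W]
    (H : Type*) [NormedAddCommGroup H] [NormedSpace ℂ H] :
    Coeff W H ≃ₗᵢ[ℂ] (FormIndex W → H) where
  toLinearEquiv := Coeff.coords W H
  norm_map' _ := rfl

/-- The coordinates of forms, as a linear isometry. -/
def Form.coordsₗᵢ (W : Type*) [AddCommGroup W] [Module ℂ W] [FiniteDimensional ℂ W] :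
    Form W ≃ₗᵢ[ℂ] (FormIndex W → ℂ) where
  toLinearEquiv := Form.coords W
  norm_map' _ := rfl

theorem Coeff.continuous_iff {Ω : Type*} [TopologicalSpace Ω] {f : Ω → Coeff W H} :
    Continuous f ↔ ∀ I, Continuous fun o => Coeff.coords W H (f o) I := by
  rw [← (Coeff.coordsₗᵢ W H).comp_continuous_iff, continuous_pi_iff]
  rfl

theorem Form.continuous_iff {Ω : Type*} [TopologicalSpace Ω] {f : Ω → Form W} :
    Continuous f ↔ ∀ I, Continuous fun o => Form.coords W (f o) I := by
  rw [← (Form.coordsₗᵢ W).comp_continuous_iff, continuous_pi_iff]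
  rfl

theorem Coeff.continuous_coords (I : FormIndex W) :
    Continuous fun k : Coeff W H => Coeff.coords W H k I :=
  Coeff.continuous_iff.1 continuous_id I

theorem Coeff.stronglyMeasurable_iff {Ω : Type*} [MeasurableSpace Ω] {f : Ω → Coeff W H} :
    StronglyMeasurable f ↔ ∀ I, StronglyMeasurable fun o => Coeff.coords W H (f o) I := by
  refine ⟨fun h I => (Coeff.continuous_coords I).comp_stronglyMeasurable h, fun h => ?_⟩
  have h1 : f = fun o => ∑ I, (Coeff.coordsₗᵢ W H).symm
      (Pi.single I (Coeff.coords W H (f o) I)) := by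
    funext o
    rw [← map_sum, Finset.univ_sum_single]
    exact ((Coeff.coordsₗᵢ W H).symm_apply_apply (f o)).symm
  rw [h1]
  refine Finset.stronglyMeasurable_fun_sum _ fun I _ => ?_
  have h2 : Continuous fun a : H => (Coeff.coordsₗᵢ W H).symm (Pi.single I a) :=
    (Coeff.coordsₗᵢ W H).symm.continuous.comp (ContinuousLinearMap.single ℂ (fun _ : FormIndex W => H) I).continuous
  exact h2.comp_stronglyMeasurable (h I)

variable {F₀ F₁ F₂ F₃ : Type*} [NormedAddCommGroup F₀] [NormedSpace ℂ F₀]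
  [NormedAddCommGroup F₁] [NormedSpace ℂ F₁]
  [NormedAddCommGroup F₂] [NormedSpace ℂ F₂] [NormedAddCommGroup F₃] [NormedSpace ℂ F₃]
  {Ω : Type*} [TopologicalSpace Ω]

theorem Continuous.coeff_sandwich {T' : Ω → F₂ →L[ℂ] F₃} {T : Ω → F₀ →L[ℂ] F₁}
    {k : Ω → Coeff W (F₁ →L[ℂ] F₂)} (hT' : Continuous T') (hT : Continuous T) (hk : Continuous k) :
    Continuous fun o => sandwich (T' o) (T o) (k o) := by
  refine Coeff.continuous_iff.2 fun I => ?_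
  simp only [Coeff.coords_sandwich]
  exact hT'.clm_comp ((Coeff.continuous_iff.1 hk I).clm_comp hT)

theorem Continuous.coeff_plainComp {k : Ω → Coeff W (F₂ →L[ℂ] F₃)}
    {l : Ω → Coeff W (F₁ →L[ℂ] F₂)} (hk : Continuous k) (hl : Continuous l) :
    Continuous fun o => plainComp (k o) (l o) := by
  refine Coeff.continuous_iff.2 fun I => ?_
  simp only [Coeff.coords_plainComp]
  exact continuous_finsetSum _ fun J _ => continuous_finsetSum _ fun J' _ =>
    (continuous_const_smul _).comp ((Coeff.continuous_iff.1 hk J).clm_comp (Coeff.continuous_iff.1 hl J'))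

theorem Continuous.coeff_gradedComp {τ₂ : Ω → F₂ →L[ℂ] F₂} {τ₃ : Ω → F₃ →L[ℂ] F₃}
    {k : Ω → Coeff W (F₂ →L[ℂ] F₃)} {l : Ω → Coeff W (F₁ →L[ℂ] F₂)} (h₂ : Continuous τ₂)
    (h₃ : Continuous τ₃) (hk : Continuous k) (hl : Continuous l) :
    Continuous fun o => gradedComp (τ₂ o) (τ₃ o) (k o) (l o) := by
  have hs : Continuous fun o => sandwich (τ₃ o) (τ₂ o) (k o) := Continuous.coeff_sandwich h₃ h₂ hk
  have hl' : Continuous fun o => formInvol (l o) :=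
    (formInvolL (W := W) (H := F₁ →L[ℂ] F₂)).continuous.comp hl
  have h1 : Continuous fun o => (1 / 2 : ℂ) • (k o + sandwich (τ₃ o) (τ₂ o) (k o)) :=
    (continuous_const_smul _).comp (hk.add hs)
  have h2 : Continuous fun o => (1 / 2 : ℂ) • (k o - sandwich (τ₃ o) (τ₂ o) (k o)) :=
    (continuous_const_smul _).comp (hk.sub hs)
  exact (Continuous.coeff_plainComp h1 hl).add (Continuous.coeff_plainComp h2 hl')

theorem Continuous.coeff_str [FiniteDimensional ℂ F₁] {τ : Ω → F₁ →L[ℂ] F₁}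
    {k : Ω → Coeff W (F₁ →L[ℂ] F₁)} (hτ : Continuous τ) (hk : Continuous k) :
    Continuous fun o => str (τ o) (k o) := by
  refine Form.continuous_iff.2 fun I => ?_
  simp only [Form.coords_str]
  let tr : (F₁ →L[ℂ] F₁) →ₗ[ℂ] ℂ :=
    { toFun := fun A => LinearMap.trace ℂ F₁ A.toLinearMap
      map_add' := fun A A' => by simp
      map_smul' := fun c A => by simp }
  have htr : Continuous tr := tr.continuous_of_finiteDimensional
  exact htr.comp (hτ.clm_comp (Coeff.continuous_iff.1 hk I))

end Continuity

/-! ### Measurability of families of homomorphisms read in frames -/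

section MeasurableFrames

variable {W : Type*} [AddCommGroup W] [Module ℂ W] [FiniteDimensional ℂ W]
  {F₁ F₂ F₃ : Type*} [NormedAddCommGroup F₁] [NormedSpace ℂ F₁] [FiniteDimensional ℂ F₁]
  [NormedAddCommGroup F₂] [NormedSpace ℂ F₂] [FiniteDimensional ℂ F₂]
  [NormedAddCommGroup F₃] [NormedSpace ℂ F₃] [FiniteDimensional ℂ F₃]
  {Ω : Type*} {V₁ V₂ V₃ : Ω → Type*}
  [∀ o, NormedAddCommGroup (V₁ o)] [∀ o, NormedSpace ℂ (V₁ o)]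
  [∀ o, NormedAddCommGroup (V₂ o)] [∀ o, NormedSpace ℂ (V₂ o)]
  [∀ o, NormedAddCommGroup (V₃ o)] [∀ o, NormedSpace ℂ (V₃ o)]
  [MeasurableSpace Ω]

/-- A family of form-valued homomorphisms is measurable when read in frames `T₁`, `T₂` of the
spaces between which it acts. -/
def MeasurableIn (T₁ : ∀ o, V₁ o ≃L[ℂ] F₁) (T₂ : ∀ o, V₂ o ≃L[ℂ] F₂)
    (k : ∀ o, Coeff W (V₁ o →L[ℂ] V₂ o)) : Prop :=
  StronglyMeasurable fun o => sandwich (T₂ o : V₂ o →L[ℂ] F₂) ((T₁ o).symm : F₁ →L[ℂ] V₁ o) (k o)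

/-- A family of endomorphisms is measurable when read in a frame `T`. -/
def MeasurableEndIn (T₁ : ∀ o, V₁ o ≃L[ℂ] F₁) (τ : ∀ o, V₁ o →L[ℂ] V₁ o) : Prop :=
  StronglyMeasurable fun o => (T₁ o : V₁ o →L[ℂ] F₁) ∘L τ o ∘L ((T₁ o).symm : F₁ →L[ℂ] V₁ o)

variable {T₁ : ∀ o, V₁ o ≃L[ℂ] F₁} {T₂ : ∀ o, V₂ o ≃L[ℂ] F₂} {T₃ : ∀ o, V₃ o ≃L[ℂ] F₃}

theorem MeasurableIn.gradedComp {τ₂ : ∀ o, V₂ o →L[ℂ] V₂ o} {τ₃ : ∀ o, V₃ o →L[ℂ] V₃ o}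
    (h₂ : MeasurableEndIn T₂ τ₂) (h₃ : MeasurableEndIn T₃ τ₃)
    {k : ∀ o, Coeff W (V₂ o →L[ℂ] V₃ o)} {l : ∀ o, Coeff W (V₁ o →L[ℂ] V₂ o)}
    (hk : MeasurableIn T₂ T₃ k) (hl : MeasurableIn T₁ T₂ l) :
    MeasurableIn T₁ T₃ fun o => EndPeriodic.gradedComp (τ₂ o) (τ₃ o) (k o) (l o) := by
  have h := (Continuous.coeff_gradedComp (W := W)
    (Ω := (F₂ →L[ℂ] F₂) × (F₃ →L[ℂ] F₃) × Coeff W (F₂ →L[ℂ] F₃) × Coeff W (F₁ →L[ℂ] F₂))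
    continuous_fst (continuous_fst.comp continuous_snd)
    (continuous_fst.comp (continuous_snd.comp continuous_snd))
    (continuous_snd.comp (continuous_snd.comp continuous_snd))).comp_stronglyMeasurable
    (h₂.prodMk (h₃.prodMk (hk.prodMk hl)))
  refine Eq.mp (congrArg StronglyMeasurable (funext fun o => ?_)) h
  simp only [Function.comp_apply]
  rw [sandwich_gradedComp (T₃ o : V₃ o →L[ℂ] F₃) ((T₁ o).symm : F₁ →L[ℂ] V₁ o)
    ((T₂ o).symm : F₂ →L[ℂ] V₂ o) (T₂ o : V₂ o →L[ℂ] F₂)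
    (τ₅ := (T₂ o : V₂ o →L[ℂ] F₂) ∘L τ₂ o ∘L ((T₂ o).symm : F₂ →L[ℂ] V₂ o))
    (τ₄ := (T₃ o : V₃ o →L[ℂ] F₃) ∘L τ₃ o ∘L ((T₃ o).symm : F₃ →L[ℂ] V₃ o))]
  · ext v; simp
  · ext v; simp
  · ext v; simp

theorem MeasurableIn.str {τ : ∀ o, V₁ o →L[ℂ] V₁ o} (hτ : MeasurableEndIn T₁ τ)
    {k : ∀ o, Coeff W (V₁ o →L[ℂ] V₁ o)} (hk : MeasurableIn T₁ T₁ k) :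
    StronglyMeasurable fun o => EndPeriodic.str (τ o) (k o) := by
  have h := (Continuous.coeff_str (W := W)
    (Ω := (F₁ →L[ℂ] F₁) × Coeff W (F₁ →L[ℂ] F₁))
    continuous_fst continuous_snd).comp_stronglyMeasurable (hτ.prodMk hk)
  refine Eq.mp (congrArg StronglyMeasurable (funext fun o => ?_)) h
  have : FiniteDimensional ℂ (V₁ o) := (T₁ o).symm.toLinearEquiv.finiteDimensional
  rw [str_sandwich (τ₁ := τ o) ((T₁ o).symm : F₁ →L[ℂ] V₁ o) (T₁ o : V₁ o →L[ℂ] F₁)]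
  · ext v; simp
  · ext v; simp

theorem MeasurableIn.stronglyMeasurable {V V' : Type*} [NormedAddCommGroup V] [NormedSpace ℂ V]
    [NormedAddCommGroup V'] [NormedSpace ℂ V'] {T : V ≃L[ℂ] F₁} {T' : V' ≃L[ℂ] F₂}
    {k : Ω → Coeff W (V →L[ℂ] V')} (hk : MeasurableIn (fun _ => T) (fun _ => T') k) :
    StronglyMeasurable k := by
  have h := (sandwichL (W := W) (T'.symm : F₂ →L[ℂ] V') (T : V →L[ℂ] F₁)).continuous.comp_stronglyMeasurable hk
  refine Eq.mp (congrArg StronglyMeasurable (funext fun o => ?_)) h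
  simp only [sandwichL_apply, sandwich_sandwich]
  convert sandwich_id (k o) using 2
  all_goals
    ext
    simp

theorem MeasurableIn.comp {Ω' : Type*} [MeasurableSpace Ω'] {g : Ω' → Ω} (hg : Measurable g)
    {k : ∀ o, Coeff W (V₁ o →L[ℂ] V₂ o)} (hk : MeasurableIn T₁ T₂ k) :
    MeasurableIn (fun o => T₁ (g o)) (fun o => T₂ (g o)) fun o => k (g o) :=
  StronglyMeasurable.comp_measurable hk hg

theorem MeasurableEndIn.comp {Ω' : Type*} [MeasurableSpace Ω'] {g : Ω' → Ω} (hg : Measurable g)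
    {τ : ∀ o, V₁ o →L[ℂ] V₁ o} (hτ : MeasurableEndIn T₁ τ) :
    MeasurableEndIn (fun o => T₁ (g o)) fun o => τ (g o) :=
  StronglyMeasurable.comp_measurable hτ hg

theorem stronglyMeasurable_clm_of_apply {A : Ω → F₁ →L[ℂ] F₂}
    (h : ∀ (φ : F₂ →L[ℂ] ℂ) (v : F₁), Measurable fun o => φ (A o v)) : StronglyMeasurable A := by
  let b₁ := Module.finBasis ℂ F₁
  let b₂ := Module.finBasis ℂ F₂
  have h1 : A = fun o => ∑ i, ∑ j, LinearMap.toContinuousLinearMap (b₂.coord j) (A o (b₁ i)) •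
      (LinearMap.toContinuousLinearMap (b₁.coord i)).smulRight (b₂ j) := by
    funext o
    refine ContinuousLinearMap.coe_injective (b₁.ext fun i => ?_)
    simp [Finsupp.single_apply, ite_smul]
  rw [h1]
  exact Finset.stronglyMeasurable_fun_sum _ fun i _ => Finset.stronglyMeasurable_fun_sum _ fun j _ =>
    (h _ _).stronglyMeasurable.smul_const _

/-- Coordinates with respect to the basis of forms are components, and a family of linear maps
between finite-dimensional spaces is measurable once its matrix entries are. The hypotheses on
kernels speak about exactly such scalar entries. -/
theorem measurableIn_of_component {k : ∀ o, Coeff W (V₁ o →L[ℂ] V₂ o)}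
    (h : ∀ (ℓ : Form W →ₗ[ℂ] ℂ) (φ : F₂ →L[ℂ] ℂ) (v : F₁),
      Measurable fun o => φ (T₂ o (component ℓ (k o) ((T₁ o).symm v)))) :
    MeasurableIn T₁ T₂ k := by
  refine Coeff.stronglyMeasurable_iff.2 fun I => stronglyMeasurable_clm_of_apply fun φ v => ?_
  simp only [Coeff.coords_sandwich]
  simp only [Coeff.coords_eq_component]
  exact h _ φ v

/-- A function that is continuous on pieces of a countable cover is measurable. -/
theorem measurable_of_countable_cover {Ω' β : Type*} [TopologicalSpace Ω'] [MeasurableSpace Ω']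
    [OpensMeasurableSpace Ω'] [TopologicalSpace β] [MeasurableSpace β] [BorelSpace β]
    {ι : Type*} [Countable ι] {f : Ω' → β} (A O : ι → Set Ω') (g : ι → Ω' → β)
    (hA : ∀ i, MeasurableSet (A i)) (hO : ∀ i, IsOpen (O i)) (hAO : ∀ i, A i ⊆ O i)
    (hg : ∀ i, ContinuousOn (g i) (O i)) (hfg : ∀ i, ∀ o ∈ A i, f o = g i o)
    (hcov : ∀ o, ∃ i, o ∈ A i) : Measurable f := by
  refine measurable_of_isOpen fun B hB => ?_
  have h : f ⁻¹' B = ⋃ i, A i ∩ (O i ∩ g i ⁻¹' B) := by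
    ext o
    simp only [Set.mem_preimage, Set.mem_iUnion, Set.mem_inter_iff]
    constructor
    · intro ho
      obtain ⟨i, hi⟩ := hcov o
      exact ⟨i, hi, hAO i hi, by rwa [← hfg i o hi]⟩
    · rintro ⟨i, hi, -, h⟩
      rwa [hfg i o hi]
  rw [h]
  exact MeasurableSet.iUnion fun i =>
    (hA i).inter ((hg i).isOpen_inter_preimage (hO i) hB).measurableSet

end MeasurableFrames

/-! ### Piecewise constant measurable choices of trivializations -/

section FrameField

variable {B : Type*} [TopologicalSpace B] (F : Type*) [NormedAddCommGroup F] [NormedSpace ℂ F]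
  (E : B → Type*) [∀ x, NormedAddCommGroup (E x)] [∀ x, NormedSpace ℂ (E x)]
  [TopologicalSpace (TotalSpace F E)] [FiberBundle F E] [VectorBundle ℂ F E]
  {X : Type*} [TopologicalSpace X] [SecondCountableTopology X] [MeasurableSpace X] [BorelSpace X]

/-- A choice of trivializations of `E` near the points `j x`, which is piecewise constant on a
countable measurable partition. -/
structure FrameField (j : X → B) where
  center : X → B
  countable : (Set.range center).Countable
  measurableSet : ∀ b, MeasurableSet (center ⁻¹' {b})
  mem : ∀ x, j x ∈ (trivializationAt F E (center x)).baseSet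

/-- By second countability, countably many trivializing neighbourhoods cover `X`. Choosing the one
with the least index that contains a given point makes the choice measurable. -/
theorem exists_frameField {j : X → B} (hj : Continuous j) : Nonempty (FrameField F E j) := by
  have hO : ∀ x, j ⁻¹' (trivializationAt F E (j x)).baseSet ∈ 𝓝 x := fun x =>
    (((trivializationAt F E (j x)).open_baseSet.preimage hj)).mem_nhds
      (FiberBundle.mem_baseSet_trivializationAt' (j x))
  obtain ⟨S, hS, hcov⟩ := TopologicalSpace.countable_cover_nhds hO
  rcases isEmpty_or_nonempty X with hX | ⟨⟨x₀⟩⟩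
  · exact ⟨⟨j, Set.countable_range j, fun b => by
      rw [Set.eq_empty_of_isEmpty (j ⁻¹' {b})]; exact MeasurableSet.empty, fun x => hX.elim x⟩⟩
  have hne : S.Nonempty := by
    have : x₀ ∈ ⋃ x ∈ S, j ⁻¹' (trivializationAt F E (j x)).baseSet := hcov ▸ Set.mem_univ _
    simp only [Set.mem_iUnion] at this
    obtain ⟨x, hx, -⟩ := this
    exact ⟨x, hx⟩
  obtain ⟨g, hg⟩ := hS.exists_eq_range hne
  have hex : ∀ x, ∃ i, j x ∈ (trivializationAt F E (j (g i))).baseSet := by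
    intro x
    have : x ∈ ⋃ x ∈ S, j ⁻¹' (trivializationAt F E (j x)).baseSet := hcov ▸ Set.mem_univ _
    simp only [Set.mem_iUnion] at this
    obtain ⟨x', hx', h⟩ := this
    rw [hg] at hx'
    obtain ⟨i, rfl⟩ := hx'
    exact ⟨i, h⟩
  classical
  have hmeas : Measurable fun x => Nat.find (hex x) := by
    refine measurable_find hex fun i => ?_
    exact ((trivializationAt F E (j (g i))).open_baseSet.preimage hj).measurableSet
  refine ⟨⟨fun x => j (g (Nat.find (hex x))), ?_, fun b => ?_, fun x => Nat.find_spec (hex x)⟩⟩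
  · refine (Set.countable_range fun i => j (g i)).mono ?_
    rintro _ ⟨x, rfl⟩
    exact ⟨_, rfl⟩
  · exact hmeas (MeasurableSet.of_discrete (s := {i | j (g i) = b}))

variable {F E} {j : X → B}

/-- The frames of a frame field. -/
def FrameField.frame (𝓣 : FrameField F E j) (x : X) : E (j x) ≃L[ℂ] F :=
  (trivializationAt F E (𝓣.center x)).continuousLinearEquivAt ℂ (j x) (𝓣.mem x)

theorem FrameField.frame_apply (𝓣 : FrameField F E j) (x : X) (v : E (j x)) :
    𝓣.frame x v = (trivializationAt F E (𝓣.center x)).continuousLinearMapAt ℂ (j x) v :=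
  congrFun (Trivialization.coe_continuousLinearEquivAt_eq _ (𝓣.mem x)) v

theorem FrameField.frame_symm_apply (𝓣 : FrameField F E j) (x : X) (v : F) :
    (𝓣.frame x).symm v = (trivializationAt F E (𝓣.center x)).symmL ℂ (j x) v :=
  congrFun (Trivialization.symm_continuousLinearEquivAt_eq _ (𝓣.mem x)) v

/-- A function of a point and of the trivialization at this point is measurable, if it is piecewise
continuous for fixed trivializations. -/
theorem FrameField.measurable {β : Type*} [TopologicalSpace β] [MeasurableSpace β] [BorelSpace β]
    (hj : Continuous j) (𝓣 : FrameField F E j) {f : X → β} {ι : Type*} [Countable ι]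
    (A O : ι → Set X) (g : ι → B → X → β) (hA : ∀ i, MeasurableSet (A i)) (hO : ∀ i, IsOpen (O i))
    (hAO : ∀ i, A i ⊆ O i) (hcov : ∀ x, ∃ i, x ∈ A i)
    (hg : ∀ i b, ContinuousOn (g i b) {x | x ∈ O i ∧ j x ∈ (trivializationAt F E b).baseSet})
    (hfg : ∀ i, ∀ x ∈ A i, f x = g i (𝓣.center x) x) : Measurable f := by
  have := 𝓣.countable.to_subtype
  refine measurable_of_countable_cover (ι := ι × Set.range 𝓣.center)
    (fun i => {x | x ∈ A i.1 ∧ x ∈ 𝓣.center ⁻¹' {i.2.1}})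
    (fun i => {x | x ∈ O i.1 ∧ j x ∈ (trivializationAt F E i.2.1).baseSet})
    (fun i => g i.1 i.2.1)
    (fun i => (hA i.1).inter (𝓣.measurableSet _))
    (fun i => (hO i.1).inter ((trivializationAt F E i.2.1).open_baseSet.preimage hj))
    ?_ (fun i => hg _ _) ?_ ?_
  · rintro ⟨i, b⟩ x ⟨hx, hb⟩
    exact ⟨hAO i hx, (show 𝓣.center x = b.1 from hb) ▸ 𝓣.mem x⟩
  · rintro ⟨i, b⟩ x ⟨hx, hb⟩
    rw [hfg i x hx, show 𝓣.center x = b.1 from hb]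
  · intro x
    obtain ⟨i, hi⟩ := hcov x
    exact ⟨(i, ⟨_, x, rfl⟩), hi, rfl⟩

/-- The same for a pair of points. -/
theorem FrameField.measurable₂ {β : Type*} [TopologicalSpace β] [MeasurableSpace β] [BorelSpace β]
    (hj : Continuous j) (𝓣 : FrameField F E j) {f : X × X → β} {ι : Type*} [Countable ι]
    (A O : ι → Set (X × X)) (g : ι → B → B → X × X → β) (hA : ∀ i, MeasurableSet (A i))
    (hO : ∀ i, IsOpen (O i)) (hAO : ∀ i, A i ⊆ O i) (hcov : ∀ x, ∃ i, x ∈ A i)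
    (hg : ∀ i b b', ContinuousOn (g i b b') {x | x ∈ O i ∧
      j x.1 ∈ (trivializationAt F E b).baseSet ∧ j x.2 ∈ (trivializationAt F E b').baseSet})
    (hfg : ∀ i, ∀ x ∈ A i, f x = g i (𝓣.center x.1) (𝓣.center x.2) x) : Measurable f := by
  have := 𝓣.countable.to_subtype
  refine measurable_of_countable_cover (ι := ι × Set.range 𝓣.center × Set.range 𝓣.center)
    (fun i => {x | x ∈ A i.1 ∧ x ∈ Prod.fst ⁻¹' (𝓣.center ⁻¹' {i.2.1.1}) ∧
      x ∈ Prod.snd ⁻¹' (𝓣.center ⁻¹' {i.2.2.1})})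
    (fun i => {x | x ∈ O i.1 ∧ j x.1 ∈ (trivializationAt F E i.2.1.1).baseSet ∧
      j x.2 ∈ (trivializationAt F E i.2.2.1).baseSet})
    (fun i => g i.1 i.2.1.1 i.2.2.1)
    (fun i => (hA i.1).inter ((measurable_fst (𝓣.measurableSet _)).inter
      (measurable_snd (𝓣.measurableSet _))))
    (fun i => (hO i.1).inter
      (((trivializationAt F E i.2.1.1).open_baseSet.preimage (hj.comp continuous_fst)).inter
        ((trivializationAt F E i.2.2.1).open_baseSet.preimage (hj.comp continuous_snd))))
    ?_ (fun i => hg _ _ _) ?_ ?_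
  · rintro ⟨i, b, b'⟩ x ⟨hx, hb, hb'⟩
    exact ⟨hAO i hx, (show 𝓣.center x.1 = b.1 from hb) ▸ 𝓣.mem x.1,
      (show 𝓣.center x.2 = b'.1 from hb') ▸ 𝓣.mem x.2⟩
  · rintro ⟨i, b, b'⟩ x ⟨hx, hb, hb'⟩
    rw [hfg i x hx, show 𝓣.center x.1 = b.1 from hb, show 𝓣.center x.2 = b'.1 from hb']
  · intro x
    obtain ⟨i, hi⟩ := hcov x
    exact ⟨(i, ⟨_, x.1, rfl⟩, ⟨_, x.2, rfl⟩), hi, rfl, rfl⟩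

end FrameField

/-- In a local trivialization of the total space the inclusion of the fibre is `x ↦ (z, d x)` with a
diffeomorphism `d`. -/
theorem IsSmoothFiberBundle.continuous_mk {EB : Type*} [NormedAddCommGroup EB] [NormedSpace ℝ EB]
    {B : Type*} [TopologicalSpace B] [ChartedSpace EB B] {n : ℕ}
    {FM : Type*} [TopologicalSpace FM] [ChartedSpace (EuclideanSpace ℝ (Fin n)) FM]
    {M : B → Type*} [∀ z, TopologicalSpace (M z)]
    [∀ z, ChartedSpace (EuclideanSpace ℝ (Fin n)) (M z)]
    [TopologicalSpace (TotalSpace FM M)]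
    [ChartedSpace (ModelProd EB (EuclideanSpace ℝ (Fin n))) (TotalSpace FM M)]
    (h : IsSmoothFiberBundle (EB := EB) n FM M) (z : B) :
    Continuous fun x : M z => (⟨z, x⟩ : TotalSpace FM M) := by
  obtain ⟨e, hz, -, -, hd⟩ := h z
  obtain ⟨d, hd⟩ := hd z hz
  have h1 : (fun x : M z => (⟨z, x⟩ : TotalSpace FM M)) =
      fun x => e.toOpenPartialHomeomorph.symm (z, d x) := by
    funext x
    have hx : (⟨z, x⟩ : TotalSpace FM M) ∈ e.source := e.mem_source.2 hz
    have h2 : e ⟨z, x⟩ = (z, d x) := Prod.ext (e.coe_fst hx) (hd x).symm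
    rw [← h2]
    exact (e.toOpenPartialHomeomorph.left_inv hx).symm
  rw [h1]
  refine e.toOpenPartialHomeomorph.continuousOn_symm.comp_continuous
    (continuous_const.prodMk d.continuous) fun x => ?_
  exact e.mem_target.2 hz

/-! ### Measurability of gradings, kernels and sections; bounds for sections -/

section Measurability

variable {EX HX : Type*} [NormedAddCommGroup EX] [NormedSpace ℝ EX] [TopologicalSpace HX]
  {IX : ModelWithCorners ℝ EX HX} {B : Type*} [TopologicalSpace B] [ChartedSpace HX B]
  {F : Type*} [NormedAddCommGroup F] [NormedSpace ℂ F] [FiniteDimensional ℂ F]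
  {E : B → Type*} [∀ x, NormedAddCommGroup (E x)] [∀ x, InnerProductSpace ℂ (E x)]
  [TopologicalSpace (TotalSpace F E)] [FiberBundle F E] [VectorBundle ℂ F E]
  {X : Type*} [TopologicalSpace X] [SecondCountableTopology X] [MeasurableSpace X] [BorelSpace X]
  {j : X → B} (𝓣 : FrameField F E j)
  {W : Type*} [AddCommGroup W] [Module ℂ W] [FiniteDimensional ℂ W]

theorem SuperBundle.measurableEndIn (hj : Continuous j) (S : SuperBundle IX F E) :
    MeasurableEndIn 𝓣.frame fun x => S.τ (j x) := by
  refine stronglyMeasurable_clm_of_apply fun φ v => ?_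
  refine 𝓣.measurable hj (ι := Unit) (fun _ => Set.univ) (fun _ => Set.univ)
    (fun _ b x => φ ((trivializationAt F E b).continuousLinearMapAt ℂ (j x)
      (S.τ (j x) ((trivializationAt F E b).symmL ℂ (j x) v))))
    (fun _ => MeasurableSet.univ) (fun _ => isOpen_univ) (fun _ => subset_rfl)
    (fun _ => ⟨(), trivial⟩) (fun _ b => ?_) ?_
  · have h := (S.smooth_τ (trivializationAt F E b) v).continuousOn
    exact φ.continuous.comp_continuousOn (h.comp hj.continuousOn fun x hx => hx.2)
  · rintro - x -
    simp only [ContinuousLinearMap.comp_apply, ContinuousLinearEquiv.coe_coe,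
      FrameField.frame_apply, FrameField.frame_symm_apply]

theorem FrameField.measurableIn_kernel (hj : Continuous j) {K : Kernel W fun x => E (j x)}
    (hK : ∀ (b b' : B) (ℓ : Form W →ₗ[ℂ] ℂ) (φ : F →L[ℂ] ℂ) (v : F),
      ContinuousOn (fun q : X × X => entry (trivializationAt F E b) (trivializationAt F E b')
        ℓ φ v (j q.1) (j q.2) (K q.1 q.2))
        {q | j q.1 ∈ (trivializationAt F E b).baseSet ∧
          j q.2 ∈ (trivializationAt F E b').baseSet}) :
    MeasurableIn (fun q : X × X => 𝓣.frame q.2) (fun q => 𝓣.frame q.1) fun q => K q.1 q.2 := by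
  refine measurableIn_of_component fun ℓ φ v => ?_
  refine 𝓣.measurable₂ hj (ι := Unit) (fun _ => Set.univ) (fun _ => Set.univ)
    (fun _ b b' q => entry (trivializationAt F E b) (trivializationAt F E b')
        ℓ φ v (j q.1) (j q.2) (K q.1 q.2))
    (fun _ => MeasurableSet.univ) (fun _ => isOpen_univ) (fun _ => subset_rfl)
    (fun _ => ⟨(), trivial⟩) (fun _ b b' => ?_) ?_
  · exact (hK b b' ℓ φ v).mono fun x hx => hx.2
  · rintro - x -
    simp only [FrameField.frame_apply, FrameField.frame_symm_apply, entry]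

variable {n : ℕ} [ChartedSpace (EuclideanSpace ℝ (Fin n)) X] {f₀ : X → Circle}

theorem exists_eq_add_int_of_isLift {U : Set X} {s : X → ℝ} (h : IsLift (𝓡 n) f₀ U s) {x : X}
    (hx : x ∈ U) (m : ℤ) : ∃ r : ℤ, segmentCoord f₀ x + m = s x + r := by
  obtain ⟨r, hr⟩ := exists_int_of_mem_cover (segmentPoint_mem_cover m x) (h.mem x hx)
  exact ⟨r, hr⟩

theorem IsLift.measurableSet_eq_add {U : Set X} {s : X → ℝ} (h : IsLift (𝓡 n) f₀ U s)
    (hf : Continuous f₀) (m r : ℤ) :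
    MeasurableSet {x | x ∈ U ∧ segmentCoord f₀ x + m = s x + r} := by
  have hm : Measurable fun x : U => s x := h.smooth.continuousOn.domRestrict.measurable
  have h1 : MeasurableSet {x : U | segmentCoord f₀ x.1 + m = s x + r} :=
    measurableSet_eq_fun (((measurable_segmentCoord hf).comp measurable_subtype_coe).add_const _)
      (hm.add_const _)
  have h2 := h.isOpen.measurableSet.subtype_image h1
  convert h2 using 1
  ext x
  simp [and_comm]

/-- Regularity of the normal kernel is given along smooth lifts only, while the points of a segment
jump. On the countably many pieces where a segment coincides with shifted lifts in both variables,
the entries are continuous. -/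
theorem FrameField.measurableIn_kernel_cover (hj : Continuous j) (hf : ContMDiff (𝓡 n) (𝓡 1) ∞ f₀)
    {K : Kernel W fun x : ℝ × X => E (j x.2)}
    (hK : ∀ (b b' : B) (ℓ : Form W →ₗ[ℂ] ℂ) (φ : F →L[ℂ] ℂ) (v : F) (U U' : Set X) (s s' : X → ℝ),
      IsLift (𝓡 n) f₀ U s → IsLift (𝓡 n) f₀ U' s' →
      ContinuousOn (fun q : X × X => entry (trivializationAt F E b) (trivializationAt F E b')
        ℓ φ v (j q.1) (j q.2) (K (s q.1, q.1) (s' q.2, q.2)))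
        {q | q.1 ∈ U ∧ q.2 ∈ U' ∧ j q.1 ∈ (trivializationAt F E b).baseSet ∧
          j q.2 ∈ (trivializationAt F E b').baseSet}) (m k : ℤ) :
    MeasurableIn (fun q : X × X => 𝓣.frame q.2) (fun q => 𝓣.frame q.1)
      fun q => K (segmentPoint f₀ m q.1) (segmentPoint f₀ k q.2) := by
  obtain ⟨C, U, s, hC, hU, hcov⟩ := exists_countable_lifts hf (O := fun _ => Set.univ)
    fun _ => univ_mem
  have := hC.to_subtype
  have hpiece := fun y m r => (hU y).1.measurableSet_eq_add hf.continuous m r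
  refine measurableIn_of_component fun ℓ φ v => ?_
  refine 𝓣.measurable₂ hj (ι := (C × ℤ) × (C × ℤ))
    (fun i => {q | q ∈ Prod.fst ⁻¹' {x | x ∈ U i.1.1 ∧ segmentCoord f₀ x + m = s i.1.1 x + i.1.2} ∧
      q ∈ Prod.snd ⁻¹' {x | x ∈ U i.2.1 ∧ segmentCoord f₀ x + k = s i.2.1 x + i.2.2}})
    (fun i => {q | q ∈ Prod.fst ⁻¹' U i.1.1 ∧ q ∈ Prod.snd ⁻¹' U i.2.1})
    (fun i b b' q => entry (trivializationAt F E b) (trivializationAt F E b')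
        ℓ φ v (j q.1) (j q.2) (K (s i.1.1 q.1 + i.1.2, q.1) (s i.2.1 q.2 + i.2.2, q.2)))
    (fun i => (measurable_fst (hpiece _ _ _)).inter (measurable_snd (hpiece _ _ _)))
    (fun i => ((hU i.1.1).1.isOpen.preimage continuous_fst).inter
      ((hU i.2.1).1.isOpen.preimage continuous_snd)) (fun i q hq => ⟨hq.1.1, hq.2.1⟩)
    (fun q => ?_) (fun i b b' => ?_) ?_
  · obtain ⟨y, hy, hq⟩ := hcov q.1
    obtain ⟨y', hy', hq'⟩ := hcov q.2
    obtain ⟨r, hr⟩ := exists_eq_add_int_of_isLift (hU y).1 hq m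
    obtain ⟨r', hr'⟩ := exists_eq_add_int_of_isLift (hU y').1 hq' k
    exact ⟨((⟨y, hy⟩, r), (⟨y', hy'⟩, r')), ⟨hq, hr⟩, ⟨hq', hr'⟩⟩
  · refine (hK b b' ℓ φ v _ _ _ _ ((hU i.1.1).1.add_int i.1.2)
      ((hU i.2.1).1.add_int i.2.2)).mono fun q hq => ⟨hq.1.1, hq.1.2, hq.2.1, hq.2.2⟩
  · rintro i q ⟨⟨-, h1⟩, -, h2⟩
    simp only [FrameField.frame_apply, FrameField.frame_symm_apply, entry, segmentPoint]
    rw [h1, h2]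

theorem FrameField.measurable_section_cover (hj : Continuous j) (hf : ContMDiff (𝓡 n) (𝓡 1) ∞ f₀)
    {u : ∀ x : ℝ × X, E (j x.2)}
    (hu : ∀ (b : B) (U : Set X) (s : X → ℝ), IsLift (𝓡 n) f₀ U s →
      ContinuousOn (fun y => (trivializationAt F E b).continuousLinearMapAt ℂ (j y) (u (s y, y)))
        {y | y ∈ U ∧ j y ∈ (trivializationAt F E b).baseSet}) (m : ℤ) (φ : F →L[ℂ] ℂ) :
    Measurable fun y => φ (𝓣.frame y (u (segmentPoint f₀ m y))) := by
  obtain ⟨C, U, s, hC, hU, hcov⟩ := exists_countable_lifts hf (O := fun _ => Set.univ)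
    fun _ => univ_mem
  have := hC.to_subtype
  have hpiece := fun y m r => (hU y).1.measurableSet_eq_add hf.continuous m r
  refine 𝓣.measurable hj (ι := C × ℤ)
    (fun i => {x | x ∈ U i.1 ∧ segmentCoord f₀ x + m = s i.1 x + i.2}) (fun i => U i.1)
    (fun i b y => φ ((trivializationAt F E b).continuousLinearMapAt ℂ (j y) (u (s i.1 y + i.2, y))))
    (fun i => hpiece _ _ _) (fun i => (hU i.1).1.isOpen) (fun i q hq => hq.1)
    (fun y => ?_) (fun i b => ?_) ?_
  · obtain ⟨y', hy', hq'⟩ := hcov y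
    obtain ⟨r', hr'⟩ := exists_eq_add_int_of_isLift (hU y').1 hq' m
    exact ⟨(⟨y', hy'⟩, r'), hq', hr'⟩
  · exact φ.continuous.comp_continuousOn (hu b _ _ ((hU i.1).1.add_int i.2))
  · rintro i q ⟨-, h1⟩
    simp only [FrameField.frame_apply, segmentPoint]
    rw [h1]

/-- A smooth metric is bounded in a local trivialization. -/
theorem SuperBundle.exists_norm_symmL_le (S : SuperBundle IX F E) (b : B) :
    ∃ C : ℝ, ∀ᶠ x in 𝓝 b, ∀ v : F, ‖(trivializationAt F E b).symmL ℂ x v‖ ≤ C * ‖v‖ := by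
  let e := trivializationAt F E b
  have hb : b ∈ e.baseSet := FiberBundle.mem_baseSet_trivializationAt' b
  let β := Module.finBasis ℂ F
  have h1 : ∀ i, ∃ C : ℝ, ∀ᶠ x in 𝓝 b, ‖e.symmL ℂ x (β i)‖ ≤ C := by
    intro i
    have hc : ContinuousAt (fun x => inner ℂ (e.symmL ℂ x (β i)) (e.symmL ℂ x (β i))) b :=
      (S.smooth_metric e (β i) (β i)).continuousOn.continuousAt (e.open_baseSet.mem_nhds hb)
    refine ⟨Real.sqrt (‖inner ℂ (e.symmL ℂ b (β i)) (e.symmL ℂ b (β i))‖ + 1), ?_⟩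
    filter_upwards [hc.norm.eventually (gt_mem_nhds (lt_add_one _))] with x hx
    refine Real.le_sqrt_of_sq_le ?_
    have h2 : ‖inner ℂ (e.symmL ℂ x (β i)) (e.symmL ℂ x (β i))‖ = ‖e.symmL ℂ x (β i)‖ ^ 2 := by
      rw [inner_self_eq_norm_sq_to_K]
      simp
    rw [← h2]
    exact hx.le
  choose C hC using h1
  let co : ∀ i, F →L[ℂ] ℂ := fun i => LinearMap.toContinuousLinearMap (β.coord i)
  refine ⟨∑ i, ‖co i‖ * C i, ?_⟩
  filter_upwards [eventually_all.2 hC] with x hx v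
  have h3 : v = ∑ i, co i v • β i := (β.sum_repr v).symm
  calc ‖e.symmL ℂ x v‖ = ‖∑ i, co i v • e.symmL ℂ x (β i)‖ := by
        conv_lhs => rw [h3]
        simp
    _ ≤ ∑ i, ‖co i v‖ * ‖e.symmL ℂ x (β i)‖ := by
        refine (norm_sum_le _ _).trans (Finset.sum_le_sum fun i _ => ?_)
        exact (norm_smul _ _).le
    _ ≤ ∑ i, (‖co i‖ * ‖v‖) * C i :=
        Finset.sum_le_sum fun i _ => mul_le_mul ((co i).le_opNorm v) (hx i) (norm_nonneg _)
          (by positivity)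
    _ = (∑ i, ‖co i‖ * C i) * ‖v‖ := by
        rw [Finset.sum_mul]
        exact Finset.sum_congr rfl fun i _ => by ring

/-- Sections over the cover that are continuous and have bounded support are bounded. -/
theorem SuperBundle.exists_norm_section_le [CompactSpace X] (S : SuperBundle IX F E)
    (hj : Continuous j) (hf : ContMDiff (𝓡 n) (𝓡 1) ∞ f₀) {u : ∀ x : ℝ × X, E (j x.2)}
    (hu : ∀ (b : B) (U : Set X) (s : X → ℝ), IsLift (𝓡 n) f₀ U s →
      ContinuousOn (fun y => (trivializationAt F E b).continuousLinearMapAt ℂ (j y) (u (s y, y)))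
        {y | y ∈ U ∧ j y ∈ (trivializationAt F E b).baseSet}) (m : ℤ) :
    ∃ C, ∀ y, ‖u (segmentPoint f₀ m y)‖ ≤ C := by
  have hloc : ∀ y₀ : X, ∃ C : ℝ, ∀ᶠ y in 𝓝 y₀, ‖u (segmentPoint f₀ m y)‖ ≤ C := by
    intro y₀
    let e := trivializationAt F E (j y₀)
    have hb : j y₀ ∈ e.baseSet := FiberBundle.mem_baseSet_trivializationAt' (j y₀)
    obtain ⟨U, s, hs, hy₀, -⟩ := exists_isLift hf (segmentPoint_mem_cover (f₀ := f₀) m y₀)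
    obtain ⟨C₀, hC₀⟩ := S.exists_norm_symmL_le (j y₀)
    have hC₀' : ∀ᶠ y in 𝓝 y₀, ∀ v : F, ‖e.symmL ℂ (j y) v‖ ≤ C₀ * ‖v‖ :=
      (hj.continuousAt.tendsto).eventually hC₀
    have hbd : ∀ r : ℤ, ∃ C : ℝ, ∀ᶠ y in 𝓝 y₀,
        ‖e.continuousLinearMapAt ℂ (j y) (u (s y + r, y))‖ ≤ C := by
      intro r
      have hc := (hu (j y₀) U _ (hs.add_int r)).continuousAt
        ((hs.isOpen.inter (e.open_baseSet.preimage hj)).mem_nhds ⟨hy₀, hb⟩)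
      exact ⟨_, (hc.norm.eventually (gt_mem_nhds (lt_add_one _))).mono fun y hy => hy.le⟩
    choose C hC using hbd
    have hsb : ∀ᶠ y in 𝓝 y₀, |s y| < |s y₀| + 1 :=
      ((hs.continuousAt hy₀).abs).eventually (gt_mem_nhds (lt_add_one _))
    -- The integer `r` with `segmentCoord y + m = s y + r` satisfies `|r| < 1 + |m| + |s y₀| + 1`
    -- near `y₀`, so only finitely many shifts of the lift `s` occur.
    let R : ℤ := ⌈|s y₀|⌉ + 2 + |m|
    refine ⟨∑ r ∈ Finset.Icc (-R) R, |C₀| * |C r|, ?_⟩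
    have hC' : ∀ᶠ y in 𝓝 y₀, ∀ r ∈ Finset.Icc (-R) R,
        ‖e.continuousLinearMapAt ℂ (j y) (u (s y + r, y))‖ ≤ C r :=
      (Finset.eventually_all _).2 fun r _ => hC r
    filter_upwards [hC', hsb, hC₀', hs.isOpen.mem_nhds hy₀,
      (e.open_baseSet.preimage hj).mem_nhds hb] with y h1 h2 h3 h4 h5
    obtain ⟨r, hr⟩ := exists_eq_add_int_of_isLift hs h4 m
    have hrR : r ∈ Finset.Icc (-R) R := by
      have h6 := segmentCoord_nonneg (f₀ := f₀) y
      have h7 := segmentCoord_lt_one (f₀ := f₀) y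
      have h8 := abs_lt.1 h2
      have h9 := Int.le_ceil |s y₀|
      have h10 : (-(|m| : ℤ) : ℝ) ≤ m := by exact_mod_cast neg_abs_le m
      have h11 : (m : ℝ) ≤ ((|m| : ℤ) : ℝ) := by exact_mod_cast le_abs_self m
      rw [Finset.mem_Icc]
      constructor
      · have : ((-R : ℤ) : ℝ) ≤ r := by
          simp only [R]; push_cast at *; linarith
        exact_mod_cast this
      · have : (r : ℝ) ≤ (R : ℤ) := by
          simp only [R]; push_cast at *; linarith
        exact_mod_cast this
    have h12 : u (segmentPoint f₀ m y) =
        e.symmL ℂ (j y) (e.continuousLinearMapAt ℂ (j y) (u (segmentPoint f₀ m y))) :=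
      (e.symmL_continuousLinearMapAt h5 _).symm
    rw [h12]
    calc _ ≤ C₀ * ‖e.continuousLinearMapAt ℂ (j y) (u (segmentPoint f₀ m y))‖ := h3 _
      _ ≤ |C₀| * |C r| := by
          refine mul_le_mul (le_abs_self _) ?_ (norm_nonneg _) (abs_nonneg _)
          have := (h1 r hrR).trans (le_abs_self _)
          rw [← hr] at this
          exact this
      _ ≤ _ := Finset.single_le_sum (f := fun r => |C₀| * |C r|)
          (fun r _ => by positivity) hrR
  choose C hC using hloc
  obtain ⟨t, ht⟩ := CompactSpace.elim_nhds_subcover _ hC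
  refine ⟨∑ y₀ ∈ t, |C y₀|, fun y => ?_⟩
  have hy : y ∈ ⋃ x ∈ t, {y | ‖u (segmentPoint f₀ m y)‖ ≤ C x} := by
    rw [ht]; trivial
  simp only [Set.mem_iUnion] at hy
  obtain ⟨y₀, hy₀, h⟩ := hy
  exact (h.trans (le_abs_self _)).trans
    (Finset.single_le_sum (f := fun y => |C y|) (fun _ _ => abs_nonneg _) hy₀)

end Measurability

/-! ### Convergence of Gaussian sums -/

section GaussianSums

theorem summable_exp_neg_abs : Summable fun m : ℤ => Real.exp (-|(m : ℝ)|) := by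
  have h : Summable fun n : ℕ => Real.exp (-(n : ℝ)) := by
    simpa using Real.summable_exp_nat_mul_iff.2 (show (-1 : ℝ) < 0 by norm_num)
  refine Summable.of_nat_of_neg ?_ ?_ <;> simpa using h

/-- Gaussian sums with exponential weights converge. -/
theorem summable_exp_abs_sub {γ : ℝ} (hγ : 0 < γ) (a : ℝ) :
    Summable fun m : ℤ => Real.exp (a * |(m : ℝ)| - γ * (m : ℝ) ^ 2) := by
  refine Summable.of_nonneg_of_le (fun _ => (Real.exp_pos _).le) (fun m => ?_)
    (summable_exp_neg_abs.mul_left (Real.exp ((a + 1) ^ 2 / (4 * γ))))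
  rw [← Real.exp_add, Real.exp_le_exp]
  -- Completing the square with `a + 1` in place of `a` leaves a factor `exp (-|m|)` to sum over.
  have h : (a + 1) * |(m : ℝ)| - γ * |(m : ℝ)| ^ 2 ≤ (a + 1) ^ 2 / (4 * γ) := by
    rw [le_div_iff₀ (by positivity)]
    nlinarith [sq_nonneg (2 * γ * |(m : ℝ)| - (a + 1))]
  rw [sq_abs] at h
  linarith

theorem summable_exp_neg_sq {γ : ℝ} (hγ : 0 < γ) :
    Summable fun m : ℤ => Real.exp (-γ * (m : ℝ) ^ 2) := by
  simpa using summable_exp_abs_sub hγ 0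

/-- Gaussian sums with a geometric weight and a linear weight converge. -/
theorem summable_pow_mul_exp_neg_sq {γ : ℝ} (hγ : 0 < γ) {R : ℝ} (hR : 0 < R) :
    Summable fun m : ℤ => (|(m : ℝ)| + 1) * (R ^ m.natAbs * Real.exp (-γ * (m : ℝ) ^ 2)) := by
  refine Summable.of_nonneg_of_le (fun m => by positivity) (fun m => ?_)
    (summable_exp_abs_sub hγ (1 + Real.log R))
  have h1 : R ^ m.natAbs = Real.exp (Real.log R * |(m : ℝ)|) := by
    rw [Real.exp_mul, Real.exp_log hR, ← Int.cast_abs, ← Nat.cast_natAbs]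
    exact (Real.rpow_natCast R _).symm
  have h2 : |(m : ℝ)| + 1 ≤ Real.exp |(m : ℝ)| := Real.add_one_le_exp _
  calc _ ≤ Real.exp |(m : ℝ)| * (Real.exp (Real.log R * |(m : ℝ)|) *
        Real.exp (-γ * (m : ℝ) ^ 2)) := by
        rw [h1]; gcongr
    _ = _ := by
        rw [← Real.exp_add, ← Real.exp_add]
        congr 1
        ring

/-- The sum of `exp (-γ m²)` over all integers. -/
def theta (γ : ℝ) : ℝ := ∑' m : ℤ, Real.exp (-γ * (m : ℝ) ^ 2)

theorem theta_nonneg (γ : ℝ) : 0 ≤ theta γ := tsum_nonneg fun _ => (Real.exp_pos _).le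

theorem summable_prod_exp_neg_sq {γ : ℝ} (hγ : 0 < γ) :
    Summable fun i : ℤ × ℤ => (|(i.1 : ℝ)| + 1) * Real.exp (-γ * (i.1 : ℝ) ^ 2) *
      ((|(i.2 : ℝ)| + 1) * Real.exp (-γ * (i.2 : ℝ) ^ 2)) := by
  have h : Summable fun m : ℤ => (|(m : ℝ)| + 1) * Real.exp (-γ * (m : ℝ) ^ 2) := by
    simpa using summable_pow_mul_exp_neg_sq hγ one_pos
  exact h.mul_of_nonneg h (fun m => by positivity) fun m => by positivity

end GaussianSums

/-! ### Gaussian decay in an extended distance -/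

section Gauss

theorem gauss_nonneg (γ : ℝ) (d : ℝ≥0∞) : 0 ≤ gauss γ d := by
  unfold gauss; split_ifs <;> positivity

theorem gauss_anti {γ : ℝ} (hγ : 0 ≤ γ) {d d' : ℝ≥0∞} (h : d ≤ d') : gauss γ d' ≤ gauss γ d := by
  unfold gauss
  split_ifs with h1 h2 h2
  · exact le_rfl
  · positivity
  · exact absurd (top_unique (h2 ▸ h)) h1
  · rw [Real.exp_le_exp]
    have := ENNReal.toReal_mono h1 h
    have h3 : 0 ≤ d.toReal := ENNReal.toReal_nonneg
    have h4 : d.toReal ^ 2 ≤ d'.toReal ^ 2 := by gcongr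
    nlinarith

theorem gauss_le_one {γ : ℝ} (hγ : 0 ≤ γ) (d : ℝ≥0∞) : gauss γ d ≤ 1 := by
  unfold gauss
  split_ifs
  · exact zero_le_one
  · rw [Real.exp_le_one_iff]
    nlinarith [mul_nonneg hγ (sq_nonneg d.toReal)]

/-- Splits the decay in two halves: one can be spent on the convergence of an integral while the
other one is kept. -/
theorem gauss_half_mul (γ : ℝ) (d : ℝ≥0∞) : gauss (γ / 2) d * gauss (γ / 2) d = gauss γ d := by
  unfold gauss
  split_ifs
  · simp
  · rw [← Real.exp_add]
    congr 1
    ring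

theorem gauss_anti_left {γ γ' : ℝ} (h : γ ≤ γ') (d : ℝ≥0∞) : gauss γ' d ≤ gauss γ d := by
  unfold gauss
  split_ifs
  · exact le_rfl
  · rw [Real.exp_le_exp]
    nlinarith [mul_le_mul_of_nonneg_right h (sq_nonneg d.toReal)]

/-- If `r ≤ d + d'`, then `exp (-γ d²) exp (-γ d'²) ≤ exp (-γ r² / 2)`. -/
theorem gauss_mul_gauss_le {γ : ℝ} (hγ : 0 ≤ γ) {r d d' : ℝ≥0∞} (h : r ≤ d + d') :
    gauss γ d * gauss γ d' ≤ gauss (γ / 2) r := by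
  by_cases h1 : d = ⊤
  · simpa [gauss, h1] using gauss_nonneg (γ / 2) r
  by_cases h2 : d' = ⊤
  · simpa [gauss, h2] using gauss_nonneg (γ / 2) r
  have h3 : r ≠ ⊤ := fun h3 => by
    rw [h3] at h
    simp only [top_le_iff, ENNReal.add_eq_top] at h
    tauto
  simp only [gauss, h1, h2, h3, if_false]
  rw [← Real.exp_add, Real.exp_le_exp]
  have h4 : r.toReal ≤ d.toReal + d'.toReal := by
    rw [← ENNReal.toReal_add h1 h2]
    exact ENNReal.toReal_mono (by simp [h1, h2]) h
  have h5 : 0 ≤ r.toReal := ENNReal.toReal_nonneg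
  have h6 : r.toReal ^ 2 ≤ (d.toReal + d'.toReal) ^ 2 := by gcongr
  have h7 : r.toReal ^ 2 ≤ 2 * (d.toReal ^ 2 + d'.toReal ^ 2) := by
    nlinarith [sq_nonneg (d.toReal - d'.toReal)]
  nlinarith [mul_le_mul_of_nonneg_left h7 hγ]

/-- Gaussian decay in the distance implies Gaussian decay in a Lipschitz function. -/
theorem gauss_le_exp {γ : ℝ} (hγ : 0 ≤ γ) {L : NNReal} (hL : 0 < L) {a : ℝ} {d : ℝ≥0∞}
    (h : ENNReal.ofReal (|a| - 2) ≤ L * d) :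
    gauss γ d ≤ Real.exp (4 * γ / L ^ 2) * Real.exp (-(γ / (2 * L ^ 2)) * a ^ 2) := by
  unfold gauss
  split_ifs with h1
  · positivity
  · rw [← Real.exp_add, Real.exp_le_exp]
    have hL' : (0 : ℝ) < L := hL
    have h2 : |a| - 2 ≤ L * d.toReal := by
      have := ENNReal.toReal_mono (by finiteness) h
      rw [ENNReal.toReal_mul, ENNReal.coe_toReal] at this
      rw [ENNReal.toReal_ofReal'] at this
      exact (le_max_left _ _).trans this
    have h0 : 0 ≤ d.toReal := ENNReal.toReal_nonneg
    -- For `|a| ≥ 2` this is `(|a| - 2)² ≥ a² / 2 - 4`, that is `(|a| - 4)² ≥ 0`; for `|a| ≤ 2` the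
    -- left side is negative.
    have h3 : a ^ 2 / 2 - 4 ≤ (L * d.toReal) ^ 2 := by
      rw [← sq_abs a]
      rcases le_total 2 |a| with h4 | h4
      · have h5 : (|a| - 2) ^ 2 ≤ (L * d.toReal) ^ 2 := by
          have : 0 ≤ |a| - 2 := by linarith
          gcongr
        nlinarith [sq_nonneg (|a| - 4)]
      · nlinarith [abs_nonneg a, sq_nonneg (L * d.toReal)]
    have h4 : (L : ℝ) ^ 2 ≠ 0 := by positivity
    have h5 : (a ^ 2 / 2 - 4) / L ^ 2 ≤ d.toReal ^ 2 := by
      rw [div_le_iff₀ (by positivity)]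
      nlinarith
    calc -γ * d.toReal ^ 2 ≤ -γ * ((a ^ 2 / 2 - 4) / L ^ 2) := by
          nlinarith [mul_le_mul_of_nonneg_left h5 hγ]
      _ = _ := by field_simp; ring

end Gauss

/-! ### Integration over spaces whose levels have bounded measure -/

section Levels

variable {Ω : Type*} [MeasurableSpace Ω]

/-- The level sets of `lev` have measure at most `v`. -/
structure BoundedLevels (μ : Measure Ω) (lev : Ω → ℤ) (v : ℝ) : Prop where
  measurable : Measurable lev
  measure_le : ∀ m, μ (lev ⁻¹' {m}) ≤ ENNReal.ofReal v
  nonneg : 0 ≤ v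

variable {μ : Measure Ω} {lev : Ω → ℤ} {v : ℝ}

theorem BoundedLevels.sigmaFinite (h : BoundedLevels μ lev v) : SigmaFinite μ := by
  refine ⟨⟨⟨fun i => ⋃ m ∈ Finset.Icc (-(i : ℤ)) i, lev ⁻¹' {m}, fun _ => trivial, fun i => ?_, ?_⟩⟩⟩
  · refine (measure_biUnion_finset_le _ _).trans_lt (ENNReal.sum_lt_top.2 fun m _ => ?_)
    exact (h.measure_le m).trans_lt ENNReal.ofReal_lt_top
  · refine Set.eq_univ_of_forall fun x => Set.mem_iUnion.2 ⟨(lev x).natAbs, ?_⟩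
    simp only [Set.mem_iUnion, Finset.mem_Icc]
    exact ⟨lev x, ⟨by omega, by omega⟩, rfl⟩

/-- The integrand depends on the level only. The image of the measure on `ℤ` has mass at most `v` at
every point, and a translated theta sum does not depend on the translation. -/
theorem BoundedLevels.lintegral_le (h : BoundedLevels μ lev v) {γ : ℝ} (hγ : 0 < γ) (a : ℤ) :
    ∫⁻ w, ENNReal.ofReal (Real.exp (-γ * ((a : ℝ) - lev w) ^ 2)) ∂μ ≤
      ENNReal.ofReal (v * theta γ) := by
  have h1 : ∫⁻ w, ENNReal.ofReal (Real.exp (-γ * ((a : ℝ) - lev w) ^ 2)) ∂μ =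
      ∫⁻ m, ENNReal.ofReal (Real.exp (-γ * ((a : ℝ) - (m : ℤ)) ^ 2)) ∂(μ.map lev) :=
    (lintegral_map (f := fun m : ℤ => ENNReal.ofReal (Real.exp (-γ * ((a : ℝ) - m) ^ 2)))
      (measurable_of_countable _) h.measurable).symm
  rw [h1, lintegral_countable']
  have hs : Summable fun m : ℤ => Real.exp (-γ * ((a : ℝ) - m) ^ 2) := by
    have := (Equiv.subLeft a).summable_iff.2 (summable_exp_neg_sq hγ)
    simpa [Function.comp_def] using this
  have ht : ∑' m : ℤ, Real.exp (-γ * ((a : ℝ) - m) ^ 2) = theta γ := by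
    have := (Equiv.subLeft a).tsum_eq fun m : ℤ => Real.exp (-γ * (m : ℝ) ^ 2)
    simpa [theta] using this
  calc _ ≤ ∑' m : ℤ, ENNReal.ofReal (Real.exp (-γ * ((a : ℝ) - m) ^ 2)) * ENNReal.ofReal v := by
        refine ENNReal.tsum_le_tsum fun m => ?_
        gcongr
        rw [Measure.map_apply h.measurable (measurableSet_singleton m)]
        exact h.measure_le m
    _ = _ := by
        rw [ENNReal.tsum_mul_right, ← ENNReal.ofReal_tsum_of_nonneg (fun _ => (Real.exp_pos _).le) hs,
          ht, ← ENNReal.ofReal_mul (theta_nonneg γ), mul_comm]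

theorem BoundedLevels.integrable_exp (h : BoundedLevels μ lev v) {γ : ℝ} (hγ : 0 < γ) (a : ℤ) :
    Integrable (fun w => Real.exp (-γ * ((a : ℝ) - lev w) ^ 2)) μ := by
  refine ⟨?_, ?_⟩
  · have : Measurable fun m : ℤ => Real.exp (-γ * ((a : ℝ) - m) ^ 2) := measurable_of_countable _
    exact (this.comp h.measurable).aestronglyMeasurable
  · rw [hasFiniteIntegral_iff_ofReal (ae_of_all _ fun _ => (Real.exp_pos _).le)]
    exact (h.lintegral_le hγ a).trans_lt ENNReal.ofReal_lt_top

theorem BoundedLevels.integral_exp_le (h : BoundedLevels μ lev v) {γ : ℝ} (hγ : 0 < γ) (a : ℤ) :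
    ∫ w, Real.exp (-γ * ((a : ℝ) - lev w) ^ 2) ∂μ ≤ v * theta γ := by
  rw [integral_eq_lintegral_of_nonneg_ae (ae_of_all _ fun _ => (Real.exp_pos _).le)
    (h.integrable_exp hγ a).aestronglyMeasurable]
  exact ENNReal.toReal_le_of_le_ofReal (mul_nonneg h.nonneg (theta_nonneg γ)) (h.lintegral_le hγ a)

variable {G : Type*} [NormedAddCommGroup G] {f : Ω → G}

theorem BoundedLevels.integrable (h : BoundedLevels μ lev v) {γ C : ℝ} (hγ : 0 < γ) {a : ℤ}
    (hf : AEStronglyMeasurable f μ)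
    (hb : ∀ᵐ w ∂μ, ‖f w‖ ≤ C * Real.exp (-γ * ((a : ℝ) - lev w) ^ 2)) : Integrable f μ :=
  ((h.integrable_exp hγ a).const_mul C).mono' hf hb

theorem BoundedLevels.norm_integral_le [NormedSpace ℝ G] (h : BoundedLevels μ lev v) {γ C : ℝ}
    (hγ : 0 < γ) {a : ℤ} (hC : 0 ≤ C)
    (hb : ∀ᵐ w ∂μ, ‖f w‖ ≤ C * Real.exp (-γ * ((a : ℝ) - lev w) ^ 2)) :
    ‖∫ w, f w ∂μ‖ ≤ C * (v * theta γ) := by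
  refine (norm_integral_le_of_norm_le ((h.integrable_exp hγ a).const_mul C) hb).trans ?_
  rw [integral_const_mul]
  exact mul_le_mul_of_nonneg_left (h.integral_exp_le hγ a) hC

end Levels

/-- On a finite measure space, summable uniform bounds allow termwise integration. The expansions in
Laurent series and the sums over levels are integrated by means of it. -/
theorem hasSum_integral_of_norm_le {Ω G ι : Type*} [MeasurableSpace Ω] {μ : Measure Ω}
    [IsFiniteMeasure μ] [NormedAddCommGroup G] [NormedSpace ℝ G] [Countable ι] {F : ι → Ω → G}
    {c : ι → ℝ} (hF : ∀ i, AEStronglyMeasurable (F i) μ) (hb : ∀ i, ∀ᵐ o ∂μ, ‖F i o‖ ≤ c i)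
    (hc : Summable c) : HasSum (fun i => ∫ o, F i o ∂μ) (∫ o, ∑' i, F i o ∂μ) := by
  have hInt : ∀ i, Integrable (F i) μ := fun i =>
    Integrable.mono' (integrable_const (c i)) (hF i) (hb i)
  refine hasSum_integral_of_summable_integral_norm hInt ?_
  refine Summable.of_nonneg_of_le (fun i => integral_nonneg fun _ => norm_nonneg _) (fun i => ?_)
    (hc.mul_left (μ.real Set.univ))
  have := integral_mono_ae (hInt i).norm (integrable_const (c i)) (hb i)
  simpa using this

/-! ### The defect as a sum over differences of levels -/

section LevelDefect

variable {X : Type*} [MeasurableSpace X] {μ : Measure X} {lev : X → ℕ} {v : ℝ}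
  {G : Type*} [NormedAddCommGroup G] [NormedSpace ℂ G] [CompleteSpace G]
  {a : X → X → G} {C γ : ℝ}

/-- The contribution to a double integral of a pair of levels. -/
def levelIntegral (μ : Measure X) (lev : X → ℕ) (a : X → X → G) (i j : ℕ) : G :=
  ∫ x in lev ⁻¹' {i}, ∫ w in lev ⁻¹' {j}, a x w ∂μ ∂μ

theorem BoundedLevels.measurable_nat (h : BoundedLevels μ (fun x => (lev x : ℤ)) v) :
    Measurable lev := by
  refine measurable_to_countable' fun i => ?_
  convert h.measurable (measurableSet_singleton (i : ℤ)) using 1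
  ext x
  simp

theorem BoundedLevels.measure_nat_le (h : BoundedLevels μ (fun x => (lev x : ℤ)) v) (i : ℕ) :
    μ (lev ⁻¹' {i}) ≤ ENNReal.ofReal v := by
  convert h.measure_le i using 2
  ext x
  simp

theorem BoundedLevels.measure_nat_lt (h : BoundedLevels μ (fun x => (lev x : ℤ)) v) (i : ℕ) :
    μ (lev ⁻¹' {i}) < ⊤ := (h.measure_nat_le i).trans_lt ENNReal.ofReal_lt_top

theorem BoundedLevels.norm_setIntegral_le (h : BoundedLevels μ (fun x => (lev x : ℤ)) v) {f : X → G}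
    {j : ℕ} {c : ℝ} (hc : 0 ≤ c) (hf : ∀ x, lev x = j → ‖f x‖ ≤ c) :
    ‖∫ w in lev ⁻¹' {j}, f w ∂μ‖ ≤ c * v := by
  have h1 := norm_setIntegral_le_of_norm_le_const (μ := μ) (s := lev ⁻¹' {j}) (f := f)
    (h.measure_nat_lt j) fun x hx => hf x hx
  refine h1.trans (mul_le_mul_of_nonneg_left ?_ hc)
  exact ENNReal.toReal_le_of_le_ofReal h.nonneg (h.measure_nat_le j)

theorem BoundedLevels.norm_levelIntegral_le (h : BoundedLevels μ (fun x => (lev x : ℤ)) v)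
    (hC : 0 ≤ C) (hb : ∀ x w, ‖a x w‖ ≤ C * Real.exp (-γ * ((lev x : ℝ) - lev w) ^ 2)) (i j : ℕ) :
    ‖levelIntegral μ lev a i j‖ ≤ C * v * v * Real.exp (-γ * ((i : ℝ) - j) ^ 2) := by
  have hv := h.nonneg
  refine (h.norm_setIntegral_le (c := C * Real.exp (-γ * ((i : ℝ) - j) ^ 2) * v) (by positivity)
    fun x hx => ?_).trans_eq (by ring)
  refine h.norm_setIntegral_le (by positivity) fun w hw => ?_
  simpa [hx, hw] using hb x w

theorem BoundedLevels.levelIntegral_swap (h : BoundedLevels μ (fun x => (lev x : ℤ)) v)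
    (ha : StronglyMeasurable (Function.uncurry a)) (hγ : 0 ≤ γ) (hC : 0 ≤ C)
    (hb : ∀ x w, ‖a x w‖ ≤ C * Real.exp (-γ * ((lev x : ℝ) - lev w) ^ 2)) (i j : ℕ) :
    levelIntegral μ lev (fun x w => a w x) i j = levelIntegral μ lev a j i := by
  have : IsFiniteMeasure (μ.restrict (lev ⁻¹' {i})) := isFiniteMeasure_restrict.2 (h.measure_nat_lt i).ne
  have : IsFiniteMeasure (μ.restrict (lev ⁻¹' {j})) := isFiniteMeasure_restrict.2 (h.measure_nat_lt j).ne
  refine (integral_integral_swap ?_).symm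
  refine Integrable.mono' (integrable_const C) ha.aestronglyMeasurable (ae_of_all _ fun q => ?_)
  refine (hb q.1 q.2).trans (mul_le_of_le_one_right hC ?_)
  rw [Real.exp_le_one_iff]
  nlinarith [sq_nonneg ((lev q.1 : ℝ) - lev q.2)]

theorem BoundedLevels.integrable_left (h : BoundedLevels μ (fun x => (lev x : ℤ)) v)
    (ha : StronglyMeasurable (Function.uncurry a)) (hγ : 0 < γ)
    (hb : ∀ x w, ‖a x w‖ ≤ C * Real.exp (-γ * ((lev x : ℝ) - lev w) ^ 2)) (x : X) :
    Integrable (a x) μ :=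
  h.integrable hγ (a := (lev x : ℤ)) (ha.comp_measurable measurable_prodMk_left).aestronglyMeasurable
    (ae_of_all _ fun w => by simpa using hb x w)

theorem summable_exp_neg_sub_sq (hγ : 0 < γ) (i : ℕ) :
    Summable fun j : ℕ => Real.exp (-γ * ((i : ℝ) - j) ^ 2) := by
  have h1 : Function.Injective fun j : ℕ => (i : ℤ) - j := fun j j' h => by simpa using h
  simpa [Function.comp_def] using (summable_exp_neg_sq hγ).comp_injective h1

theorem BoundedLevels.hasSum_levelIntegral (h : BoundedLevels μ (fun x => (lev x : ℤ)) v)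
    (ha : StronglyMeasurable (Function.uncurry a)) (hγ : 0 < γ) (hC : 0 ≤ C)
    (hb : ∀ x w, ‖a x w‖ ≤ C * Real.exp (-γ * ((lev x : ℝ) - lev w) ^ 2)) (i : ℕ) :
    HasSum (levelIntegral μ lev a i) (∫ x in lev ⁻¹' {i}, ∫ w, a x w ∂μ ∂μ) := by
  have hv := h.nonneg
  have := h.sigmaFinite
  have : IsFiniteMeasure (μ.restrict (lev ⁻¹' {i})) := isFiniteMeasure_restrict.2 (h.measure_nat_lt i).ne
  have hsplit : ∀ x, ∑' j : ℕ, ∫ w in lev ⁻¹' {j}, a x w ∂μ = ∫ w, a x w ∂μ := by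
    intro x
    have hU : ⋃ j : ℕ, lev ⁻¹' {j} = Set.univ := by
      ext w; simp
    have := hasSum_integral_iUnion (μ := μ) (f := a x) (s := fun j : ℕ => lev ⁻¹' {j})
      (fun j => h.measurable_nat (measurableSet_singleton j))
      (fun j j' hjj' => Set.disjoint_left.2 fun w hw hw' => hjj' (hw.symm.trans hw'))
      ((h.integrable_left ha hγ hb x).integrableOn)
    rw [hU, setIntegral_univ] at this
    exact this.tsum_eq
  have := hasSum_integral_of_norm_le (μ := μ.restrict (lev ⁻¹' {i}))
    (F := fun (j : ℕ) x => ∫ w in lev ⁻¹' {j}, a x w ∂μ)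
    (c := fun j : ℕ => C * Real.exp (-γ * ((i : ℝ) - j) ^ 2) * v)
    (fun j => (ha.integral_prod_right (ν := μ.restrict (lev ⁻¹' {j}))).aestronglyMeasurable)
    (fun j => ?_) (((summable_exp_neg_sub_sq hγ i).mul_left C).mul_right v)
  · simp only [hsplit] at this
    exact this
  · refine (ae_restrict_iff' (h.measurable_nat (measurableSet_singleton i))).2
      (ae_of_all _ fun x hx => ?_)
    refine h.norm_setIntegral_le (by positivity) fun w hw => ?_
    have hx' : lev x = i := hx
    simpa [hx', hw] using hb x w

/-- The part below level `N` of the integral of `a x w - a w x`. -/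
theorem BoundedLevels.setIntegral_sub_swap (h : BoundedLevels μ (fun x => (lev x : ℤ)) v)
    (ha : StronglyMeasurable (Function.uncurry a)) (hγ : 0 < γ) (hC : 0 ≤ C)
    (hb : ∀ x w, ‖a x w‖ ≤ C * Real.exp (-γ * ((lev x : ℝ) - lev w) ^ 2)) (N : ℕ) :
    ∫ x in {x | lev x ≤ N}, ((∫ w, a x w ∂μ) - ∫ w, a w x ∂μ) ∂μ =
      ∑' q : ℕ × ℕ, if q.1 ≤ N then levelIntegral μ lev a (N - q.1) (N + 1 + q.2) -
        levelIntegral μ lev a (N + 1 + q.2) (N - q.1) else 0 := by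
  have hv := h.nonneg
  have := h.sigmaFinite
  set β : ℕ → ℕ → G := fun i j => levelIntegral μ lev a i j - levelIntegral μ lev a j i with hβ
  have ha' : StronglyMeasurable (Function.uncurry fun x w => a w x) :=
    ha.comp_measurable measurable_swap
  have hb' : ∀ x w, ‖a w x‖ ≤ C * Real.exp (-γ * ((lev x : ℝ) - lev w) ^ 2) := fun x w => by
    have := hb w x
    rwa [← neg_sub, neg_sq] at this
  have hβb : ∀ i j, ‖β i j‖ ≤ 2 * (C * v * v) * Real.exp (-γ * ((i : ℝ) - j) ^ 2) := by
    intro i j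
    have h1 := h.norm_levelIntegral_le hC hb i j
    have h2 := h.norm_levelIntegral_le hC hb j i
    rw [← neg_sub, neg_sq] at h2
    exact (norm_sub_le _ _).trans ((add_le_add h1 h2).trans_eq (by ring))
  have hβs : ∀ i, Summable (β i) := fun i =>
    Summable.of_norm_bounded ((summable_exp_neg_sub_sq hγ i).mul_left _) (hβb i)
  have hInt : ∀ i, IntegrableOn (fun x => (∫ w, a x w ∂μ) - ∫ w, a w x ∂μ) (lev ⁻¹' {i}) μ := by
    intro i
    have : IsFiniteMeasure (μ.restrict (lev ⁻¹' {i})) :=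
      isFiniteMeasure_restrict.2 (h.measure_nat_lt i).ne
    refine Integrable.mono' (integrable_const (C * (v * theta γ) + C * (v * theta γ)))
      ((ha.integral_prod_right (ν := μ)).sub (ha'.integral_prod_right (ν := μ))).aestronglyMeasurable
      (ae_of_all _ fun x => (norm_sub_le _ _).trans (add_le_add ?_ ?_))
    · exact h.norm_integral_le hγ (a := lev x) hC (ae_of_all _ fun w => by simpa using hb x w)
    · exact h.norm_integral_le hγ (a := lev x) hC (ae_of_all _ fun w => by simpa using hb' x w)
  have hrow : ∀ i, HasSum (β i) (∫ x in lev ⁻¹' {i}, ((∫ w, a x w ∂μ) - ∫ w, a w x ∂μ) ∂μ) := by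
    intro i
    have : IsFiniteMeasure (μ.restrict (lev ⁻¹' {i})) :=
      isFiniteMeasure_restrict.2 (h.measure_nat_lt i).ne
    have h1 := h.hasSum_levelIntegral ha hγ hC hb i
    have h2 := h.hasSum_levelIntegral ha' hγ hC hb' i
    rw [integral_sub]
    · convert h1.sub h2 using 2 with j
      simp only [hβ]
      rw [h.levelIntegral_swap ha hγ.le hC hb i]
    · refine Integrable.mono' (integrable_const (C * (v * theta γ)))
        (ha.integral_prod_right (ν := μ)).aestronglyMeasurable (ae_of_all _ fun x => ?_)
      exact h.norm_integral_le hγ (a := lev x) hC (ae_of_all _ fun w => by simpa using hb x w)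
    · refine Integrable.mono' (integrable_const (C * (v * theta γ)))
        (ha'.integral_prod_right (ν := μ)).aestronglyMeasurable (ae_of_all _ fun x => ?_)
      exact h.norm_integral_le hγ (a := lev x) hC (ae_of_all _ fun w => by simpa using hb' x w)
  have hset : {x | lev x ≤ N} = ⋃ i ∈ Finset.range (N + 1), lev ⁻¹' {i} := by
    ext x; simp
  rw [hset, integral_biUnion_finset _
    (fun i _ => h.measurable_nat (measurableSet_singleton i))
    (fun i _ j _ hij => Set.disjoint_left.2 fun w hw hw' => hij (hw.symm.trans hw'))
    (fun i _ => hInt i)]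
  have h1 : ∀ i, ∫ x in lev ⁻¹' {i}, ((∫ w, a x w ∂μ) - ∫ w, a w x ∂μ) ∂μ =
      ∑ j ∈ Finset.range (N + 1), β i j + ∑' j, β i (N + 1 + j) := fun i => by
    rw [← (hrow i).tsum_eq, ← (hβs i).sum_add_tsum_nat_add (N + 1)]
    simp only [add_comm]
  -- `β` is antisymmetric, so its sum over the square of levels up to `N` vanishes. Only the pairs
  -- of levels on different sides of the cut survive.
  have h2 : ∑ i ∈ Finset.range (N + 1), ∑ j ∈ Finset.range (N + 1), β i j = 0 := by
    simp only [hβ, Finset.sum_sub_distrib]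
    rw [Finset.sum_comm, sub_self]
  simp only [h1, Finset.sum_add_distrib, h2, zero_add]
  have hsum : Summable fun q : ℕ × ℕ => if q.1 ≤ N then β (N - q.1) (N + 1 + q.2) else 0 := by
    have hg : Summable fun m : ℕ => Real.exp (-γ * (m : ℝ) ^ 2) := by
      simpa using summable_exp_neg_sub_sq hγ 0
    have := (hg.mul_of_nonneg hg (fun _ => (Real.exp_pos _).le) fun _ => (Real.exp_pos _).le).mul_left
      (2 * (C * v * v))
    refine Summable.of_norm_bounded this fun q => ?_
    split_ifs with hq
    · refine (hβb _ _).trans (mul_le_mul_of_nonneg_left ?_ (by positivity))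
      rw [← Real.exp_add, Real.exp_le_exp]
      have : (((N - q.1 : ℕ) : ℝ) - ((N + 1 + q.2 : ℕ) : ℝ)) = -(q.1 + q.2 + 1) := by
        push_cast [Nat.cast_sub hq]; ring
      rw [this]
      have h3 : 0 ≤ (q.1 : ℝ) := by positivity
      have h4 : 0 ≤ (q.2 : ℝ) := by positivity
      nlinarith [mul_nonneg hγ.le h3, mul_nonneg hγ.le h4, mul_nonneg hγ.le (mul_nonneg h3 h4)]
    · simp only [norm_zero]; positivity
  rw [hsum.tsum_prod' fun i => ?_]
  · rw [tsum_eq_sum (s := Finset.range (N + 1))]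
    -- Levels below the cut are counted downwards from `N`, so that an index pair `q` keeps its
    -- meaning as `N` grows.
    · rw [← Finset.sum_range_reflect]
      refine Finset.sum_congr rfl fun i hi => ?_
      have hi' : i ≤ N := by simpa [Nat.lt_succ_iff] using hi
      simp [hi']
    · intro i hi
      have hi' : ¬ i ≤ N := by simpa [Nat.lt_succ_iff] using hi
      simp [hi']
  · exact hsum.comp_injective (Prod.mk_right_injective i)

/-- There are `n + 1` pairs of natural numbers with sum `n`: a difference `n + 1` of levels is
realized by `n + 1` pairs across a given cut. This count is the origin of the weight `m` in the
defect. -/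
theorem tsum_prod_nat_add_one {g : ℕ → G} (hg : Summable fun q : ℕ × ℕ => g (q.1 + q.2 + 1)) :
    ∑' q : ℕ × ℕ, g (q.1 + q.2 + 1) = ∑' n : ℕ, ((n : ℂ) + 1) • g (n + 1) := by
  rw [← Finset.HasAntidiagonal.sigmaAntidiagonalEquivProd.tsum_eq]
  have h1 := Finset.HasAntidiagonal.sigmaAntidiagonalEquivProd.summable_iff.2 hg
  rw [Function.comp_def] at h1
  rw [Summable.tsum_sigma' (fun n => (hasSum_fintype _).summable) h1]
  refine tsum_congr fun n => ?_
  rw [tsum_fintype]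
  have h2 : ∀ b : Finset.HasAntidiagonal.antidiagonal n,
      g (((Finset.HasAntidiagonal.sigmaAntidiagonalEquivProd ⟨n, b⟩).1) +
        (Finset.HasAntidiagonal.sigmaAntidiagonalEquivProd ⟨n, b⟩).2 + 1) = g (n + 1) := by
    rintro ⟨b, hb⟩
    rw [Finset.HasAntidiagonal.sigmaAntidiagonalEquivProd_apply]
    simp [Finset.HasAntidiagonal.mem_antidiagonal.1 hb]
  simp only [h2]
  simp only [Finset.sum_const, Finset.card_univ, Fintype.card_coe, Finset.Nat.card_antidiagonal]
  rw [← Nat.cast_smul_eq_nsmul ℂ]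
  simp

theorem summable_intCast_smul {A : ℤ → G} (hγ : 0 < γ)
    (hA : ∀ m, ‖A m‖ ≤ C * Real.exp (-γ * (m : ℝ) ^ 2)) : Summable fun m : ℤ => (m : ℂ) • A m := by
  have h1 := (summable_pow_mul_exp_neg_sq hγ one_pos).mul_left C
  refine Summable.of_norm_bounded h1 fun m => ?_
  rw [norm_smul]
  have h2 : ‖(m : ℂ)‖ ≤ |(m : ℝ)| + 1 := by
    rw [show (m : ℂ) = ((m : ℝ) : ℂ) by simp, Complex.norm_real, Real.norm_eq_abs]; linarith
  calc _ ≤ (|(m : ℝ)| + 1) * (C * Real.exp (-γ * (m : ℝ) ^ 2)) := by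
        refine mul_le_mul h2 (hA m) (norm_nonneg _) (by positivity)
    _ = _ := by simp; ring

/-- Counting pairs gives each `n ≥ 1` the multiplicity `n`, once for `A (-n)` and once, with a minus
sign, for `A n`. The two halves combine to a sum over all integers, in which `m = 0` has weight `0`.
-/
theorem tsum_prod_nat_sub {A : ℤ → G} (hγ : 0 < γ) (hA : ∀ m, ‖A m‖ ≤ C * Real.exp (-γ * (m : ℝ) ^ 2)) :
    ∑' q : ℕ × ℕ, (A (-(q.1 + q.2 + 1 : ℕ)) - A (q.1 + q.2 + 1 : ℕ)) = -∑' m : ℤ, (m : ℂ) • A m := by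
  have hC : 0 ≤ C := by simpa using (norm_nonneg _).trans (hA 0)
  have hg : Summable fun m : ℕ => Real.exp (-γ * (m : ℝ) ^ 2) := by
    simpa using summable_exp_neg_sub_sq hγ 0
  have hs : Summable fun q : ℕ × ℕ => (A (-(q.1 + q.2 + 1 : ℕ)) - A (q.1 + q.2 + 1 : ℕ)) := by
    have := (hg.mul_of_nonneg hg (fun _ => (Real.exp_pos _).le) fun _ => (Real.exp_pos _).le).mul_left
      (2 * C)
    refine Summable.of_norm_bounded this fun q => ?_
    refine (norm_sub_le _ _).trans ((add_le_add (hA _) (hA _)).trans ?_)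
    have : Real.exp (-γ * ((q.1 + q.2 + 1 : ℕ) : ℝ) ^ 2) ≤
        Real.exp (-γ * (q.1 : ℝ) ^ 2) * Real.exp (-γ * (q.2 : ℝ) ^ 2) := by
      rw [← Real.exp_add, Real.exp_le_exp]
      push_cast
      have h3 : 0 ≤ (q.1 : ℝ) := by positivity
      have h4 : 0 ≤ (q.2 : ℝ) := by positivity
      nlinarith [mul_nonneg hγ.le h3, mul_nonneg hγ.le h4, mul_nonneg hγ.le (mul_nonneg h3 h4)]
    have h5 := mul_le_mul_of_nonneg_left this hC
    push_cast at h5 ⊢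
    rw [neg_sq]
    linarith
  have hs' := summable_intCast_smul hγ hA
  rw [tsum_prod_nat_add_one (g := fun k : ℕ => A (-(k : ℤ)) - A (k : ℤ)) hs]
  have hp : Summable fun n : ℕ => ((n : ℤ) : ℂ) • A n := hs'.comp_injective Nat.cast_injective
  have hn : Summable fun n : ℕ => ((-(n + 1 : ℤ) : ℤ) : ℂ) • A (-(n + 1 : ℤ)) :=
    hs'.comp_injective (i := fun n : ℕ => -(n + 1 : ℤ)) fun a b h => by simpa using h
  have htot : ∑' m : ℤ, (m : ℂ) • A m = (∑' n : ℕ, ((n : ℤ) : ℂ) • A n) +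
      ∑' n : ℕ, ((-(n + 1 : ℤ) : ℤ) : ℂ) • A (-(n + 1 : ℤ)) :=
    (HasSum.of_nat_of_neg_add_one (f := fun m : ℤ => (m : ℂ) • A m) hp.hasSum hn.hasSum).tsum_eq
  have hp' : Summable fun n : ℕ => (((n + 1 : ℕ) : ℤ) : ℂ) • A (n + 1 : ℕ) :=
    (summable_nat_add_iff (f := fun n : ℕ => ((n : ℤ) : ℂ) • A n) 1).2 hp
  have hzero : ∑' n : ℕ, ((n : ℤ) : ℂ) • A n =
      ∑' n : ℕ, (((n + 1 : ℕ) : ℤ) : ℂ) • A (n + 1 : ℕ) := by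
    have h1 := hp.tsum_eq_zero_add
    simp only [Nat.cast_zero, Int.cast_zero, zero_smul, zero_add] at h1
    exact h1
  rw [htot, hzero, ← Summable.tsum_add hp' hn, ← tsum_neg]
  refine tsum_congr fun n => ?_
  have key : ∀ (c : ℂ) (x y : G), c • (x - y) = -(c • y + (-c) • x) := fun c x y => by module
  have h2 : (((n + 1 : ℕ) : ℤ) : ℂ) = (n : ℂ) + 1 := by push_cast; rfl
  have h3 : ((-(n + 1 : ℤ) : ℤ) : ℂ) = -((n : ℂ) + 1) := by push_cast; rfl
  have h4 : ((n : ℤ) + 1) = ((n + 1 : ℕ) : ℤ) := by push_cast; rfl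
  rw [h2, h3, h4]
  exact key _ _ _

/-- The limit of the integrals of `a x w - a w x` over growing parts of a space with a periodic
end, where `A m` are the limits of the contributions of pairs of levels with difference `m`. -/
theorem BoundedLevels.tendsto_setIntegral_sub_swap (h : BoundedLevels μ (fun x => (lev x : ℤ)) v)
    (ha : StronglyMeasurable (Function.uncurry a)) (hγ : 0 < γ) (hC : 0 ≤ C)
    (hb : ∀ x w, ‖a x w‖ ≤ C * Real.exp (-γ * ((lev x : ℝ) - lev w) ^ 2)) {A : ℤ → G}
    (hA : ∀ d : ℕ, Tendsto (fun k => levelIntegral μ lev a (k + d) k) atTop (𝓝 (A d)))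
    (hA' : ∀ d : ℕ, Tendsto (fun k => levelIntegral μ lev a k (k + d)) atTop (𝓝 (A (-d)))) :
    Tendsto (fun N : ℕ => ∫ x in {x | lev x ≤ N}, ((∫ w, a x w ∂μ) - ∫ w, a w x ∂μ) ∂μ) atTop
      (𝓝 (-∑' m : ℤ, (m : ℂ) • A m)) := by
  have hv := h.nonneg
  have hAb : ∀ m, ‖A m‖ ≤ C * v * v * Real.exp (-γ * (m : ℝ) ^ 2) := by
    intro m
    obtain ⟨d, rfl | rfl⟩ := m.eq_nat_or_neg
    · refine le_of_tendsto (hA d).norm (Eventually.of_forall fun k => ?_)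
      simpa using h.norm_levelIntegral_le hC hb (k + d) k
    · refine le_of_tendsto (hA' d).norm (Eventually.of_forall fun k => ?_)
      simpa using h.norm_levelIntegral_le hC hb k (k + d)
  rw [← tsum_prod_nat_sub hγ hAb]
  simp only [h.setIntegral_sub_swap ha hγ hC hb]
  have hg : Summable fun m : ℕ => Real.exp (-γ * (m : ℝ) ^ 2) := by
    simpa using summable_exp_neg_sub_sq hγ 0
  have hg2 := (hg.mul_of_nonneg hg (fun _ => (Real.exp_pos _).le) fun _ => (Real.exp_pos _).le).mul_left
      (2 * (C * v * v))
  refine tendsto_tsum_of_dominated_convergence hg2 (fun q => ?_) (Eventually.of_forall fun N q => ?_)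
  -- For fixed `q` the lower level `N - q.1` tends to infinity, while its difference from the upper
  -- one stays `q.1 + q.2 + 1`. The truncated subtraction is harmless once `q.1 ≤ N`.
  · have h1 : Tendsto (fun N : ℕ => N - q.1) atTop atTop := tendsto_sub_atTop_nat q.1
    have h2 := ((hA' (q.1 + q.2 + 1)).comp h1).sub ((hA (q.1 + q.2 + 1)).comp h1)
    refine h2.congr' ?_
    filter_upwards [eventually_ge_atTop q.1] with N hN
    have h3 : N - q.1 + (q.1 + q.2 + 1) = N + 1 + q.2 := by omega
    simp only [Function.comp_apply, h3, hN, if_true]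
  · split_ifs with hq
    · have h1 := h.norm_levelIntegral_le hC hb (N - q.1) (N + 1 + q.2)
      have h2 := h.norm_levelIntegral_le hC hb (N + 1 + q.2) (N - q.1)
      have h5 : (((N - q.1 : ℕ) : ℝ) - ((N + 1 + q.2 : ℕ) : ℝ)) = -(q.1 + q.2 + 1) := by
        push_cast [Nat.cast_sub hq]; ring
      have h6 : (((N + 1 + q.2 : ℕ) : ℝ) - ((N - q.1 : ℕ) : ℝ)) = q.1 + q.2 + 1 := by
        push_cast [Nat.cast_sub hq]; ring
      rw [h5, neg_sq] at h1
      rw [h6] at h2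
      have h7 : Real.exp (-γ * (q.1 + q.2 + 1 : ℝ) ^ 2) ≤
          Real.exp (-γ * (q.1 : ℝ) ^ 2) * Real.exp (-γ * (q.2 : ℝ) ^ 2) := by
        rw [← Real.exp_add, Real.exp_le_exp]
        have h3 : 0 ≤ (q.1 : ℝ) := by positivity
        have h4 : 0 ≤ (q.2 : ℝ) := by positivity
        nlinarith [mul_nonneg hγ.le h3, mul_nonneg hγ.le h4, mul_nonneg hγ.le (mul_nonneg h3 h4)]
      refine (norm_sub_le _ _).trans ((add_le_add h1 h2).trans ?_)
      have h8 := mul_le_mul_of_nonneg_left h7 (show 0 ≤ C * v * v by positivity)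
      linarith
    · simp only [norm_zero]; positivity

end LevelDefect

/-! ### Laurent series and circle integrals -/

section Laurent

variable {G : Type*} [NormedAddCommGroup G] [NormedSpace ℂ G] [CompleteSpace G]

theorem circleIntegral_zpow (k : ℤ) :
    (∮ ξ in C(0, 1), ξ ^ k) = if k = -1 then 2 * Real.pi * Complex.I else 0 := by
  split_ifs with hk
  · have := circleIntegral.integral_sub_center_inv 0 (R := 1) one_ne_zero
    simpa [hk] using this
  · simpa using circleIntegral.integral_sub_zpow_of_ne hk 0 0 1

/-- The circle integral picks the coefficient of `ξ⁻¹`. -/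
theorem two_pi_I_inv_smul_circleIntegral {c : ℤ × ℤ → G} (hc : Summable fun i => ‖c i‖) :
    (2 * Real.pi * Complex.I : ℂ)⁻¹ • (∮ ξ in C(0, 1), ∑' i : ℤ × ℤ, ξ ^ (i.1 + i.2 - 1) • c i) =
      ∑' m : ℤ, c (m, -m) := by
  have hpi : (2 * Real.pi * Complex.I : ℂ) ≠ 0 := Complex.two_pi_I_ne_zero
  have hsum : HasSum (fun i : ℤ × ℤ => ∮ ξ in C(0, 1), ξ ^ (i.1 + i.2 - 1) • c i)
      (∮ ξ in C(0, 1), ∑' i : ℤ × ℤ, ξ ^ (i.1 + i.2 - 1) • c i) := by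
    have h := hasSum_integral_of_norm_le (μ := volume.restrict (Set.Ioc 0 (2 * Real.pi)))
      (F := fun (i : ℤ × ℤ) θ => deriv (circleMap 0 1) θ •
        ((circleMap 0 1 θ) ^ (i.1 + i.2 - 1) • c i)) (c := fun i => ‖c i‖)
      (fun i => ?_) (fun i => ae_of_all _ fun θ => ?_) hc
    · simp only [circleIntegral, intervalIntegral.integral_of_le Real.two_pi_pos.le]
      simp only [tsum_const_smul''] at h
      exact h
    · refine Continuous.aestronglyMeasurable ?_
      have h1 : Continuous fun θ => circleMap 0 1 θ ^ (i.1 + i.2 - 1) :=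
        (continuous_circleMap 0 1).zpow₀ _ fun θ => Or.inl (circleMap_ne_center one_ne_zero)
      simp only [deriv_circleMap]
      exact ((continuous_circleMap 0 1).mul continuous_const).smul (h1.smul continuous_const)
    · simp [norm_smul, deriv_circleMap, norm_zpow]
  have hterm : ∀ i : ℤ × ℤ, (2 * Real.pi * Complex.I : ℂ)⁻¹ •
      (∮ ξ in C(0, 1), ξ ^ (i.1 + i.2 - 1) • c i) = if i.2 = -i.1 then c i else 0 := by
    intro i
    rw [circleIntegral.integral_smul_const, circleIntegral_zpow, smul_smul]
    by_cases h : i.2 = -i.1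
    · have h1 : i.1 + i.2 - 1 = -1 := by omega
      rw [if_pos h1, if_pos h, inv_mul_cancel₀ hpi, one_smul]
    · have h1 : i.1 + i.2 - 1 ≠ -1 := by omega
      rw [if_neg h1, if_neg h, mul_zero, zero_smul]
  have h2 := hsum.const_smul (2 * Real.pi * Complex.I : ℂ)⁻¹
  rw [← h2.tsum_eq]
  simp only [hterm]
  have hc' : Summable fun i : ℤ × ℤ => if i.2 = -i.1 then c i else 0 := by
    refine Summable.of_norm_bounded hc fun i => ?_
    split_ifs <;> simp
  rw [hc'.tsum_prod]
  refine tsum_congr fun m => ?_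
  rw [tsum_eq_single (-m)]
  · simp
  · intro k hk
    simp [hk]

/-- The unit circle meets the cut of the principal branch only in `ξ = -1`, a single parameter value
`θ = π`, which the integral ignores. -/
theorem circleIntegral_congr_slitPlane {f g : ℂ → G}
    (h : ∀ ξ ∈ Complex.slitPlane, ‖ξ‖ = 1 → f ξ = g ξ) :
    (∮ ξ in C(0, 1), f ξ) = ∮ ξ in C(0, 1), g ξ := by
  refine intervalIntegral.integral_congr_ae ?_
  have h1 : ∀ᵐ θ : ℝ, θ ≠ Real.pi := by
    simp [ae_iff]
  filter_upwards [h1] with θ hθ hI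
  rw [Set.uIoc_of_le Real.two_pi_pos.le] at hI
  have hn : ‖circleMap 0 1 θ‖ = 1 := by simp
  have hs : circleMap 0 1 θ ∈ Complex.slitPlane := by
    have h2 : circleMap 0 1 θ = Complex.exp (θ * Complex.I) := by simp [circleMap]
    rw [h2, Complex.mem_slitPlane_iff, Complex.exp_ofReal_mul_I_re, Complex.exp_ofReal_mul_I_im]
    by_contra hcon
    push Not at hcon
    obtain ⟨hre, him⟩ := hcon
    have hsin : Real.sin (θ - Real.pi) = 0 := by rw [Real.sin_sub_pi, him, neg_zero]
    have h3 : θ - Real.pi ≠ 0 := sub_ne_zero.2 hθ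
    rcases lt_or_ge θ (2 * Real.pi) with hlt | hge
    · have := (Real.sin_eq_zero_iff_of_lt_of_lt (by linarith [hI.1]) (by linarith)).1 hsin
      exact h3 this
    · have : θ = 2 * Real.pi := le_antisymm hI.2 hge
      rw [this, Real.cos_two_pi] at hre
      linarith
  simp only [h _ hs hn]

theorem norm_zpow_le_pow_natAbs {ζ : ℂ} {R : ℝ} (h1 : ‖ζ‖ ≤ R) (h2 : ‖ζ‖⁻¹ ≤ R)
    (m : ℤ) : ‖ζ ^ m‖ ≤ R ^ m.natAbs := by
  obtain ⟨k, rfl | rfl⟩ := m.eq_nat_or_neg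
  · simpa using pow_le_pow_left₀ (norm_nonneg _) h1 k
  · simpa using pow_le_pow_left₀ (inv_nonneg.2 (norm_nonneg _)) h2 k

theorem summable_zpow_smul {A : ℤ → G} {C γ : ℝ} (hγ : 0 < γ)
    (hA : ∀ m, ‖A m‖ ≤ C * Real.exp (-γ * (m : ℝ) ^ 2)) {ξ : ℂ} (hξ : ξ ≠ 0) :
    Summable fun m : ℤ => ‖ξ ^ m • A m‖ := by
  have hC : 0 ≤ C := by simpa using (norm_nonneg _).trans (hA 0)
  set R := max ‖ξ‖ ‖ξ‖⁻¹
  have hR : 0 < R := lt_max_of_lt_left (norm_pos_iff.2 hξ)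
  refine Summable.of_nonneg_of_le (fun _ => norm_nonneg _) (fun m => ?_)
    ((summable_pow_mul_exp_neg_sq hγ hR).mul_left C)
  rw [norm_smul]
  calc _ ≤ R ^ m.natAbs * (C * Real.exp (-γ * (m : ℝ) ^ 2)) :=
        mul_le_mul (norm_zpow_le_pow_natAbs (le_max_left _ _) (le_max_right _ _) m) (hA m)
          (norm_nonneg _) (by positivity)
    _ = C * (1 * (R ^ m.natAbs * Real.exp (-γ * (m : ℝ) ^ 2))) := by ring
    _ ≤ _ := by
        gcongr
        linarith [abs_nonneg (m : ℝ)]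

/-- Laurent series with Gaussian coefficients can be differentiated termwise. -/
theorem hasDerivAt_tsum_zpow_smul {A : ℤ → G} {C γ : ℝ} (hγ : 0 < γ)
    (hA : ∀ m, ‖A m‖ ≤ C * Real.exp (-γ * (m : ℝ) ^ 2)) {ξ : ℂ} (hξ : ξ ≠ 0) :
    HasDerivAt (fun ζ : ℂ => ∑' m : ℤ, ζ ^ m • A m) (∑' m : ℤ, ((m : ℂ) * ξ ^ (m - 1)) • A m) ξ ∧
      Summable fun m : ℤ => ‖((m : ℂ) * ξ ^ (m - 1)) • A m‖ := by
  have hC : 0 ≤ C := by simpa using (norm_nonneg _).trans (hA 0)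
  have hpos : 0 < ‖ξ‖ := norm_pos_iff.2 hξ
  set t := Metric.ball ξ (‖ξ‖ / 2)
  have hlow : ∀ ζ ∈ t, ‖ξ‖ / 2 ≤ ‖ζ‖ := fun ζ hζ => by
    have h1 : ‖ξ - ζ‖ < ‖ξ‖ / 2 := by rw [← dist_eq_norm, dist_comm]; exact hζ
    have := norm_sub_norm_le ξ ζ
    linarith
  have hup : ∀ ζ ∈ t, ‖ζ‖ ≤ 2 * ‖ξ‖ := fun ζ hζ => by
    have h1 : ‖ζ - ξ‖ < ‖ξ‖ / 2 := by rw [← dist_eq_norm]; exact hζ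
    have := norm_sub_norm_le ζ ξ
    linarith
  have hne : ∀ ζ ∈ t, ζ ≠ 0 := fun ζ hζ => norm_pos_iff.1 (by linarith [hlow ζ hζ])
  -- `R` bounds both `‖ζ‖` and `‖ζ‖⁻¹` on the ball `t`, so `R ^ |m|` bounds `ζ ^ m` for either sign
  -- of `m`.
  set R := max (2 * ‖ξ‖) (‖ξ‖ / 2)⁻¹
  have hR : 0 < R := lt_max_of_lt_left (by positivity)
  set u : ℤ → ℝ := fun m => C * (‖ξ‖ / 2)⁻¹ *
    ((|(m : ℝ)| + 1) * (R ^ m.natAbs * Real.exp (-γ * (m : ℝ) ^ 2)))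
  have hu : Summable u := (summable_pow_mul_exp_neg_sq hγ hR).mul_left _
  have hbound : ∀ (m : ℤ) (ζ : ℂ), ζ ∈ t → ‖((m : ℂ) * ζ ^ (m - 1)) • A m‖ ≤ u m := by
    intro m ζ hζ
    have h1 : ‖ζ ^ m‖ ≤ R ^ m.natAbs := norm_zpow_le_pow_natAbs
      ((hup ζ hζ).trans (le_max_left _ _))
      ((inv_anti₀ (by positivity) (hlow ζ hζ)).trans (le_max_right _ _)) m
    have h2 : ‖ζ ^ (m - 1)‖ ≤ R ^ m.natAbs * (‖ξ‖ / 2)⁻¹ := by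
      rw [zpow_sub_one₀ (hne ζ hζ), norm_mul, norm_inv]
      exact mul_le_mul h1 (inv_anti₀ (by positivity) (hlow ζ hζ)) (by positivity) (by positivity)
    have h3 : ‖(m : ℂ)‖ ≤ |(m : ℝ)| + 1 := by
      rw [show (m : ℂ) = ((m : ℝ) : ℂ) by simp, Complex.norm_real, Real.norm_eq_abs]; linarith
    rw [norm_smul, norm_mul]
    calc _ ≤ ((|(m : ℝ)| + 1) * (R ^ m.natAbs * (‖ξ‖ / 2)⁻¹)) *
          (C * Real.exp (-γ * (m : ℝ) ^ 2)) := by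
          refine mul_le_mul ?_ (hA m) (norm_nonneg _) (by positivity)
          exact mul_le_mul h3 h2 (norm_nonneg _) (by positivity)
      _ = _ := by simp only [u]; ring
  have hmem : ξ ∈ t := Metric.mem_ball_self (by positivity)
  refine ⟨?_, Summable.of_nonneg_of_le (fun _ => norm_nonneg _) (fun m => hbound m ξ hmem) hu⟩
  exact hasDerivAt_tsum_of_isPreconnected (g := fun (m : ℤ) (ζ : ℂ) => ζ ^ m • A m)
    (g' := fun (m : ℤ) (ζ : ℂ) => ((m : ℂ) * ζ ^ (m - 1)) • A m) hu Metric.isOpen_ball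
    (convex_ball ξ _).isPreconnected
    (fun m ζ hζ => (hasDerivAt_zpow m ζ (Or.inl (hne ζ hζ))).smul_const (A m)) hbound hmem
    (summable_zpow_smul hγ hA hξ).of_norm hmem

/-- The product rule adds the exponent `c` of the prefactor to the exponent `m` of each term. With
`c = f(x) - f(x')` the resulting weight `c + m` is the difference of the coordinates of `x + m` and
`x'`. -/
theorem hasDerivAt_cpow_smul_tsum {A : ℤ → G} {C γ : ℝ} (hγ : 0 < γ)
    (hA : ∀ m, ‖A m‖ ≤ C * Real.exp (-γ * (m : ℝ) ^ 2)) {ξ : ℂ} (hξ : ξ ∈ Complex.slitPlane) (c : ℂ) :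
    HasDerivAt (fun ζ : ℂ => ζ ^ c • ∑' m : ℤ, ζ ^ m • A m)
      (ξ ^ c • ∑' m : ℤ, ((c + m) * ξ ^ (m - 1)) • A m) ξ := by
  have h0 := Complex.slitPlane_ne_zero hξ
  obtain ⟨h1, h2⟩ := hasDerivAt_tsum_zpow_smul hγ hA h0
  have h3 : HasDerivAt (fun ζ : ℂ => ζ ^ c) (c * ξ ^ (c - 1)) ξ := by
    simpa using (hasDerivAt_id ξ).cpow_const (c := c) hξ
  have h4 := h3.fun_smul h1
  convert h4 using 1
  have h5 : ∀ m : ℤ, ((c + m) * ξ ^ (m - 1)) • A m =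
      (c * ξ⁻¹) • ξ ^ m • A m + ((m : ℂ) * ξ ^ (m - 1)) • A m := by
    intro m
    rw [zpow_sub_one₀ h0, smul_smul, ← add_smul]
    congr 1
    ring
  simp only [h5]
  rw [Summable.tsum_add ((summable_zpow_smul hγ hA h0).of_norm.const_smul _) h2.of_norm,
    Summable.tsum_const_smul _ (summable_zpow_smul hγ hA h0).of_norm, smul_add, smul_smul, add_comm]
  congr 2
  rw [Complex.cpow_sub _ _ h0, Complex.cpow_one]
  field_simp

end Laurent

/-! ### The contour integrals of the defect formula -/

section FourierDefect

variable {G : Type*} [NormedAddCommGroup G] [NormedSpace ℂ G] [CompleteSpace G]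
  {Y : Type*} [MeasurableSpace Y] {ν : Measure Y} [IsFiniteMeasure ν]

/-- The circle integrals retain only the terms with `k = -m`. In the first one Fubini turns the
weight `s y` on `b y y' - b y' y` into `s y - s y'` on `b y y'`; the second one has the weight `s y
- s y' + m`. The choice of the fundamental segment drops out in the difference, and `-m` remains. -/
theorem fourier_defect {s : Y → ℝ} (hs : Measurable s) (hs0 : ∀ y, 0 ≤ s y) (hs1 : ∀ y, s y < 1)
    {b : ℤ → ℤ → Y → Y → G} (hb : ∀ m k, StronglyMeasurable (Function.uncurry (b m k)))
    {C γ : ℝ} (hγ : 0 < γ) (hC : 0 ≤ C)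
    (hbd : ∀ m k y y', ‖b m k y y'‖ ≤
      C * (Real.exp (-γ * (m : ℝ) ^ 2) * Real.exp (-γ * (k : ℝ) ^ 2)))
    {T₁ T₂ : ℂ → Y → G}
    (hT₁ : ∀ ξ, ‖ξ‖ = 1 → ∀ y, T₁ ξ y = ∑' i : ℤ × ℤ, ξ ^ (i.1 + i.2) •
      ((∫ y', b i.1 i.2 y y' ∂ν) - ∫ y', b i.1 i.2 y' y ∂ν))
    (hT₂ : ∀ ξ ∈ Complex.slitPlane, ‖ξ‖ = 1 → ∀ y, T₂ ξ y = ∑' i : ℤ × ℤ, ξ ^ (i.1 + i.2 - 1) •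
      ∫ y', ((s y : ℂ) - s y' + i.1) • b i.1 i.2 y y' ∂ν) :
    ((2 * Real.pi * Complex.I : ℂ)⁻¹ • ∮ ξ in C(0, 1), ξ⁻¹ • ∫ y, (s y : ℂ) • T₁ ξ y ∂ν) -
      (2 * Real.pi * Complex.I : ℂ)⁻¹ • ∮ ξ in C(0, 1), ∫ y, T₂ ξ y ∂ν =
      -∑' m : ℤ, (m : ℂ) • ∫ y, ∫ y', b m (-m) y y' ∂ν ∂ν := by
  set V := ν.real Set.univ
  have hV : 0 ≤ V := measureReal_nonneg
  set e : ℤ × ℤ → ℝ := fun i => (|(i.1 : ℝ)| + 1) * Real.exp (-γ * (i.1 : ℝ) ^ 2) *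
      ((|(i.2 : ℝ)| + 1) * Real.exp (-γ * (i.2 : ℝ) ^ 2))
  have he : Summable e := summable_prod_exp_neg_sq hγ
  have he0 : ∀ i, 0 ≤ e i := fun i => by positivity
  have hbe : ∀ (i : ℤ × ℤ) y y', (|(i.1 : ℝ)| + 1) * ‖b i.1 i.2 y y'‖ ≤ C * e i := by
    intro i y y'
    calc _ ≤ (|(i.1 : ℝ)| + 1) * (C * (Real.exp (-γ * (i.1 : ℝ) ^ 2) *
          Real.exp (-γ * (i.2 : ℝ) ^ 2))) := by gcongr; exact hbd _ _ _ _
      _ = C * ((|(i.1 : ℝ)| + 1) * Real.exp (-γ * (i.1 : ℝ) ^ 2) *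
          (1 * Real.exp (-γ * (i.2 : ℝ) ^ 2))) := by ring
      _ ≤ C * e i := by
          simp only [e]
          gcongr
          linarith [abs_nonneg (i.2 : ℝ)]
  have hbe' : ∀ (i : ℤ × ℤ) y y', ‖b i.1 i.2 y y'‖ ≤ C * e i := fun i y y' =>
    (le_mul_of_one_le_left (norm_nonneg _) (by linarith [abs_nonneg (i.1 : ℝ)])).trans (hbe i y y')
  have hsc : Measurable fun y => (s y : ℂ) := Complex.measurable_ofReal.comp hs
  have hsn : ∀ y, ‖(s y : ℂ)‖ ≤ 1 := fun y => by
    rw [Complex.norm_real, Real.norm_eq_abs, abs_of_nonneg (hs0 y)]; exact (hs1 y).le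
  have hwn : ∀ y y' (m : ℤ), ‖(s y : ℂ) - s y' + m‖ ≤ |(m : ℝ)| + 1 := by
    intro y y' m
    have h1 : (s y : ℂ) - s y' + m = ((s y - s y' + m : ℝ) : ℂ) := by push_cast; rfl
    rw [h1, Complex.norm_real, Real.norm_eq_abs]
    have h2 : |s y - s y'| ≤ 1 := abs_le.2 ⟨by linarith [hs0 y, hs1 y'], by linarith [hs0 y', hs1 y]⟩
    linarith [abs_add_le (s y - s y') m]
  have hbs : ∀ m k, StronglyMeasurable (Function.uncurry fun y y' => b m k y' y) := fun m k =>
    (hb m k).comp_measurable measurable_swap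
  have hI : ∀ (f : Y → G) (c : ℝ), (∀ y, ‖f y‖ ≤ c) → ‖∫ y, f y ∂ν‖ ≤ c * V := fun f c hf =>
    norm_integral_le_of_norm_le_const (ae_of_all _ hf)
  set c₁ : ℤ × ℤ → G := fun i => ∫ y, (s y : ℂ) •
    ((∫ y', b i.1 i.2 y y' ∂ν) - ∫ y', b i.1 i.2 y' y ∂ν) ∂ν
  set c₂ : ℤ × ℤ → G := fun i => ∫ y, ∫ y', ((s y : ℂ) - s y' + i.1) • b i.1 i.2 y y' ∂ν ∂ν
  have hb1 : ∀ (i : ℤ × ℤ) y,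
      ‖(s y : ℂ) • ((∫ y', b i.1 i.2 y y' ∂ν) - ∫ y', b i.1 i.2 y' y ∂ν)‖ ≤ 2 * C * V * e i := by
    intro i y
    rw [norm_smul]
    refine (mul_le_of_le_one_left (norm_nonneg _) (hsn y)).trans ((norm_sub_le _ _).trans ?_)
    have h1 := hI _ _ (hbe' i y)
    have h2 := hI _ _ fun y' => hbe' i y' y
    linarith
  have hb2 : ∀ (i : ℤ × ℤ) y y', ‖((s y : ℂ) - s y' + i.1) • b i.1 i.2 y y'‖ ≤ C * e i :=
    fun i y y' => by
      rw [norm_smul]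
      exact (mul_le_mul_of_nonneg_right (hwn y y' i.1) (norm_nonneg _)).trans (hbe i y y')
  have hm1 : ∀ i : ℤ × ℤ, StronglyMeasurable fun y =>
      (s y : ℂ) • ((∫ y', b i.1 i.2 y y' ∂ν) - ∫ y', b i.1 i.2 y' y ∂ν) := fun i =>
    hsc.stronglyMeasurable.smul
      ((hb i.1 i.2).integral_prod_right.sub (hbs i.1 i.2).integral_prod_right)
  have hm2' : ∀ i : ℤ × ℤ, StronglyMeasurable (Function.uncurry fun y y' =>
      ((s y : ℂ) - s y' + i.1) • b i.1 i.2 y y') := fun i =>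
    (((hsc.comp measurable_fst).sub (hsc.comp measurable_snd)).add_const
      (i.1 : ℂ)).stronglyMeasurable.smul (hb i.1 i.2)
  have hm2 : ∀ i : ℤ × ℤ, StronglyMeasurable fun y =>
      ∫ y', ((s y : ℂ) - s y' + i.1) • b i.1 i.2 y y' ∂ν := fun i => (hm2' i).integral_prod_right
  have hsum1 : Summable fun i => ‖c₁ i‖ := by
    refine Summable.of_nonneg_of_le (fun _ => norm_nonneg _) (fun i => hI _ _ (hb1 i)) ?_
    exact (he.mul_left _).mul_right V
  have hsum2 : Summable fun i => ‖c₂ i‖ := by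
    refine Summable.of_nonneg_of_le (fun _ => norm_nonneg _)
      (fun i => hI _ _ fun y => hI _ _ (hb2 i y)) ?_
    exact ((he.mul_left _).mul_right V).mul_right V
  have hint1 : ∀ ξ : ℂ, ‖ξ‖ = 1 → ξ⁻¹ • ∫ y, (s y : ℂ) • T₁ ξ y ∂ν =
      ∑' i : ℤ × ℤ, ξ ^ (i.1 + i.2 - 1) • c₁ i := by
    intro ξ hξ
    have hξ0 : ξ ≠ 0 := norm_pos_iff.1 (by rw [hξ]; exact one_pos)
    have h := hasSum_integral_of_norm_le (μ := ν) (F := fun (i : ℤ × ℤ) y => ξ ^ (i.1 + i.2) •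
      ((s y : ℂ) • ((∫ y', b i.1 i.2 y y' ∂ν) - ∫ y', b i.1 i.2 y' y ∂ν)))
      (c := fun i => 2 * C * V * e i)
      (fun i => ((hm1 i).const_smul _).aestronglyMeasurable)
      (fun i => ae_of_all _ fun y => by
        rw [norm_smul, norm_zpow, hξ, one_zpow, one_mul]; exact hb1 i y) (he.mul_left _)
    have h1 : ∀ y, (s y : ℂ) • T₁ ξ y = ∑' i : ℤ × ℤ, ξ ^ (i.1 + i.2) •
        ((s y : ℂ) • ((∫ y', b i.1 i.2 y y' ∂ν) - ∫ y', b i.1 i.2 y' y ∂ν)) := by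
      intro y
      rw [hT₁ ξ hξ y, ← Summable.tsum_const_smul]
      · exact tsum_congr fun i => smul_comm _ _ _
      · refine Summable.of_norm_bounded (he.mul_left (2 * C * V)) fun i => ?_
        rw [norm_smul, norm_zpow, hξ, one_zpow, one_mul]
        have h1 := hI _ _ (hbe' i y)
        have h2 := hI _ _ fun y' => hbe' i y' y
        exact (norm_sub_le _ _).trans (by linarith)
    simp only [h1]
    rw [← (h.const_smul ξ⁻¹).tsum_eq]
    refine tsum_congr fun i => ?_
    rw [integral_smul, smul_smul, zpow_sub_one₀ hξ0, mul_comm]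
  have hint2 : ∀ ξ ∈ Complex.slitPlane, ‖ξ‖ = 1 → ∫ y, T₂ ξ y ∂ν =
      ∑' i : ℤ × ℤ, ξ ^ (i.1 + i.2 - 1) • c₂ i := by
    intro ξ hξs hξ
    have h := hasSum_integral_of_norm_le (μ := ν) (F := fun (i : ℤ × ℤ) y => ξ ^ (i.1 + i.2 - 1) •
      ∫ y', ((s y : ℂ) - s y' + i.1) • b i.1 i.2 y y' ∂ν)
      (c := fun i => C * e i * V)
      (fun i => ((hm2 i).const_smul _).aestronglyMeasurable)
      (fun i => ae_of_all _ fun y => by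
        rw [norm_smul, norm_zpow, hξ, one_zpow, one_mul]; exact hI _ _ (hb2 i y))
      ((he.mul_left _).mul_right _)
    simp only [hT₂ ξ hξs hξ]
    rw [← h.tsum_eq]
    exact tsum_congr fun i => integral_smul _ _
  have hcirc1 : (∮ ξ in C(0, 1), ξ⁻¹ • ∫ y, (s y : ℂ) • T₁ ξ y ∂ν) =
      ∮ ξ in C(0, 1), ∑' i : ℤ × ℤ, ξ ^ (i.1 + i.2 - 1) • c₁ i :=
    circleIntegral_congr_slitPlane fun ξ _ hξ => hint1 ξ hξ
  have hcirc2 : (∮ ξ in C(0, 1), ∫ y, T₂ ξ y ∂ν) =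
      ∮ ξ in C(0, 1), ∑' i : ℤ × ℤ, ξ ^ (i.1 + i.2 - 1) • c₂ i :=
    circleIntegral_congr_slitPlane hint2
  rw [hcirc1, hcirc2, two_pi_I_inv_smul_circleIntegral hsum1, two_pi_I_inv_smul_circleIntegral hsum2]
  have hinj : Function.Injective fun m : ℤ => (m, -m) := fun a b h => (Prod.ext_iff.1 h).1
  have hs1' : Summable fun m : ℤ => c₁ (m, -m) := hsum1.of_norm.comp_injective hinj
  have hs2' : Summable fun m : ℤ => c₂ (m, -m) := hsum2.of_norm.comp_injective hinj
  rw [← Summable.tsum_sub hs1' hs2', ← tsum_neg]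
  refine tsum_congr fun m => ?_
  have hIntb : ∀ (f : Y → Y → G), StronglyMeasurable (Function.uncurry f) →
      (∀ y y', ‖f y y'‖ ≤ C * e (m, -m)) → Integrable (Function.uncurry f) (ν.prod ν) := fun f hf hf' =>
    Integrable.mono' (integrable_const (C * e (m, -m))) hf.aestronglyMeasurable
      (ae_of_all _ fun q => hf' q.1 q.2)
  have i1 : Integrable (Function.uncurry fun y y' => (s y : ℂ) • b m (-m) y y') (ν.prod ν) := by
    refine hIntb _ ((hsc.comp measurable_fst).stronglyMeasurable.smul (hb m (-m))) fun y y' => ?_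
    rw [norm_smul]
    exact (mul_le_of_le_one_left (norm_nonneg _) (hsn y)).trans (hbe' (m, -m) y y')
  have i2 : Integrable (Function.uncurry fun y y' => (s y : ℂ) • b m (-m) y' y) (ν.prod ν) := by
    refine hIntb _ ((hsc.comp measurable_fst).stronglyMeasurable.smul (hbs m (-m))) fun y y' => ?_
    rw [norm_smul]
    exact (mul_le_of_le_one_left (norm_nonneg _) (hsn y)).trans (hbe' (m, -m) y' y)
  have i3 : Integrable (Function.uncurry fun y y' => (s y' : ℂ) • b m (-m) y y') (ν.prod ν) := by
    refine hIntb _ ((hsc.comp measurable_snd).stronglyMeasurable.smul (hb m (-m))) fun y y' => ?_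
    rw [norm_smul]
    exact (mul_le_of_le_one_left (norm_nonneg _) (hsn y')).trans (hbe' (m, -m) y y')
  have i4 : Integrable (Function.uncurry fun y y' => (m : ℂ) • b m (-m) y y') (ν.prod ν) :=
    (hIntb _ (hb m (-m)) fun y y' => hbe' (m, -m) y y').smul (m : ℂ)
  have hc1 : c₁ (m, -m) = (∫ y, ∫ y', (s y : ℂ) • b m (-m) y y' ∂ν ∂ν) -
      ∫ y, ∫ y', (s y' : ℂ) • b m (-m) y y' ∂ν ∂ν := by
    -- Renaming the two variables moves the weight from the first point to the second.
    have hsw : ∫ y, ∫ y', (s y : ℂ) • b m (-m) y' y ∂ν ∂ν =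
        ∫ y, ∫ y', (s y' : ℂ) • b m (-m) y y' ∂ν ∂ν := integral_integral_swap i2
    have i1' : Integrable (fun y => ∫ y', (s y : ℂ) • b m (-m) y y' ∂ν) ν := i1.integral_prod_left
    have i2' : Integrable (fun y => ∫ y', (s y : ℂ) • b m (-m) y' y ∂ν) ν := i2.integral_prod_left
    rw [← hsw, ← integral_sub i1' i2']
    refine integral_congr_ae (ae_of_all _ fun y => ?_)
    simp only [smul_sub, integral_smul]
  have hc2 : c₂ (m, -m) = (∫ y, ∫ y', (s y : ℂ) • b m (-m) y y' ∂ν ∂ν) -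
      (∫ y, ∫ y', (s y' : ℂ) • b m (-m) y y' ∂ν ∂ν) +
        ∫ y, ∫ y', (m : ℂ) • b m (-m) y y' ∂ν ∂ν := by
    have i13 : Integrable (fun q : Y × Y =>
        (s q.1 : ℂ) • b m (-m) q.1 q.2 - (s q.2 : ℂ) • b m (-m) q.1 q.2) (ν.prod ν) := i1.sub i3
    rw [integral_integral i1, integral_integral i3, integral_integral i4,
      ← integral_sub (f := fun q : Y × Y => (s q.1 : ℂ) • b m (-m) q.1 q.2)
        (g := fun q : Y × Y => (s q.2 : ℂ) • b m (-m) q.1 q.2) i1 i3,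
      ← integral_add (g := fun q : Y × Y => (m : ℂ) • b m (-m) q.1 q.2) i13 i4]
    have i5 : Integrable (Function.uncurry fun y y' =>
        ((s y : ℂ) - s y' + m) • b m (-m) y y') (ν.prod ν) :=
      hIntb _ (hm2' (m, -m)) (hb2 (m, -m))
    simp only [c₂]
    rw [integral_integral i5]
    refine integral_congr_ae (ae_of_all _ fun q => ?_)
    simp only [sub_smul, add_smul]
  rw [hc1, hc2]
  simp only [integral_smul]
  abel

end FourierDefect

/-! ### Products of absolutely convergent series under bilinear maps -/

theorem summable_norm_bilinear {ι κ E₁ E₂ E₃ : Type*} [NormedAddCommGroup E₁] [NormedSpace ℂ E₁]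
    [NormedAddCommGroup E₂] [NormedSpace ℂ E₂] [NormedAddCommGroup E₃] [NormedSpace ℂ E₃]
    (B : E₁ →L[ℂ] E₂ →L[ℂ] E₃) {f : ι → E₁} {g : κ → E₂} (hf : Summable fun i => ‖f i‖)
    (hg : Summable fun i => ‖g i‖) : Summable fun i : ι × κ => ‖B (f i.1) (g i.2)‖ := by
  refine Summable.of_nonneg_of_le (fun _ => norm_nonneg _) (fun i => B.le_opNorm₂ _ _) ?_
  have := (hf.mul_of_nonneg hg (fun _ => norm_nonneg _) fun _ => norm_nonneg _).mul_left ‖B‖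
  simpa only [mul_assoc] using this

theorem bilinear_tsum_tsum {ι κ E₁ E₂ E₃ : Type*} [NormedAddCommGroup E₁] [NormedSpace ℂ E₁]
    [NormedAddCommGroup E₂] [NormedSpace ℂ E₂] [NormedAddCommGroup E₃] [NormedSpace ℂ E₃]
    [CompleteSpace E₁] [CompleteSpace E₂] [CompleteSpace E₃]
    (B : E₁ →L[ℂ] E₂ →L[ℂ] E₃) {f : ι → E₁} {g : κ → E₂} (hf : Summable fun i => ‖f i‖)
    (hg : Summable fun i => ‖g i‖) :
    B (∑' i, f i) (∑' k, g k) = ∑' i : ι × κ, B (f i.1) (g i.2) := by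
  rw [(summable_norm_bilinear B hf hg).of_norm.tsum_prod, B.map_tsum hf.of_norm]
  have h1 : (∑' i, B (f i)) (∑' k, g k) = ∑' i, B (f i) (∑' k, g k) :=
    (ContinuousLinearMap.apply ℂ E₃ (∑' k, g k)).map_tsum (B.summable hf.of_norm)
  rw [h1]
  exact tsum_congr fun i => (B (f i)).map_tsum hg.of_norm

/-! ### The lifted measure and its decomposition into segments -/

section CoverMeasure

variable {Y : Type*} [TopologicalSpace Y] [MeasurableSpace Y] [BorelSpace Y] {f₀ : Y → Circle}
  {ν : Measure Y}

/-- The summand with index `m` of the lifted measure is carried by the points with `⌊f⌋ = m`, so the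
fundamental segment sees the summand `m = 0` alone. -/
theorem restrict_segment_coverMeasure (hf : Continuous f₀) :
    (coverMeasure f₀ ν).restrict (segment f₀) = ν.map (segmentPoint f₀ 0) := by
  have hseg : segment f₀ = Set.range (segmentPoint f₀ 0) := by
    ext ⟨t, y⟩
    constructor
    · rintro ⟨hc, h0, h1⟩
      refine ⟨y, Prod.ext ?_ rfl⟩
      have := eq_segmentCoord_add_floor hc
      rw [Int.floor_eq_zero_iff.2 ⟨h0, h1⟩] at this
      exact this.symm
    · rintro ⟨y', h⟩
      rw [← h]
      refine ⟨segmentPoint_mem_cover 0 y', ?_, ?_⟩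
      · simpa [segmentPoint] using segmentCoord_nonneg y'
      · simpa [segmentPoint] using segmentCoord_lt_one y'
  have hm := fun m => measurableEmbedding_segmentPoint hf m
  have hsm : MeasurableSet (segment f₀) := hseg ▸ (hm 0).measurableSet_range
  refine Measure.ext fun A hA => ?_
  rw [Measure.restrict_apply hA, coverMeasure, Measure.sum_apply _ (hA.inter hsm),
    tsum_eq_single 0]
  · rw [Measure.map_apply (hm 0).measurable hA]
    refine (Measure.map_apply (hm 0).measurable (hA.inter hsm)).trans ?_
    congr 1
    ext y
    simp only [Set.mem_preimage, Set.mem_inter_iff, hseg, Set.mem_range_self, and_true]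
  · intro m hm0
    refine (Measure.map_apply (hm m).measurable (hA.inter hsm)).trans ?_
    convert measure_empty (μ := ν)
    refine Set.eq_empty_of_forall_notMem fun y hy => hm0 ?_
    have h1 := hy.2
    rw [hseg] at h1
    obtain ⟨y', hy'⟩ := h1
    rw [← floor_segmentPoint (f₀ := f₀) m y, ← hy', floor_segmentPoint]

theorem setIntegral_segment {G : Type*} [NormedAddCommGroup G] [NormedSpace ℝ G]
    (hf : Continuous f₀) (g : ℝ × Y → G) :
    ∫ x in segment f₀, g x ∂(coverMeasure f₀ ν) = ∫ y, g (segmentPoint f₀ 0 y) ∂ν := by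
  rw [restrict_segment_coverMeasure hf, (measurableEmbedding_segmentPoint hf 0).integral_map]

theorem aestronglyMeasurable_coverMeasure {G : Type*} [NormedAddCommGroup G] (hf : Continuous f₀)
    {g : ℝ × Y → G} (hg : ∀ m, StronglyMeasurable fun y => g (segmentPoint f₀ m y)) :
    AEStronglyMeasurable g (coverMeasure f₀ ν) :=
  aestronglyMeasurable_sum_measure_iff.2 fun m =>
    (measurableEmbedding_segmentPoint hf m).aestronglyMeasurable_map_iff.2
      (hg m).aestronglyMeasurable

theorem hasSum_integral_coverMeasure {G : Type*} [NormedAddCommGroup G] [NormedSpace ℝ G]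
    (hf : Continuous f₀) {g : ℝ × Y → G} (hg : Integrable g (coverMeasure f₀ ν)) :
    HasSum (fun m => ∫ y, g (segmentPoint f₀ m y) ∂ν) (∫ x, g x ∂(coverMeasure f₀ ν)) := by
  have h := hasSum_integral_measure hg
  convert h using 2 with m
  · exact ((measurableEmbedding_segmentPoint hf m).integral_map _).symm
  · rfl

theorem integrable_coverMeasure {G : Type*} [NormedAddCommGroup G] [IsFiniteMeasure ν]
    (hf : Continuous f₀) {g : ℝ × Y → G}
    (hg : ∀ m, StronglyMeasurable fun y => g (segmentPoint f₀ m y)) {c : ℤ → ℝ} (hc : Summable c)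
    (hb : ∀ m y, ‖g (segmentPoint f₀ m y)‖ ≤ c m) : Integrable g (coverMeasure f₀ ν) := by
  rcases isEmpty_or_nonempty Y with hY | ⟨⟨y₀⟩⟩
  · have : ν = 0 := Measure.eq_zero_of_isEmpty ν
    simp [coverMeasure, this]
  have hc0 : ∀ m, 0 ≤ c m := fun m => (norm_nonneg _).trans (hb m y₀)
  refine ⟨aestronglyMeasurable_coverMeasure hf hg, ?_⟩
  rw [HasFiniteIntegral, coverMeasure, lintegral_sum_measure]
  have h1 : ∀ m : ℤ, ∫⁻ x, ‖g x‖ₑ ∂(ν.map fun y => (segmentCoord f₀ y + m, y)) ≤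
      ENNReal.ofReal (c m) * ν Set.univ := by
    intro m
    refine ((measurableEmbedding_segmentPoint hf m).lintegral_map _).trans_le ?_
    rw [← lintegral_const]
    refine lintegral_mono fun y => ?_
    rw [← ofReal_norm]
    exact ENNReal.ofReal_le_ofReal (hb m y)
  refine (ENNReal.tsum_le_tsum h1).trans_lt ?_
  rw [ENNReal.tsum_mul_right, ← ENNReal.ofReal_tsum_of_nonneg hc0 hc]
  exact ENNReal.mul_lt_top ENNReal.ofReal_lt_top (measure_lt_top _ _)

end CoverMeasure

/-! ### Gradings, periodic kernels and their indicial families -/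

section Gradings

variable {Ω : Type*} [MeasurableSpace Ω] {V : Ω → Type*} [∀ x, NormedAddCommGroup (V x)]
  [∀ x, InnerProductSpace ℂ (V x)] {F : Type*} [NormedAddCommGroup F] [NormedSpace ℂ F]

/-- A measurable family of isometric involutions. -/
structure IsGrading (T : ∀ x, V x ≃L[ℂ] F) (τ : ∀ x, V x →L[ℂ] V x) : Prop where
  norm_le : ∀ x, ‖τ x‖ ≤ 1
  sq : ∀ x, τ x ∘L τ x = ContinuousLinearMap.id ℂ (V x)
  measurable : MeasurableEndIn T τ

end Gradings

section CoverKernels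

variable {W : Type*} [AddCommGroup W] [Module ℂ W] [FiniteDimensional ℂ W]
  {F : Type*} [NormedAddCommGroup F] [NormedSpace ℂ F] [FiniteDimensional ℂ F]
  {Y : Type*} [TopologicalSpace Y] [MeasurableSpace Y] [BorelSpace Y] {f₀ : Y → Circle}
  {V : Y → Type*} [∀ y, NormedAddCommGroup (V y)] [∀ y, InnerProductSpace ℂ (V y)]
  [∀ y, FiniteDimensional ℂ (V y)]
  {T : ∀ y, V y ≃L[ℂ] F} {τ : ∀ y, V y →L[ℂ] V y} {C C' γ : ℝ}
  {N N' : Kernel W fun x : ℝ × Y => V x.2}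

/-- The values of a kernel on the cover at points of given segments. -/
def segmentKernel (f₀ : Y → Circle) (N : Kernel W fun x : ℝ × Y => V x.2) (m k : ℤ) (y y' : Y) :
    Coeff W (V y' →L[ℂ] V y) :=
  N (segmentPoint f₀ m y) (segmentPoint f₀ k y')

/-- A measurable periodic kernel on the cover of `Y`, with Gaussian decay. -/
structure IsPeriodicKernel (f₀ : Y → Circle) (T : ∀ y, V y ≃L[ℂ] F) (C γ : ℝ)
    (N : Kernel W fun x : ℝ × Y => V x.2) : Prop where
  measurable : ∀ m k : ℤ, MeasurableIn (fun q : Y × Y => T q.2) (fun q => T q.1)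
    fun q => segmentKernel f₀ N m k q.1 q.2
  norm_le : ∀ (m k : ℤ) (y y' : Y), ‖segmentKernel f₀ N m k y y'‖ ≤
    C * Real.exp (-γ * ((m : ℝ) - k) ^ 2)
  shift : ∀ (m k j : ℤ) (y y' : Y), segmentKernel f₀ N (m + j) (k + j) y y' =
    segmentKernel f₀ N m k y y'
  pos : 0 < γ
  nonneg : 0 ≤ C

/-- The supertrace `str (N(x, w) N'(w', x'))` for points on the segments with the given numbers. -/
def segmentPairing (f₀ : Y → Circle) (τ : ∀ y, V y →L[ℂ] V y)
    (N N' : Kernel W fun x : ℝ × Y => V x.2) (m k k' m' : ℤ) (y y' : Y) : Form W :=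
  str (τ y) (gradedComp (τ y') (τ y) (segmentKernel f₀ N m k y y')
    (segmentKernel f₀ N' k' m' y' y))

theorem IsPeriodicKernel.norm_gradedComp_le (hτ : IsGrading T τ) (hN : IsPeriodicKernel f₀ T C γ N)
    {V' : Type*} [NormedAddCommGroup V'] [NormedSpace ℂ V'] {y y' : Y} {c : ℝ} (m k : ℤ)
    {l : Coeff W (V' →L[ℂ] V y')} (hl : ‖l‖ ≤ c) :
    ‖gradedComp (τ y') (τ y) (segmentKernel f₀ N m k y y') l‖ ≤
      gradedBound W * C * Real.exp (-γ * ((m : ℝ) - k) ^ 2) * c := by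
  have h1 := gradedBound_nonneg (W := W)
  have h2 := hN.nonneg
  refine (EndPeriodic.norm_gradedComp_le (hτ.norm_le _) (hτ.norm_le _) _ _).trans ?_
  have h3 := hN.norm_le m k y y'
  calc _ ≤ gradedBound W * (C * Real.exp (-γ * ((m : ℝ) - k) ^ 2)) * c :=
        mul_le_mul (mul_le_mul_of_nonneg_left h3 h1) hl (norm_nonneg _) (by positivity)
    _ = _ := by ring

theorem finrank_eq_of_frame (T : ∀ y, V y ≃L[ℂ] F) (y : Y) :
    Module.finrank ℂ (V y) = Module.finrank ℂ F := (T y).toLinearEquiv.finrank_eq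

theorem norm_segmentPairing_le (hτ : IsGrading T τ) (hN : IsPeriodicKernel f₀ T C γ N)
    (hN' : IsPeriodicKernel f₀ T C' γ N') (m k k' m' : ℤ) (y y' : Y) :
    ‖segmentPairing f₀ τ N N' m k k' m' y y'‖ ≤ Module.finrank ℂ F * gradedBound W * C * C' *
      (Real.exp (-γ * ((m : ℝ) - k) ^ 2) * Real.exp (-γ * ((k' : ℝ) - m') ^ 2)) := by
  refine (norm_str_le (hτ.norm_le y) _).trans ?_
  rw [finrank_eq_of_frame T y]
  have := hN.norm_gradedComp_le hτ (y := y) m k (hN'.norm_le k' m' y' y)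
  calc _ ≤ (Module.finrank ℂ F : ℝ) * (gradedBound W * C * Real.exp (-γ * ((m : ℝ) - k) ^ 2) *
        (C' * Real.exp (-γ * ((k' : ℝ) - m') ^ 2))) :=
        mul_le_mul_of_nonneg_left this (by positivity)
    _ = _ := by ring

theorem measurableIn_gradedComp_segment (hτ : IsGrading T τ) (hN : IsPeriodicKernel f₀ T C γ N)
    (hN' : IsPeriodicKernel f₀ T C' γ N') (m k k' m' : ℤ) :
    MeasurableIn (fun q : Y × Y × Y => T q.2.2) (fun q => T q.1) fun q : Y × Y × Y =>
      gradedComp (τ q.2.1) (τ q.1) (segmentKernel f₀ N m k q.1 q.2.1)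
        (segmentKernel f₀ N' k' m' q.2.1 q.2.2) := by
  have m1 : Measurable fun q : Y × Y × Y => (q.1, q.2.1) := by fun_prop
  have m2 : Measurable fun q : Y × Y × Y => (q.2.1, q.2.2) := by fun_prop
  exact MeasurableIn.gradedComp (T₂ := fun q : Y × Y × Y => T q.2.1)
    (hτ.measurable.comp (measurable_fst.comp measurable_snd)) (hτ.measurable.comp measurable_fst)
    ((hN.measurable m k).comp m1) ((hN'.measurable k' m').comp m2)

theorem stronglyMeasurable_gradedComp_segment (hτ : IsGrading T τ)
    (hN : IsPeriodicKernel f₀ T C γ N) (hN' : IsPeriodicKernel f₀ T C' γ N') (m k k' m' : ℤ)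
    (y y'' : Y) : StronglyMeasurable fun y' =>
      gradedComp (τ y') (τ y) (segmentKernel f₀ N m k y y')
        (segmentKernel f₀ N' k' m' y' y'') := by
  have m1 : Measurable fun y' : Y => (y, y', y'') := by fun_prop
  have h := (measurableIn_gradedComp_segment hτ hN hN' m k k' m').comp m1
  exact MeasurableIn.stronglyMeasurable (V := V y'') (V' := V y) (T := T y'') (T' := T y) h

theorem stronglyMeasurable_segmentPairing (hτ : IsGrading T τ) (hN : IsPeriodicKernel f₀ T C γ N)
    (hN' : IsPeriodicKernel f₀ T C' γ N') (m k k' m' : ℤ) :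
    StronglyMeasurable (Function.uncurry (segmentPairing f₀ τ N N' m k k' m')) := by
  have m1 : Measurable fun q : Y × Y => (q.1, q.2, q.1) := by fun_prop
  exact MeasurableIn.str (hτ.measurable.comp measurable_fst)
    ((measurableIn_gradedComp_segment hτ hN hN' m k k' m').comp m1)

theorem segmentPairing_shift (hN : IsPeriodicKernel f₀ T C γ N)
    (hN' : IsPeriodicKernel f₀ T C' γ N') (m k k' m' j : ℤ) (y y' : Y) :
    segmentPairing f₀ τ N N' (m + j) (k + j) k' m' y y' =
      segmentPairing f₀ τ N N' m k k' m' y y' ∧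
    segmentPairing f₀ τ N N' m k (k' + j) (m' + j) y y' =
      segmentPairing f₀ τ N N' m k k' m' y y' := by
  simp only [segmentPairing, hN.shift, hN'.shift, and_self]

theorem segmentPairing_comm (hτ : IsGrading T τ) {p q : ℕ}
    (hp : ∀ (m k : ℤ) (y y' : Y), HasParity (τ y') (τ y) p
      (segmentKernel f₀ N m k y y'))
    (hq : ∀ (m k : ℤ) (y y' : Y), HasParity (τ y') (τ y) q
      (segmentKernel f₀ N' m k y y')) (m k k' m' : ℤ) (y y' : Y) :
    (-1 : ℂ) ^ (p * q) • segmentPairing f₀ τ N' N m k k' m' y y' =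
      segmentPairing f₀ τ N N' k' m' m k y' y :=
  str_gradedComp_comm (hτ.sq y') (hτ.sq y) (hp k' m' y' y) (hq m k y y')

section Compositions

variable {ν : Measure Y} [IsFiniteMeasure ν]

theorem integrable_gradedComp_segment (hτ : IsGrading T τ) (hN : IsPeriodicKernel f₀ T C γ N)
    (hN' : IsPeriodicKernel f₀ T C' γ N') (m k k' m' : ℤ) (y y'' : Y) : Integrable (fun y' =>
      gradedComp (τ y') (τ y) (segmentKernel f₀ N m k y y')
        (segmentKernel f₀ N' k' m' y' y'')) ν :=
  Integrable.mono' (integrable_const _)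
    (stronglyMeasurable_gradedComp_segment hτ hN hN' m k k' m' y y'').aestronglyMeasurable
    (ae_of_all _ fun y' => hN.norm_gradedComp_le hτ m k (hN'.norm_le k' m' y' y''))

theorem integrable_segmentPairing (hτ : IsGrading T τ) (hN : IsPeriodicKernel f₀ T C γ N)
    (hN' : IsPeriodicKernel f₀ T C' γ N') (m k k' m' : ℤ) :
    Integrable (Function.uncurry (segmentPairing f₀ τ N N' m k k' m')) (ν.prod ν) :=
  Integrable.mono' (integrable_const _)
    (stronglyMeasurable_segmentPairing hτ hN hN' m k k' m').aestronglyMeasurable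
    (ae_of_all _ fun q => norm_segmentPairing_le hτ hN hN' m k k' m' q.1 q.2)

theorem str_integral_gradedComp_segment (hτ : IsGrading T τ) (hN : IsPeriodicKernel f₀ T C γ N)
    (hN' : IsPeriodicKernel f₀ T C' γ N') (m k k' m' : ℤ) (y : Y) {c : Y → ℂ} (hc : Measurable c)
    {R : ℝ} (hcb : ∀ y', ‖c y'‖ ≤ R) :
    str (τ y) (∫ y', c y' • gradedComp (τ y') (τ y)
      (segmentKernel f₀ N m k y y')
        (segmentKernel f₀ N' k' m' y' y) ∂ν) =
      ∫ y', c y' • segmentPairing f₀ τ N N' m k k' m' y y' ∂ν := by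
  have hi := (integrable_gradedComp_segment (ν := ν) hτ hN hN' m k k' m' y y).bdd_smul R
    hc.aestronglyMeasurable (ae_of_all _ hcb)
  have h := (strL (W := W) (hτ.norm_le y)).integral_comp_comm hi
  simp only [Pi.smul_apply', map_smul, strL_apply] at h
  exact h.symm

theorem exp_sub_zero_sq (γ : ℝ) (m : ℤ) :
    Real.exp (-γ * ((m : ℝ) - (0 : ℤ)) ^ 2) = Real.exp (-γ * (m : ℝ) ^ 2) := by simp

theorem IsPeriodicKernel.norm_le_zero (hN : IsPeriodicKernel f₀ T C γ N) (m : ℤ) (y y' : Y) :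
    ‖segmentKernel f₀ N m 0 y y'‖ ≤ C * Real.exp (-γ * (m : ℝ) ^ 2) := by
  simpa using hN.norm_le m 0 y y'

theorem IsPeriodicKernel.summable_weighted (hN : IsPeriodicKernel f₀ T C γ N) {φ : ℤ → ℂ}
    (hφ : ∀ m, ‖φ m‖ ≤ |(m : ℝ)| + 1) (y y' : Y) :
    Summable fun m : ℤ => ‖φ m • segmentKernel f₀ N m 0 y y'‖ := by
  have hC := hN.nonneg
  refine Summable.of_nonneg_of_le (fun _ => norm_nonneg _) (fun m => ?_)
    ((summable_pow_mul_exp_neg_sq hN.pos one_pos).mul_left C)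
  rw [norm_smul]
  calc _ ≤ (|(m : ℝ)| + 1) * (C * Real.exp (-γ * (m : ℝ) ^ 2)) :=
        mul_le_mul (hφ m) (hN.norm_le_zero m y y') (norm_nonneg _) (by positivity)
    _ = _ := by simp; ring

theorem gradedComp_smul_tsum {V₁ V₂ V₃ : Type*} [NormedAddCommGroup V₁] [NormedSpace ℂ V₁]
    [NormedAddCommGroup V₂] [NormedSpace ℂ V₂] [NormedAddCommGroup V₃] [NormedSpace ℂ V₃]
    [FiniteDimensional ℂ V₁] [FiniteDimensional ℂ V₂] [FiniteDimensional ℂ V₃]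
    {τ₂ : V₂ →L[ℂ] V₂} {τ₃ : V₃ →L[ℂ] V₃} (h₂ : ‖τ₂‖ ≤ 1) (h₃ : ‖τ₃‖ ≤ 1)
    {k : ℤ → Coeff W (V₂ →L[ℂ] V₃)} {l : ℤ → Coeff W (V₁ →L[ℂ] V₂)} {φ ψ : ℤ → ℂ}
    (hk : Summable fun m => ‖φ m • k m‖) (hl : Summable fun m => ‖ψ m • l m‖) (α β : ℂ) :
    gradedComp τ₂ τ₃ (α • ∑' m, φ m • k m) (β • ∑' m, ψ m • l m) =
      (α * β) • ∑' i : ℤ × ℤ, ψ i.2 • φ i.1 • gradedComp τ₂ τ₃ (k i.1) (l i.2) := by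
  have hB := bilinear_tsum_tsum (gradedCompL (W := W) (V₁ := V₁) h₂ h₃) hk hl
  rw [← gradedCompL_apply h₂ h₃, map_smul, map_smul, smul_apply, smul_smul, hB, mul_comm β α]
  congr 1
  refine tsum_congr fun i => ?_
  rw [map_smul, map_smul, smul_apply, gradedCompL_apply]

theorem stronglyMeasurable_smul_smul {G : Type*} [NormedAddCommGroup G] [NormedSpace ℂ G]
    (c : ℂ) {φ : Y → ℂ} (hφ : Measurable φ) {g : Y → G} (hg : StronglyMeasurable g) :
    StronglyMeasurable fun y => c • φ y • g y :=
  (hφ.stronglyMeasurable.smul hg).const_smul c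

/-- The supertrace of the composition of two Laurent series of kernels. -/
theorem str_integral_gradedComp_tsum (hτ : IsGrading T τ) (hN : IsPeriodicKernel f₀ T C γ N)
    (hN' : IsPeriodicKernel f₀ T C' γ N') {φ : ℤ → Y → ℂ} (hφm : ∀ m, Measurable (φ m))
    (hφ : ∀ m y', ‖φ m y'‖ ≤ |(m : ℝ)| + 1) {ψ : ℤ → ℂ} (hψ : ∀ k, ‖ψ k‖ ≤ 1) {α β : Y → ℂ}
    (hαβ : ∀ y', α y' * β y' = 1) (y : Y) :
    str (τ y) (∫ y', gradedComp (τ y') (τ y)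
      (α y' • ∑' m : ℤ, φ m y' • segmentKernel f₀ N m 0 y y')
      (β y' • ∑' k : ℤ, ψ k • segmentKernel f₀ N' k 0 y' y) ∂ν) =
    ∑' i : ℤ × ℤ, ψ i.2 • ∫ y', φ i.1 y' • segmentPairing f₀ τ N N' i.1 0 i.2 0 y y' ∂ν := by
  have hψ' : ∀ k, ‖ψ k‖ ≤ |(k : ℝ)| + 1 := fun k => (hψ k).trans (by linarith [abs_nonneg (k : ℝ)])
  have h1 : ∀ y', gradedComp (τ y') (τ y)
      (α y' • ∑' m : ℤ, φ m y' • segmentKernel f₀ N m 0 y y')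
      (β y' • ∑' k : ℤ, ψ k • segmentKernel f₀ N' k 0 y' y) =
      ∑' i : ℤ × ℤ, ψ i.2 • φ i.1 y' • gradedComp (τ y') (τ y)
        (segmentKernel f₀ N i.1 0 y y') (segmentKernel f₀ N' i.2 0 y' y) := by
    intro y'
    -- The prefactors `α` and `β`, in the applications opposite complex powers of `ξ`, have product
    -- `1`; afterwards no choice of a branch is visible.
    rw [gradedComp_smul_tsum (hτ.norm_le y') (hτ.norm_le y)
      (hN.summable_weighted (fun m => hφ m y') y y') (hN'.summable_weighted hψ' y' y), hαβ, one_smul]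
  let F : ℤ × ℤ → Y → Coeff W (V y →L[ℂ] V y) := fun i y' =>
    ψ i.2 • φ i.1 y' • gradedComp (τ y') (τ y)
        (segmentKernel f₀ N i.1 0 y y') (segmentKernel f₀ N' i.2 0 y' y)
  let c : ℤ × ℤ → ℝ := fun i => gradedBound W * C * C' *
    ((|(i.1 : ℝ)| + 1) * Real.exp (-γ * (i.1 : ℝ) ^ 2) *
      ((|(i.2 : ℝ)| + 1) * Real.exp (-γ * (i.2 : ℝ) ^ 2)))
  have hFm : ∀ i, AEStronglyMeasurable (F i) ν := fun i =>
    (stronglyMeasurable_smul_smul (ψ i.2) (hφm i.1)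
      (stronglyMeasurable_gradedComp_segment hτ hN hN' i.1 0 i.2 0 y y)).aestronglyMeasurable
  have hFb : ∀ i, ∀ᵐ y' ∂ν, ‖F i y'‖ ≤ c i := fun i => ae_of_all _ fun y' => by
    have hC := hN.nonneg
    have hC' := hN'.nonneg
    have hg := gradedBound_nonneg (W := W)
    have h2 := hN.norm_gradedComp_le hτ (y := y) (y' := y') i.1 0 (hN'.norm_le_zero i.2 y' y)
    rw [exp_sub_zero_sq] at h2
    calc ‖F i y'‖ = ‖ψ i.2‖ * (‖φ i.1 y'‖ * ‖gradedComp (τ y') (τ y)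
          (segmentKernel f₀ N i.1 0 y y') (segmentKernel f₀ N' i.2 0 y' y)‖) := by
          simp only [F]; rw [norm_smul, norm_smul]
      _ ≤ 1 * ((|(i.1 : ℝ)| + 1) * (gradedBound W * C * Real.exp (-γ * (i.1 : ℝ) ^ 2) *
          (C' * Real.exp (-γ * (i.2 : ℝ) ^ 2)))) := by
          refine mul_le_mul (hψ _) ?_ (by positivity) zero_le_one
          exact mul_le_mul (hφ _ _) h2 (norm_nonneg _) (by positivity)
      _ = gradedBound W * C * C' * ((|(i.1 : ℝ)| + 1) * Real.exp (-γ * (i.1 : ℝ) ^ 2) *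
          (1 * Real.exp (-γ * (i.2 : ℝ) ^ 2))) := by ring
      _ ≤ _ := by
          simp only [c]
          gcongr
          linarith [abs_nonneg (i.2 : ℝ)]
  have hsum := hasSum_integral_of_norm_le (μ := ν) hFm hFb
    ((summable_prod_exp_neg_sq hN.pos).mul_left _)
  simp only [h1]
  have h3 := (strL (W := W) (hτ.norm_le y)).hasSum hsum
  refine h3.tsum_eq.symm.trans (tsum_congr fun i => ?_)
  rw [strL_apply, integral_smul, map_smul,
    str_integral_gradedComp_segment hτ hN hN' i.1 0 i.2 0 y (hφm i.1) (hφ i.1)]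

/-- The kernel on `Y` of the indicial operator. -/
def indicialKernel (f₀ : Y → Circle) (N : Kernel W fun x : ℝ × Y => V x.2) (ξ : ℂ) : Kernel W V :=
  fun y y' => ξ ^ ((segmentCoord f₀ y : ℂ) - (segmentCoord f₀ y' : ℂ)) •
    ∑' m : ℤ, ξ ^ m • N (segmentCoord f₀ y + m, y) (segmentCoord f₀ y', y')

theorem indicialKernel_apply (ξ : ℂ) (y y' : Y) : indicialKernel f₀ N ξ y y' =
    ξ ^ ((segmentCoord f₀ y : ℂ) - (segmentCoord f₀ y' : ℂ)) •
      ∑' m : ℤ, ξ ^ m • segmentKernel f₀ N m 0 y y' := by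
  have h : ∀ m : ℤ, N (segmentCoord f₀ y + m, y) (segmentCoord f₀ y', y') =
      segmentKernel f₀ N m 0 y y' := fun m => by
    have h0 : segmentCoord f₀ y' = segmentCoord f₀ y' + ((0 : ℤ) : ℝ) := by simp
    rw [h0]
    rfl
  simp only [indicialKernel, h]

theorem hasDerivAt_indicialKernel (hN : IsPeriodicKernel f₀ T C γ N) {ξ : ℂ}
    (hξ : ξ ∈ Complex.slitPlane) (y y' : Y) :
    HasDerivAt (fun ζ => indicialKernel f₀ N ζ y y')
      (ξ ^ ((segmentCoord f₀ y : ℂ) - (segmentCoord f₀ y' : ℂ)) •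
        ∑' m : ℤ, (((segmentCoord f₀ y : ℂ) - (segmentCoord f₀ y' : ℂ) + m) * ξ ^ (m - 1)) •
          segmentKernel f₀ N m 0 y y') ξ := by
  simp only [indicialKernel_apply]
  exact hasDerivAt_cpow_smul_tsum hN.pos (fun m => hN.norm_le_zero m y y') hξ _

theorem norm_segmentCoord_sub_add_le (y y' : Y) (m : ℤ) :
    ‖(segmentCoord f₀ y : ℂ) - (segmentCoord f₀ y' : ℂ) + m‖ ≤ |(m : ℝ)| + 1 := by
  have h1 : (segmentCoord f₀ y : ℂ) - segmentCoord f₀ y' + m =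
      ((segmentCoord f₀ y - segmentCoord f₀ y' + m : ℝ) : ℂ) := by push_cast; rfl
  rw [h1, Complex.norm_real, Real.norm_eq_abs]
  have h2 : |segmentCoord f₀ y - segmentCoord f₀ y'| ≤ 1 := abs_le.2
    ⟨by linarith [segmentCoord_nonneg (f₀ := f₀) y, segmentCoord_lt_one (f₀ := f₀) y'],
      by linarith [segmentCoord_nonneg (f₀ := f₀) y', segmentCoord_lt_one (f₀ := f₀) y]⟩
  linarith [abs_add_le (segmentCoord f₀ y - segmentCoord f₀ y') m]

theorem cpow_sub_mul_cpow_sub {ξ : ℂ} (hξ : ξ ≠ 0) (a b : ℂ) : ξ ^ (a - b) * ξ ^ (b - a) = 1 := by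
  rw [← Complex.cpow_add _ _ hξ]; simp

theorem str_kcomp_indicial (hτ : IsGrading T τ) (hN : IsPeriodicKernel f₀ T C γ N)
    (hN' : IsPeriodicKernel f₀ T C' γ N') {ξ : ℂ} (hξ : ‖ξ‖ = 1) (y : Y) :
    str (τ y) (kcomp τ ν (indicialKernel f₀ N ξ) (indicialKernel f₀ N' ξ) y y) =
      ∑' i : ℤ × ℤ, ξ ^ (i.1 + i.2) • ∫ y', segmentPairing f₀ τ N N' i.1 0 i.2 0 y y' ∂ν := by
  have hξ0 : ξ ≠ 0 := norm_pos_iff.1 (by rw [hξ]; exact one_pos)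
  have h := str_integral_gradedComp_tsum (ν := ν) hτ hN hN' (φ := fun m _ => ξ ^ m)
    (fun m => measurable_const)
    (fun m _ => by rw [norm_zpow, hξ, one_zpow]; linarith [abs_nonneg (m : ℝ)])
    (ψ := fun k => ξ ^ k) (fun k => by rw [norm_zpow, hξ, one_zpow])
    (α := fun y' => ξ ^ ((segmentCoord f₀ y : ℂ) - (segmentCoord f₀ y' : ℂ)))
    (β := fun y' => ξ ^ ((segmentCoord f₀ y' : ℂ) - (segmentCoord f₀ y : ℂ)))
    (fun y' => cpow_sub_mul_cpow_sub hξ0 _ _) y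
  simp only [kcomp, indicialKernel_apply]
  rw [h]
  refine tsum_congr fun i => ?_
  rw [integral_smul, smul_smul, zpow_add₀ hξ0, mul_comm]

theorem str_kcomp_indicialDeriv (hf : Continuous f₀) (hτ : IsGrading T τ)
    (hN : IsPeriodicKernel f₀ T C γ N)
    (hN' : IsPeriodicKernel f₀ T C' γ N') {ξ : ℂ} (hξs : ξ ∈ Complex.slitPlane) (hξ : ‖ξ‖ = 1)
    (y : Y) :
    str (τ y) (kcomp τ ν (fun y y' => deriv (fun ζ => indicialKernel f₀ N ζ y y') ξ)
      (indicialKernel f₀ N' ξ) y y) =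
      ∑' i : ℤ × ℤ, ξ ^ (i.1 + i.2 - 1) •
        ∫ y', ((segmentCoord f₀ y : ℂ) - segmentCoord f₀ y' + i.1) •
          segmentPairing f₀ τ N N' i.1 0 i.2 0 y y' ∂ν := by
  have hξ0 : ξ ≠ 0 := Complex.slitPlane_ne_zero hξs
  have hsm : Measurable fun y => (segmentCoord f₀ y : ℂ) :=
    Complex.measurable_ofReal.comp (measurable_segmentCoord hf)
  have h := str_integral_gradedComp_tsum (ν := ν) hτ hN hN'
    (φ := fun m y' => ((segmentCoord f₀ y : ℂ) - (segmentCoord f₀ y' : ℂ) + m) * ξ ^ (m - 1))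
    (fun m => ((measurable_const.sub hsm).add_const _).mul_const _)
    (fun m y' => by
      rw [norm_mul, norm_zpow, hξ, one_zpow, mul_one]
      exact norm_segmentCoord_sub_add_le y y' m)
    (ψ := fun k => ξ ^ k) (fun k => by rw [norm_zpow, hξ, one_zpow])
    (α := fun y' => ξ ^ ((segmentCoord f₀ y : ℂ) - (segmentCoord f₀ y' : ℂ)))
    (β := fun y' => ξ ^ ((segmentCoord f₀ y' : ℂ) - (segmentCoord f₀ y : ℂ)))
    (fun y' => cpow_sub_mul_cpow_sub hξ0 _ _) y
  simp only [kcomp, fun y' => (hasDerivAt_indicialKernel hN hξs y y').deriv]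
  simp only [indicialKernel_apply]
  rw [h]
  refine tsum_congr fun i => ?_
  have h2 : ∀ y', (((segmentCoord f₀ y : ℂ) - (segmentCoord f₀ y' : ℂ) + i.1) * ξ ^ (i.1 - 1)) •
      segmentPairing f₀ τ N N' i.1 0 i.2 0 y y' = ξ ^ (i.1 - 1) •
      ((segmentCoord f₀ y : ℂ) - segmentCoord f₀ y' + i.1) •
          segmentPairing f₀ τ N N' i.1 0 i.2 0 y y' := fun y' => by rw [smul_smul, mul_comm]
  simp only [h2]
  rw [integral_smul, smul_smul, ← zpow_add₀ hξ0]
  congr 2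
  ring

/-- In the second composition the two series exchange their roles. Exchanging the summation indices
and using the trace property pointwise rewrites it by the same pairing with the points interchanged,
and the sign of the supercommutator is absorbed. -/
theorem str_superComm_indicial (hτ : IsGrading T τ) (hN : IsPeriodicKernel f₀ T C γ N)
    (hN' : IsPeriodicKernel f₀ T C' γ N') {p q : ℕ}
    (hp : ∀ (m k : ℤ) (y y' : Y), HasParity (τ y') (τ y) p
      (segmentKernel f₀ N m k y y'))
    (hq : ∀ (m k : ℤ) (y y' : Y), HasParity (τ y') (τ y) q
      (segmentKernel f₀ N' m k y y')) {ξ : ℂ} (hξ : ‖ξ‖ = 1) (y : Y) :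
    str (τ y) (superComm τ ν p q (indicialKernel f₀ N ξ) (indicialKernel f₀ N' ξ) y y) =
      ∑' i : ℤ × ℤ, ξ ^ (i.1 + i.2) • ((∫ y', segmentPairing f₀ τ N N' i.1 0 i.2 0 y y' ∂ν) -
        ∫ y', segmentPairing f₀ τ N N' i.1 0 i.2 0 y' y ∂ν) := by
  have hsum : ∀ (g : ℤ × ℤ → Y → Form W), (∀ i y', ‖g i y'‖ ≤
      Module.finrank ℂ F * gradedBound W * C * C' *
      (Real.exp (-γ * (i.1 : ℝ) ^ 2) * Real.exp (-γ * (i.2 : ℝ) ^ 2))) →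
      Summable fun i : ℤ × ℤ => ξ ^ (i.1 + i.2) • ∫ y', g i y' ∂ν := by
    intro g hg
    have h1 := ((summable_exp_neg_sq hN.pos).mul_of_nonneg (summable_exp_neg_sq hN.pos)
      (fun _ => (Real.exp_pos _).le) fun _ => (Real.exp_pos _).le)
    refine Summable.of_norm_bounded ((h1.mul_left
      (Module.finrank ℂ F * gradedBound W * C * C')).mul_right (ν.real Set.univ)) fun i => ?_
    rw [norm_smul, norm_zpow, hξ, one_zpow, one_mul]
    exact norm_integral_le_of_norm_le_const (ae_of_all _ (hg i))
  simp only [superComm, map_sub, map_smul]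
  rw [str_kcomp_indicial hτ hN hN' hξ, str_kcomp_indicial hτ hN' hN hξ, ← tsum_const_smul'',
    ← (Equiv.prodComm ℤ ℤ).tsum_eq fun i : ℤ × ℤ => (-1 : ℂ) ^ (p * q) • ξ ^ (i.1 + i.2) •
      ∫ y', segmentPairing f₀ τ N' N i.1 0 i.2 0 y y' ∂ν]
  have h2 : ∀ i : ℤ × ℤ, (-1 : ℂ) ^ (p * q) • ξ ^ (i.2 + i.1) •
      ∫ y', segmentPairing f₀ τ N' N i.2 0 i.1 0 y y' ∂ν =
      ξ ^ (i.1 + i.2) • ∫ y', segmentPairing f₀ τ N N' i.1 0 i.2 0 y' y ∂ν := by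
    intro i
    rw [smul_comm, ← integral_smul, add_comm]
    simp only [segmentPairing_comm hτ hp hq]
  simp only [Equiv.prodComm_apply, Prod.fst_swap, Prod.snd_swap, h2]
  rw [← Summable.tsum_sub]
  · simp only [smul_sub]
  · refine hsum _ fun i y' => ?_
    simpa using norm_segmentPairing_le hτ hN hN' i.1 0 i.2 0 y y'
  · refine hsum _ fun i y' => ?_
    simpa using norm_segmentPairing_le hτ hN hN' i.1 0 i.2 0 y' y

end Compositions

end CoverKernels

/-! ### Compositions on the cover and the Fourier–Laplace transform -/

section CoverCompositions

variable {W : Type*} [AddCommGroup W] [Module ℂ W] [FiniteDimensional ℂ W]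
  {F : Type*} [NormedAddCommGroup F] [NormedSpace ℂ F] [FiniteDimensional ℂ F]
  {Y : Type*} [TopologicalSpace Y] [MeasurableSpace Y] [BorelSpace Y] {f₀ : Y → Circle}
  {V : Y → Type*} [∀ y, NormedAddCommGroup (V y)] [∀ y, InnerProductSpace ℂ (V y)]
  [∀ y, FiniteDimensional ℂ (V y)]
  {T : ∀ y, V y ≃L[ℂ] F} {τ : ∀ y, V y →L[ℂ] V y} {C C' γ : ℝ}
  {N N' : Kernel W fun x : ℝ × Y => V x.2} {ν : Measure Y} [IsFiniteMeasure ν]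

/-- The integrand of a composition of kernels on the cover. -/
def coverIntegrand (f₀ : Y → Circle) (τ : ∀ y, V y →L[ℂ] V y)
    (N N' : Kernel W fun x : ℝ × Y => V x.2) (m m' : ℤ) (y y' : Y) (w : ℝ × Y) :
    Coeff W (V y' →L[ℂ] V y) :=
  gradedComp (τ w.2) (τ y) (N (segmentPoint f₀ m y) w) (N' w (segmentPoint f₀ m' y'))

theorem coverIntegrand_segmentPoint (m m' k : ℤ) (y y' w : Y) :
    coverIntegrand f₀ τ N N' m m' y y' (segmentPoint f₀ k w) =
      gradedComp (τ w) (τ y) (segmentKernel f₀ N m k y w) (segmentKernel f₀ N' k m' w y') := rfl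

theorem integrable_coverIntegrand (hf : Continuous f₀) (hτ : IsGrading T τ)
    (hN : IsPeriodicKernel f₀ T C γ N) (hN' : IsPeriodicKernel f₀ T C' γ N') (m m' : ℤ)
    (y y' : Y) : Integrable (coverIntegrand f₀ τ N N' m m' y y') (coverMeasure f₀ ν) := by
  have hC := hN.nonneg
  have hC' := hN'.nonneg
  have hg := gradedBound_nonneg (W := W)
  have hs : Summable fun k : ℤ => gradedBound W * C * C' * Real.exp (-γ * ((k : ℝ) - m') ^ 2) := by
    have h1 := ((Equiv.subRight m').summable_iff.2 (summable_exp_neg_sq hN.pos)).mul_left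
      (gradedBound W * C * C')
    simpa [Function.comp_def] using h1
  refine integrable_coverMeasure hf (fun k => ?_) hs fun k w => ?_
  · exact stronglyMeasurable_gradedComp_segment hτ hN hN' m k k m' y y'
  · refine (hN.norm_gradedComp_le hτ m k (hN'.norm_le k m' w y')).trans ?_
    have h1 : Real.exp (-γ * ((m : ℝ) - k) ^ 2) ≤ 1 := by
      rw [Real.exp_le_one_iff]; nlinarith [hN.pos, sq_nonneg ((m : ℝ) - k)]
    calc _ ≤ gradedBound W * C * 1 * (C' * Real.exp (-γ * ((k : ℝ) - m') ^ 2)) := by gcongr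
      _ = _ := by ring

theorem hasSum_integral_coverIntegrand (hf : Continuous f₀) (hτ : IsGrading T τ)
    (hN : IsPeriodicKernel f₀ T C γ N) (hN' : IsPeriodicKernel f₀ T C' γ N') (m m' : ℤ)
    (y y' : Y) : HasSum (fun k : ℤ => ∫ w, gradedComp (τ w) (τ y) (segmentKernel f₀ N m k y w)
      (segmentKernel f₀ N' k m' w y') ∂ν)
      (∫ w, coverIntegrand f₀ τ N N' m m' y y' w ∂(coverMeasure f₀ ν)) := by
  have h := hasSum_integral_coverMeasure hf
    (integrable_coverIntegrand (ν := ν) hf hτ hN hN' m m' y y')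
  simpa only [coverIntegrand_segmentPoint] using h

/-- Shifting the number of the intermediate segment along with the two outer ones permutes the
summands, each of which is unchanged by periodicity of both factors. -/
theorem integral_coverIntegrand_shift (hf : Continuous f₀) (hτ : IsGrading T τ)
    (hN : IsPeriodicKernel f₀ T C γ N) (hN' : IsPeriodicKernel f₀ T C' γ N') (m m' j : ℤ)
    (y y' : Y) :
    ∫ w, coverIntegrand f₀ τ N N' (m + j) (m' + j) y y' w ∂(coverMeasure f₀ ν) =
      ∫ w, coverIntegrand f₀ τ N N' m m' y y' w ∂(coverMeasure f₀ ν) := by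
  have h := hasSum_integral_coverIntegrand (ν := ν) hf hτ hN hN' (m + j) (m' + j) y y'
  rw [← (Equiv.addRight j).hasSum_iff] at h
  refine h.unique ?_
  have h2 : (fun k : ℤ => ∫ w, gradedComp (τ w) (τ y) (segmentKernel f₀ N (m + j) k y w)
      (segmentKernel f₀ N' k (m' + j) w y') ∂ν) ∘ (Equiv.addRight j) =
      fun k : ℤ => ∫ w, gradedComp (τ w) (τ y) (segmentKernel f₀ N m k y w)
      (segmentKernel f₀ N' k m' w y') ∂ν := by
    funext k
    simp only [Function.comp_apply, Equiv.coe_addRight, hN.shift, hN'.shift]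
  rw [h2]
  exact hasSum_integral_coverIntegrand hf hτ hN hN' m m' y y'

theorem superComm_cover_shift (hf : Continuous f₀) (hτ : IsGrading T τ)
    (hN : IsPeriodicKernel f₀ T C γ N) (hN' : IsPeriodicKernel f₀ T C' γ N') (p q : ℕ) (m m' j : ℤ)
    (y y' : Y) :
    segmentKernel f₀ (superComm (fun x : ℝ × Y => τ x.2) (coverMeasure f₀ ν) p q N N')
      (m + j) (m' + j) y y' =
    segmentKernel f₀ (superComm (fun x : ℝ × Y => τ x.2) (coverMeasure f₀ ν) p q N N') m m' y y' :=
  congrArg₂ (fun a b => a - (-1 : ℂ) ^ (p * q) • b)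
    (integral_coverIntegrand_shift hf hτ hN hN' m m' j y y')
    (integral_coverIntegrand_shift hf hτ hN' hN m m' j y y')

theorem hasSum_str_kcomp_cover (hf : Continuous f₀) (hτ : IsGrading T τ)
    (hN : IsPeriodicKernel f₀ T C γ N) (hN' : IsPeriodicKernel f₀ T C' γ N') (y : Y) :
    HasSum (fun k : ℤ => ∫ w, segmentPairing f₀ τ N N' 0 k k 0 y w ∂ν)
      (str (τ y) (∫ w, coverIntegrand f₀ τ N N' 0 0 y y w ∂(coverMeasure f₀ ν))) := by
  have h := (strL (W := W) (hτ.norm_le y)).hasSum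
    (hasSum_integral_coverIntegrand (ν := ν) hf hτ hN hN' 0 0 y y)
  refine Eq.mp (congrArg₂ (fun a b => HasSum a b) (funext fun k => ?_) rfl) h
  have h1 := str_integral_gradedComp_segment (ν := ν) hτ hN hN' 0 k k 0 y (c := fun _ => 1)
    measurable_const (R := 1) (by simp)
  simp only [one_smul] at h1
  exact h1

theorem hasSum_integral_str_kcomp_cover (hf : Continuous f₀) (hτ : IsGrading T τ)
    (hN : IsPeriodicKernel f₀ T C γ N) (hN' : IsPeriodicKernel f₀ T C' γ N') :
    HasSum (fun k : ℤ => ∫ y, ∫ w, segmentPairing f₀ τ N N' 0 k k 0 y w ∂ν ∂ν)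
      (∫ y, str (τ y) (∫ w, coverIntegrand f₀ τ N N' 0 0 y y w ∂(coverMeasure f₀ ν)) ∂ν) ∧
    Integrable (fun y => str (τ y)
      (∫ w, coverIntegrand f₀ τ N N' 0 0 y y w ∂(coverMeasure f₀ ν))) ν := by
  have hC := hN.nonneg
  have hC' := hN'.nonneg
  have hg := gradedBound_nonneg (W := W)
  let c : ℤ → ℝ := fun k => Module.finrank ℂ F * gradedBound W * C * C' *
      Real.exp (-γ * (k : ℝ) ^ 2) * ν.real Set.univ
  have hcs : Summable c := ((summable_exp_neg_sq hN.pos).mul_left _).mul_right _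
  have hm : ∀ k : ℤ, StronglyMeasurable fun y => ∫ w, segmentPairing f₀ τ N N' 0 k k 0 y w ∂ν :=
    fun k => (stronglyMeasurable_segmentPairing hτ hN hN' 0 k k 0).integral_prod_right
  have hb : ∀ (k : ℤ) (y : Y), ‖∫ w, segmentPairing f₀ τ N N' 0 k k 0 y w ∂ν‖ ≤ c k := by
    intro k y
    refine norm_integral_le_of_norm_le_const (ae_of_all _ fun w => ?_)
    refine (norm_segmentPairing_le hτ hN hN' 0 k k 0 y w).trans ?_
    refine mul_le_mul_of_nonneg_left ?_ (by positivity)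
    have h1 : Real.exp (-γ * (((0 : ℤ) : ℝ) - k) ^ 2) ≤ 1 := by
      rw [Real.exp_le_one_iff]; nlinarith [hN.pos, sq_nonneg (((0 : ℤ) : ℝ) - k)]
    rw [exp_sub_zero_sq]
    exact mul_le_of_le_one_left (Real.exp_pos _).le h1
  have hsum := fun y => (hasSum_str_kcomp_cover (ν := ν) hf hτ hN hN' y)
  have h := hasSum_integral_of_norm_le (μ := ν) (fun k => (hm k).aestronglyMeasurable)
    (fun k => ae_of_all _ (hb k)) hcs
  simp only [fun y => (hsum y).tsum_eq] at h
  refine ⟨h, ?_⟩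
  refine Integrable.mono' (integrable_const (∑' k, c k)) ?_ (ae_of_all _ fun y => ?_)
  · refine (aestronglyMeasurable_of_tendsto_ae (u := atTop)
      (f := fun (s : Finset ℤ) y => ∑ k ∈ s, ∫ w, segmentPairing f₀ τ N N' 0 k k 0 y w ∂ν)
      (fun s => ?_) (ae_of_all _ fun y => hsum y))
    exact (Finset.stronglyMeasurable_fun_sum s fun k _ => hm k).aestronglyMeasurable
  · rw [← (hsum y).tsum_eq]
    exact tsum_of_norm_bounded hcs.hasSum fun k => hb k y

/-- The supertrace of a supercommutator of periodic kernels integrates to `0` over a segment. -/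
theorem integral_segment_str_superComm (hf : Continuous f₀) (hτ : IsGrading T τ)
    (hN : IsPeriodicKernel f₀ T C γ N) (hN' : IsPeriodicKernel f₀ T C' γ N') {p q : ℕ}
    (hp : ∀ (m k : ℤ) (y y' : Y), HasParity (τ y') (τ y) p
      (segmentKernel f₀ N m k y y'))
    (hq : ∀ (m k : ℤ) (y y' : Y), HasParity (τ y') (τ y) q
      (segmentKernel f₀ N' m k y y')) :
    ∫ x in segment f₀, str (τ x.2)
      (superComm (fun x : ℝ × Y => τ x.2) (coverMeasure f₀ ν) p q N N' x x)
      ∂(coverMeasure f₀ ν) = 0 := by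
  obtain ⟨h1, i1⟩ := hasSum_integral_str_kcomp_cover (ν := ν) hf hτ hN hN'
  obtain ⟨h2, i2⟩ := hasSum_integral_str_kcomp_cover (ν := ν) hf hτ hN' hN
  rw [setIntegral_segment hf]
  have h3 : ∀ y, str (τ y) (superComm (fun x : ℝ × Y => τ x.2) (coverMeasure f₀ ν) p q N N'
      (segmentPoint f₀ 0 y) (segmentPoint f₀ 0 y)) =
      str (τ y) (∫ w, coverIntegrand f₀ τ N N' 0 0 y y w ∂(coverMeasure f₀ ν)) -
      (-1 : ℂ) ^ (p * q) •
        str (τ y) (∫ w, coverIntegrand f₀ τ N' N 0 0 y y w ∂(coverMeasure f₀ ν)) := by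
    intro y
    rw [← map_smul, ← map_sub]
    rfl
  refine (integral_congr_ae (ae_of_all _ h3)).trans ?_
  have i3 : Integrable (fun y => (-1 : ℂ) ^ (p * q) • str (τ y)
      (∫ w, coverIntegrand f₀ τ N' N 0 0 y y w ∂(coverMeasure f₀ ν))) ν := i2.smul ((-1 : ℂ) ^ (p * q))
  rw [integral_sub i1 i3, integral_smul, sub_eq_zero]
  refine h1.unique ?_
  have h4 := h2.const_smul ((-1 : ℂ) ^ (p * q))
  rw [← (Equiv.neg ℤ).hasSum_iff] at h4
  refine Eq.mp (congrArg₂ (fun a b => HasSum a b) (funext fun k => ?_) rfl) h4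
  simp only [Function.comp_apply, Equiv.neg_apply]
  rw [← integral_smul]
  simp only [← integral_smul, segmentPairing_comm hτ hp hq]
  rw [integral_integral_swap]
  · refine integral_congr_ae (ae_of_all _ fun y => integral_congr_ae (ae_of_all _ fun w => ?_))
    have e1 := (segmentPairing_shift (τ := τ) hN hN' (-k) 0 0 (-k) k y w).1
    have e2 := (segmentPairing_shift (τ := τ) hN hN' 0 k 0 (-k) k y w).2
    simp only [neg_add_cancel, zero_add] at e1 e2
    rw [← e1, ← e2]
  · have := (integrable_segmentPairing (ν := ν) hτ hN hN' (-k) 0 0 (-k)).swap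
    exact this

/-- The values of a section over the cover at points of a given segment. -/
def segmentSection (f₀ : Y → Circle) (u : ∀ x : ℝ × Y, Coeff W (ℂ →L[ℂ] V x.2)) (m : ℤ) (y : Y) :
    Coeff W (ℂ →L[ℂ] V y) := u (segmentPoint f₀ m y)

/-- The integrand of the application of a kernel on the cover to a section. -/
def sectionIntegrand (f₀ : Y → Circle) (τ : ∀ y, V y →L[ℂ] V y)
    (N : Kernel W fun x : ℝ × Y => V x.2) (u : ∀ x : ℝ × Y, Coeff W (ℂ →L[ℂ] V x.2)) (m : ℤ) (y : Y)
    (w : ℝ × Y) : Coeff W (ℂ →L[ℂ] V y) :=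
  gradedComp (τ w.2) (τ y) (N (segmentPoint f₀ m y) w) (u w)

theorem stronglyMeasurable_gradedComp_section (hτ : IsGrading T τ)
    (hN : IsPeriodicKernel f₀ T C γ N) {u : ∀ x : ℝ × Y, Coeff W (ℂ →L[ℂ] V x.2)}
    (hu : ∀ m : ℤ, MeasurableIn (fun _ => ContinuousLinearEquiv.refl ℂ ℂ) T
      fun y => segmentSection f₀ u m y) (m k k' : ℤ) (y : Y) : StronglyMeasurable fun y' =>
      gradedComp (τ y') (τ y) (segmentKernel f₀ N m k y y') (segmentSection f₀ u k' y') := by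
  have m1 : Measurable fun y' : Y => (y, y') := by fun_prop
  have h : MeasurableIn (fun _ : Y => ContinuousLinearEquiv.refl ℂ ℂ) (fun _ => T y) fun y' =>
      gradedComp (τ y') (τ y) (segmentKernel f₀ N m k y y') (segmentSection f₀ u k' y') :=
    MeasurableIn.gradedComp (T₂ := T) hτ.measurable
      (hτ.measurable.comp (measurable_const (a := y))) ((hN.measurable m k).comp m1) (hu k')
  exact MeasurableIn.stronglyMeasurable (V := ℂ) (V' := V y)
    (T := ContinuousLinearEquiv.refl ℂ ℂ) (T' := T y) h

/-- The intertwining relation of the indicial kernel with the Fourier–Laplace transform. -/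
theorem fourierLaplace_kapply (hf : Continuous f₀) (hτ : IsGrading T τ)
    (hN : IsPeriodicKernel f₀ T C γ N) {u : ∀ x : ℝ × Y, Coeff W (ℂ →L[ℂ] V x.2)}
    (hu : ∀ m : ℤ, MeasurableIn (fun _ => ContinuousLinearEquiv.refl ℂ ℂ) T
      fun y => segmentSection f₀ u m y)
    (hub : ∀ (m : ℤ) (y : Y), ‖segmentSection f₀ u m y‖ ≤ C' * Real.exp (-γ * (m : ℝ) ^ 2))
    {ξ : ℂ} (hξ : ξ ≠ 0) (y : Y) :
    ξ ^ (segmentCoord f₀ y : ℂ) • ∑' m : ℤ, ξ ^ m •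
      ∫ w, sectionIntegrand f₀ τ N u m y w ∂(coverMeasure f₀ ν) =
    ∫ y', gradedComp (τ y') (τ y) (indicialKernel f₀ N ξ y y')
      (ξ ^ (segmentCoord f₀ y' : ℂ) • ∑' m : ℤ, ξ ^ m • segmentSection f₀ u m y') ∂ν := by
  rcases isEmpty_or_nonempty Y with hY | ⟨⟨y₀⟩⟩
  · exact (hY.false y).elim
  have hC := hN.nonneg
  have hC' : 0 ≤ C' := by simpa using (norm_nonneg _).trans (hub 0 y₀)
  have hg := gradedBound_nonneg (W := W)
  set R := max ‖ξ‖ ‖ξ‖⁻¹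
  have hR : 0 < R := lt_max_of_lt_left (norm_pos_iff.2 hξ)
  have hξR : ∀ m : ℤ, ‖ξ ^ m‖ ≤ R ^ m.natAbs :=
    norm_zpow_le_pow_natAbs (le_max_left _ _) (le_max_right _ _)
  have hRs : Summable fun m : ℤ => R ^ m.natAbs * Real.exp (-γ * (m : ℝ) ^ 2) := by
    refine Summable.of_nonneg_of_le (fun m => by positivity) (fun m => ?_)
      (summable_pow_mul_exp_neg_sq hN.pos hR)
    exact le_mul_of_one_le_left (by positivity) (by linarith [abs_nonneg (m : ℝ)])
  let G : ℤ × ℤ → Y → Coeff W (ℂ →L[ℂ] V y) := fun i y' =>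
    gradedComp (τ y') (τ y) (segmentKernel f₀ N i.1 0 y y') (segmentSection f₀ u i.2 y')
  have hGm : ∀ i, StronglyMeasurable (G i) := fun i =>
    stronglyMeasurable_gradedComp_section hτ hN hu i.1 0 i.2 y
  have hGb : ∀ i y', ‖G i y'‖ ≤ gradedBound W * C * C' *
      (Real.exp (-γ * (i.1 : ℝ) ^ 2) * Real.exp (-γ * (i.2 : ℝ) ^ 2)) := by
    intro i y'
    have h := hN.norm_gradedComp_le hτ (y := y) i.1 0 (hub i.2 y')
    rw [exp_sub_zero_sq] at h
    exact h.trans_eq (by ring)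
  let c : ℤ × ℤ → ℝ := fun i => gradedBound W * C * C' *
      ((R ^ i.1.natAbs * Real.exp (-γ * (i.1 : ℝ) ^ 2)) *
        (R ^ i.2.natAbs * Real.exp (-γ * (i.2 : ℝ) ^ 2)))
  have hcs : Summable c := (hRs.mul_of_nonneg hRs (fun m => by positivity)
    fun m => by positivity).mul_left _
  have hterm : ∀ i y', ‖(ξ ^ i.2 * ξ ^ i.1) • G i y'‖ ≤ c i := by
    intro i y'
    rw [norm_smul, norm_mul]
    calc _ ≤ (R ^ i.2.natAbs * R ^ i.1.natAbs) * (gradedBound W * C * C' *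
          (Real.exp (-γ * (i.1 : ℝ) ^ 2) * Real.exp (-γ * (i.2 : ℝ) ^ 2))) := by
          refine mul_le_mul (mul_le_mul (hξR _) (hξR _) (norm_nonneg _) (by positivity))
            (hGb i y') (norm_nonneg _) (by positivity)
      _ = c i := by simp only [c]; ring
  have hGm' : ∀ i : ℤ × ℤ, AEStronglyMeasurable (fun y' => (ξ ^ i.2 * ξ ^ i.1) • G i y') ν :=
    fun i => (hGm i).aestronglyMeasurable.const_smul (ξ ^ i.2 * ξ ^ i.1)
  have hsum := hasSum_integral_of_norm_le (μ := ν) (F := fun i y' => (ξ ^ i.2 * ξ ^ i.1) • G i y')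
    hGm' (fun i => ae_of_all _ (hterm i)) hcs
  have hright : ∀ y', gradedComp (τ y') (τ y) (indicialKernel f₀ N ξ y y')
      (ξ ^ (segmentCoord f₀ y' : ℂ) • ∑' m : ℤ, ξ ^ m • segmentSection f₀ u m y') =
      ξ ^ (segmentCoord f₀ y : ℂ) • ∑' i : ℤ × ℤ, (ξ ^ i.2 * ξ ^ i.1) • G i y' := by
    intro y'
    rw [indicialKernel_apply, gradedComp_smul_tsum (hτ.norm_le y') (hτ.norm_le y)
      (summable_zpow_smul hN.pos (fun m => hN.norm_le_zero m y y') hξ)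
      (summable_zpow_smul hN.pos (fun m => hub m y') hξ), ← Complex.cpow_add _ _ hξ,
      sub_add_cancel]
    simp only [smul_smul, G]
  have hleft : ∀ m : ℤ, HasSum (fun k : ℤ => ∫ y', G (m - k, k) y' ∂ν)
      (∫ w, sectionIntegrand f₀ τ N u m y w ∂(coverMeasure f₀ ν)) := by
    intro m
    have hs : Summable fun k : ℤ => gradedBound W * C * C' * Real.exp (-γ * (k : ℝ) ^ 2) :=
      (summable_exp_neg_sq hN.pos).mul_left _
    -- Periodicity moves the intermediate point to segment `0`. The dependence on the difference `m
    -- - k` shows that the operator acts as a convolution in the segment numbers.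
    have hGk : ∀ (k : ℤ) (y' : Y), sectionIntegrand f₀ τ N u m y (segmentPoint f₀ k y') =
        G (m - k, k) y' := by
      intro k y'
      have := hN.shift (m - k) 0 k y y'
      rw [sub_add_cancel, zero_add] at this
      simp only [G, ← this]
      rfl
    have hi : Integrable (sectionIntegrand f₀ τ N u m y) (coverMeasure f₀ ν) := by
      refine integrable_coverMeasure hf (fun k => ?_) hs fun k y' => ?_
      · simp only [hGk]
        exact hGm _
      · rw [hGk]
        refine (hGb _ y').trans (mul_le_mul_of_nonneg_left ?_ (by positivity))
        refine mul_le_of_le_one_left (Real.exp_pos _).le ?_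
        rw [Real.exp_le_one_iff]
        nlinarith [hN.pos, sq_nonneg (((m - k : ℤ) : ℝ))]
    have h := hasSum_integral_coverMeasure hf hi
    simpa only [hGk] using h
  simp only [hright]
  rw [integral_smul, ← hsum.tsum_eq]
  congr 1
  -- This substitution turns the convolution into a product of Laurent series.
  let e : ℤ × ℤ ≃ ℤ × ℤ :=
    { toFun := fun i => (i.1 - i.2, i.2)
      invFun := fun i => (i.1 + i.2, i.2)
      left_inv := fun i => by simp
      right_inv := fun i => by simp }
  refine Eq.trans ?_ (((e.summable_iff.2 hsum.summable).tsum_prod).symm.trans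
    (e.tsum_eq fun i => ∫ y', (ξ ^ i.2 * ξ ^ i.1) • G i y' ∂ν))
  refine tsum_congr fun m => ?_
  rw [← (hleft m).tsum_eq, ← tsum_const_smul'']
  refine tsum_congr fun k => ?_
  simp only [Function.comp_apply, e, Equiv.coe_fn_mk]
  rw [integral_smul, ← zpow_add₀ hξ, add_sub_cancel]

end CoverCompositions

/-! ### Abstract metric and measure model of a periodic end -/

section EndModels

variable {X : Type*} [MeasurableSpace X] {Y : Type*} [TopologicalSpace Y] [MeasurableSpace Y]

/-- The metric and measure theoretic properties of a space with a periodic end that are used for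
estimates of kernels: `ι` embeds the half `f ≥ 0` of the cover, `d` is a distance, `δ` is the
distance to the segment `W₀`, and `lev` numbers the segments. -/
structure IsEndModel (f₀ : Y → Circle) (ι : ℝ × Y → X) (d : X → X → ℝ≥0∞) (δ : ℝ × Y → ℝ≥0∞)
    (lev : X → ℕ) (μ : Measure X) (ν : Measure Y) (L : NNReal) (v : ℝ) : Prop where
  continuous_f₀ : Continuous f₀
  symm : ∀ x x', d x x' = d x' x
  triangle : ∀ x x' x'', d x x'' ≤ d x x' + d x' x''
  pos : 0 < L
  lipschitz : ∀ x x', ENNReal.ofReal (|(lev x : ℝ) - lev x'| - 2) ≤ L * d x x'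
  lev_ι : ∀ m : ℤ, 0 ≤ m → ∀ y, (lev (ι (segmentPoint f₀ m y)) : ℤ) = m
  embedding : ∀ m : ℤ, 1 ≤ m → MeasurableEmbedding fun y => ι (segmentPoint f₀ m y)
  map_eq : ∀ m : ℤ, 1 ≤ m → ν.map (fun y => ι (segmentPoint f₀ m y)) =
    μ.restrict ((fun x => (lev x : ℤ)) ⁻¹' {m})
  bounded : BoundedLevels μ (fun x => (lev x : ℤ)) v
  le_δ : ∀ (m : ℤ) (y : Y), ENNReal.ofReal ((m : ℝ) - 3) ≤ L * δ (segmentPoint f₀ m y)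
  δ_le : ∀ m : ℤ, 1 ≤ m → ∀ (y : Y) (x : X), lev x = 0 →
    δ (segmentPoint f₀ m y) ≤ d (ι (segmentPoint f₀ m y)) x
  δ_le_add : ∀ m k : ℤ, 1 ≤ m → 1 ≤ k → ∀ y y' : Y, δ (segmentPoint f₀ m y) ≤
    d (ι (segmentPoint f₀ m y)) (ι (segmentPoint f₀ k y')) + δ (segmentPoint f₀ k y')
  δ_le_shift : ∀ (m k : ℤ) (j : ℕ), 1 ≤ m → k ≤ 0 → 0 ≤ k + j → ∀ y y' : Y,
    δ (segmentPoint f₀ m y) ≤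
      d (ι (segmentPoint f₀ (m + j) y)) (ι (segmentPoint f₀ (k + j) y'))
  min_le_shift : ∀ (m k : ℤ) (j : ℕ), 1 ≤ m → 1 ≤ k → ∀ y y' : Y,
    min (δ (segmentPoint f₀ m y)) (d (ι (segmentPoint f₀ m y)) (ι (segmentPoint f₀ k y'))) ≤
      d (ι (segmentPoint f₀ (m + j) y)) (ι (segmentPoint f₀ (k + j) y'))

variable {f₀ : Y → Circle} {ι : ℝ × Y → X} {d : X → X → ℝ≥0∞} {δ : ℝ × Y → ℝ≥0∞}
  {lev : X → ℕ} {μ : Measure X} {ν : Measure Y} {L : NNReal} {v : ℝ}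

theorem IsEndModel.measure_univ_le (hE : IsEndModel f₀ ι d δ lev μ ν L v) :
    ν Set.univ ≤ ENNReal.ofReal v := by
  have h := congrArg (fun m => m Set.univ) (hE.map_eq 1 le_rfl)
  simp only [Measure.restrict_apply_univ] at h
  rw [Measure.map_apply (hE.embedding 1 le_rfl).measurable MeasurableSet.univ,
    Set.preimage_univ] at h
  rw [h]
  exact hE.bounded.measure_le 1

theorem IsEndModel.isFiniteMeasure (hE : IsEndModel f₀ ι d δ lev μ ν L v) : IsFiniteMeasure ν :=
  ⟨hE.measure_univ_le.trans_lt ENNReal.ofReal_lt_top⟩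

theorem IsEndModel.measureReal_univ_le (hE : IsEndModel f₀ ι d δ lev μ ν L v) :
    ν.real Set.univ ≤ v :=
  ENNReal.toReal_le_of_le_ofReal hE.bounded.nonneg hE.measure_univ_le

theorem IsEndModel.setIntegral_level (hE : IsEndModel f₀ ι d δ lev μ ν L v) {G : Type*}
    [NormedAddCommGroup G] [NormedSpace ℝ G] (g : X → G) {m : ℤ} (hm : 1 ≤ m) :
    ∫ x in (fun x => (lev x : ℤ)) ⁻¹' {m}, g x ∂μ = ∫ y, g (ι (segmentPoint f₀ m y)) ∂ν := by
  rw [← hE.map_eq m hm, (hE.embedding m hm).integral_map]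

theorem BoundedLevels.hasSum_setIntegral (h : BoundedLevels μ (fun x => (lev x : ℤ)) v)
    {G : Type*} [NormedAddCommGroup G] [NormedSpace ℝ G] {g : X → G} (hg : Integrable g μ) :
    HasSum (fun j : ℤ => ∫ x in (fun x => (lev x : ℤ)) ⁻¹' {j}, g x ∂μ) (∫ x, g x ∂μ) := by
  have hU : ⋃ j : ℤ, (fun x => (lev x : ℤ)) ⁻¹' {j} = Set.univ := by
    ext w; simp
  have := hasSum_integral_iUnion (μ := μ) (f := g)
    (s := fun j : ℤ => (fun x => (lev x : ℤ)) ⁻¹' {j})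
    (fun j => h.measurable (measurableSet_singleton j))
    (fun j j' hjj' => Set.disjoint_left.2 fun w hw hw' => hjj' (hw.symm.trans hw'))
    hg.integrableOn
  rwa [hU, setIntegral_univ] at this

theorem tendsto_gauss_of_le {γ : ℝ} (hγ : 0 < γ) {L : NNReal} (hL : 0 < L) {a : ℕ → ℝ}
    (ha : Tendsto a atTop atTop) {r : ℕ → ℝ≥0∞} (h : ∀ j, ENNReal.ofReal (a j) ≤ L * r j) :
    Tendsto (fun j => gauss γ (r j)) atTop (𝓝 0) := by
  have h1 : Tendsto (fun j => Real.exp (4 * γ / L ^ 2) *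
      Real.exp (-(γ / (2 * L ^ 2)) * (a j + 2) ^ 2)) atTop (𝓝 0) := by
    have h2 : Tendsto (fun j => (γ / (2 * L ^ 2)) * (a j + 2) ^ 2) atTop atTop := by
      refine Tendsto.const_mul_atTop (by have : (0 : ℝ) < L := hL; positivity) ?_
      exact (tendsto_pow_atTop two_ne_zero).comp (tendsto_atTop_add_const_right _ 2 ha)
    have h3 := (Real.tendsto_exp_neg_atTop_nhds_zero.comp h2).const_mul (Real.exp (4 * γ / L ^ 2))
    rw [mul_zero] at h3
    refine h3.congr fun j => ?_
    simp only [Function.comp_apply, neg_mul]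
  refine squeeze_zero' (Eventually.of_forall fun _ => gauss_nonneg _ _) ?_ h1
  filter_upwards [ha.eventually_ge_atTop 0] with j hj
  refine gauss_le_exp hγ.le hL ?_
  rw [abs_of_nonneg (by linarith)]
  simpa using h j

end EndModels

/-! ### Asymptotically periodic kernels and their normal kernels -/

section AsymptoticKernels

variable {W : Type*} [AddCommGroup W] [Module ℂ W] [FiniteDimensional ℂ W]
  {F F' : Type*} [NormedAddCommGroup F] [NormedSpace ℂ F] [FiniteDimensional ℂ F]
  [NormedAddCommGroup F'] [NormedSpace ℂ F'] [FiniteDimensional ℂ F']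
  {X : Type*} [MeasurableSpace X] {Y : Type*} [TopologicalSpace Y] [MeasurableSpace Y]
  [BorelSpace Y]
  {V : X → Type*} [∀ x, NormedAddCommGroup (V x)] [∀ x, InnerProductSpace ℂ (V x)]
  [∀ x, FiniteDimensional ℂ (V x)]
  {V' : Y → Type*} [∀ y, NormedAddCommGroup (V' y)] [∀ y, InnerProductSpace ℂ (V' y)]
  [∀ y, FiniteDimensional ℂ (V' y)]
  {f₀ : Y → Circle} {ι : ℝ × Y → X} {d : X → X → ℝ≥0∞} {δ : ℝ × Y → ℝ≥0∞}
  {lev : X → ℕ} {μ : Measure X} {ν : Measure Y} {L : NNReal} {v : ℝ}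
  {T : ∀ x, V x ≃L[ℂ] F} {T' : ∀ y, V' y ≃L[ℂ] F'}
  {τ : ∀ x, V x →L[ℂ] V x} {τ' : ∀ y, V' y →L[ℂ] V' y} {C γ : ℝ}

/-- The restriction to the end of a kernel, as a kernel on the cover. -/
def pullKernel (Φ : ∀ x : ℝ × Y, V' x.2 ≃ₗᵢ[ℂ] V (ι x)) (K : Kernel W V) :
    Kernel W fun x : ℝ × Y => V' x.2 :=
  fun x x' => sandwich ((Φ x).symm.toContinuousLinearEquiv : V (ι x) →L[ℂ] V' x.2)
    ((Φ x').toContinuousLinearEquiv : V' x'.2 →L[ℂ] V (ι x')) (K (ι x) (ι x'))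

/-- The identification `Φ` of bundles over the end is compatible with the gradings. -/
def IsGraded (f₀ : Y → Circle) (Φ : ∀ x : ℝ × Y, V' x.2 ≃ₗᵢ[ℂ] V (ι x)) (τ : ∀ x, V x →L[ℂ] V x)
    (τ' : ∀ y, V' y →L[ℂ] V' y) : Prop :=
  ∀ m : ℤ, 0 ≤ m → ∀ (y : Y) (u : V' y),
    Φ (segmentPoint f₀ m y) (τ' y u) = τ (ι (segmentPoint f₀ m y)) (Φ (segmentPoint f₀ m y) u)

/-- A measurable kernel with Gaussian decay that is asymptotic to a periodic kernel. -/
structure IsAsymptoticKernel (f₀ : Y → Circle) (d : X → X → ℝ≥0∞)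
    (δ : ℝ × Y → ℝ≥0∞) (T : ∀ x, V x ≃L[ℂ] F) (T' : ∀ y, V' y ≃L[ℂ] F')
    (Φ : ∀ x : ℝ × Y, V' x.2 ≃ₗᵢ[ℂ] V (ι x)) (C γ : ℝ) (K : Kernel W V)
    (N : Kernel W fun x : ℝ × Y => V' x.2) : Prop where
  measurable : MeasurableIn (fun q : X × X => T q.2) (fun q => T q.1) fun q => K q.1 q.2
  measurable_normal : ∀ m k : ℤ, MeasurableIn (fun q : Y × Y => T' q.2) (fun q => T' q.1)
    fun q => segmentKernel f₀ N m k q.1 q.2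
  shift : ∀ (m k j : ℤ) (y y' : Y), segmentKernel f₀ N (m + j) (k + j) y y' =
    segmentKernel f₀ N m k y y'
  norm_le : ∀ x x', ‖K x x'‖ ≤ C * gauss γ (d x x')
  norm_sub_le : ∀ m k : ℤ, 1 ≤ m → 1 ≤ k → ∀ y y' : Y,
    ‖segmentKernel f₀ (pullKernel Φ K) m k y y' - segmentKernel f₀ N m k y y'‖ ≤
      C * gauss γ (min (δ (segmentPoint f₀ m y)) (δ (segmentPoint f₀ k y')))
  pos : 0 < γ
  nonneg : 0 ≤ C

variable {Φ : ∀ x : ℝ × Y, V' x.2 ≃ₗᵢ[ℂ] V (ι x)} {K K' : Kernel W V}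
  {N N' : Kernel W fun x : ℝ × Y => V' x.2}

/-- The identification of a fibre of the lifted bundle with a fibre over the end. -/
def endPush (f₀ : Y → Circle) (Φ : ∀ x : ℝ × Y, V' x.2 ≃ₗᵢ[ℂ] V (ι x)) (m : ℤ) (y : Y) :
    V' y →L[ℂ] V (ι (segmentPoint f₀ m y)) :=
  ((Φ (segmentPoint f₀ m y)).toContinuousLinearEquiv :
    V' (segmentPoint f₀ m y).2 →L[ℂ] V (ι (segmentPoint f₀ m y)))

/-- The inverse of `endPush`. -/
def endPull (f₀ : Y → Circle) (Φ : ∀ x : ℝ × Y, V' x.2 ≃ₗᵢ[ℂ] V (ι x)) (m : ℤ) (y : Y) :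
    V (ι (segmentPoint f₀ m y)) →L[ℂ] V' y :=
  ((Φ (segmentPoint f₀ m y)).symm.toContinuousLinearEquiv :
    V (ι (segmentPoint f₀ m y)) →L[ℂ] V' (segmentPoint f₀ m y).2)

theorem segmentKernel_pullKernel (m k : ℤ) (y y' : Y) :
    segmentKernel f₀ (pullKernel Φ K) m k y y' = sandwich (endPull f₀ Φ m y) (endPush f₀ Φ k y')
      (K (ι (segmentPoint f₀ m y)) (ι (segmentPoint f₀ k y'))) := rfl

theorem endPush_endPull (m : ℤ) (y : Y) : endPush f₀ Φ m y ∘L endPull f₀ Φ m y =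
    ContinuousLinearMap.id ℂ _ := by
  ext u
  exact (Φ (segmentPoint f₀ m y)).apply_symm_apply u

theorem endPull_endPush (m : ℤ) (y : Y) : endPull f₀ Φ m y ∘L endPush f₀ Φ m y =
    ContinuousLinearMap.id ℂ _ := by
  ext u
  exact (Φ (segmentPoint f₀ m y)).symm_apply_apply u

theorem IsGraded.endPush_comp (hΦ : IsGraded f₀ Φ τ τ') {m : ℤ} (hm : 0 ≤ m) (y : Y) :
    τ (ι (segmentPoint f₀ m y)) ∘L endPush f₀ Φ m y = endPush f₀ Φ m y ∘L τ' y := by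
  ext u
  exact (hΦ m hm y u).symm

theorem IsGraded.endPull_comp (hΦ : IsGraded f₀ Φ τ τ') {m : ℤ} (hm : 0 ≤ m) (y : Y) :
    endPull f₀ Φ m y ∘L τ (ι (segmentPoint f₀ m y)) = τ' y ∘L endPull f₀ Φ m y := by
  have h := congrArg (fun A => endPull f₀ Φ m y ∘L A ∘L endPull f₀ Φ m y) (hΦ.endPush_comp hm y)
  simp only [ContinuousLinearMap.comp_assoc, endPush_endPull] at h
  rw [← ContinuousLinearMap.comp_assoc (endPull f₀ Φ m y) (endPush f₀ Φ m y), endPull_endPush] at h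
  simpa using h

theorem norm_endPush_le (m : ℤ) (y : Y) : ‖endPush f₀ Φ m y‖ ≤ 1 :=
  (Φ (segmentPoint f₀ m y)).toLinearIsometry.norm_toContinuousLinearMap_le

theorem norm_endPull_le (m : ℤ) (y : Y) : ‖endPull f₀ Φ m y‖ ≤ 1 :=
  (Φ (segmentPoint f₀ m y)).symm.toLinearIsometry.norm_toContinuousLinearMap_le

theorem norm_pullKernel_le (m k : ℤ) (y y' : Y) : ‖segmentKernel f₀ (pullKernel Φ K) m k y y'‖ ≤
    ‖K (ι (segmentPoint f₀ m y)) (ι (segmentPoint f₀ k y'))‖ :=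
  norm_sandwich_le_of_le_one (norm_endPull_le m y) (norm_endPush_le k y') _

theorem IsGraded.segmentKernel_gradedComp (hΦ : IsGraded f₀ Φ τ τ') {m j : ℤ} (hm : 0 ≤ m)
    (hj : 0 ≤ j) (k : ℤ) (y w y' : Y) :
    sandwich (endPull f₀ Φ m y) (endPush f₀ Φ k y')
      (gradedComp (τ (ι (segmentPoint f₀ j w))) (τ (ι (segmentPoint f₀ m y)))
        (K (ι (segmentPoint f₀ m y)) (ι (segmentPoint f₀ j w)))
        (K' (ι (segmentPoint f₀ j w)) (ι (segmentPoint f₀ k y')))) =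
      gradedComp (τ' w) (τ' y) (segmentKernel f₀ (pullKernel Φ K) m j y w)
        (segmentKernel f₀ (pullKernel Φ K') j k w y') := by
  rw [segmentKernel_pullKernel, segmentKernel_pullKernel]
  exact sandwich_gradedComp _ _ _ _ (endPush_endPull j w) (hΦ.endPush_comp hj w)
    (hΦ.endPull_comp hm y) _ _

theorem IsGraded.hasParity (hΦ : IsGraded f₀ Φ τ τ') {m k : ℤ} (hm : 0 ≤ m) (hk : 0 ≤ k)
    {p : ℕ} (y y' : Y) (h : HasParity (τ (ι (segmentPoint f₀ k y'))) (τ (ι (segmentPoint f₀ m y))) p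
      (K (ι (segmentPoint f₀ m y)) (ι (segmentPoint f₀ k y')))) :
    HasParity (τ' y') (τ' y) p (segmentKernel f₀ (pullKernel Φ K) m k y y') := by
  rw [HasParity, segmentKernel_pullKernel, sandwich_sandwich, ← hΦ.endPull_comp hm,
    ← hΦ.endPush_comp hk, ← sandwich_sandwich, formInvol_sandwich, h, map_smul]

/-- The decay constant of a kernel with respect to the levels. -/
def levelConst (L : NNReal) (C γ : ℝ) : ℝ := C * Real.exp (4 * γ / L ^ 2)

/-- The decay rate of a kernel with respect to the levels. -/
def levelRate (L : NNReal) (γ : ℝ) : ℝ := γ / (2 * L ^ 2)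

theorem levelRate_pos (hL : 0 < L) (hγ : 0 < γ) : 0 < levelRate L γ := by
  have : (0 : ℝ) < L := hL
  unfold levelRate; positivity

theorem le_levelConst (hC : 0 ≤ C) (hγ : 0 ≤ γ) : C ≤ levelConst L C γ :=
  le_mul_of_one_le_right hC (Real.one_le_exp (by positivity))

theorem IsEndModel.gauss_le (hE : IsEndModel f₀ ι d δ lev μ ν L v) (hC : 0 ≤ C) (hγ : 0 ≤ γ)
    (x x' : X) : C * gauss γ (d x x') ≤
      levelConst L C γ * Real.exp (-levelRate L γ * ((lev x : ℝ) - lev x') ^ 2) := by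
  rw [levelConst, mul_assoc]
  exact mul_le_mul_of_nonneg_left (gauss_le_exp hγ hE.pos (hE.lipschitz x x')) hC

theorem IsAsymptoticKernel.norm_le_exp (hE : IsEndModel f₀ ι d δ lev μ ν L v)
    (hK : IsAsymptoticKernel f₀ d δ T T' Φ C γ K N) (x x' : X) : ‖K x x'‖ ≤
      levelConst L C γ * Real.exp (-levelRate L γ * ((lev x : ℝ) - lev x') ^ 2) :=
  (hK.norm_le x x').trans (hE.gauss_le hK.nonneg hK.pos.le x x')

theorem IsAsymptoticKernel.norm_pull_le_exp (hE : IsEndModel f₀ ι d δ lev μ ν L v)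
    (hK : IsAsymptoticKernel f₀ d δ T T' Φ C γ K N) {m k : ℤ} (hm : 0 ≤ m) (hk : 0 ≤ k) (y y' : Y) :
    ‖segmentKernel f₀ (pullKernel Φ K) m k y y'‖ ≤
      levelConst L C γ * Real.exp (-levelRate L γ * ((m : ℝ) - k) ^ 2) := by
  refine (norm_pullKernel_le m k y y').trans ((hK.norm_le_exp hE _ _).trans_eq ?_)
  have h1 : (lev (ι (segmentPoint f₀ m y)) : ℝ) = m := by exact_mod_cast hE.lev_ι m hm y
  have h2 : (lev (ι (segmentPoint f₀ k y')) : ℝ) = k := by exact_mod_cast hE.lev_ι k hk y'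
  rw [h1, h2]

/-- The normal kernel is the limit of the translates of the kernel. -/
theorem IsAsymptoticKernel.tendsto (hE : IsEndModel f₀ ι d δ lev μ ν L v)
    (hK : IsAsymptoticKernel f₀ d δ T T' Φ C γ K N) (m k : ℤ) (y y' : Y) :
    Tendsto (fun j : ℕ => segmentKernel f₀ (pullKernel Φ K) (m + j) (k + j) y y') atTop
      (𝓝 (segmentKernel f₀ N m k y y')) := by
  rw [tendsto_iff_norm_sub_tendsto_zero]
  have ha : Tendsto (fun j : ℕ => ((min m k : ℤ) : ℝ) - 3 + j) atTop atTop :=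
    tendsto_atTop_add_const_left _ _ tendsto_natCast_atTop_atTop
  have hg := (tendsto_gauss_of_le hK.pos hE.pos ha
    (r := fun j => min (δ (segmentPoint f₀ (m + j) y)) (δ (segmentPoint f₀ (k + j) y')))
    fun j => ?_).const_mul C
  · rw [mul_zero] at hg
    refine squeeze_zero' (Eventually.of_forall fun _ => norm_nonneg _) ?_ hg
    -- From this `j` on both shifted segments have numbers at least `1`, where the asymptotic
    -- estimate applies.
    filter_upwards [eventually_ge_atTop (1 - min m k).toNat] with j hj
    have h := hK.norm_sub_le (m + j) (k + j) (by omega) (by omega) y y'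
    rwa [hK.shift] at h
  · rcases min_choice (δ (segmentPoint f₀ (m + j) y)) (δ (segmentPoint f₀ (k + j) y')) with h | h
    · rw [h]
      refine le_trans (ENNReal.ofReal_le_ofReal ?_) (hE.le_δ (m + j) y)
      have : ((min m k : ℤ) : ℝ) ≤ m := by exact_mod_cast min_le_left m k
      push_cast; push_cast at this; linarith
    · rw [h]
      refine le_trans (ENNReal.ofReal_le_ofReal ?_) (hE.le_δ (k + j) y')
      have : ((min m k : ℤ) : ℝ) ≤ k := by exact_mod_cast min_le_right m k
      push_cast; push_cast at this; linarith

/-- Decay of the normal kernel is not part of the hypotheses. It passes to the limit from the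
translates of `K`, whose bounds depend only on the difference of the levels. -/
theorem IsAsymptoticKernel.isPeriodicKernel (hE : IsEndModel f₀ ι d δ lev μ ν L v)
    (hK : IsAsymptoticKernel f₀ d δ T T' Φ C γ K N) :
    IsPeriodicKernel f₀ T' (levelConst L C γ) (levelRate L γ) N where
  measurable := hK.measurable_normal
  norm_le m k y y' := by
    refine le_of_tendsto (hK.tendsto hE m k y y').norm ?_
    filter_upwards [eventually_ge_atTop (1 - min m k).toNat] with j hj
    have h := hK.norm_pull_le_exp hE (m := m + j) (k := k + j) (by omega) (by omega) y y'
    simpa using h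
  shift := hK.shift
  pos := levelRate_pos hE.pos hK.pos
  nonneg := mul_nonneg hK.nonneg (Real.exp_pos _).le

/-- Any lower bound for the distances of far translates of two points gives decay of the normal
kernel, again by passage to the limit. -/
theorem IsAsymptoticKernel.norm_normal_le (hE : IsEndModel f₀ ι d δ lev μ ν L v)
    (hK : IsAsymptoticKernel f₀ d δ T T' Φ C γ K N) {m k : ℤ} {y y' : Y} {r : ℝ≥0∞}
    (hr : ∀ᶠ j : ℕ in atTop,
      r ≤ d (ι (segmentPoint f₀ (m + j) y)) (ι (segmentPoint f₀ (k + j) y'))) :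
    ‖segmentKernel f₀ N m k y y'‖ ≤ C * gauss γ r := by
  refine le_of_tendsto (hK.tendsto hE m k y y').norm ?_
  filter_upwards [hr] with j hj
  refine (norm_pullKernel_le _ _ y y').trans ((hK.norm_le _ _).trans ?_)
  exact mul_le_mul_of_nonneg_left (gauss_anti hK.pos.le hj) hK.nonneg

/-- Having a given parity is a closed condition, and it holds for the translates of `K` that
converge to `N`. -/
theorem IsAsymptoticKernel.hasParity (hE : IsEndModel f₀ ι d δ lev μ ν L v)
    (hK : IsAsymptoticKernel f₀ d δ T T' Φ C γ K N) (hΦ : IsGraded f₀ Φ τ τ') {p : ℕ}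
    (hp : ∀ x x', HasParity (τ x') (τ x) p (K x x')) (m k : ℤ) (y y' : Y) :
    HasParity (τ' y') (τ' y) p (segmentKernel f₀ N m k y y') := by
  have h1 := hK.tendsto hE m k y y'
  have h2 := (formInvolL (W := W) (H := V' y' →L[ℂ] V' y)).continuous.tendsto _ |>.comp
    (((sandwichL (W := W) (τ' y) (τ' y')).continuous.tendsto _).comp h1)
  have h3 := h1.const_smul ((-1 : ℂ) ^ p)
  refine tendsto_nhds_unique_of_eventuallyEq h2 h3 ?_
  filter_upwards [eventually_ge_atTop (1 - min m k).toNat] with j hj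
  exact hΦ.hasParity (by omega) (by omega) y y' (hp _ _)

end AsymptoticKernels

theorem hasSum_exp_sub_sq {ρ : ℝ} (hρ : 0 < ρ) (a : ℤ) :
    HasSum (fun m : ℤ => Real.exp (-ρ * ((a : ℝ) - m) ^ 2)) (theta ρ) := by
  have h : HasSum (fun m : ℤ => Real.exp (-ρ * (m : ℝ) ^ 2)) (theta ρ) :=
    (summable_exp_neg_sq hρ).hasSum
  rw [← (Equiv.subLeft a).hasSum_iff] at h
  simpa [Function.comp_def] using h

/-- Interpolation between two kinds of Gaussian decay. -/
theorem le_gauss_mul_exp {a c γ ρ s : ℝ} {r : ℝ≥0∞} (hc : 0 ≤ c) (h1 : a ≤ c * gauss γ r)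
    (h2 : a ≤ c * Real.exp (-ρ * s)) :
    a ≤ c * (gauss (γ / 2) r * Real.exp (-(ρ / 2) * s)) := by
  have h3 : Real.exp (-(ρ / 2) * s) * Real.exp (-(ρ / 2) * s) = Real.exp (-ρ * s) := by
    rw [← Real.exp_add]; congr 1; ring
  rw [← gauss_half_mul] at h1
  rw [← h3] at h2
  have hX := gauss_nonneg (γ / 2) r
  have hY := (Real.exp_pos (-(ρ / 2) * s)).le
  -- With `X = gauss (γ / 2) r` and `Y = exp (-(ρ / 2) s)` the hypotheses read `a ≤ c X²` and `a ≤ c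
  -- Y²`. The smaller of the two squares is at most `X Y`.
  rcases le_total (gauss (γ / 2) r) (Real.exp (-(ρ / 2) * s)) with h | h
  · exact h1.trans (mul_le_mul_of_nonneg_left (mul_le_mul_of_nonneg_left h hX) hc)
  · exact h2.trans (mul_le_mul_of_nonneg_left (mul_le_mul_of_nonneg_right h hY) hc)

theorem norm_gradedComp_sub_le {W : Type*} [AddCommGroup W] [Module ℂ W] [FiniteDimensional ℂ W]
    {V₁ V₂ V₃ : Type*} [NormedAddCommGroup V₁] [NormedSpace ℂ V₁]
    [NormedAddCommGroup V₂] [NormedSpace ℂ V₂] [NormedAddCommGroup V₃] [NormedSpace ℂ V₃]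
    {τ₂ : V₂ →L[ℂ] V₂} {τ₃ : V₃ →L[ℂ] V₃} (h₂ : ‖τ₂‖ ≤ 1) (h₃ : ‖τ₃‖ ≤ 1)
    (k k' : Coeff W (V₂ →L[ℂ] V₃)) (l l' : Coeff W (V₁ →L[ℂ] V₂)) :
    ‖gradedComp τ₂ τ₃ k l - gradedComp τ₂ τ₃ k' l'‖ ≤
      gradedBound W * (‖k - k'‖ * ‖l‖ + ‖k'‖ * ‖l - l'‖) := by
  have h : gradedComp τ₂ τ₃ k l - gradedComp τ₂ τ₃ k' l' =
      gradedComp τ₂ τ₃ (k - k') l + gradedComp τ₂ τ₃ k' (l - l') := by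
    simp only [← gradedCompL_apply h₂ h₃, map_sub, sub_apply]
    abel
  rw [h]
  refine (norm_add_le _ _).trans ((add_le_add (norm_gradedComp_le h₂ h₃ _ _)
    (norm_gradedComp_le h₂ h₃ _ _)).trans_eq (by ring))

/-! ### Compositions of asymptotically periodic kernels -/

section AsymptoticCompositions

variable {W : Type*} [AddCommGroup W] [Module ℂ W] [FiniteDimensional ℂ W]
  {F F' : Type*} [NormedAddCommGroup F] [NormedSpace ℂ F] [FiniteDimensional ℂ F]
  [NormedAddCommGroup F'] [NormedSpace ℂ F'] [FiniteDimensional ℂ F']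
  {X : Type*} [MeasurableSpace X] {Y : Type*} [TopologicalSpace Y] [MeasurableSpace Y]
  [BorelSpace Y]
  {V : X → Type*} [∀ x, NormedAddCommGroup (V x)] [∀ x, InnerProductSpace ℂ (V x)]
  [∀ x, FiniteDimensional ℂ (V x)]
  {V' : Y → Type*} [∀ y, NormedAddCommGroup (V' y)] [∀ y, InnerProductSpace ℂ (V' y)]
  [∀ y, FiniteDimensional ℂ (V' y)]
  {f₀ : Y → Circle} {ι : ℝ × Y → X} {d : X → X → ℝ≥0∞} {δ : ℝ × Y → ℝ≥0∞}
  {lev : X → ℕ} {μ : Measure X} {ν : Measure Y} {L : NNReal} {v : ℝ}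
  {T : ∀ x, V x ≃L[ℂ] F} {T' : ∀ y, V' y ≃L[ℂ] F'}
  {τ : ∀ x, V x →L[ℂ] V x} {τ' : ∀ y, V' y →L[ℂ] V' y} {C γ : ℝ}
  {Φ : ∀ x : ℝ × Y, V' x.2 ≃ₗᵢ[ℂ] V (ι x)} {K K' : Kernel W V}
  {N N' : Kernel W fun x : ℝ × Y => V' x.2}

theorem measurableIn_gradedComp_kernels (hτ : IsGrading T τ)
    (hK : IsAsymptoticKernel f₀ d δ T T' Φ C γ K N)
    (hK' : IsAsymptoticKernel f₀ d δ T T' Φ C γ K' N') :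
    MeasurableIn (fun q : X × X × X => T q.2.2) (fun q => T q.1) fun q : X × X × X =>
      gradedComp (τ q.2.1) (τ q.1) (K q.1 q.2.1) (K' q.2.1 q.2.2) := by
  have m1 : Measurable fun q : X × X × X => (q.1, q.2.1) := by fun_prop
  have m2 : Measurable fun q : X × X × X => (q.2.1, q.2.2) := by fun_prop
  exact MeasurableIn.gradedComp (T₂ := fun q : X × X × X => T q.2.1)
    (hτ.measurable.comp (measurable_fst.comp measurable_snd)) (hτ.measurable.comp measurable_fst)
    (hK.measurable.comp m1) (hK'.measurable.comp m2)

theorem stronglyMeasurable_gradedComp_kernels (hτ : IsGrading T τ)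
    (hK : IsAsymptoticKernel f₀ d δ T T' Φ C γ K N)
    (hK' : IsAsymptoticKernel f₀ d δ T T' Φ C γ K' N') (x x' : X) :
    StronglyMeasurable fun w => gradedComp (τ w) (τ x) (K x w) (K' w x') := by
  have m1 : Measurable fun w : X => (x, w, x') := by fun_prop
  have h := (measurableIn_gradedComp_kernels hτ hK hK').comp m1
  exact MeasurableIn.stronglyMeasurable (V := V x') (V' := V x) (T := T x') (T' := T x) h

theorem norm_gradedComp_kernels_le (hτ : IsGrading T τ)
    (hK : IsAsymptoticKernel f₀ d δ T T' Φ C γ K N)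
    (hK' : IsAsymptoticKernel f₀ d δ T T' Φ C γ K' N') (x w x' : X) :
    ‖gradedComp (τ w) (τ x) (K x w) (K' w x')‖ ≤
      gradedBound W * C * C * (gauss γ (d x w) * gauss γ (d w x')) := by
  have hC := hK.nonneg
  have hg := gradedBound_nonneg (W := W)
  have h1 := gauss_nonneg γ (d x w)
  refine (norm_gradedComp_le (hτ.norm_le w) (hτ.norm_le x) _ _).trans ?_
  calc _ ≤ gradedBound W * (C * gauss γ (d x w)) * (C * gauss γ (d w x')) :=
        mul_le_mul (mul_le_mul_of_nonneg_left (hK.norm_le x w) hg) (hK'.norm_le w x')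
          (norm_nonneg _) (by positivity)
    _ = _ := by ring

/-- Half of the decay in `d x w` is converted into decay in the levels and pays for the integration
over `w`. The other half joins the decay in `d w x'` through the triangle inequality and becomes
decay in `d x x'`. -/
theorem norm_gradedComp_kernels_le_exp (hE : IsEndModel f₀ ι d δ lev μ ν L v) (hτ : IsGrading T τ)
    (hK : IsAsymptoticKernel f₀ d δ T T' Φ C γ K N)
    (hK' : IsAsymptoticKernel f₀ d δ T T' Φ C γ K' N') (x w x' : X) :
    ‖gradedComp (τ w) (τ x) (K x w) (K' w x')‖ ≤
      gradedBound W * C * levelConst L C (γ / 2) * gauss (γ / 2 / 2) (d x x') *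
        Real.exp (-levelRate L (γ / 2) * ((lev x : ℝ) - lev w) ^ 2) := by
  have hC := hK.nonneg
  have hγ := hK.pos.le
  have hg := gradedBound_nonneg (W := W)
  refine (norm_gradedComp_kernels_le hτ hK hK' x w x').trans ?_
  have h1 : gauss γ (d w x') ≤ gauss (γ / 2) (d w x') := gauss_anti_left (by linarith) _
  have h2 := gauss_mul_gauss_le (γ := γ / 2) (by linarith) (hE.triangle x w x')
  have h3 := hE.gauss_le (γ := γ / 2) hC (by linarith) x w
  have h4 := gauss_nonneg (γ / 2) (d x w)
  have h5 := gauss_nonneg (γ / 2 / 2) (d x x')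
  calc gradedBound W * C * C * (gauss γ (d x w) * gauss γ (d w x'))
      ≤ gradedBound W * C * C * (gauss γ (d x w) * gauss (γ / 2) (d w x')) := by
        have := gauss_nonneg γ (d x w)
        gcongr
    _ = gradedBound W * C * (C * gauss (γ / 2) (d x w)) *
        (gauss (γ / 2) (d x w) * gauss (γ / 2) (d w x')) := by
        rw [← gauss_half_mul γ (d x w)]; ring
    _ ≤ gradedBound W * C * (levelConst L C (γ / 2) *
        Real.exp (-levelRate L (γ / 2) * ((lev x : ℝ) - lev w) ^ 2)) * gauss (γ / 2 / 2) (d x x') :=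
        mul_le_mul (mul_le_mul_of_nonneg_left h3 (by positivity)) h2
          (mul_nonneg h4 (gauss_nonneg _ _))
          (mul_nonneg (by positivity) ((mul_nonneg hC h4).trans h3))
    _ = _ := by ring

theorem integrable_gradedComp_kernels (hE : IsEndModel f₀ ι d δ lev μ ν L v) (hτ : IsGrading T τ)
    (hK : IsAsymptoticKernel f₀ d δ T T' Φ C γ K N)
    (hK' : IsAsymptoticKernel f₀ d δ T T' Φ C γ K' N') (x x' : X) :
    Integrable (fun w => gradedComp (τ w) (τ x) (K x w) (K' w x')) μ :=
  hE.bounded.integrable (a := (lev x : ℤ)) (levelRate_pos hE.pos (half_pos hK.pos))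
    (stronglyMeasurable_gradedComp_kernels hτ hK hK' x x').aestronglyMeasurable
    (ae_of_all _ fun w => norm_gradedComp_kernels_le_exp hE hτ hK hK' x w x')

theorem norm_kcomp_le (hE : IsEndModel f₀ ι d δ lev μ ν L v) (hτ : IsGrading T τ)
    (hK : IsAsymptoticKernel f₀ d δ T T' Φ C γ K N)
    (hK' : IsAsymptoticKernel f₀ d δ T T' Φ C γ K' N') (x x' : X) :
    ‖kcomp τ μ K K' x x'‖ ≤
      gradedBound W * C * levelConst L C (γ / 2) * (v * theta (levelRate L (γ / 2))) *
        gauss (γ / 2 / 2) (d x x') := by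
  have hC := hK.nonneg
  have hg := gradedBound_nonneg (W := W)
  have h1 : 0 ≤ levelConst L C (γ / 2) := mul_nonneg hC (Real.exp_pos _).le
  have h5 := gauss_nonneg (γ / 2 / 2) (d x x')
  refine (hE.bounded.norm_integral_le (a := (lev x : ℤ)) (levelRate_pos hE.pos (half_pos hK.pos))
    (C := gradedBound W * C * levelConst L C (γ / 2) * gauss (γ / 2 / 2) (d x x')) (by positivity)
    (ae_of_all _ fun w => norm_gradedComp_kernels_le_exp hE hτ hK hK' x w x')).trans_eq (by ring)

/-- The asymptotic estimate alone cannot be summed over `j`. Interpolation with the decay of both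
kernels in the level difference makes it summable, at the price of half of the rate. -/
theorem IsAsymptoticKernel.norm_sub_le_exp (hE : IsEndModel f₀ ι d δ lev μ ν L v)
    (hK : IsAsymptoticKernel f₀ d δ T T' Φ C γ K N) {m j : ℤ} (hm : 1 ≤ m) (hj : 1 ≤ j) (y w : Y) :
    ‖segmentKernel f₀ (pullKernel Φ K) m j y w - segmentKernel f₀ N m j y w‖ ≤
      2 * levelConst L C γ * (gauss (γ / 2) (min (δ (segmentPoint f₀ m y))
        (δ (segmentPoint f₀ j w))) * Real.exp (-(levelRate L γ / 2) * ((m : ℝ) - j) ^ 2)) := by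
  have hc := le_levelConst (L := L) hK.nonneg hK.pos.le
  have hC := hK.nonneg
  refine le_gauss_mul_exp (by linarith) ((hK.norm_sub_le m j hm hj y w).trans ?_) ?_
  · exact mul_le_mul_of_nonneg_right (by linarith) (gauss_nonneg _ _)
  · refine (_root_.norm_sub_le _ _).trans ?_
    have h1 := hK.norm_pull_le_exp hE (m := m) (k := j) (by omega) (by omega) y w
    have h2 := (hK.isPeriodicKernel hE).norm_le m j y w
    linarith

theorem IsAsymptoticKernel.norm_normal_le_of_pos (hE : IsEndModel f₀ ι d δ lev μ ν L v)
    (hK : IsAsymptoticKernel f₀ d δ T T' Φ C γ K N) {m j : ℤ} (hm : 1 ≤ m) (hj : 1 ≤ j) (y w : Y) :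
    ‖segmentKernel f₀ N m j y w‖ ≤
      levelConst L C γ * (gauss (γ / 2) (min (δ (segmentPoint f₀ m y))
        (d (ι (segmentPoint f₀ m y)) (ι (segmentPoint f₀ j w)))) *
          Real.exp (-(levelRate L γ / 2) * ((m : ℝ) - j) ^ 2)) := by
  have hc := le_levelConst (L := L) hK.nonneg hK.pos.le
  have hC := hK.nonneg
  refine le_gauss_mul_exp (by linarith) ?_ ((hK.isPeriodicKernel hE).norm_le m j y w)
  refine (hK.norm_normal_le hE (Eventually.of_forall fun i =>
    hE.min_le_shift m j i hm hj y w)).trans ?_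
  exact mul_le_mul_of_nonneg_right hc (gauss_nonneg _ _)

/-- A path from a segment `m ≥ 1` of the cover to a segment `j ≤ 0` has to pass `W₀`, and this
persists for the far translates. Contributions of segments below the cut are therefore small in the
distance to `W₀`. -/
theorem IsAsymptoticKernel.norm_normal_le_of_nonpos (hE : IsEndModel f₀ ι d δ lev μ ν L v)
    (hK : IsAsymptoticKernel f₀ d δ T T' Φ C γ K N) {m j : ℤ} (hm : 1 ≤ m) (hj : j ≤ 0) (y w : Y) :
    ‖segmentKernel f₀ N m j y w‖ ≤
      levelConst L C γ * (gauss (γ / 2) (δ (segmentPoint f₀ m y)) *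
          Real.exp (-(levelRate L γ / 2) * ((m : ℝ) - j) ^ 2)) := by
  have hc := le_levelConst (L := L) hK.nonneg hK.pos.le
  have hC := hK.nonneg
  refine le_gauss_mul_exp (by linarith) ?_ ((hK.isPeriodicKernel hE).norm_le m j y w)
  refine (hK.norm_normal_le hE ?_).trans (mul_le_mul_of_nonneg_right hc (gauss_nonneg _ _))
  filter_upwards [eventually_ge_atTop (-j).toNat] with i hi
  exact hE.δ_le_shift m j i hm hj (by omega) y w

theorem IsAsymptoticKernel.norm_le_of_lev_eq_zero (hE : IsEndModel f₀ ι d δ lev μ ν L v)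
    (hK : IsAsymptoticKernel f₀ d δ T T' Φ C γ K N) {m : ℤ} (hm : 1 ≤ m) (y : Y) {x : X}
    (hx : lev x = 0) : ‖K (ι (segmentPoint f₀ m y)) x‖ ≤
      levelConst L C γ * (gauss (γ / 2) (δ (segmentPoint f₀ m y)) *
          Real.exp (-(levelRate L γ / 2) * ((m : ℝ) - (0 : ℤ)) ^ 2)) := by
  have hc := le_levelConst (L := L) hK.nonneg hK.pos.le
  have hC := hK.nonneg
  refine le_gauss_mul_exp (by linarith) ((hK.norm_le _ _).trans ?_)
    ((hK.norm_le_exp hE _ _).trans_eq ?_)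
  · exact mul_le_mul hc (gauss_anti hK.pos.le (hE.δ_le m hm y x hx)) (gauss_nonneg _ _)
      (by linarith)
  · have h1 : (lev (ι (segmentPoint f₀ m y)) : ℝ) = m := by
      exact_mod_cast hE.lev_ι m (by omega) y
    rw [h1, hx]
    simp

/-- The two triangle inequalities needed for the error terms `(K - N) K'` and `N (K' - N')`: the
decay of the two factors together controls the minimum of the distances of the outer points to `W₀`.
-/
theorem IsEndModel.min_le_add (hE : IsEndModel f₀ ι d δ lev μ ν L v) {m j k : ℤ} (hm : 1 ≤ m)
    (hj : 1 ≤ j) (hk : 1 ≤ k) (y w y' : Y) :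
    min (δ (segmentPoint f₀ m y)) (δ (segmentPoint f₀ k y')) ≤
      min (δ (segmentPoint f₀ m y)) (δ (segmentPoint f₀ j w)) +
        d (ι (segmentPoint f₀ j w)) (ι (segmentPoint f₀ k y')) ∧
    min (δ (segmentPoint f₀ m y)) (δ (segmentPoint f₀ k y')) ≤
      min (δ (segmentPoint f₀ m y)) (d (ι (segmentPoint f₀ m y)) (ι (segmentPoint f₀ j w))) +
        min (δ (segmentPoint f₀ j w)) (δ (segmentPoint f₀ k y')) := by
  constructor
  · rcases min_choice (δ (segmentPoint f₀ m y)) (δ (segmentPoint f₀ j w)) with h | h <;> rw [h]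
    · exact (min_le_left _ _).trans le_self_add
    · refine (min_le_right _ _).trans ((hE.δ_le_add k j hk hj y' w).trans_eq ?_)
      rw [hE.symm, add_comm]
  · rcases min_choice (δ (segmentPoint f₀ m y))
      (d (ι (segmentPoint f₀ m y)) (ι (segmentPoint f₀ j w))) with h | h <;> rw [h]
    · exact (min_le_left _ _).trans le_self_add
    · rcases min_choice (δ (segmentPoint f₀ j w)) (δ (segmentPoint f₀ k y')) with h' | h' <;> rw [h']
      · exact (min_le_left _ _).trans (hE.δ_le_add m j hm hj y w)
      · exact (min_le_right _ _).trans le_add_self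

/-- Telescoping as `(K - N) K' + N (K' - N')`. In each term one factor carries the decay in the
level difference, and the remaining Gaussian factors combine by the triangle inequality; the
constant is `3 = 2 + 1`, the `2` coming from the interpolated bound for `K - N`. -/
theorem norm_gradedComp_pull_sub_le (hE : IsEndModel f₀ ι d δ lev μ ν L v) (hτ' : IsGrading T' τ')
    (hK : IsAsymptoticKernel f₀ d δ T T' Φ C γ K N)
    (hK' : IsAsymptoticKernel f₀ d δ T T' Φ C γ K' N') {m j k : ℤ} (hm : 1 ≤ m) (hj : 1 ≤ j)
    (hk : 1 ≤ k) (y w y' : Y) :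
    ‖gradedComp (τ' w) (τ' y) (segmentKernel f₀ (pullKernel Φ K) m j y w)
        (segmentKernel f₀ (pullKernel Φ K') j k w y') -
      gradedComp (τ' w) (τ' y) (segmentKernel f₀ N m j y w) (segmentKernel f₀ N' j k w y')‖ ≤
    3 * gradedBound W * levelConst L C γ * levelConst L C γ *
      gauss (γ / 2 / 2) (min (δ (segmentPoint f₀ m y)) (δ (segmentPoint f₀ k y'))) *
      Real.exp (-(levelRate L γ / 2) * ((m : ℝ) - j) ^ 2) := by
  have hC := hK.nonneg
  have hγ := hK.pos
  have hc := le_levelConst (L := L) hC hγ.le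
  have hc0 := hC.trans hc
  have hg := gradedBound_nonneg (W := W)
  set c := levelConst L C γ
  set e := Real.exp (-(levelRate L γ / 2) * ((m : ℝ) - j) ^ 2)
  have he : 0 ≤ e := (Real.exp_pos _).le
  set G := gauss (γ / 2 / 2) (min (δ (segmentPoint f₀ m y)) (δ (segmentPoint f₀ k y')))
  have hmin := hE.min_le_add hm hj hk y w y'
  have hG1 := gauss_mul_gauss_le (γ := γ / 2) (by linarith) hmin.1
  have hG2 := gauss_mul_gauss_le (γ := γ / 2) (by linarith) hmin.2
  have h1 := hK.norm_sub_le_exp hE hm hj y w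
  have h2 : ‖segmentKernel f₀ (pullKernel Φ K') j k w y'‖ ≤ c *
      gauss (γ / 2) (d (ι (segmentPoint f₀ j w)) (ι (segmentPoint f₀ k y'))) :=
    (norm_pullKernel_le _ _ _ _).trans ((hK'.norm_le _ _).trans
      (mul_le_mul hc (gauss_anti_left (by linarith) _) (gauss_nonneg _ _) hc0))
  have h3 := hK.norm_normal_le_of_pos hE hm hj y w
  have h4 : ‖segmentKernel f₀ (pullKernel Φ K') j k w y' - segmentKernel f₀ N' j k w y'‖ ≤ c *
      gauss (γ / 2) (min (δ (segmentPoint f₀ j w)) (δ (segmentPoint f₀ k y'))) :=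
    (hK'.norm_sub_le j k hj hk w y').trans
      (mul_le_mul hc (gauss_anti_left (by linarith) _) (gauss_nonneg _ _) hc0)
  refine (norm_gradedComp_sub_le (hτ'.norm_le w) (hτ'.norm_le y) _ _ _ _).trans ?_
  have n1 := gauss_nonneg (γ / 2) (min (δ (segmentPoint f₀ m y)) (δ (segmentPoint f₀ j w)))
  have n2 := gauss_nonneg (γ / 2) (min (δ (segmentPoint f₀ m y))
        (d (ι (segmentPoint f₀ m y)) (ι (segmentPoint f₀ j w))))
  have a1 := mul_le_mul h1 h2 (norm_nonneg _) (by positivity)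
  have a2 := mul_le_mul h3 h4 (norm_nonneg _) (by positivity)
  calc _ ≤ gradedBound W * (2 * c * c * e * (gauss (γ / 2) (min (δ (segmentPoint f₀ m y))
          (δ (segmentPoint f₀ j w))) *
            gauss (γ / 2) (d (ι (segmentPoint f₀ j w)) (ι (segmentPoint f₀ k y')))) +
        c * c * e * (gauss (γ / 2) (min (δ (segmentPoint f₀ m y))
          (d (ι (segmentPoint f₀ m y)) (ι (segmentPoint f₀ j w)))) *
          gauss (γ / 2) (min (δ (segmentPoint f₀ j w)) (δ (segmentPoint f₀ k y'))))) := by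
        refine mul_le_mul_of_nonneg_left ((add_le_add a1 a2).trans_eq (by ring)) hg
    _ ≤ gradedBound W * (2 * c * c * e * G + c * c * e * G) := by gcongr
    _ = _ := by ring

/-- The restriction to the end of a composition is asymptotic to the composition of the normal
kernels. -/
theorem norm_pull_kcomp_sub_le (hE : IsEndModel f₀ ι d δ lev μ ν L v) (hτ : IsGrading T τ)
    (hτ' : IsGrading T' τ') (hΦ : IsGraded f₀ Φ τ τ')
    (hK : IsAsymptoticKernel f₀ d δ T T' Φ C γ K N)
    (hK' : IsAsymptoticKernel f₀ d δ T T' Φ C γ K' N') {m k : ℤ} (hm : 1 ≤ m)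
    (hk : 1 ≤ k) (y y' : Y) :
    ‖segmentKernel f₀ (pullKernel Φ (kcomp τ μ K K')) m k y y' -
      ∫ w, coverIntegrand f₀ τ' N N' m k y y' w ∂(coverMeasure f₀ ν)‖ ≤
    3 * gradedBound W * levelConst L C γ * levelConst L C γ * v * theta (levelRate L γ / 2) *
      gauss (γ / 2 / 2) (min (δ (segmentPoint f₀ m y)) (δ (segmentPoint f₀ k y'))) := by
  have hfin := hE.isFiniteMeasure
  have hνv := hE.measureReal_univ_le
  have hv := hE.bounded.nonneg
  have hC := hK.nonneg
  have hγ := hK.pos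
  have hc := le_levelConst (L := L) hC hγ.le
  have hc0 := hC.trans hc
  have hg := gradedBound_nonneg (W := W)
  have hρ := levelRate_pos hE.pos hγ
  have hN := hK.isPeriodicKernel hE
  have hN' := hK'.isPeriodicKernel hE
  set c := levelConst L C γ
  set G := gauss (γ / 2 / 2) (min (δ (segmentPoint f₀ m y)) (δ (segmentPoint f₀ k y'))) with hGdef
  have hG0 : 0 ≤ G := gauss_nonneg _ _
  have hδG : gauss (γ / 2) (δ (segmentPoint f₀ m y)) ≤ G :=
    (gauss_anti_left (by linarith) _).trans (gauss_anti (by linarith) (min_le_left _ _))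
  have hInt := integrable_gradedComp_kernels hE hτ hK hK' (ι (segmentPoint f₀ m y))
    (ι (segmentPoint f₀ k y'))
  have h1 := hE.bounded.hasSum_setIntegral
    ((sandwichL (W := W) (endPull f₀ Φ m y) (endPush f₀ Φ k y')).integrable_comp hInt)
  rw [(sandwichL (W := W) (endPull f₀ Φ m y) (endPush f₀ Φ k y')).integral_comp_comm hInt] at h1
  have h2 := hasSum_integral_coverIntegrand (ν := ν) hE.continuous_f₀ hτ' hN hN' m k y y'
  have h3 := ((hasSum_exp_sub_sq (half_pos hρ) m).mul_left
    (3 * gradedBound W * c * c * v * G))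
  refine ((h1.sub h2).norm_le_of_bounded h3 fun j => ?_).trans_eq (by ring)
  set e := Real.exp (-(levelRate L γ / 2) * ((m : ℝ) - j) ^ 2) with he_def
  have he : 0 ≤ e := (Real.exp_pos _).le
  have hnormal : j ≤ 0 → ‖∫ w, gradedComp (τ' w) (τ' y) (segmentKernel f₀ N m j y w)
      (segmentKernel f₀ N' j k w y') ∂ν‖ ≤ gradedBound W * c * c * G * e * v := by
    intro hj
    have hb : ∀ w, ‖gradedComp (τ' w) (τ' y) (segmentKernel f₀ N m j y w)
        (segmentKernel f₀ N' j k w y')‖ ≤ gradedBound W * c * c * G * e := by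
      intro w
      have b1 := hK.norm_normal_le_of_nonpos hE hm hj y w
      have b2 : ‖segmentKernel f₀ N' j k w y'‖ ≤ c := by
        refine (hN'.norm_le j k w y').trans (mul_le_of_le_one_right hc0 ?_)
        rw [Real.exp_le_one_iff]
        nlinarith [sq_nonneg ((j : ℝ) - k)]
      refine (norm_gradedComp_le (hτ'.norm_le w) (hτ'.norm_le y) _ _).trans ?_
      calc _ ≤ gradedBound W * (c * (G * e)) * c := by
            refine mul_le_mul (mul_le_mul_of_nonneg_left (b1.trans ?_) hg) b2 (norm_nonneg _)
              (by positivity)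
            gcongr
        _ = _ := by ring
    refine (norm_integral_le_of_norm_le_const (ae_of_all _ hb)).trans ?_
    exact mul_le_mul_of_nonneg_left hνv (by positivity)
  have hB : 0 ≤ gradedBound W * c * c * G * e * v := by positivity
  -- Negative segments exist on the cover only. At `j = 0` the fibre has the compact part and `W₀`,
  -- the cover a segment; the two are not comparable, but each contribution is small on its own. For
  -- `j ≥ 1` the integrands are compared pointwise.
  rcases lt_trichotomy j 0 with hj | rfl | hj
  · have hempty : (fun x => (lev x : ℤ)) ⁻¹' {j} = ∅ := by
      ext x
      simp only [Set.mem_preimage, Set.mem_singleton_iff, Set.mem_empty_iff_false, iff_false]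
      omega
    rw [hempty, setIntegral_empty, zero_sub, norm_neg]
    exact (hnormal hj.le).trans (by linarith)
  · have hzero : ‖∫ x in (fun x => (lev x : ℤ)) ⁻¹' {0},
        sandwichL (W := W) (endPull f₀ Φ m y) (endPush f₀ Φ k y')
          (gradedComp (τ x) (τ (ι (segmentPoint f₀ m y))) (K (ι (segmentPoint f₀ m y)) x)
            (K' x (ι (segmentPoint f₀ k y')))) ∂μ‖ ≤ gradedBound W * c * c * G * e * v := by
      refine (norm_setIntegral_le_of_norm_le_const
        ((hE.bounded.measure_le 0).trans_lt ENNReal.ofReal_lt_top)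
        (C := gradedBound W * c * c * G * e) fun x hx => ?_).trans ?_
      · have hx0 : lev x = 0 := by
          simpa using hx
        have b1 := hK.norm_le_of_lev_eq_zero hE hm y hx0
        have b2 : ‖K' x (ι (segmentPoint f₀ k y'))‖ ≤ c :=
          (hK'.norm_le _ _).trans ((mul_le_of_le_one_right hC (gauss_le_one hγ.le _)).trans hc)
        rw [sandwichL_apply]
        refine (norm_sandwich_le_of_le_one (norm_endPull_le m y) (norm_endPush_le k y') _).trans ?_
        refine (norm_gradedComp_le (hτ.norm_le x) (hτ.norm_le _) _ _).trans ?_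
        calc _ ≤ gradedBound W * (c * (G * e)) * c := by
              refine mul_le_mul (mul_le_mul_of_nonneg_left (b1.trans ?_) hg) b2 (norm_nonneg _)
                (by positivity)
              gcongr
          _ = _ := by ring
      · refine mul_le_mul_of_nonneg_left ?_ (by positivity)
        exact ENNReal.toReal_le_of_le_ofReal hv (hE.bounded.measure_le 0)
    refine (norm_sub_le _ _).trans ((add_le_add hzero (hnormal le_rfl)).trans ?_)
    linarith
  · have hj1 : 1 ≤ j := hj
    rw [hE.setIntegral_level _ hj1]
    have e1 : ∀ w, sandwichL (W := W) (endPull f₀ Φ m y) (endPush f₀ Φ k y')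
        (gradedComp (τ (ι (segmentPoint f₀ j w))) (τ (ι (segmentPoint f₀ m y)))
          (K (ι (segmentPoint f₀ m y)) (ι (segmentPoint f₀ j w)))
          (K' (ι (segmentPoint f₀ j w)) (ι (segmentPoint f₀ k y')))) =
        gradedComp (τ' w) (τ' y) (segmentKernel f₀ (pullKernel Φ K) m j y w)
          (segmentKernel f₀ (pullKernel Φ K') j k w y') := fun w =>
      hΦ.segmentKernel_gradedComp (by omega) (by omega) k y w y'
    have i1 : Integrable (fun w => sandwichL (W := W) (endPull f₀ Φ m y) (endPush f₀ Φ k y')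
        (gradedComp (τ (ι (segmentPoint f₀ j w))) (τ (ι (segmentPoint f₀ m y)))
          (K (ι (segmentPoint f₀ m y)) (ι (segmentPoint f₀ j w)))
          (K' (ι (segmentPoint f₀ j w)) (ι (segmentPoint f₀ k y'))))) ν := by
      have := ((sandwichL (W := W) (endPull f₀ Φ m y) (endPush f₀ Φ k y')).integrable_comp
        hInt).integrableOn (s := (fun x => (lev x : ℤ)) ⁻¹' {j})
      rw [IntegrableOn, ← hE.map_eq j hj1, (hE.embedding j hj1).integrable_map_iff] at this
      exact this
    simp only [e1] at i1 ⊢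
    rw [← integral_sub i1 (integrable_gradedComp_segment hτ' hN hN' m j j k y y')]
    refine (norm_integral_le_of_norm_le_const (ae_of_all _ fun w =>
      norm_gradedComp_pull_sub_le hE hτ' hK hK' hm hj1 hk y w y')).trans ?_
    calc _ ≤ 3 * gradedBound W * c * c * G * e * v :=
          mul_le_mul_of_nonneg_left hνv (by positivity)
      _ = _ := by ring

end AsymptoticCompositions

/-! ### Dominated convergence for double integrals and norms of supercommutators -/

theorem tendsto_integral_integral {Y G : Type*} [MeasurableSpace Y] {ν : Measure Y}
    [IsFiniteMeasure ν] [NormedAddCommGroup G] [NormedSpace ℝ G] {g : ℕ → Y → Y → G}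
    {g₀ : Y → Y → G} {R : ℝ} (hm : ∀ᶠ k in atTop, StronglyMeasurable (Function.uncurry (g k)))
    (hb : ∀ᶠ k in atTop, ∀ y y', ‖g k y y'‖ ≤ R)
    (hg : ∀ y y', Tendsto (fun k => g k y y') atTop (𝓝 (g₀ y y'))) :
    Tendsto (fun k => ∫ y, ∫ y', g k y y' ∂ν ∂ν) atTop (𝓝 (∫ y, ∫ y', g₀ y y' ∂ν ∂ν)) := by
  refine tendsto_integral_filter_of_dominated_convergence (fun _ => R * ν.real Set.univ) ?_ ?_
    (integrable_const _) (ae_of_all _ fun y => ?_)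
  · filter_upwards [hm] with k hk
    exact (hk.integral_prod_right (ν := ν)).aestronglyMeasurable
  · filter_upwards [hb] with k hk
    exact ae_of_all _ fun y => norm_integral_le_of_norm_le_const (ae_of_all _ (hk y))
  · refine tendsto_integral_filter_of_dominated_convergence (fun _ => R) ?_ ?_
      (integrable_const _) (ae_of_all _ fun y' => hg y y')
    · filter_upwards [hm] with k hk
      exact (hk.comp_measurable measurable_prodMk_left).aestronglyMeasurable
    · filter_upwards [hb] with k hk
      exact ae_of_all _ (hk y)

theorem norm_sub_neg_one_pow_smul_le {G : Type*} [NormedAddCommGroup G] [NormedSpace ℂ G] (n : ℕ)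
    {a b : G} {r : ℝ} (ha : ‖a‖ ≤ r) (hb : ‖b‖ ≤ r) : ‖a - (-1 : ℂ) ^ n • b‖ ≤ 2 * r := by
  refine (norm_sub_le _ _).trans ?_
  rw [norm_smul, norm_pow, norm_neg, norm_one, one_pow, one_mul]
  linarith

/-! ### Supercommutators and the limit of their supertraces -/

section Supercommutators

variable {W : Type*} [AddCommGroup W] [Module ℂ W] [FiniteDimensional ℂ W]
  {F F' : Type*} [NormedAddCommGroup F] [NormedSpace ℂ F] [FiniteDimensional ℂ F]
  [NormedAddCommGroup F'] [NormedSpace ℂ F'] [FiniteDimensional ℂ F']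
  {X : Type*} [MeasurableSpace X] {Y : Type*} [TopologicalSpace Y] [MeasurableSpace Y]
  [BorelSpace Y]
  {V : X → Type*} [∀ x, NormedAddCommGroup (V x)] [∀ x, InnerProductSpace ℂ (V x)]
  [∀ x, FiniteDimensional ℂ (V x)]
  {V' : Y → Type*} [∀ y, NormedAddCommGroup (V' y)] [∀ y, InnerProductSpace ℂ (V' y)]
  [∀ y, FiniteDimensional ℂ (V' y)]
  {f₀ : Y → Circle} {ι : ℝ × Y → X} {d : X → X → ℝ≥0∞} {δ : ℝ × Y → ℝ≥0∞}
  {lev : X → ℕ} {μ : Measure X} {ν : Measure Y} {L : NNReal} {v : ℝ}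
  {T : ∀ x, V x ≃L[ℂ] F} {T' : ∀ y, V' y ≃L[ℂ] F'}
  {τ : ∀ x, V x →L[ℂ] V x} {τ' : ∀ y, V' y →L[ℂ] V' y} {C γ : ℝ}
  {Φ : ∀ x : ℝ × Y, V' x.2 ≃ₗᵢ[ℂ] V (ι x)} {K K' : Kernel W V}
  {N N' : Kernel W fun x : ℝ × Y => V' x.2} {p q : ℕ}

theorem exists_norm_superComm_le (hE : IsEndModel f₀ ι d δ lev μ ν L v) (hτ : IsGrading T τ)
    (hK : IsAsymptoticKernel f₀ d δ T T' Φ C γ K N)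
    (hK' : IsAsymptoticKernel f₀ d δ T T' Φ C γ K' N') (p q : ℕ) :
    ∃ C₁ > 0, ∃ γ₁ > 0, ∀ x x', ‖superComm τ μ p q K K' x x'‖ ≤ C₁ * gauss γ₁ (d x x') := by
  set c := gradedBound W * C * levelConst L C (γ / 2) * (v * theta (levelRate L (γ / 2)))
  have hγ := hK.pos
  refine ⟨2 * |c| + 1, by positivity, γ / 2 / 2, by positivity, fun x x' => ?_⟩
  have h := norm_sub_neg_one_pow_smul_le (p * q) (norm_kcomp_le hE hτ hK hK' x x')
    (norm_kcomp_le hE hτ hK' hK x x')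
  refine h.trans ?_
  have hg := gauss_nonneg (γ / 2 / 2) (d x x')
  calc 2 * (c * gauss (γ / 2 / 2) (d x x')) = (2 * c) * gauss (γ / 2 / 2) (d x x') := by ring
    _ ≤ _ := mul_le_mul_of_nonneg_right (by linarith [le_abs_self c]) hg

theorem exists_norm_pull_superComm_sub_le (hE : IsEndModel f₀ ι d δ lev μ ν L v)
    (hτ : IsGrading T τ) (hτ' : IsGrading T' τ') (hΦ : IsGraded f₀ Φ τ τ')
    (hK : IsAsymptoticKernel f₀ d δ T T' Φ C γ K N)
    (hK' : IsAsymptoticKernel f₀ d δ T T' Φ C γ K' N') (p q : ℕ) :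
    ∃ C₁ > 0, ∃ γ₁ > 0, ∀ m k : ℤ, 1 ≤ m → 1 ≤ k → ∀ y y' : Y,
      ‖segmentKernel f₀ (pullKernel Φ (superComm τ μ p q K K')) m k y y' -
        segmentKernel f₀ (superComm (fun x : ℝ × Y => τ' x.2) (coverMeasure f₀ ν) p q N N')
          m k y y'‖ ≤
      C₁ * gauss γ₁ (min (δ (segmentPoint f₀ m y)) (δ (segmentPoint f₀ k y'))) := by
  set c := 3 * gradedBound W * levelConst L C γ * levelConst L C γ * v * theta (levelRate L γ / 2)
  have hγ := hK.pos
  refine ⟨2 * |c| + 1, by positivity, γ / 2 / 2, by positivity, fun m k hm hk y y' => ?_⟩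
  have h := norm_sub_neg_one_pow_smul_le (p * q)
    (norm_pull_kcomp_sub_le hE hτ hτ' hΦ hK hK' hm hk y y')
    (norm_pull_kcomp_sub_le hE hτ hτ' hΦ hK' hK hm hk y y')
  have e1 : segmentKernel f₀ (pullKernel Φ (superComm τ μ p q K K')) m k y y' =
      segmentKernel f₀ (pullKernel Φ (kcomp τ μ K K')) m k y y' - (-1 : ℂ) ^ (p * q) •
        segmentKernel f₀ (pullKernel Φ (kcomp τ μ K' K)) m k y y' := by
    simp only [segmentKernel_pullKernel, superComm, map_sub, map_smul]
  have e2 : segmentKernel f₀ (superComm (fun x : ℝ × Y => τ' x.2) (coverMeasure f₀ ν) p q N N')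
      m k y y' = (∫ w, coverIntegrand f₀ τ' N N' m k y y' w ∂(coverMeasure f₀ ν)) -
        (-1 : ℂ) ^ (p * q) • ∫ w, coverIntegrand f₀ τ' N' N m k y y' w ∂(coverMeasure f₀ ν) := rfl
  rw [e1, e2]
  have e3 : ∀ a b a' b' : Coeff W (V' y' →L[ℂ] V' y), a - (-1 : ℂ) ^ (p * q) • b -
      (a' - (-1 : ℂ) ^ (p * q) • b') = a - a' - (-1 : ℂ) ^ (p * q) • (b - b') := by
    intro a b a' b'
    rw [smul_sub]; abel
  rw [e3]
  refine h.trans ?_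
  have hg := gauss_nonneg (γ / 2 / 2) (min (δ (segmentPoint f₀ m y)) (δ (segmentPoint f₀ k y')))
  rw [← mul_assoc]
  exact mul_le_mul_of_nonneg_right (by linarith [le_abs_self c]) hg

/-- The integrand `str (K(x, w) K'(w, x))` of the supertrace of a composition. -/
def strIntegrand (τ : ∀ x, V x →L[ℂ] V x) (K K' : Kernel W V) (x w : X) : Form W :=
  str (τ x) (gradedComp (τ w) (τ x) (K x w) (K' w x))

theorem stronglyMeasurable_strIntegrand (hτ : IsGrading T τ)
    (hK : IsAsymptoticKernel f₀ d δ T T' Φ C γ K N)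
    (hK' : IsAsymptoticKernel f₀ d δ T T' Φ C γ K' N') :
    StronglyMeasurable (Function.uncurry (strIntegrand τ K K')) := by
  have m1 : Measurable fun q : X × X => (q.1, q.2, q.1) := by fun_prop
  exact MeasurableIn.str (hτ.measurable.comp measurable_fst)
    ((measurableIn_gradedComp_kernels hτ hK hK').comp m1)

theorem norm_strIntegrand_le (hE : IsEndModel f₀ ι d δ lev μ ν L v) (hτ : IsGrading T τ)
    (hK : IsAsymptoticKernel f₀ d δ T T' Φ C γ K N)
    (hK' : IsAsymptoticKernel f₀ d δ T T' Φ C γ K' N') (x w : X) :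
    ‖strIntegrand τ K K' x w‖ ≤ Module.finrank ℂ F * gradedBound W * C * levelConst L C γ *
      Real.exp (-levelRate L γ * ((lev x : ℝ) - lev w) ^ 2) := by
  have hC := hK.nonneg
  have hg := gradedBound_nonneg (W := W)
  have hc0 := hC.trans (le_levelConst (L := L) hC hK.pos.le)
  have h1 : Module.finrank ℂ (V x) = Module.finrank ℂ F := (T x).toLinearEquiv.finrank_eq
  refine (norm_str_le (hτ.norm_le x) _).trans ?_
  rw [h1]
  have h2 : ‖K' w x‖ ≤ C :=
    (hK'.norm_le _ _).trans (mul_le_of_le_one_right hC (gauss_le_one hK.pos.le _))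
  have h3 : ‖gradedComp (τ w) (τ x) (K x w) (K' w x)‖ ≤ gradedBound W *
      (levelConst L C γ * Real.exp (-levelRate L γ * ((lev x : ℝ) - lev w) ^ 2)) * C := by
    refine (norm_gradedComp_le (hτ.norm_le w) (hτ.norm_le x) _ _).trans ?_
    exact mul_le_mul (mul_le_mul_of_nonneg_left (hK.norm_le_exp hE x w) hg) h2 (norm_nonneg _)
      (by positivity)
  calc _ ≤ (Module.finrank ℂ F : ℝ) * (gradedBound W *
      (levelConst L C γ * Real.exp (-levelRate L γ * ((lev x : ℝ) - lev w) ^ 2)) * C) :=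
        mul_le_mul_of_nonneg_left h3 (by positivity)
    _ = _ := by ring

/-- The sign in the supercommutator is the sign of exchanging the two factors under the supertrace.
The result is the antisymmetrization of a single integrand, to which the cancellation between levels
applies. -/
theorem str_superComm (hE : IsEndModel f₀ ι d δ lev μ ν L v) (hτ : IsGrading T τ)
    (hK : IsAsymptoticKernel f₀ d δ T T' Φ C γ K N)
    (hK' : IsAsymptoticKernel f₀ d δ T T' Φ C γ K' N')
    (hp : ∀ x x', HasParity (τ x') (τ x) p (K x x'))
    (hq : ∀ x x', HasParity (τ x') (τ x) q (K' x x')) (x : X) :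
    str (τ x) (superComm τ μ p q K K' x x) =
      (∫ w, strIntegrand τ K K' x w ∂μ) - ∫ w, strIntegrand τ K K' w x ∂μ := by
  have h1 := (strL (W := W) (hτ.norm_le x)).integral_comp_comm
    (integrable_gradedComp_kernels hE hτ hK hK' x x)
  have h2 := (strL (W := W) (hτ.norm_le x)).integral_comp_comm
    (integrable_gradedComp_kernels hE hτ hK' hK x x)
  have h3 : ∀ w, (-1 : ℂ) ^ (p * q) • strIntegrand τ K' K x w = strIntegrand τ K K' w x := fun w =>
    str_gradedComp_comm (hτ.sq w) (hτ.sq x) (hp w x) (hq x w)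
  simp only [← h3]
  rw [integral_smul, superComm, map_sub, map_smul]
  exact congrArg₂ (fun a b => a - (-1 : ℂ) ^ (p * q) • b) h1.symm h2.symm

theorem IsGraded.strIntegrand_eq (hΦ : IsGraded f₀ Φ τ τ') {i j : ℤ} (hi : 0 ≤ i) (hj : 0 ≤ j)
    (y y' : Y) : strIntegrand τ K K' (ι (segmentPoint f₀ i y)) (ι (segmentPoint f₀ j y')) =
      segmentPairing f₀ τ' (pullKernel Φ K) (pullKernel Φ K') i j j i y y' := by
  rw [segmentPairing, ← hΦ.segmentKernel_gradedComp hi hj i y y' y]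
  exact (str_sandwich _ _ (endPush_endPull i y) (hΦ.endPull_comp hi y) _).symm

theorem tendsto_segmentPairing (hE : IsEndModel f₀ ι d δ lev μ ν L v) (hτ' : IsGrading T' τ')
    (hK : IsAsymptoticKernel f₀ d δ T T' Φ C γ K N)
    (hK' : IsAsymptoticKernel f₀ d δ T T' Φ C γ K' N') (i j : ℤ) (y y' : Y) :
    Tendsto (fun k : ℕ => segmentPairing f₀ τ' (pullKernel Φ K) (pullKernel Φ K')
      (i + k) (j + k) (j + k) (i + k) y y') atTop (𝓝 (segmentPairing f₀ τ' N N' i j j i y y')) := by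
  have h1 := hK.tendsto hE i j y y'
  have h2 := hK'.tendsto hE j i y' y
  have h3 := ((gradedCompL (W := W) (V₁ := V' y) (hτ'.norm_le y')
    (hτ'.norm_le y)).isBoundedBilinearMap.continuous.tendsto _).comp (h1.prodMk_nhds h2)
  exact ((strL (W := W) (hτ'.norm_le y)).continuous.tendsto _).comp h3

theorem stronglyMeasurable_strIntegrand_segment (hE : IsEndModel f₀ ι d δ lev μ ν L v)
    (hτ : IsGrading T τ) (hK : IsAsymptoticKernel f₀ d δ T T' Φ C γ K N)
    (hK' : IsAsymptoticKernel f₀ d δ T T' Φ C γ K' N') {i j : ℤ} (hi : 1 ≤ i) (hj : 1 ≤ j) :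
    StronglyMeasurable (Function.uncurry fun y y' => strIntegrand τ K K'
      (ι (segmentPoint f₀ i y)) (ι (segmentPoint f₀ j y'))) := by
  have m1 : Measurable fun q : Y × Y => (ι (segmentPoint f₀ i q.1), ι (segmentPoint f₀ j q.2)) :=
    ((hE.embedding i hi).measurable.comp measurable_fst).prodMk
      ((hE.embedding j hj).measurable.comp measurable_snd)
  have h := (stronglyMeasurable_strIntegrand hτ hK hK').comp_measurable m1
  simp only [Function.uncurry_def, Function.comp_def] at h ⊢
  exact h

theorem IsEndModel.levelIntegral_eq (hE : IsEndModel f₀ ι d δ lev μ ν L v)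
    {i j : ℕ} (hi : 1 ≤ i) (hj : 1 ≤ j) {G : Type*} [NormedAddCommGroup G] [NormedSpace ℂ G]
    [CompleteSpace G] (a : X → X → G) :
    levelIntegral μ lev a i j =
      ∫ y, ∫ y', a (ι (segmentPoint f₀ i y)) (ι (segmentPoint f₀ j y')) ∂ν ∂ν := by
  have hlev : ∀ k : ℕ, lev ⁻¹' {k} = (fun x => (lev x : ℤ)) ⁻¹' {(k : ℤ)} := by
    intro k
    ext x
    simp
  rw [levelIntegral, hlev, hlev, hE.setIntegral_level _ (by omega)]
  refine integral_congr_ae (ae_of_all _ fun y => ?_)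
  exact hE.setIntegral_level _ (by omega)

/-- Far out on the end a pair of segments at fixed difference looks like a pair of segments of the
cover. The integrands converge pointwise to the periodic pairing and are uniformly bounded on sets
of finite measure. -/
theorem tendsto_levelIntegral (hE : IsEndModel f₀ ι d δ lev μ ν L v) (hτ : IsGrading T τ)
    (hτ' : IsGrading T' τ') (hΦ : IsGraded f₀ Φ τ τ')
    (hK : IsAsymptoticKernel f₀ d δ T T' Φ C γ K N)
    (hK' : IsAsymptoticKernel f₀ d δ T T' Φ C γ K' N') (i j : ℕ) :
    Tendsto (fun k => levelIntegral μ lev (strIntegrand τ K K') (k + i) (k + j)) atTop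
      (𝓝 (∫ y, ∫ y', segmentPairing f₀ τ' N N' i j j i y y' ∂ν ∂ν)) := by
  have hfin := hE.isFiniteMeasure
  have hC := hK.nonneg
  have hg := gradedBound_nonneg (W := W)
  have hc0 := hC.trans (le_levelConst (L := L) hC hK.pos.le)
  have hmeas : ∀ᶠ k : ℕ in atTop, StronglyMeasurable (Function.uncurry fun y y' =>
      strIntegrand τ K K' (ι (segmentPoint f₀ ((k + i : ℕ) : ℤ) y))
        (ι (segmentPoint f₀ ((k + j : ℕ) : ℤ) y'))) := by
    filter_upwards [eventually_ge_atTop 1] with k hk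
    exact stronglyMeasurable_strIntegrand_segment hE hτ hK hK' (by omega) (by omega)
  have hbd : ∀ᶠ k : ℕ in atTop, ∀ y y', ‖strIntegrand τ K K'
      (ι (segmentPoint f₀ ((k + i : ℕ) : ℤ) y)) (ι (segmentPoint f₀ ((k + j : ℕ) : ℤ) y'))‖ ≤
      Module.finrank ℂ F * gradedBound W * C * levelConst L C γ := by
    refine Eventually.of_forall fun k y y' => (norm_strIntegrand_le hE hτ hK hK' _ _).trans ?_
    refine mul_le_of_le_one_right (by positivity) ?_
    rw [Real.exp_le_one_iff, neg_mul]
    have := (levelRate_pos hE.pos hK.pos).le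
    exact neg_nonpos.2 (by positivity)
  have hlim : ∀ y y', Tendsto (fun k : ℕ => strIntegrand τ K K'
      (ι (segmentPoint f₀ ((k + i : ℕ) : ℤ) y)) (ι (segmentPoint f₀ ((k + j : ℕ) : ℤ) y'))) atTop
      (𝓝 (segmentPairing f₀ τ' N N' i j j i y y')) := by
    intro y y'
    refine (tendsto_segmentPairing hE hτ' hK hK' i j y y').congr fun k => ?_
    have e1 : (i : ℤ) + k = ((k + i : ℕ) : ℤ) := by push_cast; ring
    have e2 : (j : ℤ) + k = ((k + j : ℕ) : ℤ) := by push_cast; ring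
    rw [e1, e2]
    exact (hΦ.strIntegrand_eq (by omega) (by omega) y y').symm
  refine (tendsto_integral_integral (ν := ν) hmeas hbd hlim).congr' ?_
  filter_upwards [eventually_ge_atTop 1] with k hk
  exact (hE.levelIntegral_eq (by omega) (by omega) _).symm

/-- The renormalized supertrace of a supercommutator, as a sum over differences of levels. -/
theorem tendsto_setIntegral_str_superComm (hE : IsEndModel f₀ ι d δ lev μ ν L v)
    (hτ : IsGrading T τ) (hτ' : IsGrading T' τ') (hΦ : IsGraded f₀ Φ τ τ')
    (hK : IsAsymptoticKernel f₀ d δ T T' Φ C γ K N)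
    (hK' : IsAsymptoticKernel f₀ d δ T T' Φ C γ K' N')
    (hp : ∀ x x', HasParity (τ x') (τ x) p (K x x'))
    (hq : ∀ x x', HasParity (τ x') (τ x) q (K' x x')) :
    Tendsto (fun j : ℕ => ∫ x in {x | lev x ≤ j}, str (τ x) (superComm τ μ p q K K' x x) ∂μ) atTop
      (𝓝 (-∑' m : ℤ, (m : ℂ) • ∫ y, ∫ y', segmentPairing f₀ τ' N N' m 0 (-m) 0 y y' ∂ν ∂ν)) := by
  have hC := hK.nonneg
  have hg := gradedBound_nonneg (W := W)
  have hc0 := hC.trans (le_levelConst (L := L) hC hK.pos.le)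
  have hN := hK.isPeriodicKernel hE
  have hN' := hK'.isPeriodicKernel hE
  simp only [str_superComm hE hτ hK hK' hp hq]
  refine hE.bounded.tendsto_setIntegral_sub_swap (stronglyMeasurable_strIntegrand hτ hK hK')
    (levelRate_pos hE.pos hK.pos) (by positivity) (norm_strIntegrand_le hE hτ hK hK')
    (A := fun m : ℤ => ∫ y, ∫ y', segmentPairing f₀ τ' N N' m 0 (-m) 0 y y' ∂ν ∂ν)
    (fun i => ?_) fun i => ?_
  · have h := tendsto_levelIntegral hE hτ hτ' hΦ hK hK' i 0
    have e : ∀ y y', segmentPairing f₀ τ' N N' i (0 : ℕ) (0 : ℕ) i y y' =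
        segmentPairing f₀ τ' N N' i 0 (-i) 0 y y' := by
      intro y y'
      have := (segmentPairing_shift (τ := τ') hN hN' i 0 (-i) 0 i y y').2
      simpa using this
    simp only [e] at h
    exact h
  · have h := tendsto_levelIntegral hE hτ hτ' hΦ hK hK' 0 i
    have e : ∀ y y', segmentPairing f₀ τ' N N' (0 : ℕ) i i (0 : ℕ) y y' =
        segmentPairing f₀ τ' N N' (-i) 0 (- -i) 0 y y' := by
      intro y y'
      have := (segmentPairing_shift (τ := τ') hN hN' (-i) 0 i 0 i y y').1
      simpa using this
    simp only [e] at h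
    exact h

end Supercommutators

/-! ### End-periodic Riemannian manifolds satisfy the abstract model -/

section PeriodicEndModels

open Manifold

variable {n : ℕ} {X : Type*} [TopologicalSpace X] [ChartedSpace (EuclideanSpace ℝ (Fin n)) X]
  {Y : Type*} [TopologicalSpace Y] [ChartedSpace (EuclideanSpace ℝ (Fin n)) Y] {f₀ : Y → Circle}
  [RiemannianBundle (fun x : X => TangentSpace (𝓡 n) x)]
  [RiemannianBundle (fun y : Y => TangentSpace (𝓡 n) y)]
  {D : PeriodicEnd (𝓡 n) (𝓡 n) X f₀}

namespace PeriodicEnd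

theorem ι_segmentPoint (D : PeriodicEnd (𝓡 n) (𝓡 n) X f₀) (m : ℕ) (y : Y) :
    D.ι (segmentPoint f₀ m y).1 (segmentPoint f₀ m y).2 = D.segmentMap m y := by
  simp [segmentPoint, segmentMap]

theorem segmentPoint_add (m : ℤ) (j : ℕ) (y : Y) :
    segmentPoint f₀ (m + j) y = ((segmentPoint f₀ m y).1 + j, y) := by
  simp [segmentPoint, add_assoc]

theorem le_segmentPoint (m : ℤ) (y : Y) : (m : ℝ) ≤ (segmentPoint f₀ m y).1 := by
  simpa [segmentPoint] using segmentCoord_nonneg (f₀ := f₀) y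

theorem segmentPoint_lt (m : ℤ) (y : Y) : (segmentPoint f₀ m y).1 < m + 1 := by
  have := segmentCoord_lt_one (f₀ := f₀) y
  simp only [segmentPoint]
  linarith

theorem endCoord_segmentPoint (D : PeriodicEnd (𝓡 n) (𝓡 n) X f₀) {m : ℤ} (hm : 0 ≤ m) (y : Y) :
    D.endCoord (D.ι (segmentPoint f₀ m y).1 (segmentPoint f₀ m y).2) = (segmentPoint f₀ m y).1 := by
  refine D.endCoord_ι (segmentPoint_mem_cover m y) ?_
  exact le_trans (by exact_mod_cast hm) (le_segmentPoint m y)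

theorem abs_level_sub_le (D : PeriodicEnd (𝓡 n) (𝓡 n) X f₀) (x x' : X) :
    |(D.level x : ℝ) - D.level x'| ≤ |D.endCoord x - D.endCoord x'| + 1 := by
  have h1 := Nat.floor_le (D.endCoord_nonneg x)
  have h2 := Nat.lt_floor_add_one (D.endCoord x)
  have h3 := Nat.floor_le (D.endCoord_nonneg x')
  have h4 := Nat.lt_floor_add_one (D.endCoord x')
  have h5 := le_abs_self (D.endCoord x - D.endCoord x')
  have h6 := neg_abs_le (D.endCoord x - D.endCoord x')
  rw [abs_le]
  unfold level
  constructor <;> linarith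

/-- All the Riemannian geometry is summarized here: the Lipschitz property of the coordinate, the
length-preserving translations and the equality of volumes of the segments. The estimates of kernels
use nothing else. -/
theorem IsMetricLift.isEndModel [IsManifold (𝓡 n) ∞ X] [IsManifold (𝓡 n) ∞ Y] [T2Space X]
    [CompactSpace Y] [SecondCountableTopology Y] [MeasurableSpace X] [BorelSpace X]
    [MeasurableSpace Y] [BorelSpace Y]
    [IsContMDiffRiemannianBundle (𝓡 n) ∞ (EuclideanSpace ℝ (Fin n))
      (fun x : X => TangentSpace (𝓡 n) x)]
    [IsContMDiffRiemannianBundle (𝓡 n) ∞ (EuclideanSpace ℝ (Fin n))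
      (fun y : Y => TangentSpace (𝓡 n) y)]
    (hD : D.IsMetricLift) {μ : Measure X} {ν : Measure Y}
    (hμ : IsRiemannianVolume (n := n) μ) (hν : IsRiemannianVolume (n := n) ν) :
    ∃ (L : NNReal) (v : ℝ), IsEndModel f₀ (fun x => D.ι x.1 x.2) (riemannianEDist (𝓡 n))
      (fun x => D.distSegment x.1 x.2) D.level μ ν L v := by
  obtain ⟨L, hL0, hL⟩ := exists_enorm_mfderiv_lift_le D.smooth_f₀
  have hμf := hμ.isLocallyFiniteMeasure
  have hνf := hν.isLocallyFiniteMeasure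
  have hlip := hD.endCoord_sub_le hL0 hL
  have hfin0 : μ {x | D.level x = 0} < ⊤ := by
    obtain ⟨K, hK, hsub⟩ := D.exists_isCompact_level_zero
    exact (measure_mono hsub).trans_lt hK.measure_lt_top
  have hcast : ∀ m : ℕ, (fun x => (D.level x : ℤ)) ⁻¹' {(m : ℤ)} = {x | D.level x = m} := by
    intro m; ext x; simp
  have hseg : ∀ m : ℕ, (fun y => D.ι (segmentPoint f₀ m y).1 (segmentPoint f₀ m y).2) =
      D.segmentMap m := fun m => funext fun y => D.ι_segmentPoint m y
  have hmap : ∀ m : ℕ, 1 ≤ m → ν.map (D.segmentMap m) = μ.restrict {x | D.level x = m} :=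
    fun m hm => hD.map_segmentMap hμ hν hm
  have hpos : ∀ {m : ℤ}, 1 ≤ m → ∀ y : Y, 1 ≤ (segmentPoint f₀ m y).1 := fun hm y =>
    le_trans (by exact_mod_cast hm) (le_segmentPoint _ y)
  -- The first summand bounds the volume of level `0`, the second one that of every later segment.
  refine ⟨L, (μ {x | D.level x = 0}).toReal + (ν Set.univ).toReal, ?_⟩
  constructor
  · exact D.continuous_f₀
  · exact fun x x' => riemannianEDist_comm
  · exact fun x x' x'' => riemannianEDist_triangle
  · exact hL0
  -- The loss `2` is the error `1` of the Lipschitz estimate and `1` for rounding the coordinates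
  -- down to levels.
  · intro x x'
    have h1 := D.abs_level_sub_le x x'
    rcases abs_cases (D.endCoord x - D.endCoord x') with h | h
    · refine le_trans (ENNReal.ofReal_le_ofReal ?_) (hlip x x')
      linarith
    · rw [riemannianEDist_comm]
      refine le_trans (ENNReal.ofReal_le_ofReal ?_) (hlip x' x)
      linarith
  · intro m hm y
    lift m to ℕ using hm
    rw [D.ι_segmentPoint, D.level_segmentMap]
  · intro m hm
    lift m to ℕ using by omega
    rw [hseg]
    exact D.measurableEmbedding_segmentMap m
  · intro m hm
    lift m to ℕ using by omega
    rw [hseg, hcast, hmap m (by omega)]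
  · refine ⟨(measurable_of_countable fun m : ℕ => (m : ℤ)).comp D.measurable_level, fun m => ?_,
      by positivity⟩
    rw [ENNReal.ofReal_add ENNReal.toReal_nonneg ENNReal.toReal_nonneg,
      ENNReal.ofReal_toReal hfin0.ne, ENNReal.ofReal_toReal (measure_lt_top ν _).ne]
    rcases lt_trichotomy m 0 with h | rfl | h
    · have : (fun x => (D.level x : ℤ)) ⁻¹' {m} = ∅ := by
        ext x
        simp only [Set.mem_preimage, Set.mem_singleton_iff, Set.mem_empty_iff_false, iff_false]
        omega
      rw [this, measure_empty]
      exact zero_le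
    · have := hcast 0
      rw [Nat.cast_zero] at this
      rw [this]
      exact le_self_add
    · lift m to ℕ using h.le
      rw [hcast, ← Measure.restrict_apply_univ, ← hmap m (by omega),
        Measure.map_apply (D.measurableEmbedding_segmentMap m).measurable MeasurableSet.univ,
        Set.preimage_univ]
      exact le_add_self
  -- The coordinate is at least `m` at the given point and at most `1` on `W₀`, and the Lipschitz
  -- estimate loses `1`. So `m - 2` would do as well as `m - 3`.
  · intro m y
    rcases le_or_gt ((m : ℝ) - 3) 0 with h | h
    · rw [ENNReal.ofReal_of_nonpos h]; exact zero_le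
    have hm : 0 ≤ m := by
      have : (0 : ℝ) < m := by linarith
      exact_mod_cast this.le
    have hL' : (L : ℝ≥0∞) ≠ 0 := by exact_mod_cast hL0.ne'
    rw [mul_comm, ← ENNReal.div_le_iff hL' ENNReal.coe_ne_top]
    refine le_iInf₂ fun w hw => ?_
    rw [ENNReal.div_le_iff hL' ENNReal.coe_ne_top, mul_comm]
    refine le_trans (ENNReal.ofReal_le_ofReal ?_) (hlip _ _)
    rw [D.endCoord_segmentPoint hm, D.endCoord_ι hw.1 hw.2.1]
    have h1 := le_segmentPoint (f₀ := f₀) m y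
    have h2 := hw.2.2
    linarith
  · intro m hm y x hx
    have h := hD.distSegment_le (segmentPoint_mem_cover m y) (hpos hm y) 0 (p := x) ?_
    · rwa [Nat.cast_zero, add_zero] at h
    · have := Nat.lt_floor_add_one (D.endCoord x)
      rw [show ⌊D.endCoord x⌋₊ = 0 from hx] at this
      exact this.le
  · intro m k hm hk y y'
    -- Moving the distance to the other side leaves only the infimum on the right, which can be
    -- bounded below for each point `w` of `W₀` separately.
    refine tsub_le_iff_left.1 (le_iInf₂ fun w hw => tsub_le_iff_left.2 ?_)
    exact (iInf₂_le w hw).trans riemannianEDist_triangle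
  · intro m k j hm hk hkj y y'
    have h := hD.distSegment_le (segmentPoint_mem_cover m y) (hpos hm y) j
      (p := D.ι (segmentPoint f₀ (k + j) y').1 (segmentPoint f₀ (k + j) y').2) ?_
    · rw [segmentPoint_add]
      exact h
    · rw [D.endCoord_segmentPoint hkj]
      have h1 := segmentPoint_lt (f₀ := f₀) (k + j) y'
      have h2 : ((k : ℤ) : ℝ) ≤ 0 := by exact_mod_cast hk
      push_cast at h1
      linarith
  · intro m k j hm hk y y'
    rw [segmentPoint_add, segmentPoint_add]
    exact hD.min_distSegment_le (segmentPoint_mem_cover m y) (hpos hm y)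
      (segmentPoint_mem_cover k y') (zero_le_one.trans (hpos hk y')) j

end PeriodicEnd

end PeriodicEndModels

/-! ### The defect in terms of the indicial families -/

section IndicialDefect

variable {W : Type*} [AddCommGroup W] [Module ℂ W] [FiniteDimensional ℂ W]
  {F : Type*} [NormedAddCommGroup F] [NormedSpace ℂ F] [FiniteDimensional ℂ F]
  {Y : Type*} [TopologicalSpace Y] [MeasurableSpace Y] [BorelSpace Y] {f₀ : Y → Circle}
  {V : Y → Type*} [∀ y, NormedAddCommGroup (V y)] [∀ y, InnerProductSpace ℂ (V y)]
  [∀ y, FiniteDimensional ℂ (V y)]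
  {T : ∀ y, V y ≃L[ℂ] F} {τ : ∀ y, V y →L[ℂ] V y} {C C' γ : ℝ}
  {N N' : Kernel W fun x : ℝ × Y => V x.2} {ν : Measure Y} [IsFiniteMeasure ν]

/-- The defect of the supertrace, in terms of the indicial families. -/
theorem indicial_defect (hf : Continuous f₀) (hτ : IsGrading T τ)
    (hN : IsPeriodicKernel f₀ T C γ N) (hN' : IsPeriodicKernel f₀ T C' γ N') {p q : ℕ}
    (hp : ∀ (m k : ℤ) (y y' : Y), HasParity (τ y') (τ y) p (segmentKernel f₀ N m k y y'))
    (hq : ∀ (m k : ℤ) (y y' : Y), HasParity (τ y') (τ y) q (segmentKernel f₀ N' m k y y')) :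
    ((2 * Real.pi * Complex.I : ℂ)⁻¹ •
        ∮ ξ in C(0, 1), ξ⁻¹ • ∫ x in segment f₀, (x.1 : ℂ) • str (τ x.2)
          (superComm τ ν p q (indicialKernel f₀ N ξ) (indicialKernel f₀ N' ξ) x.2 x.2)
          ∂(coverMeasure f₀ ν)) -
      (2 * Real.pi * Complex.I : ℂ)⁻¹ • ∮ ξ in C(0, 1), ∫ y, str (τ y)
        (kcomp τ ν (fun y y' => deriv (fun ζ => indicialKernel f₀ N ζ y y') ξ)
          (indicialKernel f₀ N' ξ) y y) ∂ν =
    -∑' m : ℤ, (m : ℂ) • ∫ y, ∫ y', segmentPairing f₀ τ N N' m 0 (-m) 0 y y' ∂ν ∂ν := by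
  have hseg : ∀ ξ : ℂ, ∫ x in segment f₀, (x.1 : ℂ) • str (τ x.2)
      (superComm τ ν p q (indicialKernel f₀ N ξ) (indicialKernel f₀ N' ξ) x.2 x.2)
      ∂(coverMeasure f₀ ν) = ∫ y, (segmentCoord f₀ y : ℂ) • str (τ y)
        (superComm τ ν p q (indicialKernel f₀ N ξ) (indicialKernel f₀ N' ξ) y y) ∂ν := by
    intro ξ
    rw [setIntegral_segment hf]
    refine integral_congr_ae (ae_of_all _ fun y => ?_)
    have h : (segmentPoint f₀ 0 y).1 = segmentCoord f₀ y := by simp [segmentPoint]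
    show ((segmentPoint f₀ 0 y).1 : ℂ) • _ = _
    rw [h]
    rfl
  simp only [hseg]
  refine fourier_defect (measurable_segmentCoord hf) segmentCoord_nonneg segmentCoord_lt_one
    (C := Module.finrank ℂ F * gradedBound W * C * C')
    (b := fun m k => segmentPairing f₀ τ N N' m 0 k 0)
    (T₁ := fun ξ y => str (τ y)
      (superComm τ ν p q (indicialKernel f₀ N ξ) (indicialKernel f₀ N' ξ) y y))
    (T₂ := fun ξ y => str (τ y)
        (kcomp τ ν (fun y y' => deriv (fun ζ => indicialKernel f₀ N ζ y y') ξ)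
          (indicialKernel f₀ N' ξ) y y))
    (fun m k => stronglyMeasurable_segmentPairing hτ hN hN' m 0 k 0) hN.pos ?_ ?_
    (fun ξ hξ y => str_superComm_indicial hτ hN hN' hp hq hξ y)
    (fun ξ hξs hξ y => str_kcomp_indicialDeriv hf hτ hN hN' hξs hξ y)
  · have := hN.nonneg
    have := hN'.nonneg
    have := gradedBound_nonneg (W := W)
    positivity
  · intro m k y y'
    simpa using norm_segmentPairing_le hτ hN hN' m 0 k 0 y y'

end IndicialDefect

/-! ### Bounds for form-valued sections -/

section Sections

/-- Only finitely many segments matter, so a large constant achieves any prescribed rate, in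
particular the rate of the kernel to which the section is to be paired. -/
theorem exists_norm_le_mul_exp {Y : Type*} {E : Y → Type*} [∀ y, NormedAddCommGroup (E y)]
    {u : ℤ → ∀ y, E y} (hu : ∀ m, ∃ C, ∀ y, ‖u m y‖ ≤ C) (s : Finset ℤ)
    (h0 : ∀ m ∉ s, ∀ y, u m y = 0) (γ : ℝ) :
    ∃ C : ℝ, ∀ m y, ‖u m y‖ ≤ C * Real.exp (-γ * (m : ℝ) ^ 2) := by
  choose c hc using hu
  refine ⟨∑ m ∈ s, |c m| * Real.exp (γ * (m : ℝ) ^ 2), fun m y => ?_⟩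
  by_cases hm : m ∈ s
  · have h1 : |c m| * Real.exp (γ * (m : ℝ) ^ 2) ≤ ∑ m ∈ s, |c m| * Real.exp (γ * (m : ℝ) ^ 2) :=
      Finset.single_le_sum (f := fun m : ℤ => |c m| * Real.exp (γ * (m : ℝ) ^ 2))
        (fun i _ => by positivity) hm
    calc ‖u m y‖ ≤ |c m| := (hc m y).trans (le_abs_self _)
      _ = |c m| * Real.exp (γ * (m : ℝ) ^ 2) * Real.exp (-γ * (m : ℝ) ^ 2) := by
        rw [mul_assoc, ← Real.exp_add]; simp
      _ ≤ _ := mul_le_mul_of_nonneg_right h1 (Real.exp_pos _).le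
  · rw [h0 m hm y, norm_zero]
    exact mul_nonneg (Finset.sum_nonneg fun i _ => by positivity) (Real.exp_pos _).le

variable {W : Type*} [AddCommGroup W] [Module ℂ W] [FiniteDimensional ℂ W]

theorem norm_tmul_le {H : Type*} [NormedAddCommGroup H] [NormedSpace ℂ H]
    (α : ExteriorAlgebra ℂ W) (A : H) :
    ‖(Coeff.tmul α A : Coeff W H)‖ ≤ (∑ I, ‖(formBasis W).repr α I‖) * ‖A‖ := by
  refine Coeff.norm_le (by positivity) fun I => ?_
  rw [Coeff.coords_tmul, norm_smul]
  exact mul_le_mul_of_nonneg_right (Finset.single_le_sum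
    (f := fun I => ‖(formBasis W).repr α I‖) (fun i _ => norm_nonneg _) (Finset.mem_univ I))
    (norm_nonneg _)

end Sections

/-! ### Periodicity in terms of segment numbers -/

section PeriodicKernels

variable {W : Type*} [AddCommGroup W] [Module ℂ W] {Y : Type*} {f₀ : Y → Circle}
  {V : Y → Type*} [∀ y, NormedAddCommGroup (V y)] [∀ y, NormedSpace ℂ (V y)]

/-- The fibres depend on the points of `Y` only, so the real coordinates can be rewritten without
transport between different types. -/
theorem kernel_cover_congr (N : Kernel W fun x : ℝ × Y => V x.2) (y y' : Y) {a b c d : ℝ}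
    (hac : a = c) (hbd : b = d) :
    (N (a, y) (b, y') : Coeff W (V y' →L[ℂ] V y)) = N (c, y) (d, y') := by
  subst hac hbd; rfl

end PeriodicKernels

section Shifts

variable {W : Type*} [AddCommGroup W] [Module ℂ W] {Y : Type*} [TopologicalSpace Y]
  [MeasurableSpace Y] {f₀ : Y → Circle}
  {V : Y → Type*} [∀ y, NormedAddCommGroup (V y)] [∀ y, InnerProductSpace ℂ (V y)]

theorem exists_eq_segmentPoint {x : ℝ × Y} (hx : x ∈ cover f₀) :
    ∃ m : ℤ, x.1 = segmentCoord f₀ x.2 + m :=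
  ⟨⌊x.1⌋, eq_segmentCoord_add_floor (f₀ := f₀) (t := x.1) (y := x.2) hx⟩

theorem segmentKernel_add_of_periodic {N : Kernel W fun x : ℝ × Y => V x.2}
    (h : ∀ x ∈ cover f₀, ∀ x' ∈ cover f₀, N (x.1 + 1, x.2) (x'.1 + 1, x'.2) = N x x')
    (m k j : ℤ) (y y' : Y) :
    segmentKernel f₀ N (m + j) (k + j) y y' = segmentKernel f₀ N m k y y' := by
  have h1 : ∀ (m k : ℤ), segmentKernel f₀ N (m + 1) (k + 1) y y' = segmentKernel f₀ N m k y y' := by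
    intro m k
    refine Eq.trans ?_ (h (segmentPoint f₀ m y) (segmentPoint_mem_cover m y)
      (segmentPoint f₀ k y') (segmentPoint_mem_cover k y'))
    refine kernel_cover_congr N y y' ?_ ?_ <;> simp [segmentPoint, add_assoc]
  induction j using Int.induction_on with
  | zero => simp
  | succ i ih => rw [← ih, ← h1 (m + i) (k + i), add_assoc, add_assoc]
  | pred i ih =>
    rw [← ih, ← h1 (m + (-i - 1)) (k + (-i - 1))]
    congr 1 <;> ring

theorem periodic_of_segmentKernel_add {N : Kernel W fun x : ℝ × Y => V x.2}
    (h : ∀ (m k : ℤ) (y y' : Y), segmentKernel f₀ N (m + 1) (k + 1) y y' =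
      segmentKernel f₀ N m k y y') {x x' : ℝ × Y} (hx : x ∈ cover f₀) (hx' : x' ∈ cover f₀) :
    N (x.1 + 1, x.2) (x'.1 + 1, x'.2) = N x x' := by
  obtain ⟨m, hm⟩ := exists_eq_segmentPoint hx
  obtain ⟨k, hk⟩ := exists_eq_segmentPoint hx'
  obtain ⟨t, y⟩ := x
  obtain ⟨t', y'⟩ := x'
  have h1 : (N (t + 1, y) (t' + 1, y') : Coeff W (V y' →L[ℂ] V y)) =
      segmentKernel f₀ N (m + 1) (k + 1) y y' := by
    refine kernel_cover_congr N y y' ?_ ?_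
    · rw [show t = segmentCoord f₀ y + m from hm]; push_cast; ring
    · rw [show t' = segmentCoord f₀ y' + k from hk]; push_cast; ring
  exact h1.trans ((h m k y y').trans (kernel_cover_congr N y y' hm.symm hk.symm))

end Shifts

/-! ### From bundles and smooth kernels to the abstract estimates -/

section Main

variable {EB : Type*} [NormedAddCommGroup EB] [NormedSpace ℝ EB] [FiniteDimensional ℝ EB]
  {B : Type*} [TopologicalSpace B] [ChartedSpace EB B] {n : ℕ}
  {FM : Type*} [TopologicalSpace FM] [ChartedSpace (EuclideanSpace ℝ (Fin n)) FM]
  {M : B → Type*} [∀ z, TopologicalSpace (M z)]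
  [∀ z, ChartedSpace (EuclideanSpace ℝ (Fin n)) (M z)]
  [∀ z, SecondCountableTopology (M z)]
  [∀ z, MeasurableSpace (M z)] [∀ z, BorelSpace (M z)]
  [TopologicalSpace (TotalSpace FM M)]
  [ChartedSpace (ModelProd EB (EuclideanSpace ℝ (Fin n))) (TotalSpace FM M)]
  [∀ z, RiemannianBundle (fun x : M z => TangentSpace (𝓡 n) x)]
  {FY : Type*} [TopologicalSpace FY] [ChartedSpace (EuclideanSpace ℝ (Fin n)) FY]
  {Y : B → Type*} [∀ z, TopologicalSpace (Y z)]
  [∀ z, ChartedSpace (EuclideanSpace ℝ (Fin n)) (Y z)]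
  [∀ z, SecondCountableTopology (Y z)] [∀ z, CompactSpace (Y z)]
  [∀ z, MeasurableSpace (Y z)] [∀ z, BorelSpace (Y z)]
  [TopologicalSpace (TotalSpace FY Y)]
  [ChartedSpace (ModelProd EB (EuclideanSpace ℝ (Fin n))) (TotalSpace FY Y)]
  [∀ z, RiemannianBundle (fun y : Y z => TangentSpace (𝓡 n) y)]
  {D : EndPeriodicFiberBundle (EB := EB) n FM M FY Y}
  {F : Type*} [NormedAddCommGroup F] [NormedSpace ℂ F] [FiniteDimensional ℂ F]
  {E : TotalSpace FM M → Type*} [∀ x, NormedAddCommGroup (E x)]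
  [∀ x, InnerProductSpace ℂ (E x)] [∀ x, FiniteDimensional ℂ (E x)]
  [TopologicalSpace (TotalSpace F E)] [FiberBundle F E] [VectorBundle ℂ F E]
  {E' : TotalSpace FY Y → Type*} [∀ y, NormedAddCommGroup (E' y)]
  [∀ y, InnerProductSpace ℂ (E' y)] [∀ y, FiniteDimensional ℂ (E' y)]
  [TopologicalSpace (TotalSpace F E')] [FiberBundle F E'] [VectorBundle ℂ F E']
  (S : EndPeriodicSuperBundle D F E E') {z : B}

theorem SuperBundle.isGrading {EX HX : Type*} [NormedAddCommGroup EX] [NormedSpace ℝ EX]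
    [TopologicalSpace HX] {IX : ModelWithCorners ℝ EX HX} {B : Type*} [TopologicalSpace B]
    [ChartedSpace HX B] {E : B → Type*} [∀ x, NormedAddCommGroup (E x)]
    [∀ x, InnerProductSpace ℂ (E x)] [TopologicalSpace (TotalSpace F E)] [FiberBundle F E]
    [VectorBundle ℂ F E] {X : Type*} [TopologicalSpace X] [SecondCountableTopology X]
    [MeasurableSpace X] [BorelSpace X] {j : X → B} (hj : Continuous j) (𝓣 : FrameField F E j)
    (S : SuperBundle IX F E) : IsGrading 𝓣.frame fun x => S.τ (j x) where
  norm_le x := ContinuousLinearMap.opNorm_le_bound _ zero_le_one fun v => by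
    rw [S.norm_τ, one_mul]
  sq x := by ext v; exact S.τ_τ (j x) v
  measurable := S.measurableEndIn 𝓣 hj

namespace EndPeriodicSuperBundle

theorem isGraded (z : B) : IsGraded (V := fun x : M z => E ⟨z, x⟩) (V' := fun y : Y z => E' ⟨z, y⟩)
    (ι := D.ιAt z) (D.f₀At z) (S.Φ z) (S.τM z) (S.τY z) := by
  intro m hm y u
  refine S.Φ_τ z (segmentPoint (D.f₀At z) m y) (segmentPoint_mem_cover m y) ?_ u
  exact le_trans (by exact_mod_cast hm) (PeriodicEnd.le_segmentPoint m y)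

variable {S} {K K' : S.KernelM z} {N N' : S.KernelCover z}

/-- The constants may be enlarged and the rates diminished at will. This lets two operators share
the same `C` and `γ`, as the estimates for compositions require. -/
theorem IsAPSmoothing.isAsymptoticKernel (hK : S.IsAPSmoothing z K N)
    (𝓣 : FrameField F E fun x : M z => (⟨z, x⟩ : TotalSpace FM M))
    (𝓣' : FrameField F E' fun y : Y z => (⟨z, y⟩ : TotalSpace FY Y)) :
    ∃ C > 0, ∃ γ > 0, ∀ C' γ' : ℝ, C ≤ C' → 0 < γ' → γ' ≤ γ →
      IsAsymptoticKernel (V := fun x : M z => E ⟨z, x⟩) (V' := fun y : Y z => E' ⟨z, y⟩)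
        (ι := D.ιAt z) (D.f₀At z) (Manifold.riemannianEDist (𝓡 n)) (D.distW₀ z) 𝓣.frame 𝓣'.frame
        (S.Φ z) C' γ' K N := by
  obtain ⟨C₁, hC₁, γ₁, hγ₁, h₁⟩ := hK.ap1
  obtain ⟨C₃, hC₃, γ₃, hγ₃, h₃⟩ := hK.ap3
  have hle : ∀ {C C' γ γ' : ℝ} (d : ℝ≥0∞), 0 < C → C ≤ C' → γ' ≤ γ →
      C * gauss γ d ≤ C' * gauss γ' d := fun d hC hCC' hγγ' =>
    mul_le_mul hCC' (gauss_anti_left hγγ' d) (gauss_nonneg _ _) (hC.le.trans hCC')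
  refine ⟨max C₁ C₃, lt_max_of_lt_left hC₁, min γ₁ γ₃, lt_min hγ₁ hγ₃,
    fun C' γ' hC' hγ' hγ => ?_⟩
  have hj := D.isBundle_M.continuous_mk z
  have hj' := D.isBundle_Y.continuous_mk z
  constructor
  · exact 𝓣.measurableIn_kernel hj (K := K) fun b b' ℓ φ v =>
      (hK.smooth (trivializationAt F E b) (trivializationAt F E b') ℓ φ v).continuousOn
  · exact 𝓣'.measurableIn_kernel_cover hj' (D.fiber z).smooth_f₀ (K := N)
      fun b b' ℓ φ v U U' s s' hs hs' => (hK.smooth_normal (trivializationAt F E' b)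
        (trivializationAt F E' b') ℓ φ v U U' s s' hs hs').continuousOn
  · exact segmentKernel_add_of_periodic (V := fun y : Y z => E' ⟨z, y⟩) hK.periodic
  · exact fun x x' => (h₁ x x').trans
      (hle _ hC₁ ((le_max_left _ _).trans hC') (hγ.trans (min_le_left _ _)))
  · intro m k hm hk y y'
    refine (h₃ (segmentPoint (D.f₀At z) m y) (segmentPoint_mem_cover m y)
      (segmentPoint (D.f₀At z) k y') (segmentPoint_mem_cover k y') ?_ ?_).trans
      (hle _ hC₃ ((le_max_right _ _).trans hC') (hγ.trans (min_le_right _ _)))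
    · exact le_trans (by exact_mod_cast hm) (PeriodicEnd.le_segmentPoint m y)
    · exact le_trans (by exact_mod_cast hk) (PeriodicEnd.le_segmentPoint k y')
  · exact hγ'
  · exact (lt_max_of_lt_left hC₁).le.trans hC'

end EndPeriodicSuperBundle

end Main

/-! ### Test sections, the intertwining relation, and (AP1)–(AP3) -/

section Main

variable {EB : Type*} [NormedAddCommGroup EB] [NormedSpace ℝ EB] [FiniteDimensional ℝ EB]
  {B : Type*} [TopologicalSpace B] [ChartedSpace EB B] {n : ℕ}
  {FM : Type*} [TopologicalSpace FM] [ChartedSpace (EuclideanSpace ℝ (Fin n)) FM]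
  {M : B → Type*} [∀ z, TopologicalSpace (M z)]
  [∀ z, ChartedSpace (EuclideanSpace ℝ (Fin n)) (M z)]
  [∀ z, SecondCountableTopology (M z)]
  [∀ z, MeasurableSpace (M z)] [∀ z, BorelSpace (M z)]
  [TopologicalSpace (TotalSpace FM M)]
  [ChartedSpace (ModelProd EB (EuclideanSpace ℝ (Fin n))) (TotalSpace FM M)]
  [∀ z, RiemannianBundle (fun x : M z => TangentSpace (𝓡 n) x)]
  {FY : Type*} [TopologicalSpace FY] [ChartedSpace (EuclideanSpace ℝ (Fin n)) FY]
  {Y : B → Type*} [∀ z, TopologicalSpace (Y z)]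
  [∀ z, ChartedSpace (EuclideanSpace ℝ (Fin n)) (Y z)]
  [∀ z, SecondCountableTopology (Y z)] [∀ z, CompactSpace (Y z)]
  [∀ z, MeasurableSpace (Y z)] [∀ z, BorelSpace (Y z)]
  [TopologicalSpace (TotalSpace FY Y)]
  [ChartedSpace (ModelProd EB (EuclideanSpace ℝ (Fin n))) (TotalSpace FY Y)]
  [∀ z, RiemannianBundle (fun y : Y z => TangentSpace (𝓡 n) y)]
  {D : EndPeriodicFiberBundle (EB := EB) n FM M FY Y}
  {F : Type*} [NormedAddCommGroup F] [NormedSpace ℂ F] [FiniteDimensional ℂ F]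
  {E : TotalSpace FM M → Type*} [∀ x, NormedAddCommGroup (E x)]
  [∀ x, InnerProductSpace ℂ (E x)] [∀ x, FiniteDimensional ℂ (E x)]
  [TopologicalSpace (TotalSpace F E)] [FiberBundle F E] [VectorBundle ℂ F E]
  {E' : TotalSpace FY Y → Type*} [∀ y, NormedAddCommGroup (E' y)]
  [∀ y, InnerProductSpace ℂ (E' y)] [∀ y, FiniteDimensional ℂ (E' y)]
  [TopologicalSpace (TotalSpace F E')] [FiberBundle F E'] [VectorBundle ℂ F E']
  (S : EndPeriodicSuperBundle D F E E') {z : B}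

namespace EndPeriodicSuperBundle

variable {S} {K K' : S.KernelM z} {N N' : S.KernelCover z}

theorem measurableIn_toForm {u : ∀ x : ℝ × Y z, E' ⟨z, x.2⟩} (hu : S.IsTestSection z u)
    (𝓣' : FrameField F E' fun y : Y z => (⟨z, y⟩ : TotalSpace FY Y)) (m : ℤ) :
    MeasurableIn (fun _ => ContinuousLinearEquiv.refl ℂ ℂ) 𝓣'.frame
      fun y => segmentSection (V := fun y : Y z => E' ⟨z, y⟩) (D.f₀At z) (S.toForm z u) m y := by
  refine measurableIn_of_component fun ℓ φ c => ?_
  have h := 𝓣'.measurable_section_cover (D.isBundle_Y.continuous_mk z) (D.fiber z).smooth_f₀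
    (u := u) (fun b U s hs => (hu.smooth (trivializationAt F E' b) U s hs).continuousOn) m φ
  have h2 : ∀ y : Y z, φ (𝓣'.frame y (component ℓ (segmentSection (V := fun y : Y z => E' ⟨z, y⟩)
      (D.f₀At z) (S.toForm z u) m y) ((ContinuousLinearEquiv.refl ℂ ℂ).symm c))) =
      ℓ ((Form.equiv _).symm 1) * (c * φ (𝓣'.frame y (u (segmentPoint (D.f₀At z) m y)))) := by
    intro y
    have h3 : component ℓ (segmentSection (V := fun y : Y z => E' ⟨z, y⟩)
        (D.f₀At z) (S.toForm z u) m y) = ℓ ((Form.equiv _).symm 1) •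
          ContinuousLinearMap.toSpanSingleton ℂ (u (segmentPoint (D.f₀At z) m y)) :=
      component_tmul ℓ 1 _
    rw [h3]
    have h4 : (ℓ ((Form.equiv (Cotangent EB z)).symm 1) • ContinuousLinearMap.toSpanSingleton ℂ
        (u (segmentPoint (D.f₀At z) m y))) ((ContinuousLinearEquiv.refl ℂ ℂ).symm c) =
        ℓ ((Form.equiv (Cotangent EB z)).symm 1) • c • u (segmentPoint (D.f₀At z) m y) := by
      simp
    erw [h4, map_smul, map_smul, map_smul, map_smul]
    rfl
  simp only [h2]
  exact (h.const_mul c).const_mul _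

theorem exists_norm_toForm_le {u : ∀ x : ℝ × Y z, E' ⟨z, x.2⟩} (hu : S.IsTestSection z u) (γ : ℝ) :
    ∃ C : ℝ, ∀ (m : ℤ) (y : Y z),
      ‖segmentSection (V := fun y : Y z => E' ⟨z, y⟩) (D.f₀At z) (S.toForm z u) m y‖ ≤
        C * Real.exp (-γ * (m : ℝ) ^ 2) := by
  obtain ⟨R, hR⟩ := hu.compact
  have hb : ∀ m : ℤ, ∃ C, ∀ y : Y z, ‖u (segmentPoint (D.f₀At z) m y)‖ ≤ C := fun m =>
    S.onY.exists_norm_section_le (D.isBundle_Y.continuous_mk z) (D.fiber z).smooth_f₀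
      (u := u) (fun b U s hs => (hu.smooth (trivializationAt F E' b) U s hs).continuousOn) m
  obtain ⟨C, hC⟩ := exists_norm_le_mul_exp (E := fun y : Y z => E' ⟨z, y⟩)
    (u := fun m y => u (segmentPoint (D.f₀At z) m y)) hb (Finset.Icc (-⌈R⌉ - 1) ⌈R⌉) (fun m hm y => by
      refine hR _ (segmentPoint_mem_cover m y) ?_
      have h1 := PeriodicEnd.le_segmentPoint (f₀ := D.f₀At z) m y
      have h2 := PeriodicEnd.segmentPoint_lt (f₀ := D.f₀At z) m y
      have h3 := Int.le_ceil R
      rw [Finset.mem_Icc, not_and_or, not_le, not_le] at hm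
      rcases hm with hm | hm
      · have : (m : ℝ) + 1 ≤ -⌈R⌉ - 1 := by exact_mod_cast hm
        rw [lt_abs]; right; linarith
      · have : (⌈R⌉ : ℝ) < m := by exact_mod_cast hm
        rw [lt_abs]; left; linarith) γ
  refine ⟨(∑ I, ‖(formBasis (Cotangent EB z)).repr 1 I‖) * C, fun m y => ?_⟩
  refine (norm_tmul_le (W := Cotangent EB z) 1
    (ContinuousLinearMap.toSpanSingleton ℂ (u (segmentPoint (D.f₀At z) m y)))).trans ?_
  rw [mul_assoc, ContinuousLinearMap.norm_toSpanSingleton]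
  exact mul_le_mul_of_nonneg_left (hC m y) (Finset.sum_nonneg fun _ _ => norm_nonneg _)

theorem intertwines_indicial (𝓣' : FrameField F E' fun y : Y z => (⟨z, y⟩ : TotalSpace FY Y))
    {C γ : ℝ} (hN : IsPeriodicKernel (V := fun y : Y z => E' ⟨z, y⟩) (D.f₀At z) 𝓣'.frame C γ N)
    {ν : Measure (Y z)} [IsFiniteMeasure ν] {ξ : ℂ} (hξ : ξ ≠ 0) :
    S.Intertwines z ν ξ N (S.indicial z N ξ) := by
  intro u hu y
  obtain ⟨C', hC'⟩ := exists_norm_toForm_le hu γ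
  exact fourierLaplace_kapply (V := fun y : Y z => E' ⟨z, y⟩) (u := S.toForm z u)
    (D.fiber z).smooth_f₀.continuous (S.onY.isGrading (D.isBundle_Y.continuous_mk z) 𝓣') hN
    (measurableIn_toForm hu 𝓣') hC' hξ y

/-- Every point of the cover is the point of a segment, so estimates indexed by segments are
estimates at all points. (AP2) is the diagonal case of (AP3). -/
theorem isAsymptoticTo_of_segmentKernel
    (hper : ∀ (m k : ℤ) (y y' : Y z), segmentKernel (V := fun y : Y z => E' ⟨z, y⟩)
      (D.f₀At z) N (m + 1) (k + 1) y y' = segmentKernel (V := fun y : Y z => E' ⟨z, y⟩)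
        (D.f₀At z) N m k y y')
    (h1 : ∃ C > 0, ∃ γ > 0, ∀ x x' : M z,
      ‖K x x'‖ ≤ C * gauss γ (Manifold.riemannianEDist (𝓡 n) x x'))
    (h3 : ∃ C > 0, ∃ γ > 0, ∀ m k : ℤ, 1 ≤ m → 1 ≤ k → ∀ y y' : Y z,
      ‖segmentKernel (V := fun y : Y z => E' ⟨z, y⟩) (D.f₀At z) (S.restrictEnd z K) m k y y' -
        segmentKernel (V := fun y : Y z => E' ⟨z, y⟩) (D.f₀At z) N m k y y'‖ ≤
      C * gauss γ (min (D.distW₀ z (segmentPoint (D.f₀At z) m y))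
        (D.distW₀ z (segmentPoint (D.f₀At z) k y')))) : S.IsAsymptoticTo z K N := by
  have hap3 : ∃ C > 0, ∃ γ > 0, ∀ x ∈ D.coverAt z, ∀ x' ∈ D.coverAt z, 1 ≤ x.1 → 1 ≤ x'.1 →
      ‖S.restrictEnd z K x x' - N x x'‖ ≤ C * gauss γ (min (D.distW₀ z x) (D.distW₀ z x')) := by
    obtain ⟨C, hC, γ, hγ, h⟩ := h3
    refine ⟨C, hC, γ, hγ, ?_⟩
    -- `segmentCoord` is strictly below `1`, so a point with `f ≥ 1` cannot lie in the segment `0`.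
    have hpos : ∀ (m : ℤ) (y : Y z), 1 ≤ segmentCoord (D.f₀At z) y + m → 1 ≤ m := by
      intro m y hm
      have := segmentCoord_lt_one (f₀ := D.f₀At z) y
      have : (0 : ℝ) < m := by linarith
      exact_mod_cast this
    rintro ⟨t, y⟩ hx ⟨t', y'⟩ hx' ht ht'
    obtain ⟨m, hm⟩ := exists_eq_segmentPoint hx
    obtain ⟨k, hk⟩ := exists_eq_segmentPoint hx'
    obtain rfl : t = segmentCoord (D.f₀At z) y + m := hm
    obtain rfl : t' = segmentCoord (D.f₀At z) y' + k := hk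
    exact h m k (hpos m y ht) (hpos k y' ht') y y'
  refine ⟨fun x hx x' hx' => periodic_of_segmentKernel_add (V := fun y : Y z => E' ⟨z, y⟩)
    hper hx hx', h1, ?_, hap3⟩
  obtain ⟨C, hC, γ, hγ, h⟩ := hap3
  refine ⟨C, hC, γ, hγ, fun x hx hx1 => ?_⟩
  simpa only [min_self] using h x hx x hx hx1 hx1

end EndPeriodicSuperBundle

end Main

end EndPeriodic

end

/-! ### Assembly of the supertrace defect formula -/

theorem mainTheorem3
    {EB : Type*} [NormedAddCommGroup EB] [NormedSpace ℝ EB] [FiniteDimensional ℝ EB]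
    {B : Type*} [TopologicalSpace B] [ChartedSpace EB B] [IsManifold 𝓘(ℝ, EB) ∞ B]
    [T2Space B] [CompactSpace B] {n : ℕ}
    {FM : Type*} [TopologicalSpace FM] [ChartedSpace (EuclideanSpace ℝ (Fin n)) FM]
    [IsManifold (𝓡 n) ∞ FM]
    {M : B → Type*} [∀ z, TopologicalSpace (M z)]
    [∀ z, ChartedSpace (EuclideanSpace ℝ (Fin n)) (M z)] [∀ z, IsManifold (𝓡 n) ∞ (M z)]
    [∀ z, T2Space (M z)] [∀ z, SecondCountableTopology (M z)]
    [∀ z, MeasurableSpace (M z)] [∀ z, BorelSpace (M z)]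
    [∀ z, RiemannianBundle (fun x : M z => TangentSpace (𝓡 n) x)]
    [∀ z, IsContMDiffRiemannianBundle (𝓡 n) ∞ (EuclideanSpace ℝ (Fin n))
      (fun x : M z => TangentSpace (𝓡 n) x)]
    [TopologicalSpace (TotalSpace FM M)]
    [ChartedSpace (ModelProd EB (EuclideanSpace ℝ (Fin n))) (TotalSpace FM M)]
    [IsManifold (𝓘(ℝ, EB).prod (𝓡 n)) ∞ (TotalSpace FM M)]
    [T2Space (TotalSpace FM M)] [SecondCountableTopology (TotalSpace FM M)]
    {FY : Type*} [TopologicalSpace FY] [ChartedSpace (EuclideanSpace ℝ (Fin n)) FY]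
    [IsManifold (𝓡 n) ∞ FY]
    {Y : B → Type*} [∀ z, TopologicalSpace (Y z)]
    [∀ z, ChartedSpace (EuclideanSpace ℝ (Fin n)) (Y z)] [∀ z, IsManifold (𝓡 n) ∞ (Y z)]
    [∀ z, T2Space (Y z)] [∀ z, SecondCountableTopology (Y z)] [∀ z, CompactSpace (Y z)]
    [∀ z, MeasurableSpace (Y z)] [∀ z, BorelSpace (Y z)]
    [∀ z, RiemannianBundle (fun y : Y z => TangentSpace (𝓡 n) y)]
    [∀ z, IsContMDiffRiemannianBundle (𝓡 n) ∞ (EuclideanSpace ℝ (Fin n))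
      (fun y : Y z => TangentSpace (𝓡 n) y)]
    [TopologicalSpace (TotalSpace FY Y)]
    [ChartedSpace (ModelProd EB (EuclideanSpace ℝ (Fin n))) (TotalSpace FY Y)]
    [IsManifold (𝓘(ℝ, EB).prod (𝓡 n)) ∞ (TotalSpace FY Y)]
    [T2Space (TotalSpace FY Y)] [CompactSpace (TotalSpace FY Y)]
    (D : EndPeriodic.EndPeriodicFiberBundle (EB := EB) n FM M FY Y)
    (volM : ∀ z, Measure (M z)) (hvolM : ∀ z, EndPeriodic.IsRiemannianVolume (n := n) (volM z))
    (volY : ∀ z, Measure (Y z)) (hvolY : ∀ z, EndPeriodic.IsRiemannianVolume (n := n) (volY z))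
    {F : Type*} [NormedAddCommGroup F] [NormedSpace ℂ F] [FiniteDimensional ℂ F]
    {E : TotalSpace FM M → Type*} [∀ x, NormedAddCommGroup (E x)]
    [∀ x, InnerProductSpace ℂ (E x)] [∀ x, FiniteDimensional ℂ (E x)]
    [TopologicalSpace (TotalSpace F E)] [FiberBundle F E] [VectorBundle ℂ F E]
    {E' : TotalSpace FY Y → Type*} [∀ y, NormedAddCommGroup (E' y)]
    [∀ y, InnerProductSpace ℂ (E' y)] [∀ y, FiniteDimensional ℂ (E' y)]
    [TopologicalSpace (TotalSpace F E')] [FiberBundle F E'] [VectorBundle ℂ F E']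
    (S : EndPeriodic.EndPeriodicSuperBundle D F E E')
    (P Q : ∀ z, S.KernelM z) (NP NQ : ∀ z, S.KernelCover z)
    (hP : ∀ z, S.IsAPSmoothing z (P z) (NP z)) (hQ : ∀ z, S.IsAPSmoothing z (Q z) (NQ z))
    (p q : ℕ)
    (hp : ∀ z x x', EndPeriodic.HasParity (S.τM z x') (S.τM z x) p (P z x x'))
    (hq : ∀ z x x', EndPeriodic.HasParity (S.τM z x') (S.τM z x) q (Q z x x'))
    (z : B) :
    -- the compositions `PQ` and `QP` are given by convergent integrals
    (∀ x x', Integrable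
      (fun w => EndPeriodic.gradedComp (S.τM z w) (S.τM z x) (P z x w) (Q z w x')) (volM z)) ∧
    (∀ x x', Integrable
      (fun w => EndPeriodic.gradedComp (S.τM z w) (S.τM z x) (Q z x w) (P z w x')) (volM z)) ∧
    -- the indicial families are well defined, and `P_ξ` is differentiable in `ξ`
    (∀ ξ : ℂ, ξ ≠ 0 → S.Intertwines z (volY z) ξ (NP z) (S.indicial z (NP z) ξ)) ∧
    (∀ ξ : ℂ, ξ ≠ 0 → S.Intertwines z (volY z) ξ (NQ z) (S.indicial z (NQ z) ξ)) ∧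
    (∀ ξ ∈ Complex.slitPlane, ∀ y y',
      DifferentiableAt ℂ (fun ζ : ℂ => S.indicial z (NP z) ζ y y') ξ) ∧
    -- the supertrace defect formula
    S.HasRenormalizedStr z (volM z) (volY z)
      (EndPeriodic.superComm (S.τM z) (volM z) p q (P z) (Q z))
      ((2 * Real.pi * Complex.I : ℂ)⁻¹ •
          (∮ ξ in C(0, 1), ξ⁻¹ • ∫ x in EndPeriodic.segment (D.f₀At z),
            (x.1 : ℂ) • EndPeriodic.str (S.τY z x.2)
              (EndPeriodic.superComm (S.τY z) (volY z) p q
                (S.indicial z (NP z) ξ) (S.indicial z (NQ z) ξ) x.2 x.2)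
            ∂(EndPeriodic.coverMeasure (D.f₀At z) (volY z))) -
        (2 * Real.pi * Complex.I : ℂ)⁻¹ •
          ∮ ξ in C(0, 1), ∫ y, EndPeriodic.str (S.τY z y)
            (EndPeriodic.kcomp (S.τY z) (volY z)
              (S.indicialDeriv z (NP z) ξ) (S.indicial z (NQ z) ξ) y y) ∂(volY z)) := by
  have hj := D.isBundle_M.continuous_mk z
  have hj' := D.isBundle_Y.continuous_mk z
  obtain ⟨𝓣⟩ := EndPeriodic.exists_frameField F E hj
  obtain ⟨𝓣'⟩ := EndPeriodic.exists_frameField F E' hj'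
  obtain ⟨L, v, hE'⟩ := EndPeriodic.PeriodicEnd.IsMetricLift.isEndModel (D := D.fiber z)
    (D.isometry_ι z) (hvolM z) (hvolY z)
  have hE : EndPeriodic.IsEndModel (D.f₀At z) (D.ιAt z) (Manifold.riemannianEDist (𝓡 n))
    (D.distW₀ z) (D.fiber z).level (volM z) (volY z) L v := hE'
  have := hE.isFiniteMeasure
  obtain ⟨C₁, hC₁, γ₁, hγ₁, h₁⟩ := (hP z).isAsymptoticKernel 𝓣 𝓣'
  obtain ⟨C₂, hC₂, γ₂, hγ₂, h₂⟩ := (hQ z).isAsymptoticKernel 𝓣 𝓣'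
  -- The larger constant and the smaller rate serve for both operators.
  have hKP := h₁ _ _ (le_max_left C₁ C₂) (lt_min hγ₁ hγ₂) (min_le_left γ₁ γ₂)
  have hKQ := h₂ _ _ (le_max_right C₁ C₂) (lt_min hγ₁ hγ₂) (min_le_right γ₁ γ₂)
  have hτ : EndPeriodic.IsGrading 𝓣.frame (S.τM z) := S.onM.isGrading hj 𝓣
  have hτ' : EndPeriodic.IsGrading 𝓣'.frame (S.τY z) := S.onY.isGrading hj' 𝓣'
  have hΦ := S.isGraded z
  have hNP := hKP.isPeriodicKernel hE
  have hNQ := hKQ.isPeriodicKernel hE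
  have hpN := hKP.hasParity hE hΦ (hp z)
  have hqN := hKQ.hasParity hE hΦ (hq z)
  refine ⟨fun x x' => EndPeriodic.integrable_gradedComp_kernels hE hτ hKP hKQ x x',
    fun x x' => EndPeriodic.integrable_gradedComp_kernels hE hτ hKQ hKP x x',
    fun ξ hξ => EndPeriodic.EndPeriodicSuperBundle.intertwines_indicial 𝓣' hNP hξ,
    fun ξ hξ => EndPeriodic.EndPeriodicSuperBundle.intertwines_indicial 𝓣' hNQ hξ,
    fun ξ hξ y y' =>
      (EndPeriodic.hasDerivAt_indicialKernel hNP hξ y y').differentiableAt,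
    -- The witness for the normal kernel of the supercommutator is the supercommutator of the normal
    -- kernels on the cover.
    EndPeriodic.superComm (S.τCover z) (EndPeriodic.coverMeasure (D.f₀At z) (volY z)) p q
      (NP z) (NQ z), ?_, ?_⟩
  · exact EndPeriodic.EndPeriodicSuperBundle.isAsymptoticTo_of_segmentKernel
      (fun m k y y' =>
        EndPeriodic.superComm_cover_shift hE.continuous_f₀ hτ' hNP hNQ p q m k 1 y y')
      (EndPeriodic.exists_norm_superComm_le hE hτ hKP hKQ p q)
      (EndPeriodic.exists_norm_pull_superComm_sub_le hE hτ hτ' hΦ hKP hKQ p q)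
  · have hZ : ∀ j : ℕ, D.Z z j = {x | (D.fiber z).level x ≤ j} := (D.fiber z).union_image_eq
    -- The subtracted multiples of the segment integral are all zero, so the renormalized supertrace
    -- is the plain limit over the growing parts `Z_N`.
    have h0 : ∫ x in EndPeriodic.segment (D.f₀At z), EndPeriodic.str (S.τCover z x)
        (EndPeriodic.superComm (S.τCover z) (EndPeriodic.coverMeasure (D.f₀At z) (volY z)) p q
          (NP z) (NQ z) x x) ∂(EndPeriodic.coverMeasure (D.f₀At z) (volY z)) = 0 :=
      EndPeriodic.integral_segment_str_superComm hE.continuous_f₀ hτ' hNP hNQ hpN hqN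
    have h1 := EndPeriodic.tendsto_setIntegral_str_superComm hE hτ hτ' hΦ hKP hKQ (hp z) (hq z)
    rw [← EndPeriodic.indicial_defect hE.continuous_f₀ hτ' hNP hNQ hpN hqN] at h1
    simp only [h0, hZ, smul_zero, sub_zero]
    exact h1
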